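/- Let $m,n\ge 0$, let $I=\{-m,\dots,-1,1,\dots,n\}$, and let $\mathbb Z^{m|n}$ be the set of functions $f:I\to\mathbb Z$, with the right action of $S_{m|n}=S_m\times S_n$ by composition. Put $\operatorname{sgn}(i)=\pm1$ for the sign of $i\in I$. Let $\mathbb Z^{m|n}_+$ be the set of dominant $f$, i.e. $f(-m)<\dots<f(-1)$ and $f(1)>\dots>f(n)$. Put $\operatorname{wt}(f)=\sum_i \operatorname{sgn}(i)\varepsilon_{f(i)}$ and $\#f=\frac12\bigl(m+n-\sum_{a\in\mathbb Z}|(\operatorname{wt}(f),\varepsilon_a)|\bigr)$; $f$ is typical if $\#f=0$. **The space.** Let $V=\bigoplus_a \mathbb Q(q)v_a$ and $W=\bigoplus_a\mathbb Q(q)w_a$ $(a\in\mathbb Z)$ be the natural module of $U_q(\mathfrak{gl}_\infty)$ and its dual, with $K_av_b=q^{\delta_{a,b}}v_b$, $E_av_b=\delta_{a+1,b}v_a$, $F_av_b=\delta_{a,b}v_{a+1}$, $K_aw_b=q^{-\delta_{a,b}}w_b$, $E_aw_b=\delta_{a,b}w_{a+1}$, $F_aw_b=\delta_{a+1,b}w_a$.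 Let $\mathscr T=W^{\otimes m}\otimes V^{\otimes n}$, with monomial basis $M_f=w_{f(-m)}\otimes\dots\otimes w_{f(-1)}\otimes v_{f(1)}\otimes\dots\otimes v_{f(n)}$ and action given by $\Delta(E_a)=1\otimes E_a+E_a\otimes K_{a+1}K_a^{-1}$, $\Delta(F_a)=K_aK_{a+1}^{-1}\otimes F_a+F_a\otimes1$, $\Delta(K_a)=K_a\otimes K_a$. Let $\widehat{\mathscr T}$ be its completion: the formal combinations of the $M_f$ whose projection $\pi_{\le d}$ to the span of the $M_f$ with all $f(i)\le d$ is a finite sum for every $d\in\mathbb Z$. The Iwahori–Hecke algebra of $S_{m|n}$ acts on the right: for a basic transposition $s_i$, $M_fH_i$ is $q^{-1}M_f$ if $f\cdot s_i=f$; it is $M_{f\cdot s_i}$ if $f(i)<f(i+1)$ where $s_i=(i\ i{+}1)$, $i>0$ (respectively $f(i-1)>f(i)$ where $s_i=(i{-}1\ i)$, $i<0$); and it is $M_{f\cdot s_i}-(q-q^{-1})M_f$ otherwise. Put $H_x=H_{i_1}\cdots H_{i_r}$ for a reduced expression $x=s_{i_1}\cdots s_{i_r}$, let $w_0$ be the longest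 element of $S_{m|n}$, and let $H_0=\sum_{x}(-q)^{\ell(x)-\ell(w_0)}H_x$, $\widehat{\mathscr E}=\widehat{\mathscr T}H_0$, and $K_f=M_{f\cdot w_0}H_0$ for $f\in\mathbb Z^{m|n}_+$. Infinite sums in $\widehat{\mathscr E}$ are understood to have only finitely many terms with nonzero image under $\pi_{\le d}$, for each $d$. **The bases.** There is a unique map $u\mapsto\overline u$ on $\widehat{\mathscr E}$ that is continuous (for the topology defined by the kernels of the $\pi_{\le d}$), antilinear with respect to $q\mapsto q^{-1}$, fixes $K_f$ for every typical $f\in\mathbb Z^{m|n}_+$, and satisfies $\overline{E_au}=E_a\overline u$, $\overline{F_au}=F_a\overline u$, $\overline{K_a^{\pm1}u}=K_a^{\mp1}\overline u$ for all $a$ and $u$ (in particular, $\widehat{\mathscr E}$ is stable under these operators). There are unique families $(U_f)$ and $(L_f)$ of elements of $\widehat{\mathscr E}$, indexed by $f\in\mathbb Z^{m|n}_+$, with $\overline{U_f}=U_f$, $\overline{L_f}=L_f$, $U_f\in K_f+\widehat\sum_g q\mathbb Z[q]K_g$ and $L_f\in K_f+\widehat\sum_g q^{-1}\mathbb Z[q^{-1}]K_g$.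 Write $U_f=\sum_{g}u_{g,f}(q)K_g$ and $L_f=\sum_{g}l_{g,f}(q)K_g$, with $g$ running over $\mathbb Z^{m|n}_+$. **The operators.** Let $d_i\in\mathbb Z^{m|n}$ be $j\mapsto\operatorname{sgn}(i)\delta_{i,j}$. If $f$ is conjugate under $S_{m|n}$ to a dominant function, denote that function by $f^+$. For such $f$ and $i<0<j$ with $f(i)=f(j)$, let $\mathtt L_{i,j}(f)=f-a(d_i-d_j)$, where $a$ is the smallest positive integer such that $f-a(d_i-d_j)$ and all $\mathtt L_{k,l}(f)-a(d_i-d_j)$ with $i<k<0<l<j$, $f(k)=f(l)$, are conjugate to dominant functions; and let $\mathtt R_{i,j}(f)=f+b(d_i-d_j)$, where $b$ is the smallest positive integer such that $f+b(d_i-d_j)$ and all $\mathtt R_{k,l}(f)+b(d_i-d_j)$ with $-m\le k<i$, $j<l\le n$, $f(k)=f(l)$, are conjugate to dominant functions. For $f\in\mathbb Z^{m|n}_+$ with $r=\#f$, let $i_1<\dots<i_r<0<j_r<\dots<j_1$ be the unique indices with $f(i_s)=f(j_s)$. For $\theta\in\mathbb N^r$ put $|\theta|=\theta_1+\dots+\theta_r$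 and $$\mathtt L_\theta(f)=\bigl(\mathtt L_{i_r,j_r}^{\theta_r}\circ\dots\circ\mathtt L_{i_1,j_1}^{\theta_1}(f)\bigr)^+,\quad \mathtt R_\theta(f)=\bigl(\mathtt R_{i_1,j_1}^{\theta_1}\circ\dots\circ\mathtt R_{i_r,j_r}^{\theta_r}(f)\bigr)^+,\quad \mathtt R'_\theta(f)=\bigl(\mathtt R_{i_r,j_r}^{\theta_r}\circ\dots\circ\mathtt R_{i_1,j_1}^{\theta_1}(f)\bigr)^+.$$ **Statement.** For all $f,g\in\mathbb Z^{m|n}_+$: 1. $u_{g,f}(q)=q^{|\theta|}$ if $g=\mathtt L_\theta(f)$ for some $\theta\in\{0,1\}^{\#f}$, and $u_{g,f}(q)=0$ otherwise. 2. There are only finitely many $\theta\in\mathbb N^{\#g}$ with $\mathtt R'_\theta(g)=f$, and $l_{g,f}(-q^{-1})=\sum_\theta q^{|\theta|}$, summing over these $\theta$. 3. $K_f=\sum_g q^{-|\theta_g|}L_g$, where the sum is over all $g\in\mathbb Z^{m|n}_+$ such that $\mathtt R_{\theta_g}(g)=f$ for some $\theta_g\in\{0,1\}^{\#g}$; such a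 $\theta_g$ is unique. 4. $L_f=\sum_{g,\theta}(-q)^{-|\theta|}K_g$, where the sum is over all $g\in\mathbb Z^{m|n}_+$ and $\theta\in\mathbb N^{\#g}$ such that $\mathtt R'_\theta(g)=f$. -/

import Mathlib

open scoped Polynomial

noncomputable section

namespace SuperKL

/-! ### The field of rational functions in `q` and substitutions -/

/-- The field `ℚ(q)`. -/
abbrev Qq : Type := RatFunc ℚ

/-- The indeterminate `q`. -/
def q : Qq := RatFunc.X

theorem transcendental_q : Transcendental ℚ q := by
  rw [transcendental_iff_injective]
  intro p r h
  have key : ∀ s : ℚ[X], Polynomial.aeval q s = algebraMap ℚ[X] Qq s := by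
    intro s
    rw [← RatFunc.aeval_X_left_eq_algebraMap s]
    unfold q
    congr! <;> exact Subsingleton.elim _ _
  rw [key, key] at h
  exact RatFunc.algebraMap_injective ℚ h

theorem transcendental_q_inv : Transcendental ℚ q⁻¹ := fun h =>
  transcendental_q (by simpa using h.inv)

theorem transcendental_neg_q_inv : Transcendental ℚ (-q⁻¹) := fun h =>
  transcendental_q_inv (by simpa using h.neg)

/-- The substitution `q ↦ t`, as a field endomorphism of `ℚ(q)`, for `t` transcendental. -/
def subst (t : Qq) (ht : Transcendental ℚ t) : Qq →+* Qq :=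
  RatFunc.liftRingHom (Polynomial.aeval t : ℚ[X] →ₐ[ℚ] Qq).toRingHom (by
    intro p hp
    rw [Submonoid.mem_comap, mem_nonZeroDivisors_iff_ne_zero]
    intro h
    exact nonZeroDivisors.ne_zero hp
      ((transcendental_iff_injective.mp ht) (by simpa using h)))

/-- The bar involution `c(q) ↦ c(q⁻¹)` of `ℚ(q)`. -/
def barQ : Qq →+* Qq := subst q⁻¹ transcendental_q_inv

/-- The substitution `c(q) ↦ c(-q⁻¹)`. -/
def atNegInv : Qq →+* Qq := subst (-q⁻¹) transcendental_neg_q_inv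

/-! ### Combinatorial notation -/

/-- The index set `I(m|n) = {-m, …, -1, 1, …, n}`: `inl k` stands for `k - m` and `inr k`
for `k + 1`.  Its order is that of `Sum.Lex (· < ·) (· < ·)`. -/
abbrev Idx (m n : ℕ) : Type := Fin m ⊕ Fin n

/-- `ℤ^{m|n}`, the set of all functions `I(m|n) → ℤ`. -/
abbrev IntFun (m n : ℕ) : Type := Idx m n → ℤ

variable {m n : ℕ}

/-- The strict order of `I(m|n)`. -/
def before (k i : Idx m n) : Prop := Sum.Lex (· < ·) (· < ·) k i

/-- The sign of an element of `I(m|n)`. -/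
def sgn : Idx m n → ℤ
  | Sum.inl _ => -1
  | Sum.inr _ => 1

/-- The group `S_{m|n} = S_m × S_n`. -/
abbrev S (m n : ℕ) : Type := Equiv.Perm (Fin m) × Equiv.Perm (Fin n)

/-- The right action of `S_{m|n}` on `ℤ^{m|n}` by composition of functions. -/
def act (f : IntFun m n) (x : S m n) : IntFun m n := f ∘ Equiv.sumCongr x.1 x.2

/-- The basic transpositions: `inl k` swaps the positions `k, k + 1` of the first block
and `inr k` those of the second block. -/
def simpleRefl : Fin (m - 1) ⊕ Fin (n - 1) → S m n
  | Sum.inl k => (Equiv.swap ⟨k, by omega⟩ ⟨k + 1, by omega⟩, 1)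
  | Sum.inr k => (1, Equiv.swap ⟨k, by omega⟩ ⟨k + 1, by omega⟩)

/-- The length function of `S_{m|n}`. -/
def len (x : S m n) : ℕ :=
  sInf {r | ∃ w : List (Fin (m - 1) ⊕ Fin (n - 1)), (w.map simpleRefl).prod = x ∧ w.length = r}

/-- `w` is a reduced expression of `x`. -/
def IsReduced (x : S m n) (w : List (Fin (m - 1) ⊕ Fin (n - 1))) : Prop :=
  (w.map simpleRefl).prod = x ∧ w.length = len x

/-- A chosen reduced expression of `x`. -/
def reducedWord (x : S m n) : List (Fin (m - 1) ⊕ Fin (n - 1)) :=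
  Classical.epsilon (IsReduced x)

/-- The longest element `w₀` of `S_{m|n}`. -/
def longest (m n : ℕ) : S m n := (Fin.revPerm, Fin.revPerm)

/-- `f(-m) < ⋯ < f(-1)` and `f(1) > ⋯ > f(n)`. -/
def IsDominant (f : IntFun m n) : Prop :=
  StrictMono (fun i : Fin m => f (Sum.inl i)) ∧ StrictAnti (fun j : Fin n => f (Sum.inr j))

/-- `ℤ^{m|n}_+`, the set of all dominant functions. -/
abbrev Dom (m n : ℕ) : Type := {f : IntFun m n // IsDominant f}

/-- The weight `wt(f) = ∑ᵢ sgn(i) ε_{f(i)}`. -/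
def wt (f : IntFun m n) : ℤ →₀ ℤ := ∑ i, Finsupp.single (f i) (sgn i)

/-- The degree of atypicality `#f = (m + n - ∑ₐ |(wt(f), εₐ)|) / 2`. -/
def atyp (f : IntFun m n) : ℕ := (((m : ℤ) + n - (wt f).sum fun _ c => |c|) / 2).toNat

/-- `f ∈ ℤ^{m|n}_{≤ d}`. -/
def Bounded (d : ℤ) (f : IntFun m n) : Prop := ∀ i, f i ≤ d

/-! ### The completed tensor space and the operators on it -/

/-- All families of coefficients, that is, all formal combinations `∑ u_f M_f`. -/
abbrev Fam (m n : ℕ) : Type := IntFun m n → Qq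

/-- The monomial `M_f`. -/
def monom (f : IntFun m n) : Fam m n := Pi.single f 1

/-- The completion of `W^{⊗ m} ⊗ V^{⊗ n}`: formal combinations `∑ u_f M_f` whose projection
to the span of `{M_f | f ≤ d}` is a finite sum for every `d`. -/
def That (m n : ℕ) : Submodule Qq (Fam m n) where
  carrier := {u | ∀ d, {f | Bounded d f ∧ u f ≠ 0}.Finite}
  zero_mem' := by intro d; simp
  add_mem' := by
    intro u v hu hv d
    refine ((hu d).union (hv d)).subset ?_
    rintro f ⟨hf, h⟩
    by_cases h1 : u f = 0
    · right
      refine ⟨hf, fun h2 => h ?_⟩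
      simp [h1, h2]
    · left
      exact ⟨hf, h1⟩
  smul_mem' := by
    intro c u hu d
    refine (hu d).subset ?_
    rintro f ⟨hf, h⟩
    exact ⟨hf, fun h2 => h (by simp [h2])⟩

theorem monom_mem (f : IntFun m n) : monom f ∈ That m n := by
  intro d
  refine (Set.finite_singleton f).subset ?_
  rintro g ⟨-, h⟩
  by_contra hne
  exact h (Pi.single_eq_of_ne hne _)

/-- The operator `∑ u_f M_f ↦ ∑ u_f θ(f)` on formal combinations, where `θ(f)` is the image
of `M_f` and every `M_g` occurs in `θ(f)` for finitely many `f` only. -/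
def extendOp (θ : IntFun m n → (IntFun m n →₀ Qq)) (hθ : ∀ g, {f | θ f g ≠ 0}.Finite) :
    Fam m n →ₗ[Qq] Fam m n where
  toFun u g := ∑ᶠ f, u f * θ f g
  map_add' := by
    intro u v
    funext g
    simp only [Pi.add_apply, add_mul]
    refine finsum_add_distrib ((hθ g).subset ?_) ((hθ g).subset ?_) <;>
      · intro f hf h
        exact hf (by simp [h])
  map_smul' := by
    intro c u
    funext g
    simp only [Pi.smul_apply, smul_eq_mul, RingHom.id_apply, mul_assoc]
    rw [mul_finsum]

/-- The integer `e` such that `K_a K_{a+1}⁻¹` acts as `q ^ e` on the `k`-th tensor factor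
of `M_f`. -/
def rootExp (a : ℤ) (f : IntFun m n) (k : Idx m n) : ℤ :=
  sgn k * ((if f k = a then 1 else 0) - (if f k = a + 1 then 1 else 0))

/-- The entry that `E_a` moves: `E_a w_a = w_{a+1}` and `E_a v_{a+1} = v_a`. -/
def eSource (a : ℤ) : Idx m n → ℤ
  | Sum.inl _ => a
  | Sum.inr _ => a + 1

/-- The entry that `E_a` moves to.  Source and target are exchanged for `F_a`, as
`F_a w_{a+1} = w_a` and `F_a v_a = v_{a+1}`. -/
def eTarget (a : ℤ) : Idx m n → ℤ
  | Sum.inl _ => a + 1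
  | Sum.inr _ => a

open Classical in
/-- `E_a M_f`, for the comultiplication `Δ(E_a) = 1 ⊗ E_a + E_a ⊗ K_{a+1} K_a⁻¹`. -/
def eBasis (a : ℤ) (f : IntFun m n) : IntFun m n →₀ Qq :=
  ∑ i, if f i = eSource a i then
    Finsupp.single (Function.update f i (eTarget a i))
      (q ^ (∑ k, if before i k then -rootExp a f k else 0)) else 0

open Classical in
/-- `F_a M_f`, for the comultiplication `Δ(F_a) = K_a K_{a+1}⁻¹ ⊗ F_a + F_a ⊗ 1`. -/
def fBasis (a : ℤ) (f : IntFun m n) : IntFun m n →₀ Qq :=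
  ∑ i, if f i = eTarget a i then
    Finsupp.single (Function.update f i (eSource a i))
      (q ^ (∑ k, if before k i then rootExp a f k else 0)) else 0

theorem finite_of_move (s t : Idx m n → ℤ) (c : IntFun m n → Idx m n → Qq)
    (g : IntFun m n) :
    {f : IntFun m n | (∑ i, if f i = s i then
      Finsupp.single (Function.update f i (t i)) (c f i) else 0) g ≠ 0}.Finite := by
  classical
  refine (Set.finite_range (fun i => Function.update g i (s i))).subset ?_
  intro f hf
  rw [Set.mem_ofPred_eq, Finsupp.finsetSum_apply] at hf
  obtain ⟨i, -, hi⟩ := Finset.exists_ne_zero_of_sum_ne_zero hf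
  split_ifs at hi with h
  · rw [Finsupp.single_apply] at hi
    split_ifs at hi with h2
    · refine ⟨i, ?_⟩
      simp [← h2, ← h]
    · exact absurd rfl hi
  · exact absurd rfl hi

/-- The action of `E_a`. -/
def eOp (a : ℤ) : Fam m n →ₗ[Qq] Fam m n :=
  extendOp (eBasis a) (fun g => finite_of_move _ _ _ g)

/-- The action of `F_a`. -/
def fOp (a : ℤ) : Fam m n →ₗ[Qq] Fam m n :=
  extendOp (fBasis a) (fun g => finite_of_move _ _ _ g)

/-- The action of `K_a ^ s`, which multiplies `M_f` by `q ^ (s (wt(f), ε_a))`. -/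
def kOp (a s : ℤ) : Fam m n →ₗ[Qq] Fam m n :=
  extendOp (fun f => Finsupp.single f (q ^ (s * wt f a))) (by
    intro g
    refine (Set.finite_singleton g).subset ?_
    intro f hf
    by_contra hne
    exact hf (Finsupp.single_eq_of_ne (fun h => hne h.symm)))

/-- The relation `f ≺ f · sᵢ` in the Bruhat ordering. -/
def Ascends (f : IntFun m n) : Fin (m - 1) ⊕ Fin (n - 1) → Prop
  | Sum.inl k => f (Sum.inl ⟨k + 1, by omega⟩) < f (Sum.inl ⟨k, by omega⟩)
  | Sum.inr k => f (Sum.inr ⟨k, by omega⟩) < f (Sum.inr ⟨k + 1, by omega⟩)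

open Classical in
/-- `M_f Hᵢ`. -/
def hBasis (i : Fin (m - 1) ⊕ Fin (n - 1)) (f : IntFun m n) : IntFun m n →₀ Qq :=
  if act f (simpleRefl i) = f then Finsupp.single f q⁻¹
  else if Ascends f i then Finsupp.single (act f (simpleRefl i)) 1
  else Finsupp.single (act f (simpleRefl i)) 1 - Finsupp.single f (q - q⁻¹)

theorem act_injective (x : S m n) : Function.Injective (fun f : IntFun m n => act f x) :=
  (Equiv.surjective _).injective_comp_right

/-- The right action of the generator `Hᵢ` of the Iwahori-Hecke algebra. -/
def hOp (i : Fin (m - 1) ⊕ Fin (n - 1)) : Fam m n →ₗ[Qq] Fam m n :=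
  extendOp (hBasis i) (by
    intro g
    refine ((Set.finite_singleton g).union
      ((Set.finite_singleton g).preimage
        (f := fun f : IntFun m n => act f (simpleRefl i)) (act_injective _).injOn)).subset ?_
    intro f hf
    by_contra hne
    rw [Set.mem_union, not_or] at hne
    have h1 : f ≠ g := hne.1
    have h2 : act f (simpleRefl i) ≠ g := hne.2
    apply hf
    unfold hBasis
    split_ifs <;> simp [h1, h2])

/-- The right action of `H_x = H_{i₁} ⋯ H_{iᵣ}`, where `x = s_{i₁} ⋯ s_{iᵣ}` is reduced. -/
def hxOp (x : S m n) : Fam m n →ₗ[Qq] Fam m n :=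
  (reducedWord x).foldl (fun T i => (hOp i).comp T) LinearMap.id

/-- The right action of `H₀ = ∑ₓ (-q) ^ (ℓ(x) - ℓ(w₀)) Hₓ`. -/
def h0Op (m n : ℕ) : Fam m n →ₗ[Qq] Fam m n :=
  ∑ x : S m n, ((-q) ^ ((len x : ℤ) - len (longest m n))) • hxOp x

/-! ### The completed exterior space and its canonical bases -/

/-- The completed exterior space, the image of the completed tensor space under `H₀`. -/
def Ehat (m n : ℕ) : Submodule Qq (Fam m n) := (That m n).map (h0Op m n)

/-- `K_f = M_{f · w₀} H₀`, for dominant `f`. -/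
def kVec (f : Dom m n) : Ehat m n :=
  ⟨h0Op m n (monom (act f.1 (longest m n))), Submodule.mem_map_of_mem (monom_mem _)⟩

/-- `v = ∑_g c_g B_g`, where for every `d` only finitely many summands have a nonzero
projection to the span of `{M_h | h ≤ d}`. -/
def HasExpansion (v : Ehat m n) (B : Dom m n → Ehat m n) (c : Dom m n → Qq) : Prop :=
  (∀ d, {g | ∃ h, Bounded d h ∧ c g * (B g).1 h ≠ 0}.Finite) ∧
    ∀ h, v.1 h = ∑ᶠ g, c g * (B g).1 h

/-- `β` is a bar involution: an antilinear map that is continuous (for the topology in which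
the kernels of the projections `π_{≤ d}` are a basis of neighbourhoods of zero), fixes `K_f`
for every typical `f`, and satisfies `β(Xu) = X̄ β(u)` for the generators `X = E_a, F_a,
K_a, K_a⁻¹` of the quantum group, where the bar involution fixes `E_a` and `F_a` and
inverts `K_a`. -/
structure IsBar (β : Ehat m n →ₛₗ[barQ] Ehat m n) : Prop where
  continuous : ∀ d, ∃ e, ∀ u : Ehat m n,
    (∀ h, Bounded e h → u.1 h = 0) → ∀ h, Bounded d h → (β u).1 h = 0
  typical : ∀ f : Dom m n, atyp f.1 = 0 → β (kVec f) = kVec f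
  map_e : ∀ a (u : Ehat m n), ∃ v : Ehat m n, v.1 = eOp a u.1 ∧ (β v).1 = eOp a (β u).1
  map_f : ∀ a (u : Ehat m n), ∃ v : Ehat m n, v.1 = fOp a u.1 ∧ (β v).1 = fOp a (β u).1
  map_k : ∀ a (u : Ehat m n), ∃ v : Ehat m n, v.1 = kOp a 1 u.1 ∧ (β v).1 = kOp a (-1) (β u).1
  map_k_inv : ∀ a (u : Ehat m n),
    ∃ v : Ehat m n, v.1 = kOp a (-1) u.1 ∧ (β v).1 = kOp a 1 (β u).1

open Classical in
/-- `U_f` is bar invariant and lies in `K_f + ∑_g q ℤ[q] K_g`, for every `f`. -/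
def IsCanonical (β : Ehat m n →ₛₗ[barQ] Ehat m n) (U : Dom m n → Ehat m n) : Prop :=
  ∀ f, β (U f) = U f ∧ ∃ p : Dom m n → ℤ[X],
    HasExpansion (U f) kVec fun g =>
      (if g = f then 1 else 0) + q * Polynomial.aeval q (p g)

open Classical in
/-- `L_f` is bar invariant and lies in `K_f + ∑_g q⁻¹ ℤ[q⁻¹] K_g`, for every `f`. -/
def IsDualCanonical (β : Ehat m n →ₛₗ[barQ] Ehat m n) (L : Dom m n → Ehat m n) : Prop :=
  ∀ f, β (L f) = L f ∧ ∃ p : Dom m n → ℤ[X],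
    HasExpansion (L f) kVec fun g =>
      (if g = f then 1 else 0) + q⁻¹ * Polynomial.aeval q⁻¹ (p g)

/-! ### Lowering and raising operators -/

/-- `f` is conjugate under `S_{m|n}` to a dominant function. -/
def Conj (f : IntFun m n) : Prop := ∃ x : S m n, IsDominant (act f x)

open Classical in
/-- The dominant conjugate `f⁺` of `f`. -/
def dominantConj (f : IntFun m n) : IntFun m n :=
  if h : Conj f then act f h.choose else f

/-- `d_i`, the function `j ↦ sgn(i) δ_{ij}`. -/
def dVec (i : Idx m n) : IntFun m n := Pi.single i (sgn i)

/-- `d_i - d_j` for `i` in the first and `j` in the second block. -/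
def dDiff (i : Fin m) (j : Fin n) : IntFun m n := dVec (Sum.inl i) - dVec (Sum.inr j)

/-- `L_{i,j}(f) = f - a (d_i - d_j)`, for the smallest positive integer `a` such that
`f - a (d_i - d_j)` and all `L_{k,l}(f) - a (d_i - d_j)` with `i < k < 0 < l < j` and
`f(k) = f(l)` are conjugate to dominant functions. -/
def lower (i : Fin m) (j : Fin n) (f : IntFun m n) : IntFun m n :=
  f - sInf {a : ℕ | 0 < a ∧ Conj (f - a • dDiff i j) ∧
    ∀ (k : Fin m) (l : Fin n) (_ : i < k) (_ : l < j), f (Sum.inl k) = f (Sum.inr l) →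
      Conj (lower k l f - a • dDiff i j)} • dDiff i j
termination_by (m - i.val) + j.val
decreasing_by omega

/-- `R_{i,j}(f) = f + b (d_i - d_j)`, for the smallest positive integer `b` such that
`f + b (d_i - d_j)` and all `R_{k,l}(f) + b (d_i - d_j)` with `k < i`, `j < l` and
`f(k) = f(l)` are conjugate to dominant functions. -/
def raise (i : Fin m) (j : Fin n) (f : IntFun m n) : IntFun m n :=
  f + sInf {b : ℕ | 0 < b ∧ Conj (f + b • dDiff i j) ∧
    ∀ (k : Fin m) (l : Fin n) (_ : k < i) (_ : j < l), f (Sum.inl k) = f (Sum.inr l) →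
      Conj (raise k l f + b • dDiff i j)} • dDiff i j
termination_by i.val + (n - j.val)
decreasing_by omega

/-- `i_1 < ⋯ < i_r < 0 < j_r < ⋯ < j_1` and `f(i_s) = f(j_s)` for all `s`. -/
def IsPairing (f : IntFun m n) (p : Fin (atyp f) → Fin m × Fin n) : Prop :=
  StrictMono (fun s => (p s).1) ∧ StrictAnti (fun s => (p s).2) ∧
    ∀ s, f (Sum.inl (p s).1) = f (Sum.inr (p s).2)

/-- Apply `T_{i_s, j_s}` iterated `θ_s` times for the `s` in the list `w`, the head of the
list first, where the `(i_s, j_s)` are the pairs of `f`; then pass to the dominant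
conjugate. -/
def composite (T : Fin m → Fin n → IntFun m n → IntFun m n) (f : IntFun m n)
    (θ : Fin (atyp f) → ℕ) (w : List (Fin (atyp f))) : IntFun m n :=
  open Classical in
  if h : ∃ p, IsPairing f p then
    dominantConj (w.foldl (fun g s => (T (h.choose s).1 (h.choose s).2)^[θ s] g) f)
  else f

/-- `L_θ(f) = (L_{i_r,j_r}^{θ_r} ∘ ⋯ ∘ L_{i_1,j_1}^{θ_1} (f))⁺`. -/
def lowerTheta (f : IntFun m n) (θ : Fin (atyp f) → ℕ) : IntFun m n :=
  composite lower f θ (List.finRange (atyp f))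

/-- `R_θ(f) = (R_{i_1,j_1}^{θ_1} ∘ ⋯ ∘ R_{i_r,j_r}^{θ_r} (f))⁺`. -/
def raiseTheta (f : IntFun m n) (θ : Fin (atyp f) → ℕ) : IntFun m n :=
  composite raise f θ (List.finRange (atyp f)).reverse

/-- `R'_θ(f) = (R_{i_r,j_r}^{θ_r} ∘ ⋯ ∘ R_{i_1,j_1}^{θ_1} (f))⁺`. -/
def raisePrimeTheta (f : IntFun m n) (θ : Fin (atyp f) → ℕ) : IntFun m n :=
  composite raise f θ (List.finRange (atyp f))

end SuperKL

end

open SuperKL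

noncomputable section

namespace SuperKL

/-! A dominant function is encoded by the sets `A`, `B` of its values on the two blocks. Labels in
both sets are the atypical pairs, labels in exactly one are singles, all other integers are free.
Ignoring the singles, match every pair with a free vertex to its right, without crossings. An
orientation of this matching keeps the singles and puts a pair at exactly one end of every arc. The
candidate for U_f is the sum of q^k K_g over the orientations g, where k is the number of pairs of g
at right ends of arcs.

The first key fact is that E_v and F_v map each candidate to a bar invariant scalar (0, 1 or q +
q⁻¹) times a candidate. If exactly one of v, v + 1 is a single, the labels are exchanged
(`eop_uc_swap`) or the result is zero; two suitable singles become an arc (`eop_uc_create`); if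
neither is a single, their partners are joined (`eop_uc_cap`). Every candidate arises with scalar 1
from a simpler one (`exists_simpler`), down to the typical diagrams, where it is K_f. So every bar
involution fixes all candidates. Since they approximate every element on bounded labels, continuity
leaves at most one bar involution, and the continuous antilinear map fixing them is one. Off the
diagonal the coefficients lie in qℤ[q], so the candidates are the canonical basis.

For the dual basis, let the K_g be orthogonal with square norms q^(-#g). Then E_v and F_v are
adjoint, and induction along these operators shows that all pairings of canonical elements are bar
invariant (`form_uc_bar`). Matching the pairs of g to the left gives the arcs of the right matching
of another diagram `g.lam`, and g is its orientation with all pairs at right ends. Let `incW` have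
as entry at (f, g) the coefficient of K_f in the canonical element of `g.lam`, times q^(-#g). Then
`incU * incW` is a matrix of pairings, hence bar invariant, and this makes the rows of the inverse
of `incW` bar invariant. The inverse is explicit: slide the pairs to the left one after the other,
with a factor (-q)⁻¹ for each step. That this is the inverse is the telescoping sum `sum_slide`.

The operators enter through `PairsOf.raise`: R_{i,j} moves a pair from the right end of its left arc
to the left end, because the vertices in between are singles or ends of inner arcs, and the
conditions defining R_{i,j} exclude exactly these. Moving the rightmost pair first yields the
orientations (R_θ), moving the leftmost pair first yields the slides (R'_θ). The operators L_{i,j}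
are the mirror images of the R_{i,j}.

To return to the tensor space, H₀ H_i = -q H₀ is proved on the regular module and transported to
orbits. Thus the completed exterior space consists of the families in the completed tensor space
with u H_i = -q u. Such a family is determined by its values at dominant functions, where the K_f
become Kronecker deltas and E_v, F_v become `eop`, `fop`. -/

/-! ### Weight diagrams and their cup matchings -/

/-- A weight diagram: the sets of values of a dominant function on the two blocks. -/
@[ext] structure WD where
  A : Finset ℤ
  B : Finset ℤ

instance : DecidableEq WD := Classical.decEq _

namespace WD

/-- The values taken on both blocks. -/
def P (g : WD) : Finset ℤ := g.A ∩ g.B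

/-- `ι` matches every `x` in both blocks with a free vertex to the right, as one matches
opening with closing parentheses, the vertices in exactly one block being ignored. -/
structure RM (f : WD) (ι : ℤ → ℤ) : Prop where
  inv : ∀ x, ι (ι x) = x
  sing : ∀ x, ¬(x ∈ f.A ↔ x ∈ f.B) → ι x = x
  pair : ∀ x, (x ∈ f.A ∧ x ∈ f.B) ↔ x < ι x
  nc : ∀ x y, x < y → y < ι x → (y ∈ f.A ↔ y ∈ f.B) → x < ι y ∧ ι y < ι x ∧ ι y ≠ y

/-- Induction from the rightmost pair. If ι p < κ p, then ι p lies under the κ-arc of p, so κ (ι p)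
is a pair to the right of p. There both matchings agree, which forces κ (ι p) = p, a contradiction.
-/
theorem RM.unique {f : WD} {ι κ : ℤ → ℤ} (h : RM f ι) (k : RM f κ) : ι = κ := by
  have key : ∀ (N : ℕ) (p : ℤ), p ∈ f.P → (∀ x ∈ f.P, x ≤ p + N) → ι p = κ p := by
    intro N
    induction N using Nat.strong_induction_on with
    | _ N ih =>
    have main : ∀ (ι κ : ℤ → ℤ), RM f ι → RM f κ → ∀ p, p ∈ f.P → (∀ x ∈ f.P, x ≤ p + N) →
        (∀ r ∈ f.P, p < r → ι r = κ r) → ¬ (ι p < κ p) := by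
      intro ι κ h k p hp hN ihp hlt
      have h1 := (h.pair p).1 (by simpa [P] using hp)
      have h2 := k.nc p (ι p) h1 hlt
        (by by_contra hs; have := h.sing _ hs; rw [h.inv] at this; omega)
      have h3 : ¬ (ι p < κ (ι p)) := fun h4 => by
        have := (h.pair _).1 ((k.pair _).2 h4); rw [h.inv] at this; omega
      have h4 : κ (ι p) ∈ f.P := by
        have := (k.pair (κ (ι p))).2 (by rw [k.inv]; omega)
        simpa [P] using this
      have h5 := ihp _ h4 h2.1
      rw [k.inv] at h5
      have := congrArg ι h5
      rw [h.inv, h.inv] at this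
      omega
    intro p hp hN
    have ihp : ∀ r ∈ f.P, p < r → ι r = κ r := by
      intro r hr hpr
      have := hN r hr
      refine ih (N - (r - p).toNat) (by omega) r hr (fun x hx => ?_)
      have := hN x hx
      omega
    have a := main ι κ h k p hp hN ihp
    have b := main κ ι k h p hp hN (fun r hr hpr => (ihp r hr hpr).symm)
    omega
  have key2 : ∀ p ∈ f.P, ι p = κ p := by
    intro p hp
    obtain ⟨M, hM⟩ := f.P.bddAbove
    exact key (M - p).toNat p hp (fun x hx => by
      have := hM hx; have := hM hp; omega)
  have key3 : ∀ (ι κ : ℤ → ℤ), RM f ι → RM f κ → (∀ p ∈ f.P, ι p = κ p) →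
      ∀ x, ι x < x → κ x = ι x := by
    intro ι κ h k e x hx
    have := e (ι x) (by have := (h.pair (ι x)).2 (by rw [h.inv]; exact hx); simpa [P] using this)
    rw [h.inv] at this
    conv_lhs => rw [this]
    exact k.inv _
  funext x
  rcases lt_trichotomy x (ι x) with hx | hx | hx
  · exact key2 x (by have := (h.pair x).2 hx; simpa [P] using this)
  · rcases lt_trichotomy x (κ x) with hy | hy | hy
    · have := (h.pair x).1 ((k.pair x).2 hy); omega
    · omega
    · exact key3 κ ι k h (fun p hp => (key2 p hp).symm) x hy
  · exact (key3 ι κ h k key2 x hx).symm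

/-- The rightmost pair p must be matched with the first free vertex w to its right, since all
vertices in between are singles. Then p and w are demoted to singles and the other pairs are matched
by induction. -/
theorem exists_RM (f : WD) : ∃ ι, RM f ι := by
  induction hn : f.P.card using Nat.strong_induction_on generalizing f with
  | _ n ih =>
  by_cases hP : f.P = ∅
  · refine ⟨id, fun _ => rfl, fun _ _ => rfl, fun x => ?_, fun x y h1 h2 => ?_⟩
    · have : x ∉ f.P := by simp [hP]
      simpa [P] using this
    · simp at h2; omega
  have hne : f.P.Nonempty := Finset.nonempty_iff_ne_empty.2 hP
  set p := f.P.max' hne with hp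
  have hpP : p ∈ f.P := Finset.max'_mem _ _
  have hmax : ∀ x ∈ f.P, x ≤ p := fun x hx => Finset.le_max' _ _ hx
  have hex : ∃ k : ℕ, p + 1 + k ∉ f.A ∪ f.B := by
    obtain ⟨M, hM⟩ := (f.A ∪ f.B).bddAbove
    refine ⟨(M - p).toNat, fun h => ?_⟩
    have := hM h; omega
  classical
  set w := p + 1 + (Nat.find hex : ℤ) with hw
  have hw1 : w ∉ f.A ∪ f.B := Nat.find_spec hex
  have hw2 : ∀ y, p < y → y < w → y ∈ f.A ∪ f.B := by
    intro y h1 h2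
    have := Nat.find_min hex (m := (y - p - 1).toNat) (by omega)
    rw [not_not] at this
    convert this using 1; omega
  have hpw : p < w := by omega
  -- In the smaller diagram p keeps only its label in `B` and w acquires one there, so the inductive
  -- matching fixes both.
  obtain ⟨ι, hι⟩ := ih ((⟨f.A.erase p, insert w f.B⟩ : WD).P.card) (by
    rw [← hn]
    apply Finset.card_lt_card
    rw [Finset.ssubset_iff_of_subset]
    · exact ⟨p, hpP, by simp [P]⟩
    · intro x
      simp only [P, Finset.mem_inter, Finset.mem_erase, Finset.mem_insert]
      rintro ⟨⟨h1, h2⟩, h3 | h3⟩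
      · subst h3; exact absurd (Finset.mem_union_left _ h2) hw1
      · exact ⟨h2, h3⟩) ⟨f.A.erase p, insert w f.B⟩ rfl
  have e1 : ι p = p := hι.sing p (by
    simp only [P, Finset.mem_inter] at hpP
    simp [hpP.2])
  have e2 : ι w = w := hι.sing w (by
    simp only [Finset.mem_union, not_or] at hw1
    simp [hw1.1])
  simp only [P, Finset.mem_inter] at hpP hmax
  simp only [Finset.mem_union, not_or] at hw1 hw2
  obtain ⟨h1, h2, h3, h4⟩ := hι
  simp only [Finset.mem_erase, Finset.mem_insert] at h2 h3 h4
  clear_value w p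
  clear hex hP hn ih hw hne hp
  refine ⟨fun x => if x = p then w else if x = w then p else ι x, ?_, ?_, ?_, ?_⟩
  · intro x; grind
  · intro x hx
    have := h2 x
    have : x ≠ p := by rintro rfl; simp [hpP] at hx
    have : x ≠ w := by rintro rfl; simp [hw1] at hx
    simp_all
  · intro x
    have := h3 x
    by_cases e : x = p
    · simp [e, hpP, hpw]
    · by_cases e' : x = w
      · subst e'; simp [e, hw1, hpw.le]
      · simp [e, e'] at this ⊢; exact this
  · intro x y hxy hyx hy
    by_cases e : x = p
    · subst e
      simp only [if_true] at hyx
      have := hw2 y hxy hyx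
      have := hmax y
      grind
    · by_cases e' : x = w
      · subst e'; simp only [e, if_true, if_false] at hyx; omega
      · simp only [e, e', if_false] at hyx ⊢
        have hxx := h3 x
        have := hmax x
        have hp' : ¬ (p < x) := by grind
        have hq := h4 x w
        have hinv := h1 x
        have : ι x ≠ p := by grind
        have : ι x ≠ w := by grind
        by_cases e2 : y = p
        · subst e2; simp only [if_true]
          have : w < ι x := by
            have := hw2 (ι x)
            have := h2 (ι x)
            grind
          omega
        · by_cases e3 : y = w
          · subst e3; simp only [e2, if_true]; omega
          · simp only [e2, e3, if_false]
            exact h4 x y hxy hyx (by simpa [e2, e3] using hy)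

/-- The matching of a weight diagram. -/
def mt (f : WD) : ℤ → ℤ := f.exists_RM.choose

theorem mt_RM (f : WD) : RM f f.mt := f.exists_RM.choose_spec

/-- `g` is obtained from `f` by moving some of the pairs to the other ends of their arcs. -/
def Orient (ι : ℤ → ℤ) (f g : WD) : Prop :=
  (∀ x, (x ∈ g.A ∧ x ∉ g.B) ↔ (x ∈ f.A ∧ x ∉ f.B)) ∧
  (∀ x, (x ∈ g.B ∧ x ∉ g.A) ↔ (x ∈ f.B ∧ x ∉ f.A)) ∧
  ∀ x, (ι x ∈ g.A ∧ ι x ∈ g.B) ↔ (¬(x ∈ g.A ∧ x ∈ g.B) ∧ ι x ≠ x)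

/-- The number of pairs of `g` at the right ends of arcs. -/
def cnt (ι : ℤ → ℤ) (g : WD) : ℕ := (g.P.filter fun x => ι x < x).card

open Classical in
/-- The coefficient of `g` in the canonical basis element of `f`. -/
def uc (f g : WD) : Qq := if Orient f.mt f g then q ^ cnt f.mt g else 0

open Classical in
theorem uc_eq {f : WD} {ι : ℤ → ℤ} (h : RM f ι) (g : WD) :
    uc f g = if Orient ι f g then q ^ cnt ι g else 0 := by
  unfold uc; rw [f.mt_RM.unique h]

theorem orient_of_uc_ne {f g : WD} (h : uc f g ≠ 0) : Orient f.mt f g := by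
  by_contra h2; exact h (by simp [uc, h2])

theorem orient_self (f : WD) : Orient f.mt f f := by
  refine ⟨fun _ => Iff.rfl, fun _ => Iff.rfl, fun x => ?_⟩
  have h := f.mt_RM
  rw [h.pair, h.pair, h.inv]; omega

theorem uc_self (f : WD) : uc f f = 1 := by
  have : cnt f.mt f = 0 := by
    rw [cnt, Finset.card_eq_zero, Finset.filter_eq_empty_iff]
    intro x hx
    have := (f.mt_RM.pair x).1 (by simpa [P] using hx)
    omega
  simp [uc, orient_self, this]

/-- The action of `E_v` on coefficient functions. -/
def eop (v : ℤ) (c : WD → Qq) (g : WD) : Qq :=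
  (if v + 1 ∈ g.A ∧ v ∉ g.A then
    q ^ ((if v + 1 ∈ g.B then 1 else 0 : ℤ) - (if v ∈ g.B then 1 else 0)) *
      c ⟨insert v (g.A.erase (v + 1)), g.B⟩ else 0) +
  (if v ∈ g.B ∧ v + 1 ∉ g.B then c ⟨g.A, insert (v + 1) (g.B.erase v)⟩ else 0)

end WD

/-! ### Surgery on a matching: joining the partners of two adjacent vertices -/

namespace WD

/-- Remove the vertices `v` and `v + 1` from a matching and join their partners. -/
def surg (v : ℤ) (ι : ℤ → ℤ) (x : ℤ) : ℤ :=
  if x = v ∨ x = v + 1 then x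
  else if ι x = v then (if ι (v + 1) = v + 1 then x else ι (v + 1))
  else if ι x = v + 1 then (if ι v = v then x else ι v)
  else ι x

theorem surg_inv {v : ℤ} {ι : ℤ → ℤ} (inv : ∀ x, ι (ι x) = x) (x : ℤ) :
    surg v ι (surg v ι x) = x := by
  have h1 := inv x
  have h2 := inv v
  have h3 := inv (v + 1)
  unfold surg
  by_cases e1 : x = v
  · simp [e1]
  by_cases e2 : x = v + 1
  · simp [e2]
  by_cases e3 : ι x = v
  · have : ι v = x := by rw [← e3, h1]
    by_cases e4 : ι (v + 1) = v + 1
    · simp [e1, e2, e3, e4]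
    · simp only [e1, e2, e3, e4]
      grind
  by_cases e3' : ι x = v + 1
  · have : ι (v + 1) = x := by rw [← e3', h1]
    by_cases e4 : ι v = v
    · simp [e1, e2, e3', e4]
    · simp only [e1, e2, e3', e4]
      grind
  grind

-- No vertex y lies strictly between v and v + 1, so the joined arc can be drawn along the old arcs
-- without creating a crossing. Only the noncrossing conditions among x, y, v, v + 1 and their
-- partners matter; with these at hand the claim is a finite case distinction.
set_option maxHeartbeats 4000000 in
theorem surg_nc {v : ℤ} {ι : ℤ → ℤ} {ns : ℤ → Prop} (inv : ∀ x, ι (ι x) = x)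
    (nc : ∀ x y, x < y → y < ι x → ns y → x < ι y ∧ ι y < ι x ∧ ι y ≠ y)
    (sing : ∀ x, ¬ ns x → ι x = x) (h0 : ns v) (h1 : ns (v + 1)) (x y : ℤ) (hxy : x < y) (hyx : y < surg v ι x)
    (hy : ns y) (hv : y ≠ v) (hv1 : y ≠ v + 1) :
    x < surg v ι y ∧ surg v ι y < surg v ι x ∧ surg v ι y ≠ y := by
  have i1 := inv x
  have i2 := inv y
  have i3 := inv v
  have i4 := inv (v + 1)
  have ny : ∀ z, z < y → y < ι z → z < ι y ∧ ι y < ι z ∧ ι y ≠ y := fun z a b => nc z y a b hy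
  have nv : ∀ z, z < v → v < ι z → z < ι v ∧ ι v < ι z ∧ ι v ≠ v := fun z a b => nc z v a b h0
  have nw : ∀ z, z < v + 1 → v + 1 < ι z → z < ι (v + 1) ∧ ι (v + 1) < ι z ∧ ι (v + 1) ≠ v + 1 :=
    fun z a b => nc z (v + 1) a b h1
  have nY : ns (ι y) := by
    by_contra h
    have := sing _ h
    rw [i2] at this
    rw [← this] at h
    exact h hy
  have nY' : ∀ z, z < ι y → ι y < ι z → z < ι (ι y) ∧ ι (ι y) < ι z ∧ ι (ι y) ≠ ι y :=
    fun z a b => nc z (ι y) a b nY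
  clear nc sing nY
  rw [i2] at nY'
  have z1 := nY' v
  have z2 := nY' (v + 1)
  have z3 := nY' x
  have z4 := nY' (ι v)
  have z5 := nY' (ι (v + 1))
  rw [i3] at z4
  rw [i4] at z5
  clear nY'
  have y1 := ny x
  have y2 := ny v
  have y3 := ny (v + 1)
  have y4 := ny (ι v)
  have y5 := ny (ι (v + 1))
  have v1 := nv x
  have v2 := nv y
  have v3 := nv (ι y)
  have v4 := nv (ι (v + 1))
  have v5 := nv (ι x)
  have w1 := nw x
  have w2 := nw y
  have w3 := nw (ι y)
  have w4 := nw (ι v)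
  have w5 := nw (ι x)
  clear ny nv nw inv h0 h1 hy
  rw [i2] at v3 w3
  rw [i3] at w4 y4
  rw [i4] at v4 y5
  rw [i1] at v5 w5
  have sy : ∀ a b, ι (ι a) = a → ι (ι b) = b → (ι a = b ↔ ι b = a) := fun a b h1 h2 =>
    ⟨fun h => by rw [← h, h1], fun h => by rw [← h, h2]⟩
  have c1 := sy x v i1 i3
  have c2 := sy x (v + 1) i1 i4
  have c3 := sy y v i2 i3
  have c4 := sy y (v + 1) i2 i4
  have c5 := sy x y i1 i2
  have c6 := sy v (v + 1) i3 i4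
  have c7 : ι x = ι y → x = y := fun h => by rw [← i1, h, i2]
  have c8 : ι v = ι (v + 1) → v = v + 1 := fun h => by
    have := congrArg ι h
    rwa [i3, i4] at this
  have c9 : ι y = ι v → y = v := fun h => by rw [← i2, h, i3]
  have c10 : ι y = ι (v + 1) → y = v + 1 := fun h => by rw [← i2, h, i4]
  clear sy
  clear i1 i2 i3 i4
  unfold surg at hyx ⊢
  generalize hX : ι x = X at *
  generalize hY : ι y = Y at *
  generalize hp : ι v = p at *
  generalize hr : ι (v + 1) = r at *
  clear hX hY hp hr
  split_ifs at hyx ⊢ <;> grind (splits := 40)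

end WD

/-! ### Exchanging the labels of two adjacent vertices -/

namespace WD

/-- Exchange the labels of the vertices `v` and `v + 1`. -/
def sw (v : ℤ) (f : WD) : WD :=
  ⟨f.A.map (Equiv.swap v (v + 1)).toEmbedding, f.B.map (Equiv.swap v (v + 1)).toEmbedding⟩

theorem mem_sw_A {v x : ℤ} {f : WD} : x ∈ (sw v f).A ↔ Equiv.swap v (v + 1) x ∈ f.A := by
  simp [sw, Finset.mem_map_equiv, Equiv.symm_swap]

theorem mem_sw_B {v x : ℤ} {f : WD} : x ∈ (sw v f).B ↔ Equiv.swap v (v + 1) x ∈ f.B := by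
  simp [sw, Finset.mem_map_equiv, Equiv.symm_swap]

theorem sw_sw (v : ℤ) (f : WD) : sw v (sw v f) = f := by
  ext x
  · simp [mem_sw_A]
  · simp [mem_sw_B]

theorem swap_lt {v x y : ℤ} (h : x < y) (hne : x ≠ v ∨ y ≠ v + 1) :
    Equiv.swap v (v + 1) x < Equiv.swap v (v + 1) y := by
  simp only [Equiv.swap_apply_def]; split_ifs <;> omega

/-- The exchange reverses the order of v and v + 1 only. As one of them is a single, it preserves
the order of the vertices that the matching sees, and so the matching is transported. -/
theorem RM_sw {v : ℤ} {f : WD} {ι : ℤ → ℤ} (h : RM f ι)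
    (hs : ¬(v ∈ f.A ↔ v ∈ f.B) ∨ ¬(v + 1 ∈ f.A ↔ v + 1 ∈ f.B)) :
    RM (sw v f) fun x => Equiv.swap v (v + 1) (ι (Equiv.swap v (v + 1) x)) := by
  set τ := Equiv.swap v (v + 1) with hτ
  have tt : ∀ x, τ (τ x) = x := fun x => by simp [hτ]
  have hfix : ι v = v ∨ ι (v + 1) = v + 1 := hs.imp (h.sing _) (h.sing _)
  have lt1 : ∀ x y, x < y → (x ≠ v ∨ y ≠ v + 1) → τ x < τ y := fun x y => swap_lt
  have lt2 : ∀ x, x < ι x → τ x < τ (ι x) := by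
    intro x hx
    refine lt1 _ _ hx ?_
    by_contra hc
    push Not at hc
    have := h.inv x
    rw [hc.2] at this
    rw [hc.1] at this hc
    rcases hfix with h | h <;> omega
  have lt3 : ∀ x, ι x < x → τ (ι x) < τ x := by
    intro x hx
    have := lt2 (ι x)
    rw [h.inv] at this
    exact this hx
  have tv : τ v = v + 1 := by simp [hτ]
  have tw : τ (v + 1) = v := by simp [hτ]
  refine ⟨fun x => ?_, fun x hx => ?_, fun x => ?_, fun x y hxy hyx hy => ?_⟩
  · rw [tt, h.inv, tt]
  · rw [mem_sw_A, mem_sw_B] at hx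
    rw [h.sing _ hx, tt]
  · rw [mem_sw_A, mem_sw_B, h.pair]
    constructor
    · intro hx
      have := lt2 _ hx
      rwa [tt] at this
    · intro hx
      by_contra hc
      rcases (not_lt.1 hc).lt_or_eq with h1 | h1
      · have := lt3 (τ x) h1
        rw [tt] at this
        exact absurd hx (by omega)
      · rw [h1, tt] at hx; omega
  · rw [mem_sw_A, mem_sw_B] at hy
    have ns : ∀ z, (z ∈ f.A ↔ z ∈ f.B) → ∀ z', (z' ∈ f.A ↔ z' ∈ f.B) → z < z' → τ z < τ z' := by
      intro z hz z' hz' hlt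
      refine lt1 _ _ hlt ?_
      by_contra hc
      push Not at hc
      rw [hc.1] at hz; rw [hc.2] at hz'
      tauto
    have ns' : ∀ z, (τ z ∈ f.A ↔ τ z ∈ f.B) → ∀ z', (τ z' ∈ f.A ↔ τ z' ∈ f.B) → z < z' →
        τ z < τ z' := by
      intro z hz z' hz' hlt
      by_contra hc
      have : τ z ≠ τ z' := fun e => by rw [τ.injective e] at hlt; omega
      have := ns _ hz' _ hz (by omega)
      rw [tt, tt] at this; omega
    have hιns : ∀ z, ι z ≠ z → (z ∈ f.A ↔ z ∈ f.B) := fun z hz => by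
      by_contra hc; exact hz (h.sing _ hc)
    have hx : (τ x ∈ f.A ↔ τ x ∈ f.B) := by
      apply hιns
      intro e; rw [e, tt] at hyx; omega
    have hx' : (ι (τ x) ∈ f.A ↔ ι (τ x) ∈ f.B) := by
      apply hιns
      rw [h.inv]
      intro e; rw [← e, tt] at hyx; omega
    have k := h.nc (τ x) (τ y) (ns' _ hx _ hy hxy)
      (by have := ns' y hy (τ (ι (τ x))) (by rwa [tt]) hyx; rwa [tt] at this) hy
    have hy' : (ι (τ y) ∈ f.A ↔ ι (τ y) ∈ f.B) := by
      apply hιns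
      rw [h.inv]; exact k.2.2.symm
    refine ⟨?_, ?_, ?_⟩
    · have := ns _ hx _ hy' k.1; rwa [tt] at this
    · exact ns _ hy' _ hx' k.2.1
    · intro e
      apply k.2.2
      have := congrArg τ e
      rwa [tt] at this

theorem uc_sw {v : ℤ} {f : WD} (g : WD)
    (hs : ¬(v ∈ f.A ↔ v ∈ f.B) ∨ ¬(v + 1 ∈ f.A ↔ v + 1 ∈ f.B)) :
    uc (sw v f) (sw v g) = uc f g := by
  classical
  have h := f.mt_RM
  have h' := RM_sw h hs
  rw [uc_eq h', uc_eq h]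
  set ι := f.mt
  set τ := Equiv.swap v (v + 1) with hτ
  have tt : ∀ x, τ (τ x) = x := fun x => by simp [hτ]
  have e1 : Orient (fun x => τ (ι (τ x))) (sw v f) (sw v g) ↔ Orient ι f g := by
    simp only [Orient, mem_sw_A, mem_sw_B]
    refine and_congr ⟨fun k x => ?_, fun k x => k _⟩
      (and_congr ⟨fun k x => ?_, fun k x => k _⟩ ⟨fun k x => ?_, fun k x => ?_⟩)
    · have := k (τ x); simpa [← hτ, tt] using this
    · have := k (τ x); simpa [← hτ, tt] using this
    · have := k (τ x)
      simpa [← hτ, tt] using this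
    · have := k (τ x)
      rw [← hτ, tt, this]
      refine and_congr Iff.rfl (not_congr ⟨fun e => by rw [e, tt], fun e => ?_⟩)
      have := congrArg τ e
      rwa [tt] at this
  by_cases ho : Orient ι f g
  · rw [if_pos ho, if_pos (e1.2 ho)]
    congr 1
    unfold cnt
    symm
    refine Finset.card_bij (fun x _ => τ x) ?_ (fun a _ b _ e => τ.injective e) ?_
    · intro x hx
      simp only [Finset.mem_filter, P, Finset.mem_inter, mem_sw_A, mem_sw_B, ← hτ, tt] at hx ⊢
      refine ⟨hx.1, ?_⟩
      have hl := (h'.pair (τ (ι x))).1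
      simp only [mem_sw_A, mem_sw_B, ← hτ, tt, h.inv] at hl
      exact hl ((h.pair _).2 (by rw [h.inv]; exact hx.2))
    · intro y hy
      refine ⟨τ y, ?_, tt y⟩
      simp only [Finset.mem_filter, P, Finset.mem_inter, mem_sw_A, mem_sw_B, ← hτ] at hy ⊢
      refine ⟨hy.1, ?_⟩
      have := (h'.pair (τ (ι (τ y)))).2
      simp only [tt, h.inv, mem_sw_A, mem_sw_B, ← hτ] at this
      have := (h.pair _).1 (this hy.2)
      rwa [h.inv] at this
  · rw [if_neg ho, if_neg (fun h => ho (e1.1 h))]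

theorem uc_swap {v : ℤ} {f : WD} (g : WD)
    (hs : ¬(v ∈ f.A ↔ v ∈ f.B) ∨ ¬(v + 1 ∈ f.A ↔ v + 1 ∈ f.B)) :
    uc f (sw v g) = uc (sw v f) g := by
  rw [← uc_sw (sw v g) hs, sw_sw]

/-- All diagrams occurring in the canonical element share the singles of `f`. So at v and v + 1 each
of them shows one prescribed single and an empty vertex or a pair; for these shapes only one summand
of `eop` survives, with power q⁰, and it moves the single across. -/
theorem eop_uc_swap {v : ℤ} {f : WD}
    (hs : (v ∈ f.A ∧ v ∉ f.B ∧ (v + 1 ∈ f.A ↔ v + 1 ∈ f.B)) ∨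
      (v + 1 ∈ f.B ∧ v + 1 ∉ f.A ∧ (v ∈ f.A ↔ v ∈ f.B))) (g : WD) :
    eop v (uc f) g = uc (sw v f) g := by
  rw [← uc_swap g (by tauto)]
  have key : ∀ h, uc f h ≠ 0 →
      (v ∈ h.A ∧ v ∉ h.B ∧ (v + 1 ∈ h.A ↔ v + 1 ∈ h.B)) ∨
      (v + 1 ∈ h.B ∧ v + 1 ∉ h.A ∧ (v ∈ h.A ↔ v ∈ h.B)) := by
    intro h hh
    obtain ⟨h1, h2, -⟩ := orient_of_uc_ne hh
    have a := h1 v; have b := h2 v; have c := h1 (v + 1); have d := h2 (v + 1)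
    clear h1 h2
    rcases hs with hs | hs
    · exact Or.inl ⟨(a.2 ⟨hs.1, hs.2.1⟩).1, (a.2 ⟨hs.1, hs.2.1⟩).2, by grind⟩
    · exact Or.inr ⟨(d.2 ⟨hs.1, hs.2.1⟩).1, (d.2 ⟨hs.1, hs.2.1⟩).2, by grind⟩
  have hne : v ≠ v + 1 := by omega
  have eA : ∀ (X : Finset ℤ), v ∉ X → v + 1 ∈ X →
      X.map (Equiv.swap v (v + 1)).toEmbedding = insert v (X.erase (v + 1)) := by
    intro X h1 h2
    ext x
    simp only [Finset.mem_map_equiv, Equiv.symm_swap, Finset.mem_insert, Finset.mem_erase,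
      Equiv.swap_apply_def]
    split_ifs <;> grind
  have eB : ∀ (X : Finset ℤ), v ∈ X → v + 1 ∉ X →
      X.map (Equiv.swap v (v + 1)).toEmbedding = insert (v + 1) (X.erase v) := by
    intro X h1 h2
    ext x
    simp only [Finset.mem_map_equiv, Equiv.symm_swap, Finset.mem_insert, Finset.mem_erase,
      Equiv.swap_apply_def]
    split_ifs <;> grind
  have eC : ∀ (X : Finset ℤ), (v ∈ X ↔ v + 1 ∈ X) →
      X.map (Equiv.swap v (v + 1)).toEmbedding = X := by
    intro X h1
    ext x
    simp only [Finset.mem_map_equiv, Equiv.symm_swap, Equiv.swap_apply_def]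
    split_ifs <;> grind
  have k1 := key ⟨insert v (g.A.erase (v + 1)), g.B⟩
  have k2 := key ⟨g.A, insert (v + 1) (g.B.erase v)⟩
  have k3 := key (sw v g)
  simp only [mem_sw_A, mem_sw_B, Equiv.swap_apply_left, Equiv.swap_apply_right] at k3
  simp only [Finset.mem_insert, Finset.mem_erase, hne] at k1 k2
  unfold eop
  by_cases c1 : v + 1 ∈ g.A ∧ v ∉ g.A
  · have c2 : ¬ (v ∈ g.A ↔ v + 1 ∈ g.A) := by tauto
    rw [if_pos c1]
    have z2 : (if v ∈ g.B ∧ v + 1 ∉ g.B then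
        uc f ⟨g.A, insert (v + 1) (g.B.erase v)⟩ else 0) = 0 := by
      split_ifs with hb
      · by_contra hc; have := k2 hc; clear * - this c1 hb; simp at this; grind
      · rfl
    rw [z2, add_zero]
    by_cases hb : v ∈ g.B ↔ v + 1 ∈ g.B
    · rw [sw, eA _ c1.2 c1.1, eC _ hb]
      simp [hb]
    · have h1 : uc f ⟨insert v (g.A.erase (v + 1)), g.B⟩ = 0 := by
        by_contra hc; have := k1 hc; clear * - this c1 hb; simp at this; grind
      have h2 : uc f (sw v g) = 0 := by
        by_contra hc; have := k3 hc; clear * - this c1 hb; grind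
      rw [h1, h2, mul_zero]
  · rw [if_neg c1, zero_add]
    by_cases hb : v ∈ g.B ∧ v + 1 ∉ g.B
    · rw [if_pos hb]
      by_cases ha : v ∈ g.A ↔ v + 1 ∈ g.A
      · rw [sw, eC _ ha, eB _ hb.1 hb.2]
      · have h1 : uc f ⟨g.A, insert (v + 1) (g.B.erase v)⟩ = 0 := by
          by_contra hc; have := k2 hc; clear * - this ha hb; simp at this; grind
        have h2 : uc f (sw v g) = 0 := by
          by_contra hc; have := k3 hc; clear * - this ha hb; grind
        rw [h1, h2]
    · rw [if_neg hb]
      by_contra hc; have := k3 (Ne.symm hc); clear * - this c1 hb; grind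

end WD

theorem q_ne_zero : (q : Qq) ≠ 0 := RatFunc.X_ne_zero

/-! ### Creating an arc between adjacent vertices -/

namespace WD

/-- Add the arc `(v, v + 1)` to a matching. -/
def addArc (v : ℤ) (ι : ℤ → ℤ) (x : ℤ) : ℤ :=
  if x = v then v + 1 else if x = v + 1 then v else ι x

theorem RM_addArc {v : ℤ} {f : WD} {ι : ℤ → ℤ} (h : RM f ι)
    (h0 : v ∈ f.A ∧ v ∉ f.B) (h1 : v + 1 ∈ f.B ∧ v + 1 ∉ f.A) :
    RM ⟨f.A, insert v (f.B.erase (v + 1))⟩ (addArc v ι) := by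
  obtain ⟨i1, i2, i3, i4⟩ := h
  have e0 := i2 v (by grind)
  have e1 := i2 (v + 1) (by grind)
  have ne0 : ∀ x, x ≠ v → ι x ≠ v := fun x hx e => hx (by rw [← i1 x, e, e0])
  have ne1 : ∀ x, x ≠ v + 1 → ι x ≠ v + 1 := fun x hx e => hx (by rw [← i1 x, e, e1])
  unfold addArc
  refine ⟨fun x => ?_, fun x hx => ?_, fun x => ?_, fun x y hxy hyx hy => ?_⟩
  · have := i1 x; have := ne0 x; have := ne1 x
    by_cases a : x = v
    · simp [a]
    · by_cases b : x = v + 1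
      · simp [b]
      · simp [*]
  · have := i2 x
    simp only [Finset.mem_insert, Finset.mem_erase] at hx
    clear i1 i2 i3 i4 ne0 ne1
    grind
  · have := i3 x
    simp only [Finset.mem_insert, Finset.mem_erase]
    clear i1 i2 i3 i4 ne0 ne1
    grind
  · simp only [Finset.mem_insert, Finset.mem_erase] at hy
    have a1 := i4 x y hxy
    have := i2 x; have := ne0 x; have := ne1 x
    have := ne0 y; have := ne1 y
    clear i1 i2 i3 i4 ne0 ne1
    by_cases c0 : x = v
    · simp only [c0, if_true] at hyx; omega
    by_cases c1 : x = v + 1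
    · subst c1; simp at hyx; omega
    simp only [c0, c1, if_false] at hyx ⊢
    by_cases d0 : y = v
    · subst d0; simp; omega
    by_cases d1 : y = v + 1
    · subst d1; simp; omega
    simp only [d0, d1, if_false, false_or, ne_eq, not_false_eq_true, true_and] at hy ⊢
    exact a1 hyx hy

/-- Of the two singles, E_v can move the one at v + 1 to v with coefficient 1, making a pair at v,
or the one at v to v + 1 with coefficient q, making a pair at v + 1. These are the two orientations
of the new arc with their weights. -/
theorem eop_uc_create {v : ℤ} {f : WD}
    (h0 : v ∈ f.A ∧ v ∉ f.B) (h1 : v + 1 ∈ f.B ∧ v + 1 ∉ f.A) (g : WD) :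
    eop v (uc f) g = uc ⟨f.A, insert v (f.B.erase (v + 1))⟩ g := by
  classical
  have h := f.mt_RM
  have h' := RM_addArc h h0 h1
  rw [uc_eq h']
  set ι := f.mt with hι
  have e0 := h.sing v (by grind)
  have e1 := h.sing (v + 1) (by grind)
  have ne0 : ∀ x, x ≠ v → ι x ≠ v := fun x hx e => hx (by rw [← h.inv x, e, e0])
  have ne1 : ∀ x, x ≠ v + 1 → ι x ≠ v + 1 := fun x hx e => hx (by rw [← h.inv x, e, e1])
  have hne : v ≠ v + 1 := by omega
  have key : ∀ k, uc f k ≠ 0 → (v ∈ k.A ∧ v ∉ k.B) ∧ (v + 1 ∈ k.B ∧ v + 1 ∉ k.A) := by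
    intro k hk
    obtain ⟨a, b, -⟩ := orient_of_uc_ne hk
    exact ⟨(a v).2 h0, (b (v + 1)).2 h1⟩
  have k1 := key ⟨insert v (g.A.erase (v + 1)), g.B⟩
  have k2 := key ⟨g.A, insert (v + 1) (g.B.erase v)⟩
  simp only [Finset.mem_insert, Finset.mem_erase, hne] at k1 k2
  have key' : Orient (addArc v ι) ⟨f.A, insert v (f.B.erase (v + 1))⟩ g →
      (v ∈ g.A ∧ v ∈ g.B ∧ v + 1 ∉ g.A ∧ v + 1 ∉ g.B) ∨
      (v ∉ g.A ∧ v ∉ g.B ∧ v + 1 ∈ g.A ∧ v + 1 ∈ g.B) := by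
    rintro ⟨a, b, c⟩
    have a0 := a v; have a1 := a (v + 1); have b0 := b v; have b1 := b (v + 1)
    have c0 := c v
    simp only [addArc, if_true, Finset.mem_insert, Finset.mem_erase] at a0 a1 b0 b1 c0
    clear a b c key k1 k2 ne0 ne1
    grind
  unfold eop
  by_cases s1 : v ∈ g.A ∧ v ∈ g.B ∧ v + 1 ∉ g.A ∧ v + 1 ∉ g.B
  · have hO : Orient (addArc v ι) ⟨f.A, insert v (f.B.erase (v + 1))⟩ g ↔
        Orient ι f ⟨g.A, insert (v + 1) (g.B.erase v)⟩ := by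
      refine and_congr (forall_congr' fun x => ?_) (and_congr (forall_congr' fun x => ?_)
        (forall_congr' fun x => ?_))
      · simp only [Finset.mem_insert, Finset.mem_erase]; grind
      · simp only [Finset.mem_insert, Finset.mem_erase]; grind
      · have := ne0 x; have := ne1 x
        simp only [Finset.mem_insert, Finset.mem_erase, addArc]; grind
    rw [if_neg (fun h => s1.2.2.1 h.1), if_pos ⟨s1.2.1, s1.2.2.2⟩, zero_add, uc_eq h]
    simp only [hO]
    congr 2
    unfold cnt
    congr 1
    ext x
    simp only [P, Finset.mem_filter, Finset.mem_inter, Finset.mem_insert, Finset.mem_erase, addArc]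
    grind
  by_cases s2 : v ∉ g.A ∧ v ∉ g.B ∧ v + 1 ∈ g.A ∧ v + 1 ∈ g.B
  · have hO : Orient (addArc v ι) ⟨f.A, insert v (f.B.erase (v + 1))⟩ g ↔
        Orient ι f ⟨insert v (g.A.erase (v + 1)), g.B⟩ := by
      refine and_congr (forall_congr' fun x => ?_) (and_congr (forall_congr' fun x => ?_)
        (forall_congr' fun x => ?_))
      · simp only [Finset.mem_insert, Finset.mem_erase]; grind
      · simp only [Finset.mem_insert, Finset.mem_erase]; grind
      · have := ne0 x; have := ne1 x
        simp only [Finset.mem_insert, Finset.mem_erase, addArc]; grind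
    rw [if_pos ⟨s2.2.2.1, s2.1⟩, if_neg (show ¬ (v ∈ g.B ∧ v + 1 ∉ g.B) from fun h => s2.2.1 h.1), add_zero, uc_eq h]
    simp only [hO]
    have hc : cnt (addArc v ι) g = cnt ι ⟨insert v (g.A.erase (v + 1)), g.B⟩ + 1 := by
      unfold cnt
      rw [← Finset.card_insert_of_notMem (a := v + 1)]
      · congr 1
        ext x
        simp only [P, Finset.mem_filter, Finset.mem_inter, Finset.mem_insert, Finset.mem_erase,
          addArc]
        grind
      · simp [P]
    rw [hc, pow_succ]
    simp only [s2, if_true, if_false, sub_zero, zpow_one]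
    split_ifs
    · ring
    · ring
  · rw [if_neg (fun hc => (key' hc).elim s1 s2)]
    have z1 : (v + 1 ∈ g.A ∧ v ∉ g.A) → uc f ⟨insert v (g.A.erase (v + 1)), g.B⟩ = 0 := by
      intro hh; by_contra hc; have := k1 hc; clear * - this hh s1 s2; grind
    have z2 : (v ∈ g.B ∧ v + 1 ∉ g.B) → uc f ⟨g.A, insert (v + 1) (g.B.erase v)⟩ = 0 := by
      intro hh; by_contra hc; have := k2 hc; clear * - this hh s1 s2; grind
    rw [ite_eq_right_iff.2 (fun c => by rw [z1 c, mul_zero]), ite_eq_right_iff.2 z2, add_zero]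

end WD

/-! ### The diagram left after a cap -/

namespace WD

/-- The weight diagram whose matching is `surg v f.mt`, with singles at `v` and `v + 1`. -/
def capWD (v : ℤ) (f : WD) : WD :=
  ⟨insert (v + 1) ((f.A \ f.B) ∪
      (insert (f.mt v) (insert (f.mt (v + 1)) f.P)).filter fun x => x < surg v f.mt x),
    insert v ((f.B \ f.A) ∪
      (insert (f.mt v) (insert (f.mt (v + 1)) f.P)).filter fun x => x < surg v f.mt x)⟩

theorem surg_left (v : ℤ) (ι : ℤ → ℤ) : surg v ι v = v := by simp [surg]
theorem surg_right (v : ℤ) (ι : ℤ → ℤ) : surg v ι (v + 1) = v + 1 := by simp [surg]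

theorem surg_of_ne {v : ℤ} {ι : ℤ → ℤ} {x : ℤ} (h0 : x ≠ v) (h1 : x ≠ v + 1) (h2 : ι x ≠ v)
    (h3 : ι x ≠ v + 1) : surg v ι x = ι x := by simp [surg, h0, h1, h2, h3]

/-- The finite set filtered in `capWD` contains all left ends after surgery: an unchanged arc starts
at a pair of `f`, and the new arc joins the partners of v and v + 1. -/
theorem capWD_A {v : ℤ} {f : WD} (x : ℤ) :
    x ∈ (capWD v f).A ↔ x = v + 1 ∨ (x ∈ f.A ∧ x ∉ f.B) ∨ x < surg v f.mt x := by
  simp only [capWD, Finset.mem_insert, Finset.mem_union, Finset.mem_sdiff, Finset.mem_filter]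
  refine or_congr Iff.rfl (or_congr Iff.rfl ⟨fun h => h.2, fun h => ⟨?_, h⟩⟩)
  have hi := f.mt_RM.inv x
  by_cases a : f.mt x = v
  · left; rw [← a, hi]
  by_cases b : f.mt x = v + 1
  · right; left; rw [← b, hi]
  right; right
  have c : x ≠ v := by rintro rfl; rw [surg_left] at h; omega
  have d : x ≠ v + 1 := by rintro rfl; rw [surg_right] at h; omega
  rw [surg_of_ne c d a b, ← f.mt_RM.pair] at h
  simpa [P] using h

theorem capWD_B {v : ℤ} {f : WD} (x : ℤ) :
    x ∈ (capWD v f).B ↔ x = v ∨ (x ∈ f.B ∧ x ∉ f.A) ∨ x < surg v f.mt x := by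
  have := capWD_A (v := v) (f := f) x
  simp only [capWD, Finset.mem_insert, Finset.mem_union, Finset.mem_sdiff, Finset.mem_filter]
    at this ⊢
  have hd : x < surg v f.mt x → x ≠ v + 1 ∧ ¬ (x ∈ f.A ∧ x ∉ f.B) := by
    intro h
    have d : x ≠ v + 1 := by rintro rfl; rw [surg_right] at h; omega
    have c : x ≠ v := by rintro rfl; rw [surg_left] at h; omega
    refine ⟨d, fun hs => ?_⟩
    have e := f.mt_RM.sing x (by tauto)
    rw [surg_of_ne c d (by omega) (by omega)] at h
    omega
  refine or_congr Iff.rfl (or_congr Iff.rfl ⟨fun h => h.2, fun h => ?_⟩)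
  have := this.2 (Or.inr (Or.inr h))
  have := hd h
  tauto

theorem RM_capWD {v : ℤ} {f : WD} (h0 : v ∈ f.A ↔ v ∈ f.B) (h1 : v + 1 ∈ f.A ↔ v + 1 ∈ f.B) :
    RM (capWD v f) (surg v f.mt) := by
  have h := f.mt_RM
  set ι := f.mt with hι
  have sur : ∀ x, ¬ (x ∈ f.A ↔ x ∈ f.B) → surg v ι x = x := by
    intro x hx
    have e := h.sing x hx
    have c : x ≠ v := by rintro rfl; exact hx h0
    have d : x ≠ v + 1 := by rintro rfl; exact hx h1
    rw [surg_of_ne c d (by omega) (by omega), e]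
  refine ⟨surg_inv h.inv, fun x hx => ?_, fun x => ?_, fun x y hxy hyx hy => ?_⟩
  · rw [capWD_A, capWD_B] at hx
    by_cases c : x = v
    · rw [c, surg_left]
    by_cases d : x = v + 1
    · rw [d, surg_right]
    exact sur x (by tauto)
  · rw [capWD_A, capWD_B]
    constructor
    · rintro ⟨a | a | a, b⟩
      · subst a
        rcases b with b | b | b
        · omega
        · tauto
        · exact b
      · rcases b with b | b | b
        · subst b; tauto
        · tauto
        · exact b
      · exact a
    · intro a; exact ⟨Or.inr (Or.inr a), Or.inr (Or.inr a)⟩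
  · rw [capWD_A, capWD_B] at hy
    have ey : (y ∈ f.A ↔ y ∈ f.B) := by
      by_contra hc
      have := sur y hc
      rw [← hι, this] at hy
      have hv : y ≠ v := by rintro rfl; exact hc h0
      have hv1 : y ≠ v + 1 := by rintro rfl; exact hc h1
      simp only [hv, hv1, lt_irrefl, or_false, false_or] at hy
      tauto
    have hv : y ≠ v := by
      rintro rfl
      rw [← hι, surg_left] at hy
      have : ¬ (y = y + 1) := by omega
      simp only [this, lt_irrefl, or_false, false_or, true_or, iff_true] at hy
      tauto
    have hv1 : y ≠ v + 1 := by
      rintro rfl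
      rw [← hι, surg_right] at hy
      have : ¬ (v + 1 = v) := by omega
      simp only [this, lt_irrefl, or_false, false_or, true_or, true_iff] at hy
      tauto
    exact surg_nc (ns := fun y => (y ∈ f.A ↔ y ∈ f.B)) h.inv h.nc h.sing h0 h1 x y hxy hyx ey hv hv1

end WD

/-! ### Orientations and their weights under surgery -/

namespace WD

theorem inv_ne {ι : ℤ → ℤ} (inv : ∀ x, ι (ι x) = x) {a b : ℤ} (h : ι a ≠ b) : ι b ≠ a :=
  fun e => h (by rw [← e, inv])

theorem surg_of_left {v : ℤ} {ι : ℤ → ℤ} (inv : ∀ x, ι (ι x) = x) (h0 : ι v ≠ v)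
    (h1 : ι v ≠ v + 1) : surg v ι (ι v) = if ι (v + 1) = v + 1 then ι v else ι (v + 1) := by
  simp [surg, h0, h1, inv v]

theorem surg_of_right {v : ℤ} {ι : ℤ → ℤ} (inv : ∀ x, ι (ι x) = x) (h0 : ι (v + 1) ≠ v + 1)
    (h1 : ι v ≠ v + 1) : surg v ι (ι (v + 1)) = if ι v = v then ι (v + 1) else ι v := by
  have : ι (v + 1) ≠ v := inv_ne inv h1
  simp [surg, h0, this, inv (v + 1)]

/-- Here p marks the pairs after the cap. Adding a pair at v empties the partner of v; as v + 1
stays empty, its partner must be a pair unless v + 1 is unmatched. Together this orients the joined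
arc. -/
theorem orient_surg_left {v : ℤ} {ι : ℤ → ℤ} {p : ℤ → Prop} (inv : ∀ x, ι (ι x) = x)
    (p0 : ¬ p v) (p1 : ¬ p (v + 1)) (hne : ι v ≠ v + 1) :
    (∀ x, (p (ι x) ∨ ι x = v) ↔ (¬ (p x ∨ x = v) ∧ ι x ≠ x)) ↔
      (∀ x, p (surg v ι x) ↔ (¬ p x ∧ surg v ι x ≠ x)) ∧
        ι v ≠ v ∧ (p (ι (v + 1)) ∨ ι (v + 1) = v + 1) := by
  have hne' : ι (v + 1) ≠ v := inv_ne inv hne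
  have iv := inv v
  have iw := inv (v + 1)
  have sv := surg_left v ι
  have sw := surg_right v ι
  constructor
  · intro H
    have a0 := H v
    have a1 := H (v + 1)
    have a2 := H (ι v)
    have a3 := H (ι (v + 1))
    rw [iv] at a2
    rw [iw] at a3
    have c0 : ι v ≠ v := by grind
    have sp := surg_of_left inv c0 hne
    refine ⟨fun x => ?_, c0, by grind⟩
    have a4 := H x
    by_cases x0 : x = v
    · subst x0; rw [sv]; simp [p0]
    by_cases x1 : x = v + 1
    · subst x1; rw [sw]; simp [p1]
    by_cases x2 : ι x = v
    · have : x = ι v := by rw [← x2, inv]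
      subst this
      rw [sp]; grind
    by_cases x3 : ι x = v + 1
    · have : x = ι (v + 1) := by rw [← x3, inv]
      subst this
      rw [surg_of_right inv (by grind) hne]; grind
    rw [surg_of_ne x0 x1 x2 x3]; grind
  · rintro ⟨H, c0, c1⟩ x
    have sp := surg_of_left inv c0 hne
    have a2 := H (ι v)
    rw [sp] at a2
    by_cases x0 : x = v
    · subst x0; grind
    by_cases x1 : x = v + 1
    · subst x1; grind
    by_cases x2 : ι x = v
    · have : x = ι v := by rw [← x2, inv]
      subst this
      grind
    by_cases x3 : ι x = v + 1
    · have : x = ι (v + 1) := by rw [← x3, inv]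
      subst this
      have a3 := H (ι (v + 1))
      rw [surg_of_right inv (by grind) hne] at a3; grind
    have a4 := H x
    rw [surg_of_ne x0 x1 x2 x3] at a4; grind

theorem orient_surg_right {v : ℤ} {ι : ℤ → ℤ} {p : ℤ → Prop} (inv : ∀ x, ι (ι x) = x)
    (p0 : ¬ p v) (p1 : ¬ p (v + 1)) (hne : ι v ≠ v + 1) :
    (∀ x, (p (ι x) ∨ ι x = v + 1) ↔ (¬ (p x ∨ x = v + 1) ∧ ι x ≠ x)) ↔
      (∀ x, p (surg v ι x) ↔ (¬ p x ∧ surg v ι x ≠ x)) ∧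
        ι (v + 1) ≠ v + 1 ∧ (p (ι v) ∨ ι v = v) := by
  have hne' : ι (v + 1) ≠ v := inv_ne inv hne
  have iv := inv v
  have iw := inv (v + 1)
  have sv := surg_left v ι
  have sw := surg_right v ι
  constructor
  · intro H
    have a0 := H v
    have a1 := H (v + 1)
    have a2 := H (ι v)
    have a3 := H (ι (v + 1))
    rw [iv] at a2
    rw [iw] at a3
    have c0 : ι (v + 1) ≠ v + 1 := by grind
    have sp := surg_of_right inv c0 hne
    refine ⟨fun x => ?_, c0, by grind⟩
    have a4 := H x
    by_cases x0 : x = v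
    · subst x0; rw [sv]; simp [p0]
    by_cases x1 : x = v + 1
    · subst x1; rw [sw]; simp [p1]
    by_cases x2 : ι x = v
    · have : x = ι v := by rw [← x2, inv]
      subst this
      rw [surg_of_left inv (by grind) hne]; grind
    by_cases x3 : ι x = v + 1
    · have : x = ι (v + 1) := by rw [← x3, inv]
      subst this
      rw [sp]; grind
    rw [surg_of_ne x0 x1 x2 x3]; grind
  · rintro ⟨H, c0, c1⟩ x
    have sp := surg_of_right inv c0 hne
    have a2 := H (ι (v + 1))
    rw [sp] at a2
    by_cases x0 : x = v
    · subst x0; grind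
    by_cases x1 : x = v + 1
    · subst x1; grind
    by_cases x2 : ι x = v
    · have : x = ι v := by rw [← x2, inv]
      subst this
      have a3 := H (ι v)
      rw [surg_of_left inv (by grind) hne] at a3; grind
    by_cases x3 : ι x = v + 1
    · have : x = ι (v + 1) := by rw [← x3, inv]
      subst this
      grind
    have a4 := H x
    rw [surg_of_ne x0 x1 x2 x3] at a4; grind

theorem orient_surg_arc {v w : ℤ} {ι : ℤ → ℤ} {p : ℤ → Prop} (inv : ∀ x, ι (ι x) = x)
    (p0 : ¬ p v) (p1 : ¬ p (v + 1)) (he : ι v = v + 1) (hw : w = v ∨ w = v + 1) :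
    (∀ x, (p (ι x) ∨ ι x = w) ↔ (¬ (p x ∨ x = w) ∧ ι x ≠ x)) ↔
      (∀ x, p (surg v ι x) ↔ (¬ p x ∧ surg v ι x ≠ x)) := by
  have he' : ι (v + 1) = v := by rw [← he, inv]
  have sv := surg_left v ι
  have sw := surg_right v ι
  refine forall_congr' fun x => ?_
  by_cases x0 : x = v
  · subst x0; rw [sv, he]; rcases hw with rfl | rfl <;> simp [p0, p1]
  by_cases x1 : x = v + 1
  · subst x1; rw [sw, he']; rcases hw with rfl | rfl <;> simp [p0, p1]
  have x2 : ι x ≠ v := fun h => x1 (by rw [← he, ← h, inv])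
  have x3 : ι x ≠ v + 1 := fun h => x0 (by rw [← he', ← h, inv])
  rw [surg_of_ne x0 x1 x2 x3]
  rcases hw with rfl | rfl <;> simp [*]

variable {v : ℤ} {f : WD} {ι : ℤ → ℤ}

/-- The extra right end cancels the factor q⁻¹ in `eop_uc_of_capShape`. If v is a right end, it is
counted itself. If v is a left end, the arc of v + 1 lies under that of v, and the partner of v + 1
is a right end that turns into a left end when the arcs are joined. -/
theorem cnt_surg_left (h : RM f ι) (h0 : v ∈ f.A ↔ v ∈ f.B) (h1 : v + 1 ∈ f.A ↔ v + 1 ∈ f.B)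
    (hne : ι v ≠ v + 1) (hv : ι v ≠ v) {P : Finset ℤ} (p0 : v ∉ P) (p1 : v + 1 ∉ P)
    (p2 : ι v ∉ P) (p3 : ι (v + 1) ∈ P ∨ ι (v + 1) = v + 1) :
    ((insert v P).filter fun x => ι x < x).card = (P.filter fun x => surg v ι x < x).card + 1 := by
  have inv := h.inv
  have gen : ∀ x ∈ P, x ≠ ι (v + 1) → surg v ι x = ι x := fun x hx hr =>
    surg_of_ne (by rintro rfl; exact p0 hx) (by rintro rfl; exact p1 hx)
      (fun e => p2 (by rwa [← e, inv])) (fun e => hr (by rw [← e, inv]))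
  have hr : ι (v + 1) ≠ v + 1 → surg v ι (ι (v + 1)) = ι v := fun c => by
    rw [surg_of_right inv c hne, if_neg hv]
  have hne' : ι (v + 1) ≠ v := inv_ne inv hne
  rcases lt_or_gt_of_ne hv with c | c
  · rw [Finset.filter_insert, if_pos c, Finset.card_insert_of_notMem (by simp [p0])]
    congr 2
    refine Finset.filter_congr fun x hx => ?_
    by_cases e : x = ι (v + 1)
    · have e' : ι (v + 1) ≠ v + 1 := by rintro e'; rw [e, e'] at hx; exact p1 hx
      have := h.nc (ι (v + 1)) v
      rw [inv] at this
      rw [e, inv, hr e']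
      have := fun a => this a (by omega) h0
      omega
    · rw [gen x hx e]
  · have k := h.nc v (v + 1) (by omega) (by omega) h1
    have p3 := p3.resolve_right k.2.2
    rw [Finset.filter_insert, if_neg (by omega)]
    rw [← Finset.card_insert_of_notMem (a := ι (v + 1))]
    · congr 1
      ext x
      simp only [Finset.mem_filter, Finset.mem_insert]
      by_cases e : x = ι (v + 1)
      · rw [e, inv]; simp [p3]; omega
      · simp only [e, false_or]
        refine and_congr_right fun hx => ?_
        rw [gen x hx e]
    · simp only [Finset.mem_filter, hr k.2.2]; omega

/-- The count is unchanged: if v + 1 is a right end, then the partner of v turns from a left end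
into a right end and replaces it. If v + 1 is a left end, the partner of v keeps its type. -/
theorem cnt_surg_right (h : RM f ι) (h0 : v ∈ f.A ↔ v ∈ f.B) (h1 : v + 1 ∈ f.A ↔ v + 1 ∈ f.B)
    (hne : ι v ≠ v + 1) (hv : ι (v + 1) ≠ v + 1) {P : Finset ℤ} (p0 : v ∉ P) (p1 : v + 1 ∉ P)
    (p2 : ι (v + 1) ∉ P) (p3 : ι v ∈ P ∨ ι v = v) :
    ((insert (v + 1) P).filter fun x => ι x < x).card =
      (P.filter fun x => surg v ι x < x).card := by
  have inv := h.inv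
  have gen : ∀ x ∈ P, x ≠ ι v → surg v ι x = ι x := fun x hx hr =>
    surg_of_ne (by rintro rfl; exact p0 hx) (by rintro rfl; exact p1 hx)
      (fun e => hr (by rw [← e, inv])) (fun e => p2 (by rwa [← e, inv]))
  have hr : ι v ≠ v → surg v ι (ι v) = ι (v + 1) := fun c => by
    rw [surg_of_left inv c hne, if_neg hv]
  have hne' : ι (v + 1) ≠ v := inv_ne inv hne
  rcases lt_or_gt_of_ne hv with c | c
  · have k := h.nc (ι (v + 1)) v (by omega) (by rw [inv]; omega) h0
    rw [inv] at k
    have p3 := p3.resolve_right k.2.2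
    rw [Finset.filter_insert, if_pos c, Finset.card_insert_of_notMem (by simp [p1])]
    rw [← Finset.card_insert_of_notMem (a := ι v)]
    · congr 1
      ext x
      simp only [Finset.mem_filter, Finset.mem_insert]
      by_cases e : x = ι v
      · rw [e, hr k.2.2]; simp [p3, k.1]
      · simp only [e, false_or]
        refine and_congr_right fun hx => ?_
        rw [gen x hx e]
    · simp only [Finset.mem_filter, inv]; omega
  · rw [Finset.filter_insert, if_neg (by omega)]
    congr 1
    refine Finset.filter_congr fun x hx => ?_
    by_cases e : x = ι v
    · have e' : ι v ≠ v := by rintro e'; rw [e, e'] at hx; exact p0 hx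
      have k := h.nc v (v + 1) (by omega)
      rw [e, inv, hr e']
      have := fun a => k a h1
      omega
    · rw [gen x hx e]

theorem cnt_surg_arc (h : RM f ι) (he : ι v = v + 1) {P : Finset ℤ} (p0 : v ∉ P) (p1 : v + 1 ∉ P) :
    ((insert v P).filter fun x => ι x < x).card = (P.filter fun x => surg v ι x < x).card ∧
    ((insert (v + 1) P).filter fun x => ι x < x).card =
      (P.filter fun x => surg v ι x < x).card + 1 := by
  have inv := h.inv
  have he' : ι (v + 1) = v := by rw [← he, inv]
  have e : (P.filter fun x => ι x < x) = P.filter fun x => surg v ι x < x := by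
    refine Finset.filter_congr fun x hx => ?_
    rw [surg_of_ne (by rintro rfl; exact p0 hx) (by rintro rfl; exact p1 hx)
      (fun e => p1 (by rw [← he, ← e, inv]; exact hx))
      (fun e => p0 (by rw [← he', ← e, inv]; exact hx))]
  constructor
  · rw [Finset.filter_insert, if_neg (by omega), e]
  · rw [Finset.filter_insert, if_pos (by omega), Finset.card_insert_of_notMem (by simp [p1]), e]

end WD

/-! ### E_v at two vertices that are not singles -/

namespace WD

/-- The shape at the vertices `v`, `v + 1` of the diagrams produced by a cap. -/
def CapShape (v : ℤ) (g : WD) : Prop := v ∈ g.B ∧ v ∉ g.A ∧ v + 1 ∈ g.A ∧ v + 1 ∉ g.B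

theorem eop_uc_of_capShape {v : ℤ} {f g : WD} (hg : CapShape v g) :
    eop v (uc f) g = q⁻¹ * uc f ⟨insert v (g.A.erase (v + 1)), g.B⟩ +
      uc f ⟨g.A, insert (v + 1) (g.B.erase v)⟩ := by
  obtain ⟨a, b, c, d⟩ := hg
  simp [eop, a, b, c, d]

theorem eop_uc_of_not_capShape {v : ℤ} {f g : WD} (h0 : v ∈ f.A ↔ v ∈ f.B)
    (h1 : v + 1 ∈ f.A ↔ v + 1 ∈ f.B) (hg : ¬ CapShape v g) : eop v (uc f) g = 0 := by
  have key : ∀ k, uc f k ≠ 0 → (v ∈ k.A ↔ v ∈ k.B) ∧ (v + 1 ∈ k.A ↔ v + 1 ∈ k.B) := by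
    intro k hk
    obtain ⟨a, b, -⟩ := orient_of_uc_ne hk
    have a0 := a v; have b0 := b v; have a1 := a (v + 1); have b1 := b (v + 1)
    clear a b
    constructor
    · clear a1 b1 h1; grind
    · clear a0 b0 h0; grind
  have hne : v ≠ v + 1 := by omega
  have k1 := key ⟨insert v (g.A.erase (v + 1)), g.B⟩
  have k2 := key ⟨g.A, insert (v + 1) (g.B.erase v)⟩
  simp only [Finset.mem_insert, Finset.mem_erase, hne] at k1 k2
  unfold eop
  unfold CapShape at hg
  have z1 : (v + 1 ∈ g.A ∧ v ∉ g.A) → uc f ⟨insert v (g.A.erase (v + 1)), g.B⟩ = 0 := by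
    intro hh; by_contra hc; have := k1 hc; clear * - this hh hg; grind
  have z2 : (v ∈ g.B ∧ v + 1 ∉ g.B) → uc f ⟨g.A, insert (v + 1) (g.B.erase v)⟩ = 0 := by
    intro hh; by_contra hc; have := k2 hc; clear * - this hh hg; grind
  rw [ite_eq_right_iff.2 (fun c => by rw [z1 c, mul_zero]), ite_eq_right_iff.2 z2, add_zero]

theorem uc_capWD_of_not_capShape {v : ℤ} {f g : WD} (h0 : v ∈ f.A ↔ v ∈ f.B)
    (h1 : v + 1 ∈ f.A ↔ v + 1 ∈ f.B) (hg : ¬ CapShape v g) : uc (capWD v f) g = 0 := by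
  by_contra hc
  obtain ⟨a, b, -⟩ := orient_of_uc_ne hc
  apply hg
  have a1 := (a (v + 1)).2
  have b0 := (b v).2
  rw [capWD_A, capWD_B, surg_right] at a1
  rw [capWD_A, capWD_B, surg_left] at b0
  have hne : ¬ (v = v + 1) := by omega
  have hne' : ¬ (v + 1 = v) := by omega
  simp only [lt_irrefl, or_false, hne, false_or, hne', true_or, true_and] at a1 b0
  have a1 := a1 (by tauto)
  have b0 := b0 (by tauto)
  exact ⟨b0.1, b0.2, a1.1, a1.2⟩

theorem capWD_single {v : ℤ} {f : WD} (h0 : v ∈ f.A ↔ v ∈ f.B) (h1 : v + 1 ∈ f.A ↔ v + 1 ∈ f.B)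
    (x : ℤ) :
    ((x ∈ (capWD v f).A ∧ x ∉ (capWD v f).B) ↔ (x = v + 1 ∨ (x ∈ f.A ∧ x ∉ f.B))) ∧
    ((x ∈ (capWD v f).B ∧ x ∉ (capWD v f).A) ↔ (x = v ∨ (x ∈ f.B ∧ x ∉ f.A))) := by
  have hne : ¬ (v = v + 1) := by omega
  rw [capWD_A, capWD_B]
  by_cases x0 : x = v
  · subst x0; rw [surg_left]; clear h1; simp; grind
  by_cases x1 : x = v + 1
  · subst x1; rw [surg_right]; clear h0; simp; grind
  simp only [x0, x1, false_or]
  have : ¬ (x ∈ f.A ↔ x ∈ f.B) → ¬ x < surg v f.mt x := fun hs => by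
    have e := f.mt_RM.sing x hs
    rw [surg_of_ne x0 x1 (by omega) (by omega)]; omega
  clear h0 h1
  by_cases ha : x ∈ f.A <;> by_cases hb : x ∈ f.B <;> simp [ha, hb] at this ⊢ <;> omega

/-- The diagram `h` stands for either of the two that E_v can send to `g`, with its additional pair
at w equal to v or v + 1. The condition `R` is what the surgery lemmas require beyond an orientation
of the joined arcs. -/
theorem orient_cap_iff {v w : ℤ} {f g h : WD} (h0 : v ∈ f.A ↔ v ∈ f.B)
    (h1 : v + 1 ∈ f.A ↔ v + 1 ∈ f.B) (hg : CapShape v g)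
    (hP : ∀ x, (x ∈ h.A ∧ x ∈ h.B) ↔ ((x ∈ g.A ∧ x ∈ g.B) ∨ x = w))
    (hA : ∀ x, x ≠ v → x ≠ v + 1 → ((x ∈ h.A ↔ x ∈ g.A) ∧ (x ∈ h.B ↔ x ∈ g.B)))
    (hv : v ∈ h.A ↔ v ∈ h.B) (hv1 : v + 1 ∈ h.A ↔ v + 1 ∈ h.B) {R : Prop}
    (hR : (∀ x, ((f.mt x ∈ g.A ∧ f.mt x ∈ g.B) ∨ f.mt x = w) ↔
        (¬ ((x ∈ g.A ∧ x ∈ g.B) ∨ x = w) ∧ f.mt x ≠ x)) ↔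
      (∀ x, (surg v f.mt x ∈ g.A ∧ surg v f.mt x ∈ g.B) ↔
        (¬ (x ∈ g.A ∧ x ∈ g.B) ∧ surg v f.mt x ≠ x)) ∧ R) :
    Orient f.mt f h ↔ Orient (surg v f.mt) (capWD v f) g ∧ R := by
  unfold Orient
  simp only [hP, hR]
  rw [and_assoc, and_assoc]
  obtain ⟨g0, g1, g2, g3⟩ := hg
  refine and_congr (forall_congr' fun x => ?_) (and_congr (forall_congr' fun x => ?_) Iff.rfl)
  · rw [(capWD_single h0 h1 x).1]
    by_cases x0 : x = v
    · subst x0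
      have hne : ¬ (x = x + 1) := by omega
      simp only [hne, false_or]; clear * - h0 g0 g1 hv; grind
    by_cases x1 : x = v + 1
    · subst x1; simp only [true_or]; clear * - h1 g2 g3 hv1; grind
    rw [(hA x x0 x1).1, (hA x x0 x1).2]; simp [x1]
  · rw [(capWD_single h0 h1 x).2]
    by_cases x0 : x = v
    · subst x0; simp only [true_or]; clear * - h0 g0 g1 hv; grind
    by_cases x1 : x = v + 1
    · subst x1
      have hne : ¬ (v + 1 = v) := by omega
      simp only [hne, false_or]; clear * - h1 g2 g3 hv1; grind
    rw [(hA x x0 x1).1, (hA x x0 x1).2]; simp [x0]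

/-- A diagram after the cap comes from a pair at v, with factor q⁻¹, and from a pair at v + 1, with
factor 1. If v and v + 1 are matched with each other, both are orientations and contribute q⁻¹ · 1 +
1 · q. If both are unmatched, neither is. Otherwise exactly one is, and the count of right ends
makes its power of q correct. -/
theorem eop_uc_cap {v : ℤ} {f : WD} (h0 : v ∈ f.A ↔ v ∈ f.B) (h1 : v + 1 ∈ f.A ↔ v + 1 ∈ f.B)
    (g : WD) :
    eop v (uc f) g = (if f.mt v = v + 1 then q + q⁻¹ else
      if f.mt v = v ∧ f.mt (v + 1) = v + 1 then 0 else 1) * uc (capWD v f) g := by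
  classical
  by_cases hg : CapShape v g
  swap
  · rw [eop_uc_of_not_capShape h0 h1 hg, uc_capWD_of_not_capShape h0 h1 hg, mul_zero]
  rw [eop_uc_of_capShape hg, uc_eq (RM_capWD h0 h1), uc_eq f.mt_RM, uc_eq f.mt_RM]
  have hR := f.mt_RM
  set ι := f.mt with hι
  have inv := hR.inv
  have hg' := hg
  obtain ⟨g0, g1, g2, g3⟩ := hg'
  have hne : v ≠ v + 1 := by omega
  have p0 : ¬ (v ∈ g.A ∧ v ∈ g.B) := by tauto
  have p1 : ¬ (v + 1 ∈ g.A ∧ v + 1 ∈ g.B) := by tauto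
  have P0 : v ∉ g.P := by simpa [P] using p0
  have P1 : v + 1 ∉ g.P := by simpa [P] using p1
  have eP1 : (⟨insert v (g.A.erase (v + 1)), g.B⟩ : WD).P = insert v g.P := by
    ext x
    simp only [P, Finset.mem_inter, Finset.mem_insert, Finset.mem_erase]
    clear * - g0 g1 g2 g3; grind
  have eP2 : (⟨g.A, insert (v + 1) (g.B.erase v)⟩ : WD).P = insert (v + 1) g.P := by
    ext x
    simp only [P, Finset.mem_inter, Finset.mem_insert, Finset.mem_erase]
    clear * - g0 g1 g2 g3; grind
  have O1 : ∀ R, _ → (Orient ι f ⟨insert v (g.A.erase (v + 1)), g.B⟩ ↔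
      Orient (surg v ι) (capWD v f) g ∧ R) := fun R hR => orient_cap_iff (w := v) h0 h1 hg
    (fun x => by
      simp only [Finset.mem_insert, Finset.mem_erase]; clear * - g0 g1 g2 g3; grind)
    (fun x a b => by simp [a, b]) (by simp [g0]) (by simp [g3]) hR
  have O2 : ∀ R, _ → (Orient ι f ⟨g.A, insert (v + 1) (g.B.erase v)⟩ ↔
      Orient (surg v ι) (capWD v f) g ∧ R) := fun R hR => orient_cap_iff (w := v + 1) h0 h1 hg
    (fun x => by
      simp only [Finset.mem_insert, Finset.mem_erase]; clear * - g0 g1 g2 g3; grind)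
    (fun x a b => by simp [a, b]) (by simp [g1]) (by simp [g2]) hR
  simp only [cnt, eP1, eP2]
  by_cases he : ι v = v + 1
  · rw [if_pos he]
    have o1 := O1 True (by
      rw [and_true]
      exact orient_surg_arc (p := fun x => x ∈ g.A ∧ x ∈ g.B) inv p0 p1 he (Or.inl rfl))
    have o2 := O2 True (by
      rw [and_true]
      exact orient_surg_arc (p := fun x => x ∈ g.A ∧ x ∈ g.B) inv p0 p1 he (Or.inr rfl))
    rw [and_true] at o1 o2
    simp only [o1, o2, (cnt_surg_arc hR he P0 P1).1, (cnt_surg_arc hR he P0 P1).2]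
    split_ifs <;> ring
  rw [if_neg he]
  have o1 := O1 _ (orient_surg_left (p := fun x => x ∈ g.A ∧ x ∈ g.B) inv p0 p1 he)
  have o2 := O2 _ (orient_surg_right (p := fun x => x ∈ g.A ∧ x ∈ g.B) inv p0 p1 he)
  have mP : ∀ x, (x ∈ g.A ∧ x ∈ g.B) ↔ x ∈ g.P := fun x => by simp [P]
  rw [mP] at o1 o2
  by_cases hO : Orient (surg v ι) (capWD v f) g
  swap
  · rw [if_neg (fun h => hO (o1.1 h).1), if_neg (fun h => hO (o2.1 h).1), if_neg hO]; ring
  rw [if_pos hO]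
  have hOv := hO.2.2
  simp only [mP] at hOv
  by_cases r0 : ι v = v
  · rw [if_neg (fun h => (o1.1 h).2.1 r0)]
    by_cases r1 : ι (v + 1) = v + 1
    · rw [if_neg (fun h => (o2.1 h).2.1 r1), if_pos ⟨r0, r1⟩]; ring
    · have := hOv (ι (v + 1))
      rw [surg_of_right inv r1 he, if_pos r0] at this
      rw [if_pos (o2.2 ⟨hO, r1, Or.inr r0⟩), if_neg (fun h => r1 h.2),
        cnt_surg_right hR h0 h1 he r1 P0 P1 (fun h => (this.1 h).2 rfl) (Or.inr r0)]
      ring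
  by_cases r1 : ι (v + 1) = v + 1
  · rw [if_neg (fun h => (o2.1 h).2.1 r1)]
    have := hOv (ι v)
    rw [surg_of_left inv r0 he, if_pos r1] at this
    rw [if_pos (o1.2 ⟨hO, r0, Or.inr r1⟩), if_neg (fun h => r0 h.1),
        cnt_surg_left hR h0 h1 he r0 P0 P1 (fun h => (this.1 h).2 rfl) (Or.inr r1), pow_succ]
    field_simp [q_ne_zero]
    ring
  · have := hOv (ι v)
    rw [surg_of_left inv r0 he, if_neg r1] at this
    have hpr : ι (v + 1) ≠ ι v := fun e => by
      have := congrArg ι e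
      rw [inv, inv] at this
      omega
    rw [if_neg (fun h => r0 h.1 : ¬ (ι v = v ∧ _))]
    by_cases hp : ι v ∈ g.P
    · have hr : ι (v + 1) ∉ g.P := fun h => (this.1 h).1 hp
      rw [if_neg (fun h => (o1.1 h).2.2.elim hr r1),
        if_pos (o2.2 ⟨hO, r1, Or.inl hp⟩), cnt_surg_right hR h0 h1 he r1 P0 P1 hr (Or.inl hp)]
      ring
    · have hr : ι (v + 1) ∈ g.P := this.2 ⟨hp, hpr⟩
      rw [if_pos (o1.2 ⟨hO, r0, Or.inl hr⟩),
        if_neg (fun h => (o2.1 h).2.2.elim hp r0),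
        cnt_surg_left hR h0 h1 he r0 P0 P1 hp (Or.inl hr), pow_succ]
      field_simp [q_ne_zero]
      ring

end WD

theorem barQ_q : barQ q = q⁻¹ := by
  have : (q : Qq) = algebraMap ℚ[X] Qq Polynomial.X := RatFunc.algebraMap_X.symm
  conv_lhs => rw [this]
  unfold barQ subst
  rw [RatFunc.liftRingHom_algebraMap]
  simp

theorem barQ_q_inv : barQ q⁻¹ = q := by rw [map_inv₀, barQ_q, inv_inv]

/-! ### E_v and F_v map canonical elements to multiples of canonical elements -/

namespace WD

/-- The bar invariant factor by which `E_v` multiplies. -/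
theorem exists_eop_uc (v : ℤ) (f : WD) :
    ∃ (c : Qq) (f' : WD), barQ c = c ∧ ∀ g, eop v (uc f) g = c * uc f' g := by
  by_cases h0 : v ∈ f.A ↔ v ∈ f.B
  · by_cases h1 : v + 1 ∈ f.A ↔ v + 1 ∈ f.B
    · refine ⟨_, capWD v f, ?_, eop_uc_cap h0 h1⟩
      split_ifs
      · rw [map_add, barQ_q, barQ_q_inv, add_comm]
      · simp
      · simp
    · by_cases h2 : v + 1 ∈ f.B
      · refine ⟨1, sw v f, map_one _, fun g => ?_⟩
        rw [one_mul, eop_uc_swap (Or.inr ⟨h2, by tauto, h0⟩)]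
      -- All diagrams involved have v + 1 in the first block only: no label of the first block can
      -- move there, and the second block has no label at v + 1 to move.
      · refine ⟨0, f, map_zero _, fun g => ?_⟩
        have h2' : v + 1 ∈ f.A := by tauto
        rw [zero_mul]
        have key : ∀ k, uc f k ≠ 0 → (v + 1 ∈ k.A ∧ v + 1 ∉ k.B) ∧ (v ∈ k.A ↔ v ∈ k.B) := by
          intro k hk
          obtain ⟨a, b, -⟩ := orient_of_uc_ne hk
          have a0 := a v; have b0 := b v
          refine ⟨(a (v + 1)).2 ⟨h2', h2⟩, ?_⟩
          clear a b; grind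
        have hne : v ≠ v + 1 := by omega
        have k1 := key ⟨insert v (g.A.erase (v + 1)), g.B⟩
        have k2 := key ⟨g.A, insert (v + 1) (g.B.erase v)⟩
        simp only [Finset.mem_insert, Finset.mem_erase, hne] at k1 k2
        unfold eop
        rw [ite_eq_right_iff.2 (fun c => ?_), ite_eq_right_iff.2 (fun c => ?_), add_zero]
        · by_contra hc; have := k2 hc; clear * - this c; grind
        · have : uc f ⟨insert v (g.A.erase (v + 1)), g.B⟩ = 0 := by
            by_contra hc; have := k1 hc; clear * - this c; grind
          rw [this, mul_zero]
  · by_cases h2 : v ∈ f.A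
    · have h3 : v ∉ f.B := by tauto
      by_cases h1 : v + 1 ∈ f.A ↔ v + 1 ∈ f.B
      · refine ⟨1, sw v f, map_one _, fun g => ?_⟩
        rw [one_mul, eop_uc_swap (Or.inl ⟨h2, h3, h1⟩)]
      · by_cases h4 : v + 1 ∈ f.B
        · refine ⟨1, ⟨f.A, insert v (f.B.erase (v + 1))⟩, map_one _, fun g => ?_⟩
          rw [one_mul]
          exact eop_uc_create ⟨h2, h3⟩ ⟨h4, by tauto⟩ g
        · refine ⟨0, f, map_zero _, fun g => ?_⟩
          have h4' : v + 1 ∈ f.A := by tauto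
          rw [zero_mul]
          have key : ∀ k, uc f k ≠ 0 → (v ∈ k.A ∧ v ∉ k.B) ∧ (v + 1 ∈ k.A ∧ v + 1 ∉ k.B) := by
            intro k hk
            obtain ⟨a, b, -⟩ := orient_of_uc_ne hk
            exact ⟨(a v).2 ⟨h2, h3⟩, (a (v + 1)).2 ⟨h4', h4⟩⟩
          have hne : v ≠ v + 1 := by omega
          have k1 := key ⟨insert v (g.A.erase (v + 1)), g.B⟩
          have k2 := key ⟨g.A, insert (v + 1) (g.B.erase v)⟩
          simp only [Finset.mem_insert, Finset.mem_erase, hne] at k1 k2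
          unfold eop
          rw [ite_eq_right_iff.2 (fun c => ?_), ite_eq_right_iff.2 (fun c => ?_), add_zero]
          · by_contra hc; have := k2 hc; clear * - this c; grind
          · have : uc f ⟨insert v (g.A.erase (v + 1)), g.B⟩ = 0 := by
              by_contra hc; have := k1 hc; clear * - this c; grind
            rw [this, mul_zero]
    · refine ⟨0, f, map_zero _, fun g => ?_⟩
      have h3 : v ∈ f.B := by tauto
      rw [zero_mul]
      have key : ∀ k, uc f k ≠ 0 → (v ∈ k.B ∧ v ∉ k.A) := by
        intro k hk
        obtain ⟨a, b, -⟩ := orient_of_uc_ne hk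
        exact (b v).2 ⟨h3, h2⟩
      have hne : v ≠ v + 1 := by omega
      have k1 := key ⟨insert v (g.A.erase (v + 1)), g.B⟩
      have k2 := key ⟨g.A, insert (v + 1) (g.B.erase v)⟩
      simp only [Finset.mem_insert, Finset.mem_erase, hne] at k1 k2
      unfold eop
      rw [ite_eq_right_iff.2 (fun c => ?_), ite_eq_right_iff.2 (fun c => ?_), add_zero]
      · by_contra hc; have := k2 hc; clear * - this c; grind
      · have : uc f ⟨insert v (g.A.erase (v + 1)), g.B⟩ = 0 := by
          by_contra hc; have := k1 hc; clear * - this c; grind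
        rw [this, mul_zero]

/-- Exchange the two blocks. -/
def tr (f : WD) : WD := ⟨f.B, f.A⟩

@[simp] theorem tr_tr (f : WD) : f.tr.tr = f := rfl

theorem RM_tr {f : WD} {ι : ℤ → ℤ} (h : RM f ι) : RM f.tr ι :=
  ⟨h.inv, fun x hx => h.sing x (fun e => hx e.symm), fun x => by rw [← h.pair]; exact and_comm,
    fun x y a b c => h.nc x y a b c.symm⟩

theorem uc_tr (f g : WD) : uc f.tr g.tr = uc f g := by
  classical
  rw [uc_eq (RM_tr f.mt_RM), uc_eq f.mt_RM]
  have : Orient f.mt f.tr g.tr ↔ Orient f.mt f g := by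
    simp only [Orient, tr]
    constructor
    · rintro ⟨a, b, c⟩
      exact ⟨b, a, fun x => by have := c x; rwa [and_comm, and_comm (b := x ∈ g.A)] at this⟩
    · rintro ⟨a, b, c⟩
      exact ⟨b, a, fun x => by have := c x; rwa [and_comm, and_comm (b := x ∈ g.B)] at this⟩
  have e : cnt f.mt g.tr = cnt f.mt g := by
    simp only [cnt, P, tr, Finset.inter_comm]
  simp only [this, e]

/-- The action of `F_v` on coefficient functions. -/
def fop (v : ℤ) (c : WD → Qq) (g : WD) : Qq :=
  (if v ∈ g.A ∧ v + 1 ∉ g.A then c ⟨insert (v + 1) (g.A.erase v), g.B⟩ else 0) +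
  (if v + 1 ∈ g.B ∧ v ∉ g.B then
    q ^ ((if v + 1 ∈ g.A then 1 else 0 : ℤ) - (if v ∈ g.A then 1 else 0)) *
      c ⟨g.A, insert v (g.B.erase (v + 1))⟩ else 0)

/-- The matching does not distinguish the two blocks, so this symmetry transfers all results from
E_v to F_v. -/
theorem fop_eq (v : ℤ) (c : WD → Qq) (g : WD) : fop v c g = eop v (fun h => c h.tr) g.tr := by
  rw [fop, eop, add_comm]; rfl

theorem fop_uc (v : ℤ) (f g : WD) : fop v (uc f) g = eop v (uc f.tr) g.tr := by
  rw [fop_eq]; congr 1; funext h; rw [← uc_tr, tr_tr]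

theorem exists_fop_uc (v : ℤ) (f : WD) :
    ∃ (c : Qq) (f' : WD), barQ c = c ∧ ∀ g, fop v (uc f) g = c * uc f' g := by
  obtain ⟨c, f', hc, h⟩ := exists_eop_uc v f.tr
  refine ⟨c, f'.tr, hc, fun g => ?_⟩
  rw [fop_uc, h, ← uc_tr, tr_tr]

/-- Every canonical basis element of an atypical diagram is obtained from a simpler one by some
`E_v` or `F_v`. -/
theorem exists_simpler {f : WD} (hf : f.P.Nonempty) :
    ∃ (v : ℤ) (f' : WD), ((∀ g, eop v (uc f') g = uc f g) ∨ (∀ g, fop v (uc f') g = uc f g)) ∧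
      (f'.P.card < f.P.card ∨ (f'.P.card = f.P.card ∧
        ∃ p ∈ f.P, ∃ p' ∈ f'.P, (∀ x ∈ f.P, x ≤ p) ∧ (∀ x ∈ f'.P, x ≤ p') ∧
          f'.mt p' - p' < f.mt p - p)) := by
  set p := f.P.max' hf
  have hp : p ∈ f.P := Finset.max'_mem _ _
  have hmax : ∀ x ∈ f.P, x ≤ p := fun x hx => Finset.le_max' _ _ hx
  clear_value p
  have hp' : p ∈ f.A ∧ p ∈ f.B := by simpa [P] using hp
  have hne : p ≠ p + 1 := by omega
  have h1 : ¬ (p + 1 ∈ f.A ∧ p + 1 ∈ f.B) := fun h => by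
    have := hmax (p + 1) (by simpa [P] using h); omega
  have hlt := (f.mt_RM.pair p).1 hp'
  -- As p is the rightmost pair, p + 1 is empty or a single. If it is empty, it ends the arc of p,
  -- and this arc is created by E_p from two singles. If it is a single, exchanging the labels of p
  -- and p + 1 shortens the arc of the rightmost pair by one.
  by_cases hs : p + 1 ∈ f.A ↔ p + 1 ∈ f.B
  · refine ⟨p, ⟨f.A, insert (p + 1) (f.B.erase p)⟩, Or.inl fun g => ?_, Or.inl ?_⟩
    · rw [eop_uc_create (by simp [hp'.1]) (by simp; tauto)]
      congr 1
      ext x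
      · simp
      · simp only [Finset.mem_insert, Finset.mem_erase]; clear * - hp' h1 hs; grind
    · apply Finset.card_lt_card
      rw [Finset.ssubset_iff_of_subset]
      · exact ⟨p, hp, by simp [P]⟩
      · intro x
        simp only [P, Finset.mem_inter, Finset.mem_insert, Finset.mem_erase]
        clear * - hp' h1 hs; grind
  · refine ⟨p, sw p f, ?_, Or.inr ⟨?_, p, hp, p + 1, ?_, hmax, ?_, ?_⟩⟩
    · by_cases ha : p + 1 ∈ f.A
      · left
        intro g
        have hb : p + 1 ∉ f.B := fun h => h1 ⟨ha, h⟩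
        rw [eop_uc_swap, sw_sw]
        left
        simp [mem_sw_A, mem_sw_B, ha, hb, hp'.1, hp'.2]
      · right
        intro g
        have hb : p + 1 ∈ f.B := by tauto
        have : (sw p f).tr = sw p f.tr := rfl
        rw [fop_uc, this, eop_uc_swap, sw_sw, uc_tr]
        left
        simp [mem_sw_A, mem_sw_B, tr, ha, hb, hp'.1, hp'.2]
    · have : (sw p f).P = f.P.map (Equiv.swap p (p + 1)).toEmbedding := by
        simp [P, sw, Finset.map_inter]
      rw [this, Finset.card_map]
    · simp [P, mem_sw_A, mem_sw_B, hp'.1, hp'.2]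
    · intro x hx
      simp only [P, Finset.mem_inter, mem_sw_A, mem_sw_B] at hx
      by_contra hc
      rw [Equiv.swap_apply_of_ne_of_ne (by omega) (by omega)] at hx
      have := hmax x (by simpa [P] using hx); omega
    · rw [(mt_RM (sw p f)).unique (RM_sw f.mt_RM (Or.inr hs))]
      simp only [Equiv.swap_apply_right]
      have h2 : f.mt p ≠ p + 1 := fun e => by
        have := f.mt_RM.sing _ hs
        rw [← e, f.mt_RM.inv] at this; omega
      rw [Equiv.swap_apply_of_ne_of_ne (by omega) h2]
      omega

end WD

namespace WD

/-! ### The order on weight diagrams -/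

theorem finite_subset_pair (X Y : Finset ℤ) : {g : WD | g.A ⊆ X ∧ g.B ⊆ Y}.Finite := by
  refine ((X.powerset ×ˢ Y.powerset).finite_toSet.preimage (f := fun g : WD => (g.A, g.B))
    (fun g _ h _ e => WD.ext (congrArg Prod.fst e) (congrArg Prod.snd e))).subset ?_
  rintro g ⟨h1, h2⟩
  simp [h1, h2]

theorem mem_P {g : WD} {x : ℤ} : x ∈ g.P ↔ x ∈ g.A ∧ x ∈ g.B := by simp [P]

/-- `f ≤ g` if `f` and `g` have the same singles and the pairs of `g` are to the right of those
of `f`. -/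
instance : PartialOrder WD where
  le f g := f.A \ f.B = g.A \ g.B ∧ f.B \ f.A = g.B \ g.A ∧ f.P.card = g.P.card ∧
    ∀ t, (g.P.filter (· < t)).card ≤ (f.P.filter (· < t)).card
  le_refl f := ⟨rfl, rfl, rfl, fun _ => le_rfl⟩
  le_trans f g h := fun ⟨a, b, c, d⟩ ⟨a', b', c', d'⟩ =>
    ⟨a.trans a', b.trans b', c.trans c', fun t => (d' t).trans (d t)⟩
  le_antisymm f g := by
    rintro ⟨a, b, -, d⟩ ⟨-, -, -, d'⟩
    have key : ∀ t, (g.P.filter (· < t)).card = (f.P.filter (· < t)).card :=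
      fun t => le_antisymm (d t) (d' t)
    have aux : ∀ (s : Finset ℤ) (t : ℤ), (s.filter (· < t + 1)).card =
        (s.filter (· < t)).card + if t ∈ s then 1 else 0 := by
      intro s t
      have : s.filter (· < t + 1) = s.filter (· < t) ∪ s.filter (· = t) := by
        ext x; simp only [Finset.mem_filter, Finset.mem_union]; grind
      rw [this, Finset.card_union_of_disjoint, Finset.filter_eq']
      · split_ifs <;> simp
      · rw [Finset.disjoint_left]; simp only [Finset.mem_filter]; intro x; omega
    have hP : f.P = g.P := by
      ext t
      have := key (t + 1)
      rw [aux, aux, key] at this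
      split_ifs at this <;> first | tauto | omega
    have dec : ∀ h : WD, h.A = (h.A \ h.B) ∪ h.P ∧ h.B = (h.B \ h.A) ∪ h.P := by
      intro h
      constructor <;> ext x <;> simp only [Finset.mem_union, Finset.mem_sdiff, mem_P] <;> tauto
    ext1
    · rw [(dec f).1, (dec g).1, a, hP]
    · rw [(dec f).2, (dec g).2, b, hP]

theorem bound_of_P {f g : WD} (h1 : f.A \ f.B = g.A \ g.B) (h2 : f.B \ f.A = g.B \ g.A)
    {p : ℤ → Prop} (hg : ∀ x ∈ g.A ∪ g.B, p x) (hP : ∀ x ∈ f.P, p x) :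
    ∀ x ∈ f.A ∪ f.B, p x := by
  intro x hx
  by_cases h : x ∈ f.P
  · exact hP x h
  · apply hg
    have a := Finset.ext_iff.1 h1 x
    have b := Finset.ext_iff.1 h2 x
    simp only [Finset.mem_union, Finset.mem_sdiff, mem_P] at *
    tauto

/-- All pairs of `g` lie below d + 1, so the counting condition at t = d + 1 forces the same for
`f`. This makes triangular sums locally finite and the resulting maps continuous. -/
theorem le_bound {f g : WD} (h : f ≤ g) {d : ℤ} (hd : ∀ x ∈ g.A ∪ g.B, x ≤ d) :
    ∀ x ∈ f.A ∪ f.B, x ≤ d := by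
  obtain ⟨a, b, c, e⟩ := h
  refine bound_of_P a b hd fun x hx => ?_
  have h1 := e (d + 1)
  rw [Finset.filter_true_of_mem (s := g.P), ← c] at h1
  · have := Finset.eq_of_subset_of_card_le (Finset.filter_subset _ _) h1
    rw [← this, Finset.mem_filter] at hx
    omega
  · intro y hy
    have := hd y (Finset.mem_union_left _ (mem_P.1 hy).1)
    omega

theorem bound_le {f g : WD} (h : f ≤ g) {d : ℤ} (hd : ∀ x ∈ f.A ∪ f.B, d ≤ x) :
    ∀ x ∈ g.A ∪ g.B, d ≤ x := by
  obtain ⟨a, b, c, e⟩ := h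
  refine bound_of_P a.symm b.symm hd fun x hx => ?_
  have h1 := e d
  rw [Finset.filter_false_of_mem (s := f.P)] at h1
  · rw [Finset.card_empty, Nat.le_zero, Finset.card_eq_zero, Finset.filter_eq_empty_iff] at h1
    have := h1 hx; omega
  · intro y hy
    have := hd y (Finset.mem_union_left _ (mem_P.1 hy).1)
    omega

/-- Diagrams above `f` inherit its lower bound, so an upper bound confines their labels to an
interval. The convergence of the expansions rests on this. -/
theorem finite_ge_bounded (f : WD) (d : ℤ) :
    {g : WD | f ≤ g ∧ ∀ x ∈ g.A ∪ g.B, x ≤ d}.Finite := by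
  obtain ⟨e, he⟩ : ∃ e : ℤ, ∀ x ∈ f.A ∪ f.B, e ≤ x := (f.A ∪ f.B).bddBelow
  refine (finite_subset_pair (Finset.Icc e d) (Finset.Icc e d)).subset ?_
  rintro g ⟨h1, h2⟩
  have h3 := bound_le h1 he
  exact ⟨fun x hx => Finset.mem_Icc.2 ⟨h3 x (Finset.mem_union_left _ hx),
    h2 x (Finset.mem_union_left _ hx)⟩, fun x hx => Finset.mem_Icc.2
    ⟨h3 x (Finset.mem_union_right _ hx), h2 x (Finset.mem_union_right _ hx)⟩⟩

instance : LocallyFiniteOrder WD :=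
  LocallyFiniteOrder.ofFiniteIcc fun f g => by
    obtain ⟨d, hd⟩ : ∃ e : ℤ, ∀ x ∈ g.A ∪ g.B, x ≤ e := (g.A ∪ g.B).bddAbove
    exact (finite_ge_bounded f d).subset fun h hh => ⟨hh.1, le_bound hh.2 hd⟩

theorem card_le {f g : WD} (h : f ≤ g) : f.A.card = g.A.card ∧ f.B.card = g.B.card := by
  obtain ⟨a, b, c, -⟩ := h
  have dec : ∀ h : WD, h.A.card = (h.A \ h.B).card + h.P.card ∧
      h.B.card = (h.B \ h.A).card + h.P.card := by
    intro h
    constructor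
    · rw [P, Finset.card_sdiff_add_card_inter]
    · rw [P, Finset.inter_comm, Finset.card_sdiff_add_card_inter]
  rw [(dec f).1, (dec f).2, (dec g).1, (dec g).2, a, b, c]
  exact ⟨rfl, rfl⟩

/-! ### Orientations and the order -/

theorem Orient.mem {ι : ℤ → ℤ} (hι : ∀ x, ι (ι x) = x) {f g : WD} (h : Orient ι f g) (x : ℤ) :
    x ∈ g.P ↔ ι x ∉ g.P ∧ x ≠ ι x := by
  have := h.2.2 (ι x)
  rw [hι] at this
  rw [mem_P, mem_P]; exact this

/-- Two orientations of one matching can be compared arc by arc: if on every arc the pair of `g` is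
not to the right of the pair of `h`, the counting conditions hold. -/
theorem Orient.le {ι : ℤ → ℤ} (hι : ∀ x, ι (ι x) = x) {f g h : WD} (hg : Orient ι f g)
    (hh : Orient ι f h) (hgh : ∀ y ∈ h.P, y ∈ g.P ∨ ι y < y) : g ≤ h := by
  have single : ∀ k, Orient ι f k → k.A \ k.B = f.A \ f.B ∧ k.B \ k.A = f.B \ f.A := by
    intro k hk
    constructor <;> ext x <;> simp only [Finset.mem_sdiff]
    · exact hk.1 x
    · exact hk.2.1 x
  have card : ∀ (k k' : WD) (t : ℤ), Orient ι f k → Orient ι f k' →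
      (∀ y ∈ k.P, y < t → y ∈ k'.P ∨ ι y < t) →
      (k.P.filter (· < t)).card ≤ (k'.P.filter (· < t)).card := by
    intro k k' t hk hk' H
    -- A pair is sent to the end of its arc that carries the pair in the other orientation.
    refine Finset.card_le_card_of_injOn (fun y => if y ∈ k'.P then y else ι y) ?_ ?_
    · intro y hy
      simp only [Finset.coe_filter, Set.mem_ofPred_eq] at hy ⊢
      split_ifs with h1
      · exact ⟨h1, hy.2⟩
      · refine ⟨?_, (H y hy.1 hy.2).resolve_left h1⟩
        rw [hk'.mem hι, hι]
        exact ⟨h1, fun e => ((hk.mem hι y).1 hy.1).2 e.symm⟩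
    · intro y hy z hz
      simp only [Finset.coe_filter, Set.mem_ofPred_eq] at hy hz ⊢
      have a := (hk.mem hι y).1 hy.1
      have b := (hk.mem hι z).1 hz.1
      have inj : ι y = ι z → y = z := fun e => by rw [← hι y, e, hι]
      split_ifs
      · exact id
      · rintro rfl; exact absurd hy.1 b.1
      · rintro rfl; exact absurd hz.1 a.1
      · exact inj
  obtain ⟨N, hN⟩ : ∃ N : ℤ, ∀ x ∈ (g.P ∪ h.P) ∪ (g.P ∪ h.P).image ι, x ≤ N :=
    Finset.bddAbove _
  have hN' : ∀ y, y ∈ g.P ∨ y ∈ h.P → y < N + 1 ∧ ι y < N + 1 := fun y hy => by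
    have h1 := hN y (by simp only [Finset.mem_union]; tauto)
    have h2 := hN (ι y) (Finset.mem_union_right _ (Finset.mem_image_of_mem _
      (by simp only [Finset.mem_union]; tauto)))
    omega
  refine ⟨(single g hg).1.trans (single h hh).1.symm,
    (single g hg).2.trans (single h hh).2.symm, ?_, fun t => ?_⟩
  · have h1 := card g h (N + 1) hg hh fun y hy _ => Or.inr (hN' y (Or.inl hy)).2
    have h2 := card h g (N + 1) hh hg fun y hy _ => Or.inr (hN' y (Or.inr hy)).2
    rw [Finset.filter_true_of_mem fun y hy => (hN' y (Or.inl hy)).1,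
      Finset.filter_true_of_mem fun y hy => (hN' y (Or.inr hy)).1] at h1 h2
    omega
  · refine card h g t hh hg fun y hy hyt => (hgh y hy).imp_right fun e => e.trans hyt

theorem le_of_orient {ι : ℤ → ℤ} {f g : WD} (hf : RM f ι) (h : Orient ι f g) : f ≤ g := by
  have h0 : Orient ι f f := by rw [hf.unique f.mt_RM]; exact orient_self f
  refine h0.le hf.inv h fun y hy => ?_
  by_cases c : ι y < y
  · exact Or.inr c
  · left
    rw [mem_P, hf.pair]
    have := ((h.mem hf.inv y).1 hy).2
    omega

theorem le_of_uc_ne {f g : WD} (h : uc f g ≠ 0) : f ≤ g :=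
  le_of_orient f.mt_RM (orient_of_uc_ne h)

theorem finite_uc (f : WD) : (Function.support (uc f)).Finite := by
  refine (finite_subset_pair (f.A ∪ f.P.image f.mt) (f.B ∪ f.P.image f.mt)).subset ?_
  intro g hg
  have h := orient_of_uc_ne hg
  have key : ∀ x, x ∈ g.A → x ∈ g.B → x ∈ f.P ∨ x ∈ f.P.image f.mt := by
    intro x ha hb
    have := ((h.mem f.mt_RM.inv x).1 (mem_P.2 ⟨ha, hb⟩)).2
    rcases lt_or_gt_of_ne this with c | c
    · left; rw [mem_P, f.mt_RM.pair]; exact c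
    · right
      rw [Finset.mem_image]
      exact ⟨f.mt x, by rw [mem_P, f.mt_RM.pair, f.mt_RM.inv]; exact c, f.mt_RM.inv x⟩
  constructor
  · intro x hx
    by_cases hb : x ∈ g.B
    · have := key x hx hb
      simp only [Finset.mem_union, mem_P] at this ⊢; tauto
    · exact Finset.mem_union_left _ ((h.1 x).1 ⟨hx, hb⟩).1
  · intro x hx
    by_cases hb : x ∈ g.A
    · have := key x hb hx
      simp only [Finset.mem_union, mem_P] at this ⊢; tauto
    · exact Finset.mem_union_left _ ((h.2.1 x).1 ⟨hx, hb⟩).1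

/-! ### Left matchings -/

/-- `ι` matches every pair with a free vertex to the left. -/
structure LM (f : WD) (ι : ℤ → ℤ) : Prop where
  inv : ∀ x, ι (ι x) = x
  sing : ∀ x, ¬(x ∈ f.A ↔ x ∈ f.B) → ι x = x
  pair : ∀ x, (x ∈ f.A ∧ x ∈ f.B) ↔ ι x < x
  nc : ∀ x y, ι x < y → y < x → (y ∈ f.A ↔ y ∈ f.B) → ι x < ι y ∧ ι y < x ∧ ι y ≠ y

/-- The mirror image of a weight diagram. -/
def neg (f : WD) : WD := ⟨f.A.map (Equiv.neg ℤ).toEmbedding, f.B.map (Equiv.neg ℤ).toEmbedding⟩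

theorem mem_neg_A {f : WD} {x : ℤ} : x ∈ f.neg.A ↔ -x ∈ f.A := by
  simp [neg]

theorem mem_neg_B {f : WD} {x : ℤ} : x ∈ f.neg.B ↔ -x ∈ f.B := by
  simp [neg]

theorem LM.neg {f : WD} {ι : ℤ → ℤ} (h : LM f ι) : RM f.neg fun x => -ι (-x) where
  inv x := by simp [h.inv]
  sing x hx := by
    rw [mem_neg_A, mem_neg_B] at hx
    rw [h.sing _ hx, neg_neg]
  pair x := by rw [mem_neg_A, mem_neg_B, h.pair]; omega
  nc x y h1 h2 h3 := by
    rw [mem_neg_A, mem_neg_B] at h3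
    have := h.nc (-x) (-y) (by omega) (by omega) h3
    omega

theorem RM.of_neg {f : WD} {ι : ℤ → ℤ} (h : RM f.neg ι) : LM f fun x => -ι (-x) where
  inv x := by simp [h.inv]
  sing x hx := by
    rw [h.sing _ (by simpa [mem_neg_A, mem_neg_B] using hx), neg_neg]
  pair x := by
    have := h.pair (-x)
    simp only [mem_neg_A, mem_neg_B, neg_neg] at this
    rw [this]; omega
  nc x y h1 h2 h3 := by
    have := h.nc (-x) (-y) (by omega) (by omega) (by simpa [mem_neg_A, mem_neg_B] using h3)
    omega

theorem LM.unique {f : WD} {ι κ : ℤ → ℤ} (h : LM f ι) (k : LM f κ) : ι = κ := by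
  have := h.neg.unique k.neg
  funext x
  have := congrFun this (-x)
  simpa using this

/-- The left matching. -/
def lmt (f : WD) : ℤ → ℤ := fun x => -f.neg.mt (-x)

theorem lmt_LM (f : WD) : LM f f.lmt := f.neg.mt_RM.of_neg

/-- The diagram whose pairs are the other ends of the left arcs of `f`. -/
def lam (f : WD) : WD := ⟨f.A \ f.B ∪ f.P.image f.lmt, f.B \ f.A ∪ f.P.image f.lmt⟩

theorem mem_image_lmt {f : WD} {x : ℤ} : x ∈ f.P.image f.lmt ↔ x < f.lmt x := by
  rw [Finset.mem_image]
  constructor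
  · rintro ⟨y, hy, rfl⟩
    rw [mem_P, f.lmt_LM.pair] at hy
    rwa [f.lmt_LM.inv]
  · intro h
    refine ⟨f.lmt x, ?_, f.lmt_LM.inv x⟩
    rw [mem_P, f.lmt_LM.pair, f.lmt_LM.inv]
    exact h

theorem mem_lam {f : WD} {x : ℤ} : (x ∈ f.lam.A ↔ (x ∈ f.A ∧ x ∉ f.B) ∨ x < f.lmt x) ∧
    (x ∈ f.lam.B ↔ (x ∈ f.B ∧ x ∉ f.A) ∨ x < f.lmt x) := by
  simp only [lam, Finset.mem_union, Finset.mem_sdiff, mem_image_lmt, and_self]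

/-- The same arcs are read from the other side: each joins a pair of `f.lam` at its left end with a
vertex that is free in `f.lam`. So `f` is the orientation of `f.lam` with all pairs at right ends.
-/
theorem lam_RM (f : WD) : RM f.lam f.lmt where
  inv := f.lmt_LM.inv
  sing x hx := by
    rw [mem_lam.1, mem_lam.2] at hx
    exact f.lmt_LM.sing x (by tauto)
  pair x := by
    rw [mem_lam.1, mem_lam.2]; tauto
  nc x y h1 h2 h3 := by
    rw [mem_lam.1, mem_lam.2] at h3
    have hs : y ∈ f.A ↔ y ∈ f.B := by
      by_contra hc
      have := f.lmt_LM.sing y hc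
      have e : ¬ (y < f.lmt y) := by omega
      tauto
    have := f.lmt_LM.nc (f.lmt x) y (by rwa [f.lmt_LM.inv]) h2 hs
    rwa [f.lmt_LM.inv] at this

theorem orient_lam (f : WD) : Orient f.lmt f.lam f := by
  have hs := f.lmt_LM.sing
  refine ⟨fun x => ?_, fun x => ?_, fun x => ?_⟩
  · rw [mem_lam.1, mem_lam.2]
    have := hs x
    have e : f.lmt x = x → ¬ (x < f.lmt x) := by omega
    tauto
  · rw [mem_lam.1, mem_lam.2]
    have := hs x
    have e : f.lmt x = x → ¬ (x < f.lmt x) := by omega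
    tauto
  · rw [f.lmt_LM.pair, f.lmt_LM.pair, f.lmt_LM.inv]; omega

/-- The coefficient of the dual canonical basis element of `g` in the monomial of `f`. -/
def wc (f g : WD) : Qq := q⁻¹ ^ g.P.card * uc g.lam f

theorem card_P_le {f g : WD} (h : f ≤ g) : f.P.card = g.P.card := h.2.2.1

/-- Both `f` and `g` are orientations of the arcs of `g.lam`, and `g` is the largest one because its
pairs are all at right ends. -/
theorem le_of_wc_ne {f g : WD} (h : wc f g ≠ 0) : f ≤ g := by
  have h1 := orient_of_uc_ne (right_ne_zero_of_mul h)
  rw [g.lam.mt_RM.unique g.lam_RM] at h1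
  refine h1.le g.lmt_LM.inv g.orient_lam fun y hy => Or.inr ?_
  rwa [mem_P, g.lmt_LM.pair] at hy

theorem wc_self (f : WD) : wc f f = 1 := by
  classical
  rw [wc, uc_eq f.lam_RM, if_pos f.orient_lam, cnt, Finset.filter_true_of_mem, inv_pow,
    inv_mul_cancel₀ (pow_ne_zero _ q_ne_zero)]
  intro x hx
  rwa [mem_P, f.lmt_LM.pair] at hx

end WD

namespace WD

/-! ### A contravariant form -/

/-- A form for which `E_v` and `F_v` are adjoint. -/
def form (c c' : WD → Qq) : Qq := ∑ᶠ h : WD, q⁻¹ ^ h.P.card * (c h * c' h)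

theorem form_comm (c c' : WD → Qq) : form c c' = form c' c := by
  simp only [form, mul_comm (c _)]

theorem form_smul (a : Qq) (c c' : WD → Qq) : form (fun h => a * c h) c' = a * form c c' := by
  unfold form
  rw [mul_finsum]
  congr 1; funext h; ring

open Classical in
/-- Exchange the labels `v` and `v + 1` in the first block. -/
def swA (v : ℤ) : WD ≃ WD where
  toFun g := ⟨g.A.map (Equiv.swap v (v + 1)).toEmbedding, g.B⟩
  invFun g := ⟨g.A.map (Equiv.swap v (v + 1)).toEmbedding, g.B⟩
  left_inv g := by ext x <;> simp
  right_inv g := by ext x <;> simp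

theorem map_swap_of_mem {s : Finset ℤ} {v : ℤ} (h : v ∈ s) (h' : v + 1 ∉ s) :
    s.map (Equiv.swap v (v + 1)).toEmbedding = insert (v + 1) (s.erase v) := by
  ext x
  rw [Finset.mem_map_equiv, Equiv.symm_swap, Finset.mem_insert, Finset.mem_erase,
    Equiv.swap_apply_def]
  split_ifs <;> grind

/-- The first summand of the action of `E_v`. -/
def eop₁ (v : ℤ) (c : WD → Qq) (g : WD) : Qq :=
  if v + 1 ∈ g.A ∧ v ∉ g.A then
    q ^ ((if v + 1 ∈ g.B then 1 else 0 : ℤ) - (if v ∈ g.B then 1 else 0)) *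
      c ⟨insert v (g.A.erase (v + 1)), g.B⟩ else 0

/-- The first summand of the action of `F_v`. -/
def fop₁ (v : ℤ) (c : WD → Qq) (g : WD) : Qq :=
  if v ∈ g.A ∧ v + 1 ∉ g.A then c ⟨insert (v + 1) (g.A.erase v), g.B⟩ else 0

theorem card_insert_erase_inter {s t : Finset ℤ} {a b : ℤ} (hb : b ∈ s) (ha : a ∉ s) :
    ((insert a (s.erase b) ∩ t).card : ℤ) + (if b ∈ t then 1 else 0) =
      (s ∩ t).card + (if a ∈ t then 1 else 0) := by
  have h1 : (insert a (s.erase b) ∩ t) =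
      if a ∈ t then insert a ((s ∩ t).erase b) else (s ∩ t).erase b := by
    split_ifs <;> ext x <;> simp only [Finset.mem_inter, Finset.mem_insert, Finset.mem_erase] <;>
      grind
  have h2 : (((s ∩ t).erase b).card : ℤ) + (if b ∈ t then 1 else 0) = (s ∩ t).card := by
    split_ifs with h
    · rw [Finset.card_erase_of_mem (Finset.mem_inter.2 ⟨hb, h⟩)]
      have : 0 < (s ∩ t).card := Finset.card_pos.2 ⟨b, Finset.mem_inter.2 ⟨hb, h⟩⟩
      omega
    · rw [Finset.erase_eq_of_notMem (by simp [h])]; simp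
  rw [h1]
  by_cases h : a ∈ t
  · rw [if_pos h, if_pos h, Finset.card_insert_of_notMem (by simp [ha]), ← h2]; push_cast; ring
  · rw [if_neg h, if_neg h, h2, add_zero]

theorem swA_eq {v : ℤ} {g : WD} (h : v ∈ g.A) (h' : v + 1 ∉ g.A) :
    swA v g = ⟨insert (v + 1) (g.A.erase v), g.B⟩ := by
  rw [swA, Equiv.coe_fn_mk, map_swap_of_mem h h']

/-- Exchanging v and v + 1 in the first block changes the number of pairs by [v + 1 ∈ B] - [v ∈ B].
The resulting change of the weight of the form cancels the power of q in E_v. -/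
theorem form_eop₁ (v : ℤ) (c c' : WD → Qq) : form (eop₁ v c) c' = form c (fop₁ v c') := by
  unfold form
  rw [← finsum_comp_equiv (swA v)]
  congr 1; funext h
  by_cases H : v ∈ h.A ∧ v + 1 ∉ h.A
  · have h1 : v + 1 ∈ insert (v + 1) (h.A.erase v) ∧ v ∉ insert (v + 1) (h.A.erase v) := by
      simp
    have h3 : insert v ((insert (v + 1) (h.A.erase v)).erase (v + 1)) = h.A := by
      ext x; simp only [Finset.mem_insert, Finset.mem_erase]; grind
    rw [swA_eq H.1 H.2, fop₁, if_pos H, eop₁, if_pos h1]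
    simp only [h3]
    have e := card_insert_erase_inter (t := h.B) H.1 H.2
    have e' : ((P ⟨insert (v + 1) (h.A.erase v), h.B⟩).card : ℤ) = (h.P.card : ℤ) +
      ((if v + 1 ∈ h.B then 1 else 0 : ℤ) - (if v ∈ h.B then 1 else 0)) := by
      simp only [P]; omega
    have e2 : q⁻¹ ^ (P ⟨insert (v + 1) (h.A.erase v), h.B⟩).card *
        q ^ ((if v + 1 ∈ h.B then 1 else 0 : ℤ) - (if v ∈ h.B then 1 else 0)) =
        q⁻¹ ^ h.P.card := by
      rw [← zpow_natCast, ← zpow_natCast, e', inv_zpow', inv_zpow', ← zpow_add₀ q_ne_zero]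
      congr 1; ring
    rw [← e2]; ring
  · have h1 : ¬ (v + 1 ∈ (swA v h).A ∧ v ∉ (swA v h).A) := by
      simpa [swA, Finset.mem_map_equiv] using H
    rw [fop₁, if_neg H, eop₁, if_neg h1]; ring

theorem form_tr (c c' : WD → Qq) : form c c' = form (fun h => c h.tr) (fun h => c' h.tr) := by
  unfold form
  let e : WD ≃ WD := ⟨tr, tr, fun _ => rfl, fun _ => rfl⟩
  rw [← finsum_comp_equiv e]
  congr 1; funext h
  change q⁻¹ ^ (h.B ∩ h.A).card * _ = q⁻¹ ^ (h.A ∩ h.B).card * _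
  rw [Finset.inter_comm]
  rfl

theorem form_add {a b c : WD → Qq} (hc : (Function.support c).Finite) :
    form (fun h => a h + b h) c = form a c + form b c := by
  unfold form
  rw [← finsum_add_distrib]
  · congr 1; funext h; ring
  · exact hc.subset fun h hh e => hh (by simp [e])
  · exact hc.subset fun h hh e => hh (by simp [e])

theorem eop_eq (v : ℤ) (c : WD → Qq) (g : WD) :
    eop v c g = eop₁ v c g + fop₁ v (fun h => c h.tr) g.tr := rfl

theorem fop_eq' (v : ℤ) (c : WD → Qq) (g : WD) :
    fop v c g = fop₁ v c g + eop₁ v (fun h => c h.tr) g.tr := rfl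

theorem form_eop (v : ℤ) {c c' : WD → Qq} (hc : (Function.support c).Finite)
    (hc' : (Function.support c').Finite) : form (eop v c) c' = form c (fop v c') := by
  have h1 : form (fun g => fop₁ v (fun h => c h.tr) g.tr) c' =
      form c (fun g => eop₁ v (fun h => c' h.tr) g.tr) := by
    rw [form_tr, form_tr c]
    simp only [tr_tr]
    rw [form_comm, ← form_eop₁, form_comm]
  rw [show eop v c = fun g => _ from funext (eop_eq v c),
    show fop v c' = fun g => _ from funext (fop_eq' v c'), form_add hc', form_comm c, form_add hc,
    form_eop₁, h1, form_comm c, form_comm c]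

/-- Induction on diagrams along the operators `E_v` and `F_v`. -/
theorem uc_induction {motive : WD → Prop} (base : ∀ f : WD, f.P = ∅ → motive f)
    (step : ∀ (v : ℤ) (f f' : WD), motive f' →
      (eop v (uc f') = uc f ∨ fop v (uc f') = uc f) → motive f) (f : WD) : motive f := by
  -- Lexicographic induction on the number r of pairs and on a bound s for the length of the arc of
  -- the rightmost pair.
  suffices H : ∀ (r : ℕ) (s : ℕ) (f : WD), f.P.card = r →
      (∀ p ∈ f.P, (∀ x ∈ f.P, x ≤ p) → f.mt p - p ≤ s) → motive f by
    obtain ⟨s, hs⟩ := (f.P.image fun p => f.mt p - p).bddAbove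
    refine H _ s.toNat f rfl fun p hp _ => ?_
    have := hs (Finset.mem_coe.2 (Finset.mem_image_of_mem (fun p => f.mt p - p) hp))
    omega
  intro r
  induction r using Nat.strong_induction_on with
  | _ r ih =>
  intro s
  induction s using Nat.strong_induction_on with
  | _ s ih2 =>
  intro f hr hs
  rcases f.P.eq_empty_or_nonempty with h | h
  · exact base f h
  · obtain ⟨v, f', hEF, hm⟩ := exists_simpler h
    refine step v f f' ?_ (hEF.imp funext funext)
    rcases hm with hm | ⟨hm, p, hp, p', hp', hpm, hpm', hlt⟩
    · obtain ⟨s, hs⟩ := (f'.P.image fun p => f'.mt p - p).bddAbove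
      refine ih _ (hr ▸ hm) s.toNat f' rfl fun p hp _ => ?_
      have := hs (Finset.mem_coe.2 (Finset.mem_image_of_mem (fun p => f'.mt p - p) hp))
      omega
    · have h1 := hs p hp hpm
      have h2 := (f'.mt_RM.pair p').1 (mem_P.1 hp')
      refine ih2 (f'.mt p' - p').toNat (by omega) f' (hm.trans hr) fun p2 hp2 hm2 => ?_
      have : p2 = p' := le_antisymm (hpm' _ hp2) (hm2 _ hp')
      rw [this]; omega

theorem uc_of_P_eq_empty {f : WD} (h : f.P = ∅) (g : WD) : uc f g = if g = f then 1 else 0 := by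
  split_ifs with hg
  · rw [hg, uc_self]
  · by_contra hc
    have := le_of_uc_ne hc
    have hP : g.P = ∅ := by
      rw [← Finset.card_eq_zero, ← card_P_le this, h, Finset.card_empty]
    refine hg (le_antisymm ?_ this)
    exact ⟨this.1.symm, this.2.1.symm, this.2.2.1.symm, fun t => by rw [hP, h]⟩

/-- If `f` is typical, its canonical element is K_f and the pairing is a coefficient equal to 0 or
1. Otherwise an operator producing the canonical element of `f` is moved by adjointness to the side
of `a`, where it acts by a bar invariant scalar. -/
theorem form_uc_bar (a f : WD) : barQ (form (uc a) (uc f)) = form (uc a) (uc f) := by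
  induction f using uc_induction generalizing a with
  | base f h =>
    have hf := uc_of_P_eq_empty h
    have e : form (uc a) (uc f) = uc a f := by
      unfold form
      rw [finsum_eq_single _ f, hf, if_pos rfl, h]
      · simp
      · intro g hg; rw [hf, if_neg hg]; simp
    rw [e]
    by_cases ha : uc a f = 0
    · rw [ha, map_zero]
    · have h1 := le_of_uc_ne ha
      have haP : a.P = ∅ := by
        rw [← Finset.card_eq_zero, card_P_le h1, h, Finset.card_empty]
      have : a = f := le_antisymm h1
        ⟨h1.1.symm, h1.2.1.symm, h1.2.2.1.symm, fun t => by rw [haP, h]⟩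
      rw [this, uc_self, map_one]
  | step v f f' key hEF =>
    rcases hEF with hE | hF
    · rw [← hE, form_comm, form_eop v (finite_uc _) (finite_uc _), form_comm]
      obtain ⟨c, a', hc, h'⟩ := exists_fop_uc v a
      rw [show fop v (uc a) = _ from funext h', form_smul, map_mul, hc, key]
    · rw [← hF, ← form_eop v (finite_uc _) (finite_uc _)]
      obtain ⟨c, a', hc, h'⟩ := exists_eop_uc v a
      rw [show eop v (uc a) = _ from funext h', form_smul, map_mul, hc, key]

/-- Comparable diagrams have equally many pairs, so the power of q in `wc` is the weight of the
form. This is how the matrix `incU * incW` becomes bar invariant. -/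
theorem sum_uc_wc (f g : WD) :
    ∑ h ∈ Finset.Icc f g, uc f h * wc h g = form (uc f) (uc g.lam) := by
  unfold form
  rw [finsum_eq_sum_of_support_subset (s := Finset.Icc f g)]
  · refine Finset.sum_congr rfl fun h hh => ?_
    rw [wc, card_P_le (Finset.mem_Icc.1 hh).2]; ring
  · intro h hh
    rw [Function.mem_support] at hh
    have h1 : uc f h ≠ 0 := fun e => hh (by simp [e])
    have h2 : uc g.lam h ≠ 0 := fun e => hh (by simp [e])
    rw [Finset.coe_Icc]
    refine ⟨le_of_uc_ne h1, le_of_wc_ne (mul_ne_zero (pow_ne_zero _ (inv_ne_zero q_ne_zero)) h2)⟩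

end WD

namespace WD

/-! ### Unitriangular matrices indexed by weight diagrams -/

/-- Triangular matrices. -/
abbrev Inc : Type := IncidenceAlgebra Qq WD

/-- Triangular recursion. -/
theorem exists_triangular_rec (M : Inc) (a : WD) : ∃ F : WD → Qq, ∀ b : WD,
    F b = if a = b then 1 else -∑ x ∈ Finset.Ico a b, F x * M x b := by
  let G : (b : WD) → ((x : WD) → (Finset.Icc a x).card < (Finset.Icc a b).card → Qq) → Qq :=
    fun b r => if a = b then 1 else -∑ x ∈ (Finset.Ico a b).attach,
      r x.1 (Finset.card_lt_card (Finset.Icc_ssubset_Icc_right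
        ((Finset.mem_Ico.1 x.2).1.trans (Finset.mem_Ico.1 x.2).2.le) le_rfl
        (Finset.mem_Ico.1 x.2).2)) * M x.1 b
  refine ⟨(measure fun b : WD => (Finset.Icc a b).card).wf.fix G, fun b => ?_⟩
  rw [WellFounded.fix_eq]
  simp only [G]
  split_ifs
  · rfl
  · congr 1
    exact Finset.sum_attach (Finset.Ico a b) (fun x => _ * M x b)

theorem Inc.exists_left_inv (M : Inc) (hM : ∀ a, M a a = 1) :
    ∃ N : Inc, N * M = 1 ∧ ∀ a, N a a = 1 := by
  choose F hF using exists_triangular_rec M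
  refine ⟨⟨F, fun a b h => ?_⟩, ?_, fun a => ?_⟩
  · rw [hF, if_neg (fun e => h e.le), Finset.Ico_eq_empty (fun h' => h h'.le)]
    simp
  · refine IncidenceAlgebra.ext fun a b hab => ?_
    rw [IncidenceAlgebra.mul_apply, IncidenceAlgebra.one_apply, ← Finset.Ico_insert_right hab,
      Finset.sum_insert (by simp), hM, mul_one, IncidenceAlgebra.coe_mk, hF a b]
    split_ifs with h
    · subst h; simp
    · simp
  · rw [IncidenceAlgebra.coe_mk, hF, if_pos rfl]

theorem Inc.mul_eq_one_comm {M N : Inc} (hM : ∀ a, M a a = 1) (h : N * M = 1) : M * N = 1 := by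
  have hN : ∀ a, N a a = 1 := fun a => by
    have : (N * M) a a = (1 : Inc) a a := by rw [h]
    simpa [hM] using this
  obtain ⟨K, hK, -⟩ := Inc.exists_left_inv N hN
  calc M * N = K * N * M * N := by rw [hK, one_mul]
    _ = K * (N * M) * N := by rw [mul_assoc K]
    _ = 1 := by rw [h, mul_one, hK]

/-- The entrywise bar involution. -/
def Inc.bar (M : Inc) : Inc := ⟨fun f g => barQ (M f g), fun f g h => by
  rw [IncidenceAlgebra.apply_eq_zero_of_not_le h, map_zero]⟩

theorem Inc.bar_apply (M : Inc) (f g : WD) : M.bar f g = barQ (M f g) := rfl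

theorem Inc.bar_mul (M N : Inc) : (M * N).bar = M.bar * N.bar := by
  refine IncidenceAlgebra.ext fun a b _ => ?_
  simp only [Inc.bar_apply, IncidenceAlgebra.mul_apply, map_sum, map_mul]

theorem Inc.bar_one : (1 : Inc).bar = 1 := by
  refine IncidenceAlgebra.ext fun a b _ => ?_
  simp only [Inc.bar_apply, IncidenceAlgebra.one_apply]
  split_ifs <;> simp

/-! ### The matrices of the two bases and of the bar involution -/

/-- The coefficients of the canonical basis. -/
def incU : Inc := ⟨uc, fun _ _ h => by by_contra hc; exact h (le_of_uc_ne hc)⟩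

/-- The coefficients of the monomial basis in terms of the dual canonical basis. -/
def incW : Inc := ⟨wc, fun _ _ h => by by_contra hc; exact h (le_of_wc_ne hc)⟩

theorem incU_self (f : WD) : incU f f = 1 := uc_self f

theorem incW_self (f : WD) : incW f f = 1 := wc_self f

theorem incU_bar_self (f : WD) : incU.bar f f = 1 := by
  rw [Inc.bar_apply, incU_self, map_one]

theorem bar_incU_mul_incW : (incU * incW).bar = incU * incW := by
  refine IncidenceAlgebra.ext fun a b _ => ?_
  rw [Inc.bar_apply, IncidenceAlgebra.mul_apply]
  exact (congrArg barQ (sum_uc_wc a b)).trans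
    ((form_uc_bar _ _).trans (sum_uc_wc a b).symm)

/-- The inverse of the matrix of the canonical basis. -/
def incV : Inc := (Inc.exists_left_inv incU incU_self).choose

theorem incV_mul : incV * incU = 1 := (Inc.exists_left_inv incU incU_self).choose_spec.1

theorem mul_incV : incU * incV = 1 := Inc.mul_eq_one_comm incU_self incV_mul

/-- The matrix of the bar involution. -/
def incR : Inc := incV.bar * incU

theorem bar_incU_mul_incR : incU.bar * incR = incU := by
  rw [incR, ← mul_assoc, ← Inc.bar_mul, mul_incV, Inc.bar_one, one_mul]

/-- The inverse of `incW` is the matrix of a bar invariant family. -/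
theorem bar_mul_incR_of_mul_incW {L : Inc} (hL : incW * L = 1) : L.bar * incR = L := by
  have hL1 : ∀ a, L a a = 1 := fun a => by
    have : (incW * L) a a = (1 : Inc) a a := by rw [hL]
    simpa [incW_self] using this
  have hL' : L * incW = 1 := Inc.mul_eq_one_comm hL1 hL
  -- Insert `incW * L = 1` behind `incU`. Then `incU * incW` can be replaced by its bar, and all
  -- barred factors cancel.
  calc L.bar * incR = L.bar * incV.bar * (incU * incW) * L := by
        rw [incR, mul_assoc _ _ L, mul_assoc incU, hL, mul_one, mul_assoc]
    _ = ((L * incV) * (incU * incW)).bar * L := by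
        rw [Inc.bar_mul (L * incV), Inc.bar_mul L, bar_incU_mul_incW]
    _ = L := by
        rw [mul_assoc L, ← mul_assoc incV, incV_mul, one_mul, hL', Inc.bar_one, one_mul]

/-! ### Completed combinations of weight diagrams -/

/-- All labels of `g` are at most `d`. -/
def Bd (d : ℤ) (g : WD) : Prop := ∀ x ∈ g.A ∪ g.B, x ≤ d

theorem exists_Bd (g : WD) : ∃ d, Bd d g := (g.A ∪ g.B).bddAbove

theorem Bd.mono {d e : ℤ} (h : d ≤ e) {g : WD} (hg : Bd d g) : Bd e g :=
  fun x hx => (hg x hx).trans h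

/-- Coefficient functions with finitely many nonzero values on bounded diagrams. -/
def Cf : Submodule Qq (WD → Qq) where
  carrier := {c | ∀ d, {f | Bd d f ∧ c f ≠ 0}.Finite}
  zero_mem' := by intro d; simp
  add_mem' := by
    intro u v hu hv d
    refine ((hu d).union (hv d)).subset ?_
    rintro f ⟨hf, h⟩
    by_cases h1 : u f = 0
    · right
      refine ⟨hf, fun h2 => h ?_⟩
      simp [h1, h2]
    · left
      exact ⟨hf, h1⟩
  smul_mem' := by
    intro c u hu d
    refine (hu d).subset ?_
    rintro f ⟨hf, h⟩
    exact ⟨hf, fun h2 => h (by simp [h2])⟩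

theorem row_mem (M : Inc) (f : WD) : (fun g => M f g) ∈ Cf := fun d =>
  (finite_ge_bounded f d).subset fun _ hg => ⟨IncidenceAlgebra.le_of_ne_zero hg.2, hg.1⟩

/-- The product of a row vector and a triangular matrix. -/
def vmul (c : WD → Qq) (M : Inc) (g : WD) : Qq := ∑ᶠ f, c f * M f g

theorem vmul_eq_sum (c : WD → Qq) (M : Inc) {d : ℤ} {g : WD} (hg : Bd d g) (s : Finset WD)
    (hs : ∀ f, Bd d f → c f ≠ 0 → f ∈ s) : vmul c M g = ∑ f ∈ s, c f * M f g := by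
  refine finsum_eq_sum_of_support_subset _ fun f hf => ?_
  rw [Function.mem_support] at hf
  exact hs f (fun x hx => le_bound (IncidenceAlgebra.le_of_ne_zero (right_ne_zero_of_mul hf))
    hg x hx) (left_ne_zero_of_mul hf)

theorem vmul_eq_sum' {c : WD → Qq} (hc : c ∈ Cf) (M : Inc) {d : ℤ} {g : WD} (hg : Bd d g) :
    vmul c M g = ∑ f ∈ (hc d).toFinset, c f * M f g :=
  vmul_eq_sum c M hg _ fun f h1 h2 => by simpa using ⟨h1, h2⟩

theorem finite_ge_of_mem {c : WD → Qq} (hc : c ∈ Cf) (d : ℤ) :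
    {h : WD | Bd d h ∧ ∃ f, Bd d f ∧ c f ≠ 0 ∧ f ≤ h}.Finite := by
  refine ((hc d).biUnion fun f _ => finite_ge_bounded f d).subset ?_
  rintro h ⟨h1, f, h2, h3, h4⟩
  exact Set.mem_biUnion (x := f) ⟨h2, h3⟩ ⟨h4, h1⟩

theorem exists_of_vmul_ne {c : WD → Qq} {M : Inc} {g : WD} {d : ℤ} (hg : Bd d g)
    (h : vmul c M g ≠ 0) : ∃ f, Bd d f ∧ c f ≠ 0 ∧ f ≤ g := by
  by_contra! hc
  apply h
  refine finsum_eq_zero_of_forall_eq_zero fun f => ?_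
  by_contra hne
  have h1 := IncidenceAlgebra.le_of_ne_zero (right_ne_zero_of_mul hne)
  exact hc f (fun x hx => le_bound h1 hg x hx) (left_ne_zero_of_mul hne) h1

theorem vmul_mem {c : WD → Qq} (hc : c ∈ Cf) (M : Inc) : vmul c M ∈ Cf := fun d =>
  (finite_ge_of_mem hc d).subset fun _ hg => ⟨hg.1, exists_of_vmul_ne hg.1 hg.2⟩

/-- For the coefficient at a diagram bounded by d, both sums live on the finitely many diagrams
bounded by d above some element of the support of `c`; there they may be interchanged. -/
theorem vmul_vmul {c : WD → Qq} (hc : c ∈ Cf) (M N : Inc) :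
    vmul (vmul c M) N = vmul c (M * N) := by
  funext g
  obtain ⟨d, hd⟩ := exists_Bd g
  have hs' : ∀ h, h ∈ (finite_ge_of_mem hc d).toFinset ↔
      Bd d h ∧ ∃ f, Bd d f ∧ c f ≠ 0 ∧ f ≤ h := fun h => by simp
  rw [vmul_eq_sum' hc (M * N) hd, vmul_eq_sum (vmul c M) N hd (finite_ge_of_mem hc d).toFinset
    (fun f h1 h2 => (hs' f).2 ⟨h1, exists_of_vmul_ne h1 h2⟩),
    Finset.sum_congr rfl fun h hh => by
      rw [vmul_eq_sum' hc M ((hs' h).1 hh).1, Finset.sum_mul], Finset.sum_comm]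
  refine Finset.sum_congr rfl fun f hf => ?_
  have hf' : Bd d f ∧ c f ≠ 0 := by simpa using hf
  rw [IncidenceAlgebra.mul_apply, Finset.mul_sum]
  symm
  refine Finset.sum_subset_zero_on_sdiff ?_ ?_ ?_
  · intro h hh
    rw [Finset.mem_Icc] at hh
    exact (hs' h).2 ⟨fun x hx => le_bound hh.2 hd x hx, f, hf'.1, hf'.2, hh.1⟩
  · intro h hh
    rw [Finset.mem_sdiff, Finset.mem_Icc] at hh
    by_contra hc
    exact hh.2 ⟨IncidenceAlgebra.le_of_ne_zero
      (right_ne_zero_of_mul (left_ne_zero_of_mul hc)),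
      IncidenceAlgebra.le_of_ne_zero (right_ne_zero_of_mul hc)⟩
  · intros; ring

theorem vmul_one (c : WD → Qq) : vmul c 1 = c := by
  funext g
  rw [vmul, finsum_eq_single _ g]
  · simp
  · intro f hf; simp [hf]

theorem vmul_add {b c : WD → Qq} (hb : b ∈ Cf) (hc : c ∈ Cf) (M : Inc) :
    vmul (b + c) M = vmul b M + vmul c M := by
  funext g
  obtain ⟨d, hd⟩ := exists_Bd g
  have h1 : ∀ f, Bd d f → (b f ≠ 0 ∨ c f ≠ 0) →
      f ∈ (hb d).toFinset ∪ (hc d).toFinset := fun f h1 h2 => by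
    simp only [Finset.mem_union, Set.Finite.mem_toFinset, Set.mem_ofPred_eq]; tauto
  rw [Pi.add_apply, vmul_eq_sum b M hd _ fun f a h => h1 f a (Or.inl h),
    vmul_eq_sum c M hd _ fun f a h => h1 f a (Or.inr h),
    vmul_eq_sum (b + c) M hd ((hb d).toFinset ∪ (hc d).toFinset), ← Finset.sum_add_distrib]
  · exact Finset.sum_congr rfl fun f _ => by rw [Pi.add_apply]; ring
  · intro f a h
    refine h1 f a ?_
    by_contra! hc
    exact h (by simp [hc])

theorem vmul_smul (a : Qq) (c : WD → Qq) (M : Inc) : vmul (a • c) M = a • vmul c M := by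
  funext g
  simp only [vmul, Pi.smul_apply, smul_eq_mul, mul_assoc, mul_finsum]

open Classical in
theorem vmul_single (f : WD) (M : Inc) : vmul (Pi.single f 1) M = fun g => M f g := by
  funext g
  rw [vmul, finsum_eq_single _ f]
  · simp
  · intro h hh; simp [hh]

theorem vmul_row (M N : Inc) (f : WD) : vmul (fun g => M f g) N = fun g => (M * N) f g := by
  have h : Pi.single f 1 ∈ Cf := by
    rw [show Pi.single f 1 = fun g => (1 : Inc) f g by
      funext g; rw [IncidenceAlgebra.one_apply, Pi.single_apply]; simp [eq_comm]]
    exact row_mem 1 f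
  rw [← vmul_single f M, vmul_vmul h, vmul_single]

end WD

namespace WD

/-! ### The bar involution in coordinates -/

/-- The bar involution on coefficient functions. -/
def bet (c : WD → Qq) : WD → Qq := vmul (fun f => barQ (c f)) incR

theorem bar_mem {c : WD → Qq} (hc : c ∈ Cf) : (fun f => barQ (c f)) ∈ Cf := fun d =>
  (hc d).subset fun f hf => ⟨hf.1, fun h => hf.2 (by simp [h])⟩

theorem bet_mem {c : WD → Qq} (hc : c ∈ Cf) : bet c ∈ Cf := vmul_mem (bar_mem hc) _

theorem bet_add {b c : WD → Qq} (hb : b ∈ Cf) (hc : c ∈ Cf) : bet (b + c) = bet b + bet c := by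
  rw [bet, bet, bet, ← vmul_add (bar_mem hb) (bar_mem hc)]
  congr 1; funext f; simp

theorem bet_smul (a : Qq) (c : WD → Qq) : bet (a • c) = barQ a • bet c := by
  rw [bet, bet, ← vmul_smul]
  congr 1; funext f; simp

theorem bet_zero : bet 0 = 0 := by
  have := bet_smul 0 0
  simpa using this

theorem uc_mem (f : WD) : uc f ∈ Cf := row_mem incU f

theorem bet_row_of {M : Inc} (hM : M.bar * incR = M) (f : WD) :
    bet (fun g => M f g) = fun g => M f g := by
  have := vmul_row M.bar incR f
  rw [hM] at this
  exact this

theorem bet_uc (f : WD) : bet (uc f) = uc f := bet_row_of bar_incU_mul_incR f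

/-- A nonzero entry M f g requires f ≤ g, so a bound for `g` holds for `f` as well. This is the
source of the continuity of the bar involution. -/
theorem vmul_local {c c' : WD → Qq} {M : Inc} {d : ℤ} (h : ∀ g, Bd d g → c g = c' g)
    {g : WD} (hg : Bd d g) : vmul c M g = vmul c' M g := by
  refine finsum_congr fun f => ?_
  by_cases hM : M f g = 0
  · rw [hM, mul_zero, mul_zero]
  · rw [h f fun x hx => le_bound (IncidenceAlgebra.le_of_ne_zero hM) hg x hx]

theorem bet_local {c c' : WD → Qq} {d : ℤ} (h : ∀ g, Bd d g → c g = c' g)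
    {g : WD} (hg : Bd d g) : bet c g = bet c' g :=
  vmul_local (fun g hg => by rw [h g hg]) hg

theorem bet_sum {s : Finset WD} {y : WD → Qq} {F : WD → WD → Qq} (hF : ∀ f, F f ∈ Cf) :
    bet (∑ f ∈ s, y f • F f) = ∑ f ∈ s, barQ (y f) • bet (F f) := by
  classical
  induction s using Finset.induction_on with
  | empty => simp [bet_zero]
  | insert a s ha ih =>
    rw [Finset.sum_insert ha, Finset.sum_insert ha, bet_add, ih, bet_smul]
    · exact Cf.smul_mem _ (hF a)
    · exact Cf.sum_mem fun f _ => Cf.smul_mem _ (hF f)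

/-- Every element agrees on bounded diagrams with a combination of canonical basis elements. -/
theorem exists_approx {c : WD → Qq} (hc : c ∈ Cf) (d : ℤ) :
    ∃ (s : Finset WD) (y : WD → Qq), (∀ f ∈ s, ∃ g, c g ≠ 0 ∧ g ≤ f) ∧
      ∀ g, Bd d g → c g = (∑ f ∈ s, y f • uc f) g := by
  have hy := vmul_mem hc incV
  refine ⟨(hy d).toFinset, vmul c incV, fun f hf => ?_, fun g hg => ?_⟩
  · have hf' : Bd d f ∧ vmul c incV f ≠ 0 := by simpa using hf
    obtain ⟨g, -, h2, h3⟩ := exists_of_vmul_ne hf'.1 hf'.2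
    exact ⟨g, h2, h3⟩
  · have h1 : vmul (vmul c incV) incU = c := by rw [vmul_vmul hc, incV_mul, vmul_one]
    rw [← congrFun h1 g, vmul_eq_sum' hy _ hg, Finset.sum_apply]
    rfl

/-- On canonical elements T acts by bar invariant scalars, hence commutes with the bar involution.
Any element agrees with a finite combination of them on diagrams bounded by d, and both operators
respect such agreement. The threshold d₀ leaves room for the labels created by T. -/
theorem bet_comm (T : (WD → Qq) →ₗ[Qq] (WD → Qq)) (d₀ : ℤ)
    (hloc : ∀ d, d₀ ≤ d → ∀ c c' : WD → Qq, (∀ g, Bd d g → c g = c' g) →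
      ∀ g, Bd d g → T c g = T c' g)
    (hT : ∀ f, ∃ (a : Qq) (f' : WD), barQ a = a ∧ T (uc f) = a • uc f')
    {c : WD → Qq} (hc : c ∈ Cf) : bet (T c) = T (bet c) := by
  funext g
  obtain ⟨d, hd⟩ := exists_Bd g
  have hd := hd.mono (le_max_left d d₀)
  have hd₀ := le_max_right d d₀
  generalize max d d₀ = e at *
  obtain ⟨s, y, -, h⟩ := exists_approx hc e
  choose a f' ha hf' using hT
  rw [bet_local (hloc e hd₀ c _ h) hd, hloc e hd₀ (bet c) _ (fun g hg => bet_local h hg) g hd,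
    bet_sum uc_mem, map_sum, map_sum]
  simp only [map_smul, hf', bet_uc]
  rw [bet_sum fun f => Cf.smul_mem _ (uc_mem _)]
  simp only [bet_smul, ha, bet_uc]

theorem eop₁_local {v d : ℤ} (hv : v + 1 ≤ d) {c c' : WD → Qq} (h : ∀ g, Bd d g → c g = c' g)
    {g : WD} (hg : Bd d g) : eop₁ v c g = eop₁ v c' g := by
  unfold eop₁
  rw [h]
  intro x hx
  simp only [Finset.mem_union, Finset.mem_insert, Finset.mem_erase] at hx
  rcases hx with (rfl | hx) | hx
  · omega
  · exact hg x (Finset.mem_union_left _ hx.2)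
  · exact hg x (Finset.mem_union_right _ hx)

theorem fop₁_local {v d : ℤ} (hv : v + 1 ≤ d) {c c' : WD → Qq} (h : ∀ g, Bd d g → c g = c' g)
    {g : WD} (hg : Bd d g) : fop₁ v c g = fop₁ v c' g := by
  unfold fop₁
  rw [h]
  intro x hx
  simp only [Finset.mem_union, Finset.mem_insert, Finset.mem_erase] at hx
  rcases hx with (rfl | hx) | hx
  · omega
  · exact hg x (Finset.mem_union_left _ hx.2)
  · exact hg x (Finset.mem_union_right _ hx)

theorem Bd.tr {d : ℤ} {g : WD} (hg : Bd d g) : Bd d g.tr := fun x hx =>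
  hg x (by simp only [WD.tr, Finset.mem_union] at hx ⊢; tauto)

theorem eop_local {v d : ℤ} (hv : v + 1 ≤ d) {c c' : WD → Qq} (h : ∀ g, Bd d g → c g = c' g)
    {g : WD} (hg : Bd d g) : eop v c g = eop v c' g := by
  rw [eop_eq, eop_eq, eop₁_local hv h hg, fop₁_local hv (fun g hg => h _ hg.tr) hg.tr]

theorem fop_local {v d : ℤ} (hv : v + 1 ≤ d) {c c' : WD → Qq} (h : ∀ g, Bd d g → c g = c' g)
    {g : WD} (hg : Bd d g) : fop v c g = fop v c' g := by
  rw [fop_eq', fop_eq', fop₁_local hv h hg, eop₁_local hv (fun g hg => h _ hg.tr) hg.tr]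

/-- `eop` as a linear map. -/
def eopL (v : ℤ) : (WD → Qq) →ₗ[Qq] (WD → Qq) where
  toFun := eop v
  map_add' b c := by
    funext g; simp only [eop, Pi.add_apply]; split_ifs <;> ring
  map_smul' a c := by
    funext g; simp only [eop, Pi.smul_apply, smul_eq_mul, RingHom.id_apply]; split_ifs <;> ring

/-- `fop` as a linear map. -/
def fopL (v : ℤ) : (WD → Qq) →ₗ[Qq] (WD → Qq) where
  toFun := fop v
  map_add' b c := by
    funext g; simp only [fop, Pi.add_apply]; split_ifs <;> ring
  map_smul' a c := by
    funext g; simp only [fop, Pi.smul_apply, smul_eq_mul, RingHom.id_apply]; split_ifs <;> ring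

theorem bet_eop (v : ℤ) {c : WD → Qq} (hc : c ∈ Cf) : bet (eop v c) = eop v (bet c) :=
  bet_comm (eopL v) (v + 1) (fun _ hd _ _ h _ hg => eop_local hd h hg)
    (fun f => (exists_eop_uc v f).imp fun _ => Exists.imp fun _ h => ⟨h.1, funext h.2⟩) hc

theorem bet_fop (v : ℤ) {c : WD → Qq} (hc : c ∈ Cf) : bet (fop v c) = fop v (bet c) :=
  bet_comm (fopL v) (v + 1) (fun _ hd _ _ h _ hg => fop_local hd h hg)
    (fun f => (exists_fop_uc v f).imp fun _ => Exists.imp fun _ h => ⟨h.1, funext h.2⟩) hc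

/-- Diagrams with `m` labels in the first and `n` labels in the second block. -/
def Sz (m n : ℕ) (g : WD) : Prop := g.A.card = m ∧ g.B.card = n

theorem Sz.of_le {m n : ℕ} {f g : WD} (h : f ≤ g) : Sz m n f ↔ Sz m n g := by
  rw [Sz, Sz, (card_le h).1, (card_le h).2]

theorem sz_of_vmul_ne {m n : ℕ} {c : WD → Qq} (hc : ∀ g, c g ≠ 0 → Sz m n g) {M : Inc} {g : WD}
    (h : vmul c M g ≠ 0) : Sz m n g := by
  obtain ⟨d, hd⟩ := exists_Bd g
  obtain ⟨f, -, h1, h2⟩ := exists_of_vmul_ne hd h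
  exact (Sz.of_le h2).1 (hc f h1)

theorem sz_of_bet_ne {m n : ℕ} {c : WD → Qq} (hc : ∀ g, c g ≠ 0 → Sz m n g) {g : WD}
    (h : bet c g ≠ 0) : Sz m n g :=
  sz_of_vmul_ne (fun g hg => hc g fun h => hg (by simp [h])) h

end WD

/-! ### Peeling arcs -/

theorem exists_step (S : Finset ℤ) (x : ℤ) :
    ∃ z, z < x ∧ z ∉ S ∧ ∀ z', z < z' → z' < x → z' ∈ S := by
  have h : ∃ k : ℕ, x - 1 - k ∉ S := by
    by_contra! h
    have : Set.Infinite (S : Set ℤ) :=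
      Set.infinite_of_injective_forall_mem (f := fun k : ℕ => x - 1 - k)
        (fun a b e => by simpa using e) h
    exact this S.finite_toSet
  classical
  refine ⟨x - 1 - Nat.find h, by omega, Nat.find_spec h, fun z' h1 h2 => ?_⟩
  have := Nat.find_min h (m := (x - 1 - z').toNat) (by omega)
  rw [not_not] at this
  convert this using 1
  omega

/-- The largest element below `x` outside `S`. -/
def step (S : Finset ℤ) (x : ℤ) : ℤ := (exists_step S x).choose

theorem step_lt (S : Finset ℤ) (x : ℤ) : step S x < x := (exists_step S x).choose_spec.1

theorem step_notMem (S : Finset ℤ) (x : ℤ) : step S x ∉ S := (exists_step S x).choose_spec.2.1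

theorem mem_of_step_lt {S : Finset ℤ} {x z : ℤ} (h : step S x < z) (h' : z < x) : z ∈ S :=
  (exists_step S x).choose_spec.2.2 z h h'

theorem step_iterate_le (S : Finset ℤ) (x : ℤ) (k : ℕ) : (step S)^[k] x ≤ x - k := by
  induction k with
  | zero => simp
  | succ k ih =>
    rw [Function.iterate_succ_apply']
    have := step_lt S ((step S)^[k] x)
    push_cast; omega

theorem step_iterate_notMem {S : Finset ℤ} {x : ℤ} (hx : x ∉ S) (k : ℕ) :
    (step S)^[k] x ∉ S := by
  cases k with
  | zero => exact hx
  | succ k => rw [Function.iterate_succ_apply']; exact step_notMem _ _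

/-- Move the pairs `x` in the list `k` steps to the left, one after the other, where each pair
ignores the left arcs of the pairs before it.  The result is the list of the left arcs. -/
def slide : Finset ℤ → List (ℤ × ℕ) → List (ℤ × ℤ)
  | _, [] => []
  | S, (x, k) :: l => ((step S)^[k] x, step S ((step S)^[k] x)) ::
      slide (insert ((step S)^[k] x) (insert (step S ((step S)^[k] x)) S)) l

/-- The weight of an orientation of arcs. -/
def arcWeight : List (ℤ × ℤ) → Finset ℤ → Qq
  | [], F => if F = ∅ then 1 else 0
  | (y, t) :: L, F =>
      if y ∈ F ∧ t ∉ F then arcWeight L (F.erase y)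
      else if t ∈ F ∧ y ∉ F then q⁻¹ * arcWeight L (F.erase t) else 0

/-- Let y_k be the position of the first pair after k steps and X the set of the other pairs.
Summing over the other coordinates by induction leaves (-q)⁻ᵏ (δ_k + q⁻¹ δ_{k+1}), where δ_k
indicates F = {y_k} ∪ X. The sum over k telescopes to δ_0 minus a boundary term, which vanishes. -/
theorem sum_slide {r N : ℕ} (S : Finset ℤ) (x : Fin r → ℤ) (F : Finset ℤ) (hx : StrictMono x)
    (hS : ∀ s, x s ∉ S) (hN : ∀ s, ∀ z ∈ F, x s < z + N) :
    ∑ θ : Fin r → Fin N, (-q)⁻¹ ^ (∑ s, (θ s : ℕ)) *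
      arcWeight (slide S (List.ofFn fun s => (x s, (θ s : ℕ)))) F =
      if F = Finset.univ.image x then 1 else 0 := by
  induction r generalizing S F with
  | zero => simp [slide, arcWeight]
  | succ r ih =>
    set X := Finset.univ.image fun s : Fin r => x s.succ
    set y : ℕ → ℤ := fun k => (step S)^[k] (x 0)
    have hy : ∀ k, y k ≤ x 0 := fun k => (step_iterate_le S _ k).trans (by omega)
    have hyX : ∀ k, y k ∉ X := fun k h => by
      obtain ⟨s, -, e⟩ := Finset.mem_image.1 h
      have := hx (Fin.succ_pos s)
      have := hy k
      omega
    have hy1 : ∀ k, y (k + 1) = step S (y k) := fun k => Function.iterate_succ_apply' _ _ _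
    set δ : ℕ → Qq := fun k => if F = insert (y k) X then 1 else 0
    -- The first arc has ends y_k and y_{k+1}. Whichever of them F contains is removed, and the
    -- induction hypothesis applies with both ends added to the removed vertices.
    have inner : ∀ k : ℕ, ∑ θ : Fin r → Fin N, (-q)⁻¹ ^ (k + ∑ s, (θ s : ℕ)) *
        arcWeight (slide S ((x 0, k) :: List.ofFn fun s => (x s.succ, (θ s : ℕ)))) F =
        (-q)⁻¹ ^ k * (δ k + q⁻¹ * δ (k + 1)) := by
      intro k
      have IH : ∀ G ⊆ F, ∑ θ : Fin r → Fin N, (-q)⁻¹ ^ (∑ s, (θ s : ℕ)) *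
          arcWeight (slide (insert (y k) (insert (step S (y k)) S))
            (List.ofFn fun s => (x s.succ, (θ s : ℕ)))) G = if G = X then 1 else 0 := by
        intro G hG
        refine ih _ _ G (hx.comp (Fin.strictMono_succ)) (fun s hs => ?_)
          (fun s z hz => hN s.succ z (hG hz))
        have h0 := hx (Fin.succ_pos s)
        have h1 := hy k
        have h2 := step_lt S (y k)
        rw [Finset.mem_insert, Finset.mem_insert] at hs
        rcases hs with hs | hs | hs
        · omega
        · omega
        · exact hS _ hs
      have hlt : y (k + 1) < y k := by rw [hy1]; exact step_lt _ _
      have key : ∀ (j i : ℕ), y j ∉ X → (y j ∈ F ∧ y i ∉ F) → y i ∉ X → y i ≠ y j →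
          ((if F.erase (y j) = X then 1 else 0 : Qq) = if F = insert (y j) X then 1 else 0) ∧
          ¬ F = insert (y i) X := by
        intro j i h1 h2 h3 h4
        refine ⟨if_congr ⟨?_, ?_⟩ rfl rfl, ?_⟩
        · rintro e; rw [← e, Finset.insert_erase h2.1]
        · rintro e; rw [e, Finset.erase_insert h1]
        · intro e; exact h2.2 (e ▸ Finset.mem_insert_self _ _)
      simp only [slide, arcWeight]
      change ∑ θ : Fin r → Fin N, (-q)⁻¹ ^ (k + ∑ s, (θ s : ℕ)) *
        (if y k ∈ F ∧ step S (y k) ∉ F then arcWeight (slide (insert (y k)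
            (insert (step S (y k)) S)) _) (F.erase (y k))
          else if step S (y k) ∈ F ∧ y k ∉ F then q⁻¹ * arcWeight (slide (insert (y k)
            (insert (step S (y k)) S)) _) (F.erase (step S (y k))) else 0) = _
      rw [← hy1] at IH ⊢
      simp only [pow_add, mul_assoc]
      rw [← Finset.mul_sum]
      congr 1
      split_ifs with h1 h2
      · rw [IH _ (Finset.erase_subset _ _)]
        have := key k (k + 1) (hyX _) h1 (hyX _) hlt.ne
        rw [this.1]
        simp only [δ, if_neg this.2]; ring
      · simp only [mul_left_comm _ q⁻¹]
        rw [← Finset.mul_sum, IH _ (Finset.erase_subset _ _)]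
        have := key (k + 1) k (hyX _) h2 (hyX _) hlt.ne'
        rw [this.1]
        simp only [δ, if_neg this.2]; ring
      · have a1 : ¬ F = insert (y k) X := by
          intro e
          have : y k ∈ F := e ▸ Finset.mem_insert_self _ _
          have h3 : y (k + 1) ∈ F := by tauto
          rw [e, Finset.mem_insert] at h3
          exact h3.elim (fun h => hlt.ne h) (hyX _)
        have a2 : ¬ F = insert (y (k + 1)) X := by
          intro e
          have : y (k + 1) ∈ F := e ▸ Finset.mem_insert_self _ _
          have h3 : y k ∈ F := by tauto
          rw [e, Finset.mem_insert] at h3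
          exact h3.elim (fun h => hlt.ne h.symm) (hyX _)
        simp only [δ, if_neg a1, if_neg a2]; simp
    have tele : ∀ M : ℕ, ∑ k ∈ Finset.range M, (-q)⁻¹ ^ k * (δ k + q⁻¹ * δ (k + 1)) =
        δ 0 - (-q)⁻¹ ^ M * δ M := by
      intro M
      induction M with
      | zero => simp
      | succ M ih =>
        rw [Finset.sum_range_succ, ih, pow_succ, inv_neg]; ring
    -- After N steps the first pair has passed all of F to the left.
    have hδ : δ N = 0 := by
      refine if_neg fun e => ?_
      have h1 : y N ∈ F := e ▸ Finset.mem_insert_self _ _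
      have h2 := hN 0 _ h1
      have h3 : y N ≤ x 0 - N := step_iterate_le S _ N
      omega
    rw [← (Fin.consEquiv fun _ => Fin N).sum_comp, Fintype.sum_prod_type]
    simp only [Fin.consEquiv_apply, Fin.sum_univ_succ, Fin.cons_zero, Fin.cons_succ,
      List.ofFn_succ, inner]
    rw [Fin.sum_univ_eq_sum_range (fun k => (-q)⁻¹ ^ k * (δ k + q⁻¹ * δ (k + 1))) N, tele, hδ,
      mul_zero, sub_zero]
    have : Finset.univ.image x = insert (x 0) X := by
      ext z
      simp only [X, Finset.mem_image, Finset.mem_univ, true_and, Finset.mem_insert]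
      rw [Fin.exists_fin_succ, eq_comm]
    rw [this]
    rfl

/-! ### The matching of a list of arcs -/

/-- The arcs in the list can be peeled off one after the other, each joining neighbours among
the vertices that are not yet removed. -/
def Peelable : Finset ℤ → List (ℤ × ℤ) → Prop
  | _, [] => True
  | S, (y, t) :: L => y ∉ S ∧ t ∉ S ∧ t < y ∧ (∀ z, t < z → z < y → z ∈ S) ∧
      Peelable (insert y (insert t S)) L

/-- The involution exchanging the ends of the arcs. -/
def arcInv : List (ℤ × ℤ) → ℤ → ℤ
  | [], z => z
  | (y, t) :: L, z => if z = y then t else if z = t then y else arcInv L z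

/-- By the definition of `step`, only removed vertices lie under an arc. The later pairs start to
the right of the ends already removed and so are not affected by them. -/
theorem slide_peelable (l : List (ℤ × ℕ)) (S : Finset ℤ) (hl : (l.map Prod.fst).SortedLT)
    (hS : ∀ p ∈ l, p.1 ∉ S) : Peelable S (slide S l) := by
  induction l generalizing S with
  | nil => trivial
  | cons p l ih =>
    obtain ⟨x, k⟩ := p
    have hl' : (x :: l.map Prod.fst).Pairwise (· < ·) := hl.pairwise
    rw [List.pairwise_cons] at hl'
    refine ⟨step_iterate_notMem (hS (x, k) (by simp)) k, step_notMem _ _, step_lt _ _,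
      fun z => mem_of_step_lt, ih _ hl'.2.sortedLT fun p hp => ?_⟩
    have h1 := hl'.1 p.1 (List.mem_map_of_mem hp)
    have h2 := step_iterate_le S x k
    have h3 := step_lt S ((step S)^[k] x)
    rw [Finset.mem_insert, Finset.mem_insert]
    rintro (e | e | e)
    · omega
    · omega
    · exact hS p (by simp [hp]) e

/-- The first arc joins neighbours among the remaining vertices. So nothing that remains lies under
it, and an arc of the tail encloses both of its ends or neither. -/
theorem arcInv_props {S : Finset ℤ} {L : List (ℤ × ℤ)} (h : Peelable S L) :
    (∀ z, arcInv L (arcInv L z) = z) ∧ (∀ z ∈ S, arcInv L z = z) ∧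
    (∀ z, z ∈ L.map Prod.fst ↔ arcInv L z < z) ∧
    (∀ x y, arcInv L x < y → y < x → y ∉ S →
      arcInv L x < arcInv L y ∧ arcInv L y < x ∧ arcInv L y ≠ y) := by
  induction L generalizing S with
  | nil =>
    refine ⟨fun _ => rfl, fun _ _ => rfl, fun z => by simp [arcInv], fun x y h1 h2 => ?_⟩
    simp only [arcInv] at h1; omega
  | cons p L ih =>
    obtain ⟨y₀, t₀⟩ := p
    obtain ⟨hy, ht, hlt, hbt, hP⟩ := h
    obtain ⟨i1, i2, i3, i4⟩ := ih hP
    set κ := arcInv L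
    have ky : κ y₀ = y₀ := i2 _ (by simp)
    have kt : κ t₀ = t₀ := i2 _ (by simp)
    have kS : ∀ z ∈ S, κ z = z := fun z hz => i2 _ (by simp [hz])
    have e : ∀ z, arcInv ((y₀, t₀) :: L) z = if z = y₀ then t₀ else if z = t₀ then y₀ else κ z :=
      fun z => rfl
    have ne_y : ∀ z, z ≠ y₀ → κ z ≠ y₀ := fun z hz h => hz (by rw [← i1 z, h, ky])
    have ne_t : ∀ z, z ≠ t₀ → κ z ≠ t₀ := fun z hz h => hz (by rw [← i1 z, h, kt])
    refine ⟨fun z => ?_, fun z hz => ?_, fun z => ?_, fun x y h1 h2 h3 => ?_⟩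
    · simp only [e]
      by_cases hz : z = y₀
      · rw [if_pos hz, if_neg hlt.ne, if_pos rfl, hz]
      · by_cases hz' : z = t₀
        · rw [if_neg hz, if_pos hz', if_pos rfl, hz']
        · rw [if_neg hz, if_neg hz', if_neg (ne_y z hz), if_neg (ne_t z hz'), i1]
    · have z1 : z ≠ y₀ := by rintro rfl; exact hy hz
      have z2 : z ≠ t₀ := by rintro rfl; exact ht hz
      rw [e, if_neg z1, if_neg z2, kS z hz]
    · rw [List.map_cons, List.mem_cons, i3, e]
      split_ifs with a b
      · simp [a, hlt]
      · subst b; rw [kt]; simp only [a, false_or]; omega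
      · simp [a]
    · simp only [e] at h1 ⊢
      by_cases hx : x = y₀
      · rw [if_pos hx] at h1
        exact absurd (hbt y h1 (hx ▸ h2)) h3
      by_cases hx' : x = t₀
      · rw [if_neg hx, if_pos hx'] at h1; omega
      rw [if_neg hx, if_neg hx'] at h1 ⊢
      have a1 : x ∉ S := fun h => by rw [kS x h] at h1; omega
      have a2 : κ x ∉ S := fun h => by have := kS _ h; rw [i1] at this; omega
      have a3 := ne_y x hx
      have a4 := ne_t x hx'
      have a5 : ¬ (t₀ < x ∧ x < y₀) := fun h => a1 (hbt x h.1 h.2)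
      have a6 : ¬ (t₀ < κ x ∧ κ x < y₀) := fun h => a2 (hbt _ h.1 h.2)
      by_cases hz : y = y₀
      · subst hz; rw [if_pos rfl]; omega
      by_cases hz' : y = t₀
      · subst hz'; rw [if_neg hz, if_pos rfl]; omega
      rw [if_neg hz, if_neg hz']
      exact i4 x y h1 h2 (by simp [hz, hz', h3])

/-- The recursion gives q⁻¹ for each arc with its pair on the left. Written as q⁻¹ for every arc and
q for every pair on the right, this has the shape of `wc`. -/
theorem arcWeight_eq {S : Finset ℤ} {L : List (ℤ × ℤ)} (h : Peelable S L) (F : Finset ℤ)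
    [Decidable (∀ x, arcInv L x ∈ F ↔ x ∉ F ∧ arcInv L x ≠ x)] :
    arcWeight L F = if ∀ x, arcInv L x ∈ F ↔ x ∉ F ∧ arcInv L x ≠ x then
      q⁻¹ ^ L.length * q ^ (F.filter fun x => arcInv L x < x).card else 0 := by
  classical
  induction L generalizing S F with
  | nil =>
    simp only [arcWeight]
    by_cases hF : F = ∅
    · subst hF
      rw [if_pos rfl, if_pos (by intro x; simp [arcInv])]
      simp
    · rw [if_neg hF, if_neg]
      intro hc
      obtain ⟨x, hx⟩ := Finset.nonempty_iff_ne_empty.2 hF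
      have := hc x
      simp only [arcInv] at this
      tauto
  | cons p L ih =>
    obtain ⟨y₀, t₀⟩ := p
    obtain ⟨hy, ht, hlt, hbt, hP⟩ := h
    obtain ⟨i1, i2, -, -⟩ := arcInv_props hP
    have IH := fun F => ih hP F
    set κ := arcInv L
    have ky : κ y₀ = y₀ := i2 _ (by simp)
    have kt : κ t₀ = t₀ := i2 _ (by simp)
    have ne_y : ∀ z, z ≠ y₀ → κ z ≠ y₀ := fun z hz h => hz (by rw [← i1 z, h, ky])
    have ne_t : ∀ z, z ≠ t₀ → κ z ≠ t₀ := fun z hz h => hz (by rw [← i1 z, h, kt])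
    have e : ∀ z, arcInv ((y₀, t₀) :: L) z = if z = y₀ then t₀ else if z = t₀ then y₀ else κ z :=
      fun z => rfl
    have ey : arcInv ((y₀, t₀) :: L) y₀ = t₀ := by rw [e, if_pos rfl]
    have et : arcInv ((y₀, t₀) :: L) t₀ = y₀ := by rw [e, if_neg hlt.ne, if_pos rfl]
    have eo : ∀ z, z ≠ y₀ → z ≠ t₀ → arcInv ((y₀, t₀) :: L) z = κ z := fun z h1 h2 => by
      rw [e, if_neg h1, if_neg h2]
    have cond : ∀ (a : ℤ), (a = y₀ ∧ y₀ ∈ F ∧ t₀ ∉ F ∨ a = t₀ ∧ t₀ ∈ F ∧ y₀ ∉ F) →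
        ((∀ x, arcInv ((y₀, t₀) :: L) x ∈ F ↔ x ∉ F ∧ arcInv ((y₀, t₀) :: L) x ≠ x) ↔
        ∀ x, κ x ∈ F.erase a ↔ x ∉ F.erase a ∧ κ x ≠ x) := by
      intro a ha
      refine forall_congr' fun x => ?_
      by_cases h1 : x = y₀
      · subst h1
        rw [ey, ky]; simp only [Finset.mem_erase]; grind
      by_cases h2 : x = t₀
      · subst h2
        rw [et, kt]; simp only [Finset.mem_erase]; grind
      rw [eo x h1 h2]
      have := ne_y x h1
      have := ne_t x h2
      simp only [Finset.mem_erase]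
      grind
    simp only [arcWeight]
    split_ifs with h1 h2 h3 h4 h5
    · rw [IH, if_pos ((cond y₀ (Or.inl ⟨rfl, h1⟩)).1 h2)]
      have : F.filter (fun x => arcInv ((y₀, t₀) :: L) x < x) =
          insert y₀ ((F.erase y₀).filter fun x => κ x < x) := by
        ext x
        simp only [Finset.mem_filter, Finset.mem_insert, Finset.mem_erase]
        by_cases a1 : x = y₀
        · subst a1; simp [ey, h1.1, hlt]
        by_cases a2 : x = t₀
        · subst a2; simp [h1.2, a1]
        rw [eo x a1 a2]; simp [a1]
      rw [this, Finset.card_insert_of_notMem (by simp), List.length_cons, pow_succ, pow_succ]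
      field_simp [q_ne_zero]
    · rw [IH, if_neg fun h => h2 ((cond y₀ (Or.inl ⟨rfl, h1⟩)).2 h)]
    · rw [IH, if_pos ((cond t₀ (Or.inr ⟨rfl, h3⟩)).1 h4)]
      have : F.filter (fun x => arcInv ((y₀, t₀) :: L) x < x) =
          ((F.erase t₀).filter fun x => κ x < x) := by
        ext x
        simp only [Finset.mem_filter, Finset.mem_erase]
        by_cases a1 : x = y₀
        · subst a1; simp [h3.2]
        by_cases a2 : x = t₀
        · subst a2; rw [et]; simp only [ne_eq, not_true_eq_false, false_and, iff_false]; omega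
        rw [eo x a1 a2]; simp [a2]
      rw [this, List.length_cons, pow_succ]
      ring
    · rw [IH, if_neg fun h => h4 ((cond t₀ (Or.inr ⟨rfl, h3⟩)).2 h), mul_zero]
    · exfalso
      have a := h5 y₀
      rw [ey] at a
      have : t₀ ≠ y₀ := hlt.ne
      tauto
    · rfl

/-! ### Left ends, right ends and orientations of peelable arcs -/

/-- The right ends of the arcs. -/
def heads (L : List (ℤ × ℤ)) : Finset ℤ := (L.map Prod.fst).toFinset

theorem mem_heads {L : List (ℤ × ℤ)} {z : ℤ} : z ∈ heads L ↔ z ∈ L.map Prod.fst :=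
  List.mem_toFinset

theorem Peelable.notMem {S : Finset ℤ} {L : List (ℤ × ℤ)} (h : Peelable S L) :
    ∀ p ∈ L, p.1 ∉ S ∧ p.2 ∉ S := by
  induction L generalizing S with
  | nil => simp
  | cons a L ih =>
    obtain ⟨hy, ht, -, -, hP⟩ := h
    intro p hp
    rcases List.mem_cons.1 hp with rfl | hp
    · exact ⟨hy, ht⟩
    · have := ih hP p hp
      simp only [Finset.mem_insert, not_or] at this
      exact ⟨this.1.2.2, this.2.2.2⟩

theorem Peelable.disjoint {S : Finset ℤ} {L : List (ℤ × ℤ)} (h : Peelable S L) {z : ℤ}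
    (hz : z ∈ heads L) : z ∉ S := by
  obtain ⟨p, hp, rfl⟩ := List.mem_map.1 (mem_heads.1 hz)
  exact (h.notMem p hp).1

theorem Peelable.nodup {S : Finset ℤ} {L : List (ℤ × ℤ)} (h : Peelable S L) :
    (L.map Prod.fst).Nodup := by
  induction L generalizing S with
  | nil => simp
  | cons a L ih =>
    obtain ⟨y, t⟩ := a
    obtain ⟨hy, ht, -, -, hP⟩ := h
    rw [List.map_cons, List.nodup_cons]
    refine ⟨fun hm => ?_, ih hP⟩
    exact hP.disjoint (mem_heads.2 hm) (by simp)

theorem Peelable.card_heads {S : Finset ℤ} {L : List (ℤ × ℤ)} (h : Peelable S L) :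
    (heads L).card = L.length := by
  rw [heads, List.toFinset_card_of_nodup h.nodup, List.length_map]

theorem slide_le (S : Finset ℤ) (l : List (ℤ × ℕ)) :
    List.Forall₂ (fun (a : ℤ × ℤ) (p : ℤ × ℕ) => a.1 ≤ p.1 - p.2) (slide S l) l := by
  induction l generalizing S with
  | nil => exact List.Forall₂.nil
  | cons p l ih => exact List.Forall₂.cons (step_iterate_le _ _ _) (ih _)

theorem slide_length (S : Finset ℤ) (l : List (ℤ × ℕ)) : (slide S l).length = l.length :=
  (slide_le S l).length_eq

theorem countP_slide (S : Finset ℤ) (l : List (ℤ × ℕ)) (t : ℤ) :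
    (l.map Prod.fst).countP (· < t) ≤ ((slide S l).map Prod.fst).countP (· < t) := by
  induction l generalizing S with
  | nil => simp [slide]
  | cons p l ih =>
    obtain ⟨x, k⟩ := p
    simp only [slide, List.map_cons, List.countP_cons]
    have h1 := ih (insert ((step S)^[k] x) (insert (step S ((step S)^[k] x)) S))
    have h2 := step_iterate_le S x k
    have : (if decide (x < t) = true then 1 else 0) ≤
        if decide ((step S)^[k] x < t) = true then 1 else 0 := by
      simp only [decide_eq_true_eq]
      split_ifs <;> omega
    omega

theorem card_filter_toFinset {l : List ℤ} (hl : l.Nodup) (t : ℤ) :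
    (l.toFinset.filter (· < t)).card = l.countP (· < t) := by
  have : l.toFinset.filter (· < t) = (l.filter (· < t)).toFinset := by
    ext; simp
  rw [this, List.toFinset_card_of_nodup (hl.filter _), List.countP_eq_length_filter]

/-- The choice of an end of every arc: the right end if `θ s = 0`, the left end otherwise. -/
def ends {r : ℕ} (a : Fin r → ℤ × ℤ) (θ : Fin r → ℕ) (s : Fin r) : ℤ :=
  if θ s = 0 then (a s).1 else (a s).2

theorem Peelable.ne {r : ℕ} {S : Finset ℤ} {a : Fin r → ℤ × ℤ} (h : Peelable S (List.ofFn a))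
    (s s' : Fin r) : (a s).1 ≠ (a s').2 ∧
      (s ≠ s' → (a s).1 ≠ (a s').1 ∧ (a s).2 ≠ (a s').2) := by
  induction r generalizing S with
  | zero => exact s.elim0
  | succ r ih =>
    rw [List.ofFn_succ] at h
    obtain ⟨hy, ht, hlt, hbt, hP⟩ := h
    have h1 : ∀ u : Fin r, _ := fun u => hP.notMem (a u.succ) (List.mem_ofFn.2 ⟨u, rfl⟩)
    simp only [Finset.mem_insert, not_or] at h1
    have IH := ih hP
    cases s using Fin.cases with
    | zero =>
      cases s' using Fin.cases with
      | zero => exact ⟨hlt.ne', by simp⟩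
      | succ s' =>
        have := h1 s'
        exact ⟨Ne.symm this.2.1, fun _ => ⟨Ne.symm this.1.1, Ne.symm this.2.2.1⟩⟩
    | succ s =>
      cases s' using Fin.cases with
      | zero =>
        have := h1 s
        exact ⟨this.1.2.1, fun _ => ⟨this.1.1, this.2.2.1⟩⟩
      | succ s' =>
        have := IH s s'
        exact ⟨this.1, fun hne => this.2 fun e => hne (by rw [e])⟩

theorem ends_injective {r : ℕ} {S : Finset ℤ} {a : Fin r → ℤ × ℤ}
    (h : Peelable S (List.ofFn a)) (θ : Fin r → ℕ) : Function.Injective (ends a θ) := by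
  intro s s' e
  by_contra hne
  have h1 := h.ne s s'
  have h2 := h.ne s' s
  unfold ends at e
  split_ifs at e
  · exact (h1.2 hne).1 e
  · exact h1.1 e
  · exact h2.1 e.symm
  · exact (h1.2 hne).2 e

/-- All ends of peelable arcs are distinct, so the set of chosen ends determines the choice on each
arc. This gives the uniqueness of θ for R_θ. -/
theorem image_ends_injective {r : ℕ} {S : Finset ℤ} {a : Fin r → ℤ × ℤ}
    (h : Peelable S (List.ofFn a)) {θ η : Fin r → ℕ} (hθ : ∀ s, θ s ≤ 1) (hη : ∀ s, η s ≤ 1)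
    (e : Finset.univ.image (ends a θ) = Finset.univ.image (ends a η)) : θ = η := by
  funext s
  have h1 : ends a θ s ∈ Finset.univ.image (ends a η) := e ▸ Finset.mem_image_of_mem _ (by simp)
  obtain ⟨s', -, e'⟩ := Finset.mem_image.1 h1
  have a1 := hθ s
  have a2 := hη s
  have h1 := h.ne s s'
  have h2 := h.ne s' s
  have h3 := h.ne s s
  unfold ends at e'
  by_cases hs : s' = s
  · subst hs
    split_ifs at e' with c1 c2 c2
    · omega
    · exact absurd e' h3.1
    · exact absurd e'.symm h3.1
    · omega
  · exfalso
    split_ifs at e' with c1 c2 c2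
    · exact (h2.2 hs).1 e'
    · exact h2.1 e'
    · exact h1.1 e'.symm
    · exact (h2.2 hs).2 e'

theorem image_ends_succ {r : ℕ} (a : Fin (r + 1) → ℤ × ℤ) (θ : Fin (r + 1) → ℕ) :
    Finset.univ.image (ends a θ) =
      insert (ends a θ 0) (Finset.univ.image (ends (fun s => a s.succ) fun s => θ s.succ)) := by
  ext z
  simp only [Finset.mem_image, Finset.mem_univ, true_and, Finset.mem_insert]
  rw [Fin.exists_fin_succ, eq_comm (a := z)]
  rfl

theorem arcWeight_ends {r : ℕ} {S : Finset ℤ} {a : Fin r → ℤ × ℤ}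
    (h : Peelable S (List.ofFn a)) {θ : Fin r → ℕ} (hθ : ∀ s, θ s ≤ 1) :
    arcWeight (List.ofFn a) (Finset.univ.image (ends a θ)) = q⁻¹ ^ ∑ s, θ s := by
  induction r generalizing S with
  | zero => simp [arcWeight]
  | succ r ih =>
    have hne := h.ne
    rw [List.ofFn_succ] at h ⊢
    obtain ⟨hy, ht, hlt, hbt, hP⟩ := h
    have h1 : ∀ u : Fin r, _ := fun u => hP.notMem (a u.succ) (List.mem_ofFn.2 ⟨u, rfl⟩)
    simp only [Finset.mem_insert, not_or] at h1
    set X := Finset.univ.image (ends (fun s => a s.succ) fun s => θ s.succ) with hX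
    have hn : ∀ z, z = (a 0).1 ∨ z = (a 0).2 → z ∉ X := by
      intro z hz hm
      obtain ⟨u, -, e⟩ := Finset.mem_image.1 hm
      have := h1 u
      unfold ends at e
      split_ifs at e <;> grind
    have IH := ih hP (θ := fun s => θ s.succ) fun s => hθ _
    rw [image_ends_succ, ← hX, Fin.sum_univ_succ, pow_add, ← IH, ← hX]
    have ha := hθ 0
    obtain h0 | h0 : θ 0 = 0 ∨ θ 0 = 1 := by omega
    · have e0 : ends a θ 0 = (a 0).1 := by simp [ends, h0]
      rw [e0, h0]
      change (if _ then _ else _) = _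
      rw [if_pos, Finset.erase_insert (hn _ (Or.inl rfl))]
      · simp
      · refine ⟨Finset.mem_insert_self _ _, ?_⟩
        rw [Finset.mem_insert, not_or]
        exact ⟨hlt.ne, hn _ (Or.inr rfl)⟩
    · have e0 : ends a θ 0 = (a 0).2 := by simp [ends, h0]
      rw [e0, h0]
      change (if _ then _ else if _ then _ else _) = _
      have c : (a 0).1 ∉ insert (a 0).2 X := by
        rw [Finset.mem_insert, not_or]
        exact ⟨hlt.ne', hn _ (Or.inl rfl)⟩
      rw [if_neg (fun hh => c hh.1), if_pos ⟨Finset.mem_insert_self _ _, c⟩,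
        Finset.erase_insert (hn _ (Or.inr rfl))]
      simp

theorem exists_ends_of_arcWeight_ne {r : ℕ} {a : Fin r → ℤ × ℤ} {F : Finset ℤ}
    (h : arcWeight (List.ofFn a) F ≠ 0) :
    ∃ θ : Fin r → ℕ, (∀ s, θ s ≤ 1) ∧ F = Finset.univ.image (ends a θ) := by
  induction r generalizing F with
  | zero =>
    refine ⟨fun _ => 0, fun _ => by simp, ?_⟩
    by_contra hF
    exact h (by simpa [arcWeight] using hF)
  | succ r ih =>
    rw [List.ofFn_succ] at h
    change (if (a 0).1 ∈ F ∧ (a 0).2 ∉ F then arcWeight _ (F.erase (a 0).1) else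
      if (a 0).2 ∈ F ∧ (a 0).1 ∉ F then q⁻¹ * arcWeight _ (F.erase (a 0).2) else 0) ≠ 0 at h
    split_ifs at h with h1 h2
    · obtain ⟨θ, hθ, e⟩ := ih h
      refine ⟨Fin.cons 0 θ, fun s => by cases s using Fin.cases <;> simp [hθ], ?_⟩
      rw [image_ends_succ]
      simp only [Fin.cons_succ]
      rw [← e, show ends a (Fin.cons 0 θ) 0 = (a 0).1 by simp [ends], Finset.insert_erase h1.1]
    · obtain ⟨θ, hθ, e⟩ := ih (right_ne_zero_of_mul h)
      refine ⟨Fin.cons 1 θ, fun s => by cases s using Fin.cases <;> simp [hθ], ?_⟩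
      rw [image_ends_succ]
      simp only [Fin.cons_succ]
      rw [← e, show ends a (Fin.cons 1 θ) 0 = (a 0).2 by simp [ends], Finset.insert_erase h2.1]
    · exact absurd rfl h

namespace WD

/-! ### The dual canonical basis -/

/-- The labels occurring in exactly one block. -/
def sings (g : WD) : Finset ℤ := (g.A ∪ g.B) \ g.P

theorem mem_sings {g : WD} {x : ℤ} : x ∈ g.sings ↔ ¬ (x ∈ g.A ↔ x ∈ g.B) := by
  simp only [sings, Finset.mem_sdiff, Finset.mem_union, mem_P]; tauto

/-- Replace the pairs of `g` by the elements of `Y`. -/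
def withP (g : WD) (Y : Finset ℤ) : WD := ⟨g.A \ g.B ∪ Y, g.B \ g.A ∪ Y⟩

theorem withP_props {g : WD} {Y : Finset ℤ} (h : ∀ z ∈ Y, z ∉ g.sings) :
    (g.withP Y).P = Y ∧ (g.withP Y).A \ (g.withP Y).B = g.A \ g.B ∧
      (g.withP Y).B \ (g.withP Y).A = g.B \ g.A ∧ (g.withP Y).sings = g.sings := by
  have key : ∀ z, z ∈ Y → (z ∈ g.A ↔ z ∈ g.B) := fun z hz => by
    have := h z hz; rw [mem_sings, not_not] at this; exact this
  refine ⟨?_, ?_, ?_, ?_⟩ <;> ext z <;> have := key z <;>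
    simp only [mem_P, mem_sings, withP, Finset.mem_union, Finset.mem_sdiff] <;> tauto

theorem eq_of_P {f g : WD} (h1 : f.A \ f.B = g.A \ g.B) (h2 : f.B \ f.A = g.B \ g.A)
    (h3 : f.P = g.P) : f = g := by
  ext z
  · have a := Finset.ext_iff.1 h1 z
    have c := Finset.ext_iff.1 h3 z
    simp only [Finset.mem_sdiff, mem_P] at a c; tauto
  · have a := Finset.ext_iff.1 h2 z
    have c := Finset.ext_iff.1 h3 z
    simp only [Finset.mem_sdiff, mem_P] at a c; tauto

theorem LM_of_peelable {h : WD} {L : List (ℤ × ℤ)} (hL : Peelable h.sings L)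
    (hP : h.P = heads L) : LM h (arcInv L) := by
  obtain ⟨i1, i2, i3, i4⟩ := arcInv_props hL
  refine ⟨i1, fun x hx => i2 x (mem_sings.2 hx), fun x => ?_, fun x y h1 h2 h3 =>
    i4 x y h1 h2 fun hc => mem_sings.1 hc h3⟩
  rw [← i3, ← mem_heads, ← hP, mem_P]

/-- Uniqueness of the left matching identifies it with the arcs in the list. Orientations of it with
the singles of `h` are then governed by the set of pairs alone. -/
theorem wc_eq_arcWeight {f h : WD} {L : List (ℤ × ℤ)} (hL : Peelable h.sings L)
    (hP : h.P = heads L) (h1 : f.A \ f.B = h.A \ h.B) (h2 : f.B \ f.A = h.B \ h.A) :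
    wc f h = arcWeight L f.P := by
  classical
  have hl : h.lmt = arcInv L := h.lmt_LM.unique (LM_of_peelable hL hP)
  rw [wc, uc_eq h.lam_RM, arcWeight_eq hL, hP, hL.card_heads]
  have hlam := h.orient_lam
  have : Orient h.lmt h.lam f ↔ ∀ x, arcInv L x ∈ f.P ↔ x ∉ f.P ∧ arcInv L x ≠ x := by
    constructor
    · intro ho x
      have := ho.2.2 x
      rw [hl] at this
      rw [mem_P, mem_P]; exact this
    · intro ho
      refine ⟨fun x => ?_, fun x => ?_, fun x => ?_⟩
      · rw [← hlam.1 x]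
        have := Finset.ext_iff.1 h1 x
        simpa only [Finset.mem_sdiff] using this
      · rw [← hlam.2.1 x]
        have := Finset.ext_iff.1 h2 x
        simpa only [Finset.mem_sdiff] using this
      · have := ho x
        rw [hl]
        rw [mem_P, mem_P] at this; exact this
  rw [hl] at this
  simp only [cnt, hl, mul_ite, mul_zero]
  exact if_congr this rfl rfl

/-! ### Sliding the pairs of a diagram to the left -/

/-- `x` lists the pairs of `g` in increasing order. -/
structure Enum (g : WD) {r : ℕ} (x : Fin r → ℤ) : Prop where
  mono : StrictMono x
  image : Finset.univ.image x = g.P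

/-- Slide the pairs of `g` to the left. -/
def slideWD (g : WD) (l : List (ℤ × ℕ)) : WD := g.withP (heads (slide g.sings l))

/-- The pairs together with the numbers of steps. -/
def steps {r : ℕ} (x : Fin r → ℤ) (θ : Fin r → ℕ) : List (ℤ × ℕ) :=
  List.ofFn fun s => (x s, θ s)

section Enum

variable {g : WD} {r : ℕ} {x : Fin r → ℤ}

theorem Enum.notMem (h : Enum g x) (s : Fin r) : x s ∉ g.sings := by
  have : x s ∈ g.P := h.image ▸ Finset.mem_image_of_mem _ (Finset.mem_univ _)
  rw [mem_sings]
  rw [mem_P] at this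
  tauto

theorem Enum.peelable (h : Enum g x) (θ : Fin r → ℕ) :
    Peelable g.sings (slide g.sings (steps x θ)) := by
  refine slide_peelable _ _ ?_ ?_
  · rw [steps, List.map_ofFn]
    exact h.mono.sortedLT_ofFn
  · intro p hp
    obtain ⟨s, rfl⟩ := List.mem_ofFn.1 hp
    exact h.notMem s

theorem Enum.slide_props (h : Enum g x) (θ : Fin r → ℕ) :
    (g.slideWD (steps x θ)).P = heads (slide g.sings (steps x θ)) ∧
    (g.slideWD (steps x θ)).A \ (g.slideWD (steps x θ)).B = g.A \ g.B ∧
      (g.slideWD (steps x θ)).B \ (g.slideWD (steps x θ)).A = g.B \ g.A ∧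
      (g.slideWD (steps x θ)).sings = g.sings :=
  withP_props fun _ hz => (h.peelable θ).disjoint hz

theorem Enum.slide_le (h : Enum g x) (θ : Fin r → ℕ) : g.slideWD (steps x θ) ≤ g := by
  obtain ⟨h1, h2, h3, -⟩ := h.slide_props θ
  have hx : g.P = ((steps x θ).map Prod.fst).toFinset := by
    rw [← h.image]
    ext z
    simp [steps]
  have hnd : ((steps x θ).map Prod.fst).Nodup := by
    rw [steps, List.map_ofFn]
    exact List.nodup_ofFn.2 h.mono.injective
  refine ⟨h2, h3, ?_, fun t => ?_⟩
  · rw [h1, (h.peelable θ).card_heads, slide_length, hx, List.toFinset_card_of_nodup hnd,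
      List.length_map]
  · rw [h1, hx, heads, card_filter_toFinset hnd, card_filter_toFinset (h.peelable θ).nodup]
    exact countP_slide _ _ _

/-- Each step lowers a label by at least one. Hence a given result bounds every coordinate of θ,
which yields the finiteness of the sums over θ. -/
theorem Enum.le_of_slide (h : Enum g x) {θ : Fin r → ℕ} (s : Fin r) :
    ∃ z ∈ (g.slideWD (steps x θ)).P, z ≤ x s - θ s := by
  have h1 := SuperKL.slide_le g.sings (steps x θ)
  have hl : (slide g.sings (steps x θ)).length = r := by rw [slide_length]; simp [steps]
  rw [List.forall₂_iff_get] at h1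
  have h2 := h1.2 s (by rw [hl]; exact s.2) (by simp [steps])
  refine ⟨((slide g.sings (steps x θ)).get ⟨s, by rw [hl]; exact s.2⟩).1, ?_, ?_⟩
  · rw [(h.slide_props θ).1, mem_heads]
    exact List.mem_map_of_mem (List.get_mem _ _)
  · simpa [steps] using h2

theorem Enum.finite (h : Enum g x) (f : WD) :
    {θ : Fin r → ℕ | g.slideWD (steps x θ) = f}.Finite := by
  obtain ⟨e, he⟩ : ∃ e : ℤ, ∀ z ∈ f.P, e ≤ z := f.P.bddBelow
  refine (Set.Finite.pi' (t := fun s => {k : ℕ | (k : ℤ) ≤ x s - e}) fun s => ?_).subset ?_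
  · exact (Set.finite_le_nat (x s - e).toNat).subset fun k (hk : (k : ℤ) ≤ _) => by
      change k ≤ _; omega
  · rintro θ rfl s
    obtain ⟨z, hz, hz'⟩ := h.le_of_slide (θ := θ) s
    have := he z hz
    change (θ s : ℤ) ≤ _
    omega

/-- The coefficients of the dual canonical basis. -/
def lcx (g : WD) {r : ℕ} (x : Fin r → ℤ) (f : WD) : Qq :=
  ∑ᶠ (θ : Fin r → ℕ) (_ : g.slideWD (steps x θ) = f), (-q)⁻¹ ^ ∑ s, θ s

theorem Enum.lcx_eq_sum (h : Enum g x) {f : WD} {N : ℕ} (hN : ∀ s, ∀ z ∈ f.P, x s < z + N) :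
    lcx g x f = ∑ θ : Fin r → Fin N,
      if g.slideWD (steps x fun s => (θ s : ℕ)) = f then (-q)⁻¹ ^ ∑ s, (θ s : ℕ) else 0 := by
  have e : Function.Injective fun (θ : Fin r → Fin N) (s : Fin r) => (θ s : ℕ) :=
    fun a b hab => funext fun s => Fin.ext (congrFun hab s)
  have h1 : lcx g x f = ∑ᶠ θ : Fin r → ℕ, if g.slideWD (steps x θ) = f then
      (-q)⁻¹ ^ ∑ s, θ s else 0 := by
    refine finsum_congr fun θ => ?_
    rw [finsum_eq_if]
  rw [h1, finsum_eq_sum_of_support_subset (s := Finset.univ.image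
    fun (θ : Fin r → Fin N) (s : Fin r) => (θ s : ℕ)), Finset.sum_image e.injOn]
  intro θ hθ
  have hθ' : g.slideWD (steps x θ) = f := by
    by_contra hc; exact hθ (if_neg hc)
  have hlt : ∀ s, θ s < N := fun s => by
    obtain ⟨z, hz, hz'⟩ := h.le_of_slide (θ := θ) s
    have := hN s z (hθ' ▸ hz)
    omega
  simp only [Finset.coe_image, Finset.coe_univ, Set.image_univ, Set.mem_range]
  exact ⟨fun s => ⟨θ s, hlt s⟩, rfl⟩

theorem Enum.lcx_le (h : Enum g x) {f : WD} (hf : lcx g x f ≠ 0) : f ≤ g := by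
  by_contra hc
  apply hf
  refine finsum_eq_zero_of_forall_eq_zero fun θ => ?_
  rw [finsum_eq_if, if_neg]
  rintro rfl
  exact hc (h.slide_le θ)

/-- After interchanging the sums, each θ contributes only at the diagram to which it slides `g`.
There `wc` is the weight of the sliding arcs, and `sum_slide` applies. -/
theorem Enum.sum_wc_lcx (h : Enum g x) {f : WD} (hfg : f ≤ g) :
    ∑ k ∈ Finset.Icc f g, wc f k * lcx g x k = if f = g then 1 else 0 := by
  obtain ⟨e, he⟩ : ∃ e : ℤ, ∀ z ∈ f.A ∪ f.B, e ≤ z := (f.A ∪ f.B).bddBelow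
  obtain ⟨M, hM⟩ : ∃ M : ℤ, ∀ z ∈ g.P, z ≤ M := g.P.bddAbove
  -- N exceeds the distance from a lower bound of the labels of `f` to an upper bound of the pairs
  -- of `g`, so for all k ≥ f the sums may be truncated to coordinates below N.
  obtain ⟨N, hN'⟩ : ∃ N : ℕ, M < e + N := ⟨(M - e).toNat + 1, by push_cast; omega⟩
  have hN : ∀ k, f ≤ k → ∀ s, ∀ z ∈ k.P, x s < z + N := fun k hk s z hz => by
    have h1 := bound_le hk he z (Finset.mem_union_left _ (mem_P.1 hz).1)
    have h2 : x s ≤ M := hM _ (h.image ▸ Finset.mem_image_of_mem _ (Finset.mem_univ _))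
    omega
  rw [Finset.sum_congr rfl fun k hk => by
    rw [h.lcx_eq_sum (hN k (Finset.mem_Icc.1 hk).1), Finset.mul_sum], Finset.sum_comm]
  have := sum_slide g.sings x f.P h.mono h.notMem (hN f le_rfl)
  have hP : f.P = Finset.univ.image x ↔ f = g := by
    rw [h.image]
    exact ⟨fun e => eq_of_P hfg.1 hfg.2.1 e, fun e => by rw [e]⟩
  simp only [hP] at this
  rw [← this]
  refine Finset.sum_congr rfl fun θ _ => ?_
  obtain ⟨h1, h2, h3, h4⟩ := h.slide_props fun s => (θ s : ℕ)
  have hw : wc f (g.slideWD (steps x fun s => (θ s : ℕ))) =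
      arcWeight (slide g.sings (steps x fun s => (θ s : ℕ))) f.P := by
    refine wc_eq_arcWeight (h4 ▸ h.peelable _) h1 (hfg.1.trans h2.symm) (hfg.2.1.trans h3.symm)
  change _ = _ * arcWeight (slide g.sings (steps x fun s => (θ s : ℕ))) f.P
  rw [← hw]
  generalize hk : g.slideWD (steps x fun s => (θ s : ℕ)) = k
  by_cases hfk : f ≤ k
  · rw [Finset.sum_eq_single k]
    · rw [if_pos rfl, mul_comm]
    · intro b _ hb; rw [if_neg (Ne.symm hb), mul_zero]
    · intro hc
      exact absurd (Finset.mem_Icc.2 ⟨hfk, hk ▸ h.slide_le _⟩) hc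
  · have : wc f k = 0 := by
      by_contra hc; exact hfk (le_of_wc_ne hc)
    rw [this, mul_zero]
    refine Finset.sum_eq_zero fun b hb => ?_
    rw [if_neg, mul_zero]
    rintro rfl
    exact hfk (Finset.mem_Icc.1 hb).1

theorem enum_orderEmb (g : WD) : Enum g (g.P.orderEmbOfFin rfl) :=
  ⟨(g.P.orderEmbOfFin rfl).strictMono, by
    ext z
    simp⟩

theorem Enum.card (h : Enum g x) : g.P.card = r := by
  rw [← h.image, Finset.card_image_of_injective _ h.mono.injective, Finset.card_fin]

theorem Enum.unique (h : Enum g x) {y : Fin r → ℤ} (h' : Enum g y) : x = y := by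
  have a := Finset.orderEmbOfFin_unique h.card (f := x)
    (fun s => h.image ▸ Finset.mem_image_of_mem _ (Finset.mem_univ _)) h.mono
  have b := Finset.orderEmbOfFin_unique h.card (f := y)
    (fun s => h'.image ▸ Finset.mem_image_of_mem _ (Finset.mem_univ _)) h'.mono
  rw [a, b]

end Enum

/-- The coefficients of the dual canonical basis. -/
def incL : Inc := ⟨fun f g => lcx g (g.P.orderEmbOfFin rfl) f, fun _ g h => by
  by_contra hc; exact h (g.enum_orderEmb.lcx_le hc)⟩

theorem Enum.incL_eq {g : WD} {r : ℕ} {x : Fin r → ℤ} (h : Enum g x) (f : WD) :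
    incL f g = lcx g x f := by
  obtain rfl := h.card
  rw [h.unique g.enum_orderEmb]
  rfl

theorem incW_mul_incL : incW * incL = 1 := by
  refine IncidenceAlgebra.ext fun f g hfg => ?_
  rw [IncidenceAlgebra.mul_apply, IncidenceAlgebra.one_apply]
  exact g.enum_orderEmb.sum_wc_lcx hfg

theorem incL_self (f : WD) : incL f f = 1 := by
  have : (incW * incL) f f = (1 : Inc) f f := by rw [incW_mul_incL]
  simpa [incW_self] using this

theorem bet_incL (f : WD) : bet (fun g => incL f g) = fun g => incL f g :=
  bet_row_of (bar_mul_incR_of_mul_incW incW_mul_incL) f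

end WD

variable {m n : ℕ}

/-! ### Lengths and reduced words -/

open Classical in
/-- The number of inversions of `x` between places with related values. -/
def pinv {m : ℕ} (ω : Fin m → Fin m → Prop) (x : Equiv.Perm (Fin m)) : ℕ :=
  ∑ p : Fin m × Fin m, if p.1 < p.2 ∧ x p.2 < x p.1 ∧ ω (x p.1) (x p.2) then 1 else 0

-- Exchanging two adjacent places changes the relative order of these two places only. The relation
-- ω is used for equality of entries, and also with the zero function to count all inversions.
open Classical in
theorem pinv_mul_swap {ω : Fin m → Fin m → Prop} (hω : ∀ a b, ω a b → ω b a)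
    {x : Equiv.Perm (Fin m)} {k k' : Fin m} (hk : k.val + 1 = k'.val) (h : x k < x k') :
    pinv ω (x * Equiv.swap k k') = pinv ω x + if ω (x k) (x k') then 1 else 0 := by
  have hne : k ≠ k' := fun e => by subst e; omega
  have h1 : pinv ω (x * Equiv.swap k k') = ∑ p : Fin m × Fin m,
      if Equiv.swap k k' p.1 < Equiv.swap k k' p.2 ∧ x p.2 < x p.1 ∧ ω (x p.1) (x p.2)
      then 1 else 0 := by
    rw [pinv, ← ((Equiv.swap k k').prodCongr (Equiv.swap k k')).sum_comp]
    refine Finset.sum_congr rfl fun p _ => ?_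
    simp
  have h2 : (if ω (x k) (x k') then 1 else 0) = ∑ p : Fin m × Fin m,
      if p = (k', k) then (if ω (x k) (x k') then 1 else 0) else 0 := by
    rw [Finset.sum_ite_eq' Finset.univ (k', k)]; simp
  rw [h1, pinv, h2, ← Finset.sum_add_distrib]
  refine Finset.sum_congr rfl fun p _ => ?_
  obtain ⟨a, b⟩ := p
  have hs : ∀ z, (Equiv.swap k k' z).val =
      if z = k then k'.val else if z = k' then k.val else z.val := fun z => by
    rw [Equiv.swap_apply_def]; split_ifs <;> rfl
  simp only [Prod.mk.injEq]
  by_cases c : a = k' ∧ b = k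
  · obtain ⟨rfl, rfl⟩ := c
    have e1 : ¬ (a < b) := by rw [Fin.lt_def]; omega
    rw [Equiv.swap_apply_left, Equiv.swap_apply_right]
    have e2 : b < a := by rw [Fin.lt_def]; omega
    have e3 : ω (x b) (x a) ↔ ω (x a) (x b) := ⟨hω _ _, hω _ _⟩
    simp [e1, e2, h, e3]
  · rw [if_neg c, add_zero]
    by_cases c' : a = k ∧ b = k'
    · obtain ⟨rfl, rfl⟩ := c'
      have : ¬ (x b < x a) := not_lt.2 h.le
      simp [this]
    · refine if_congr (and_congr_left fun hx => ?_) rfl rfl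
      have hab : a ≠ b := fun e => by subst e; exact lt_irrefl _ hx.1
      rw [Fin.lt_def, Fin.lt_def, hs, hs]
      have q1 : a = k ↔ a.val = k.val := Fin.ext_iff
      have q2 : a = k' ↔ a.val = k'.val := Fin.ext_iff
      have q3 : b = k ↔ b.val = k.val := Fin.ext_iff
      have q4 : b = k' ↔ b.val = k'.val := Fin.ext_iff
      have q5 : a ≠ b ↔ a.val ≠ b.val := Fin.ext_iff.not
      rw [q5] at hab
      rw [q2, q3] at c
      rw [q1, q4] at c'
      simp only [q1, q2, q3, q4]
      split_ifs <;> omega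

/-- The place `i`, for a basic transposition `s_i`. -/
def lo : (i : Fin (m - 1) ⊕ Fin (n - 1)) → Idx m n
  | Sum.inl k => Sum.inl ⟨k, by omega⟩
  | Sum.inr k => Sum.inr ⟨k, by omega⟩

/-- The place `i + 1`, for a basic transposition `s_i`. -/
def hi : (i : Fin (m - 1) ⊕ Fin (n - 1)) → Idx m n
  | Sum.inl k => Sum.inl ⟨k + 1, by omega⟩
  | Sum.inr k => Sum.inr ⟨k + 1, by omega⟩

/-- `x s_i` is longer than `x`. -/
def Asc (x : S m n) : Fin (m - 1) ⊕ Fin (n - 1) → Prop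
  | Sum.inl k => x.1 ⟨k, by omega⟩ < x.1 ⟨k + 1, by omega⟩
  | Sum.inr k => x.2 ⟨k, by omega⟩ < x.2 ⟨k + 1, by omega⟩

/-- The permutation of the places. -/
def perm (x : S m n) : Equiv.Perm (Idx m n) := Equiv.sumCongr x.1 x.2

theorem perm_mul (x y : S m n) : perm (x * y) = perm x * perm y := by
  ext i; cases i <;> rfl

theorem act_eq (f : IntFun m n) (x : S m n) (i : Idx m n) : act f x i = f (perm x i) := rfl

theorem act_mul (f : IntFun m n) (x y : S m n) : act f (x * y) = act (act f x) y := by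
  funext i; rw [act_eq, act_eq, act_eq, perm_mul]; rfl

theorem act_one (f : IntFun m n) : act f 1 = f := by
  funext i; cases i <;> rfl

theorem simpleRefl_mul_self (i : Fin (m - 1) ⊕ Fin (n - 1)) :
    (simpleRefl i : S m n) * simpleRefl i = 1 := by
  cases i <;> simp [simpleRefl]

theorem mul_simpleRefl_cancel (x : S m n) (i : Fin (m - 1) ⊕ Fin (n - 1)) :
    x * simpleRefl i * simpleRefl i = x := by
  rw [mul_assoc, simpleRefl_mul_self, mul_one]

theorem simpleRefl_mul_cancel (x : S m n) (i : Fin (m - 1) ⊕ Fin (n - 1)) :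
    simpleRefl i * (simpleRefl i * x) = x := by
  rw [← mul_assoc, simpleRefl_mul_self, one_mul]

theorem simpleRefl_inv (i : Fin (m - 1) ⊕ Fin (n - 1)) :
    (simpleRefl i : S m n)⁻¹ = simpleRefl i :=
  inv_eq_of_mul_eq_one_left (simpleRefl_mul_self i)

theorem perm_simpleRefl (i : Fin (m - 1) ⊕ Fin (n - 1)) :
    perm (simpleRefl i : S m n) = Equiv.swap (lo i) (hi i) := by
  cases i with
  | inl k => exact Equiv.Perm.sumCongr_swap_one _ _
  | inr k => exact Equiv.Perm.sumCongr_one_swap _ _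

/-- The number of inversions between places with equal values of `f`. -/
def sinv (f : IntFun m n) (x : S m n) : ℕ :=
  pinv (fun a b => f (Sum.inl a) = f (Sum.inl b)) x.1 +
    pinv (fun a b => f (Sum.inr a) = f (Sum.inr b)) x.2

theorem sinv_mul (f : IntFun m n) {x : S m n} {i : Fin (m - 1) ⊕ Fin (n - 1)} (h : Asc x i) :
    sinv f (x * simpleRefl i) = sinv f x +
      if f (perm x (lo i)) = f (perm x (hi i)) then 1 else 0 := by
  cases i with
  | inl k =>
    simp only [sinv, simpleRefl, Prod.fst_mul, Prod.snd_mul, mul_one]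
    rw [pinv_mul_swap (fun _ _ => Eq.symm) rfl h]
    simp only [perm, lo, hi, Equiv.sumCongr_apply, Sum.map_inl]
    split_ifs <;> omega
  | inr k =>
    simp only [sinv, simpleRefl, Prod.fst_mul, Prod.snd_mul, mul_one]
    rw [pinv_mul_swap (fun _ _ => Eq.symm) rfl h]
    simp only [perm, lo, hi, Equiv.sumCongr_apply, Sum.map_inr]
    split_ifs <;> omega

theorem asc_mul_of_not {x : S m n} {i : Fin (m - 1) ⊕ Fin (n - 1)} :
    Asc (x * simpleRefl i) i ↔ ¬ Asc x i := by
  cases i with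
  | inl k =>
    simp only [Asc, simpleRefl, Prod.fst_mul, Equiv.Perm.mul_apply, Equiv.swap_apply_left,
      Equiv.swap_apply_right, not_lt]
    refine ⟨le_of_lt, fun h => lt_of_le_of_ne h fun e => ?_⟩
    have := x.1.injective e
    simp at this
  | inr k =>
    simp only [Asc, simpleRefl, Prod.snd_mul, Equiv.Perm.mul_apply, Equiv.swap_apply_left,
      Equiv.swap_apply_right, not_lt]
    refine ⟨le_of_lt, fun h => lt_of_le_of_ne h fun e => ?_⟩
    have := x.2.injective e
    simp at this

/-- The number of inversions. -/
def ninv (x : S m n) : ℕ := sinv 0 x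

theorem ninv_mul {x : S m n} {i : Fin (m - 1) ⊕ Fin (n - 1)} (h : Asc x i) :
    ninv (x * simpleRefl i) = ninv x + 1 := by
  rw [ninv, sinv_mul _ h]; simp [ninv]

theorem ninv_mul' {x : S m n} {i : Fin (m - 1) ⊕ Fin (n - 1)} (h : ¬ Asc x i) :
    ninv x = ninv (x * simpleRefl i) + 1 := by
  rw [← ninv_mul (asc_mul_of_not.2 h), mul_simpleRefl_cancel]

theorem ninv_mul_le (x : S m n) (i : Fin (m - 1) ⊕ Fin (n - 1)) :
    ninv (x * simpleRefl i) ≤ ninv x + 1 := by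
  by_cases h : Asc x i
  · exact (ninv_mul h).le
  · have := ninv_mul' h; omega

theorem ninv_one : ninv (1 : S m n) = 0 := by
  simp only [ninv, sinv, pinv, Prod.fst_one, Prod.snd_one, Equiv.Perm.one_apply]
  exact Nat.add_eq_zero_iff.2 ⟨Finset.sum_eq_zero fun p _ => if_neg fun h => lt_asymm h.1 h.2.1,
    Finset.sum_eq_zero fun p _ => if_neg fun h => lt_asymm h.1 h.2.1⟩

theorem perm_eq_one {x : Equiv.Perm (Fin m)}
    (h : ∀ k : Fin (m - 1), x ⟨k, by omega⟩ < x ⟨k + 1, by omega⟩) : x = 1 := by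
  cases m with
  | zero => exact Subsingleton.elim _ _
  | succ m =>
    have h1 : StrictMono x := Fin.strictMono_iff_lt_succ.2 fun k => h k
    let e : Fin (m + 1) ≃o Fin (m + 1) := ⟨x, h1.le_iff_le⟩
    ext k
    have : e = OrderIso.refl _ := Subsingleton.elim _ _
    exact congrArg Fin.val (congrArg (fun e : Fin (m + 1) ≃o Fin (m + 1) => e k) this)

theorem eq_one_of_asc {x : S m n} (h : ∀ i, Asc x i) : x = 1 :=
  Prod.ext (perm_eq_one fun k => h (Sum.inl k)) (perm_eq_one fun k => h (Sum.inr k))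

theorem S_induction {p : S m n → Prop} (h1 : p 1)
    (hs : ∀ x i, Asc x i → p x → p (x * simpleRefl i)) (x : S m n) : p x := by
  induction hN : ninv x using Nat.strong_induction_on generalizing x with
  | _ N ih =>
  by_cases h : ∀ i, Asc x i
  · rw [eq_one_of_asc h]; exact h1
  · push Not at h
    obtain ⟨i, hi⟩ := h
    have := ninv_mul' hi
    rw [← mul_simpleRefl_cancel x i]
    exact hs _ _ (asc_mul_of_not.2 hi) (ih _ (by omega) _ rfl)

theorem exists_word (x : S m n) :
    ∃ w : List (Fin (m - 1) ⊕ Fin (n - 1)), (w.map simpleRefl).prod = x ∧ w.length = ninv x := by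
  induction x using S_induction with
  | h1 => exact ⟨[], by simp, by simp [ninv_one]⟩
  | hs x i hi ih =>
    obtain ⟨w, rfl, hw⟩ := ih
    exact ⟨w ++ [i], by simp, by rw [ninv_mul hi, ← hw]; simp⟩

theorem ninv_prod_le (w : List (Fin (m - 1) ⊕ Fin (n - 1))) :
    ninv (w.map (simpleRefl (m := m) (n := n))).prod ≤ w.length := by
  induction w using List.reverseRecOn with
  | nil => simp [ninv_one]
  | append_singleton w i ih =>
    simp only [List.map_append, List.map_cons, List.map_nil, List.prod_append, List.prod_singleton,
      List.length_append, List.length_singleton]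
    exact (ninv_mul_le _ _).trans (by omega)

theorem len_eq (x : S m n) : len x = ninv x := by
  refine le_antisymm (Nat.sInf_le (exists_word x)) ?_
  refine le_csInf ⟨_, exists_word x⟩ ?_
  rintro r ⟨w, rfl, rfl⟩
  exact ninv_prod_le w

theorem isReduced_reducedWord (x : S m n) : IsReduced x (reducedWord x) := by
  obtain ⟨w, h1, h2⟩ := exists_word x
  exact Classical.epsilon_spec (p := IsReduced x) ⟨w, h1, h2.trans (len_eq x).symm⟩

theorem ninv_inv (x : S m n) : ninv x⁻¹ = ninv x := by
  have key : ∀ y : S m n, ninv y⁻¹ ≤ ninv y := by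
    intro y
    obtain ⟨w, h1, h2⟩ := exists_word y
    have h3 := ninv_prod_le (m := m) (n := n) w.reverse
    rw [List.length_reverse, h2] at h3
    convert h3 using 2
    rw [← h1, List.prod_inv_reverse, List.map_reverse, List.map_map]
    congr 2
    refine List.map_congr_left fun i _ => simpleRefl_inv i
  refine le_antisymm (key x) ?_
  have := key x⁻¹
  rwa [inv_inv] at this

/-- A reduced word moves a vector up step by step. -/
theorem foldl_reduced {V : Type*} [AddCommGroup V] [Module Qq V]
    (O : Fin (m - 1) ⊕ Fin (n - 1) → V →ₗ[Qq] V) (B : S m n → V)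
    (hB : ∀ x i, Asc x i → O i (B x) = B (x * simpleRefl i)) (x : S m n) :
    (reducedWord x).foldl (fun T i => (O i).comp T) LinearMap.id (B 1) = B x := by
  have key : ∀ w : List (Fin (m - 1) ⊕ Fin (n - 1)),
      w.length = ninv (w.map (simpleRefl (m := m) (n := n))).prod →
      w.foldl (fun T i => (O i).comp T) LinearMap.id (B 1) = B (w.map simpleRefl).prod := by
    intro w
    induction w using List.reverseRecOn with
    | nil => intro _; simp
    | append_singleton w i ih =>
      intro h
      have h1 := ninv_prod_le (m := m) (n := n) w
      simp only [List.map_append, List.map_cons, List.map_nil, List.prod_append,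
        List.prod_singleton, List.length_append, List.length_singleton, List.foldl_append,
        List.foldl_cons, List.foldl_nil, LinearMap.comp_apply] at h ⊢
      -- A descent along the word would leave the product with fewer inversions than the word has
      -- letters.
      by_cases ha : Asc (w.map (simpleRefl (m := m) (n := n))).prod i
      · have := ninv_mul ha
        rw [ih (by omega), hB _ _ ha]
      · have := ninv_mul' ha
        omega
  have hr := isReduced_reducedWord x
  have := key _ (by rw [hr.1, hr.2, len_eq])
  rwa [hr.1] at this

/-- Left multiplication by s_j exchanges the values j and j + 1. It can only affect the order of the
values at i and i + 1 if these are j and j + 1, that is, if s_j x = x s_i. -/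
theorem asc_simpleRefl_mul {x : S m n} {i j : Fin (m - 1) ⊕ Fin (n - 1)}
    (h : simpleRefl j * x ≠ x * simpleRefl i) : Asc (simpleRefl j * x) i ↔ Asc x i := by
  have aux : ∀ {m : ℕ} (x : Equiv.Perm (Fin m)) (k l : Fin (m - 1)),
      Equiv.swap (⟨l, by omega⟩ : Fin m) ⟨l + 1, by omega⟩ * x ≠
        x * Equiv.swap ⟨k, by omega⟩ ⟨k + 1, by omega⟩ →
      (Equiv.swap (⟨l, by omega⟩ : Fin m) ⟨l + 1, by omega⟩ (x ⟨k, by omega⟩) <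
        Equiv.swap (⟨l, by omega⟩ : Fin m) ⟨l + 1, by omega⟩ (x ⟨k + 1, by omega⟩) ↔
        x ⟨k, by omega⟩ < x ⟨k + 1, by omega⟩) := by
    intro m x k l hne
    rw [Equiv.mul_swap_eq_swap_mul] at hne
    have hne' : ∀ a b : Fin m, a = x ⟨k, by omega⟩ → b = x ⟨k + 1, by omega⟩ →
        ¬ (a.val = l ∧ b.val = l + 1) ∧ ¬ (b.val = l ∧ a.val = l + 1) := by
      rintro a b ha hb
      refine ⟨fun hc => hne ?_, fun hc => hne ?_⟩
      · rw [← ha, ← hb]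
        exact congrArg₂ (fun u v => Equiv.swap u v * x) (Fin.ext hc.1.symm) (Fin.ext hc.2.symm)
      · rw [← ha, ← hb, Equiv.swap_comm a b]
        exact congrArg₂ (fun u v => Equiv.swap u v * x) (Fin.ext hc.1.symm) (Fin.ext hc.2.symm)
    have hxx : x ⟨k, by omega⟩ ≠ x ⟨k + 1, by omega⟩ := fun e => by
      have := x.injective e; simp at this
    have h2 := hne' _ _ rfl rfl
    generalize x ⟨k, by omega⟩ = a at *
    generalize x ⟨k + 1, by omega⟩ = b at *
    have hs : ∀ z : Fin m, (Equiv.swap (⟨l, by omega⟩ : Fin m) ⟨l + 1, by omega⟩ z).val =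
        if z.val = l then l.val + 1 else if z.val = l + 1 then l.val else z.val := fun z => by
      rw [Equiv.swap_apply_def]
      simp only [Fin.ext_iff]
      split_ifs <;> rfl
    rw [Fin.lt_def, Fin.lt_def, hs, hs]
    have h3 : a.val ≠ b.val := fun e => hxx (Fin.ext e)
    split_ifs <;> omega
  cases i with
  | inl k =>
    cases j with
    | inl l => exact aux x.1 k l fun e => h (Prod.ext e (by simp [simpleRefl]))
    | inr l => simp [Asc, simpleRefl]
  | inr k =>
    cases j with
    | inl l => simp [Asc, simpleRefl]
    | inr l => exact aux x.2 k l fun e => h (Prod.ext (by simp [simpleRefl]) e)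

theorem asc_inv_iff {x : S m n} {i j : Fin (m - 1) ⊕ Fin (n - 1)}
    (h : simpleRefl j * x = x * simpleRefl i) : Asc x⁻¹ j ↔ Asc x i := by
  have e : ninv (x⁻¹ * simpleRefl j) = ninv (x * simpleRefl i) := by
    rw [← ninv_inv, mul_inv_rev, inv_inv, simpleRefl_inv, h]
  have e2 := ninv_inv x
  by_cases h1 : Asc x⁻¹ j
  · have := ninv_mul h1
    by_cases h2 : Asc x i
    · exact iff_of_true h1 h2
    · have := ninv_mul' h2; omega
  · have := ninv_mul' h1
    by_cases h2 : Asc x i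
    · have := ninv_mul h2; omega
    · exact iff_of_false h1 h2

/-! ### The symmetrizer on the regular module -/

/-- `∑ₓ (-q) ^ (ℓ(x) - ℓ(w₀)) Oₓ` for operators `O_i`. -/
def h0Of {V : Type*} [AddCommGroup V] [Module Qq V]
    (O : Fin (m - 1) ⊕ Fin (n - 1) → V →ₗ[Qq] V) : V →ₗ[Qq] V :=
  ∑ x : S m n, ((-q) ^ ((len x : ℤ) - len (longest m n))) •
    (reducedWord x).foldl (fun T i => (O i).comp T) LinearMap.id

theorem h0Op_eq : h0Op m n = h0Of hOp := rfl

theorem h0Of_apply {V : Type*} [AddCommGroup V] [Module Qq V]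
    (O : Fin (m - 1) ⊕ Fin (n - 1) → V →ₗ[Qq] V) (v : V) :
    h0Of O v = ∑ x : S m n, ((-q) ^ ((len x : ℤ) - len (longest m n))) •
      (reducedWord x).foldl (fun T i => (O i).comp T) LinearMap.id v := by
  simp [h0Of, LinearMap.sum_apply]

theorem h0Of_intertwine {V V' : Type*} [AddCommGroup V] [Module Qq V] [AddCommGroup V']
    [Module Qq V'] {O : Fin (m - 1) ⊕ Fin (n - 1) → V →ₗ[Qq] V}
    {O' : Fin (m - 1) ⊕ Fin (n - 1) → V' →ₗ[Qq] V'} (Φ : V →ₗ[Qq] V')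
    (h : ∀ i v, Φ (O i v) = O' i (Φ v)) (v : V) : Φ (h0Of O v) = h0Of O' (Φ v) := by
  rw [h0Of_apply, h0Of_apply, map_sum]
  refine Finset.sum_congr rfl fun x _ => ?_
  rw [map_smul]
  congr 1
  induction reducedWord x using List.reverseRecOn with
  | nil => rfl
  | append_singleton w i ih => simp [List.foldl_append, h, ih]

/-- Right multiplication by `H_i` on the regular module. -/
def regR (i : Fin (m - 1) ⊕ Fin (n - 1)) : (S m n → Qq) →ₗ[Qq] (S m n → Qq) :=
  open Classical in
  { toFun := fun u x => u (x * simpleRefl i) - if Asc x i then 0 else (q - q⁻¹) * u x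
    map_add' := fun u v => by
      funext x; simp only [Pi.add_apply]; split_ifs <;> ring
    map_smul' := fun a u => by
      funext x; simp only [Pi.smul_apply, smul_eq_mul, RingHom.id_apply]; split_ifs <;> ring }

/-- Left multiplication by `H_j` on the regular module. -/
def regL (j : Fin (m - 1) ⊕ Fin (n - 1)) : (S m n → Qq) →ₗ[Qq] (S m n → Qq) :=
  open Classical in
  { toFun := fun u x => u (simpleRefl j * x) - if Asc x⁻¹ j then 0 else (q - q⁻¹) * u x
    map_add' := fun u v => by
      funext x; simp only [Pi.add_apply]; split_ifs <;> ring
    map_smul' := fun a u => by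
      funext x; simp only [Pi.smul_apply, smul_eq_mul, RingHom.id_apply]; split_ifs <;> ring }

open Classical in
theorem regR_apply (i : Fin (m - 1) ⊕ Fin (n - 1)) (u : S m n → Qq) (x : S m n) :
    regR i u x = u (x * simpleRefl i) - if Asc x i then 0 else (q - q⁻¹) * u x := rfl

open Classical in
theorem regL_apply (i : Fin (m - 1) ⊕ Fin (n - 1)) (u : S m n → Qq) (x : S m n) :
    regL i u x = u (simpleRefl i * x) - if Asc x⁻¹ i then 0 else (q - q⁻¹) * u x := rfl

/-- Away from the coincidence s_j x = x s_i neither multiplication affects the descents of the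
other; in the coincidence the two formulas agree. -/
theorem regL_regR (i j : Fin (m - 1) ⊕ Fin (n - 1)) (u : S m n → Qq) :
    regL j (regR i u) = regR i (regL j u) := by
  classical
  funext x
  simp only [regL_apply, regR_apply, mul_assoc]
  by_cases h : simpleRefl j * x = x * simpleRefl i
  · have h1 := asc_inv_iff h
    have h3 : Asc (x * simpleRefl i)⁻¹ j ↔ ¬ Asc x i := by
      rw [← h, mul_inv_rev, simpleRefl_inv, asc_mul_of_not, h1]
    simp only [h1, h3, h, asc_mul_of_not]
  · have h2 := asc_simpleRefl_mul h
    have h3 : Asc (x * simpleRefl i)⁻¹ j ↔ Asc x⁻¹ j := by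
      rw [mul_inv_rev, simpleRefl_inv]
      refine asc_simpleRefl_mul fun e => h ?_
      have := congrArg (fun z => z⁻¹) e
      simp only [mul_inv_rev, inv_inv, simpleRefl_inv] at this
      exact this.symm
    simp only [h2, h3]
    split_ifs <;> ring

open Classical in
theorem regR_single {x : S m n} {i : Fin (m - 1) ⊕ Fin (n - 1)} (h : Asc x i) :
    regR i (Pi.single x 1) = Pi.single (x * simpleRefl i) 1 := by
  funext y
  rw [regR_apply]
  have e : y * simpleRefl i = x ↔ y = x * simpleRefl i := by
    constructor
    · rintro rfl; rw [mul_simpleRefl_cancel]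
    · rintro rfl; rw [mul_simpleRefl_cancel]
  rw [Pi.single_apply, Pi.single_apply, Pi.single_apply]
  simp only [e]
  by_cases hy : y = x
  · subst hy; simp [h]
  · simp [hy]

open Classical in
theorem regL_single {x : S m n} {i : Fin (m - 1) ⊕ Fin (n - 1)} (h : Asc x⁻¹ i) :
    regL i (Pi.single x 1) = Pi.single (simpleRefl i * x) 1 := by
  funext y
  rw [regL_apply]
  have e : simpleRefl i * y = x ↔ y = simpleRefl i * x := by
    constructor
    · rintro rfl; rw [simpleRefl_mul_cancel]
    · rintro rfl; rw [simpleRefl_mul_cancel]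
  rw [Pi.single_apply, Pi.single_apply, Pi.single_apply]
  simp only [e]
  by_cases hy : y = x
  · subst hy; simp [h]
  · simp [hy]

theorem neg_q_ne_zero : (-q : Qq) ≠ 0 := neg_ne_zero.2 q_ne_zero

open Classical in
theorem h0Of_regR_one : h0Of regR (Pi.single (1 : S m n) 1) =
    fun x => (-q) ^ ((len x : ℤ) - len (longest m n)) := by
  rw [h0Of_apply]
  funext y
  rw [Finset.sum_apply, Finset.sum_eq_single y]
  · rw [foldl_reduced regR (fun x => Pi.single x 1) fun x i h => regR_single h]
    simp
  · intro x _ hx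
    rw [foldl_reduced regR (fun x => Pi.single x 1) fun x i h => regR_single h]
    simp [Pi.single_eq_of_ne hx.symm]
  · simp

/-- At the unit element the coefficients (-q)^(ℓ(x) - ℓ(w₀)) are explicit and the claim is checked
directly. The other basis vectors arise from the unit by left multiplications, which commute with
everything on the right. -/
theorem regR_h0Of (i : Fin (m - 1) ⊕ Fin (n - 1)) (u : S m n → Qq) :
    regR i (h0Of regR u) = (-q) • h0Of regR u := by
  classical
  suffices H : (regR i).comp (h0Of regR) = (-q) • h0Of (m := m) (n := n) regR from
    LinearMap.congr_fun H u
  have one : regR i (h0Of regR (Pi.single (1 : S m n) 1)) =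
      (-q) • h0Of regR (Pi.single (1 : S m n) 1) := by
    rw [h0Of_regR_one]
    funext x
    rw [regR_apply, Pi.smul_apply, smul_eq_mul]
    by_cases h : Asc x i
    · rw [if_pos h, len_eq, len_eq x, ninv_mul h, sub_zero, ← zpow_one_add₀ neg_q_ne_zero]
      congr 1; push_cast; ring
    · rw [if_neg h, len_eq, len_eq x, ninv_mul' h,
        show ((ninv (x * simpleRefl i) + 1 : ℕ) : ℤ) - len (longest m n) =
          ((ninv (x * simpleRefl i) : ℤ) - len (longest m n)) + 1 by push_cast; ring,
        zpow_add_one₀ neg_q_ne_zero]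
      have := q_ne_zero
      field_simp
      ring
  have all : ∀ y : S m n, regR i (h0Of regR (Pi.single y⁻¹ 1)) =
      (-q) • h0Of regR (Pi.single y⁻¹ 1) := by
    intro y
    induction y using S_induction with
    | h1 => rw [inv_one]; exact one
    | hs y j hj ih =>
      have e : (Pi.single (y * simpleRefl j)⁻¹ 1 : S m n → Qq) = regL j (Pi.single y⁻¹ 1) := by
        rw [regL_single (by rwa [inv_inv]), mul_inv_rev, simpleRefl_inv]
      rw [e, ← h0Of_intertwine (regL j) (fun i v => regL_regR i j v), ← regL_regR, ih, map_smul]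
  refine LinearMap.pi_ext fun y a => ?_
  have h1 : (Pi.single y a : S m n → Qq) = a • Pi.single y 1 := by
    rw [← Pi.single_smul, smul_eq_mul, mul_one]
  have h2 := all y⁻¹
  rw [inv_inv] at h2
  rw [h1, map_smul, map_smul, LinearMap.comp_apply, h2]
  rfl

/-! ### Antisymmetric families -/

theorem act_simpleRefl_eq (g : IntFun m n) (i : Fin (m - 1) ⊕ Fin (n - 1)) (k : Idx m n) :
    act g (simpleRefl i) k = g (Equiv.swap (lo i) (hi i) k) := by
  rw [act_eq, perm_simpleRefl]

theorem act_simpleRefl_self {g : IntFun m n} {i : Fin (m - 1) ⊕ Fin (n - 1)} :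
    act g (simpleRefl i) = g ↔ g (lo i) = g (hi i) := by
  constructor
  · intro h
    have := congrFun h (hi i)
    rwa [act_simpleRefl_eq, Equiv.swap_apply_right] at this
  · intro h
    funext k
    rw [act_simpleRefl_eq, Equiv.swap_apply_def]
    split_ifs with h1 h2
    · rw [h1, h]
    · rw [h2, h]
    · rfl

theorem act_act_simpleRefl (g : IntFun m n) (i : Fin (m - 1) ⊕ Fin (n - 1)) :
    act (act g (simpleRefl i)) (simpleRefl i) = g := by
  rw [← act_mul, simpleRefl_mul_self, act_one]

theorem ascends_act {g : IntFun m n} {i : Fin (m - 1) ⊕ Fin (n - 1)}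
    (h : g (lo i) ≠ g (hi i)) : Ascends (act g (simpleRefl i)) i ↔ ¬ Ascends g i := by
  have h1 := act_simpleRefl_eq g i (lo i)
  have h2 := act_simpleRefl_eq g i (hi i)
  rw [Equiv.swap_apply_left] at h1
  rw [Equiv.swap_apply_right] at h2
  cases i <;> simp only [Ascends, lo, hi] at * <;> rw [h1, h2] <;> omega

open Classical in
theorem hOp_apply (i : Fin (m - 1) ⊕ Fin (n - 1)) (u : Fam m n) (g : IntFun m n) :
    hOp i u g = if act g (simpleRefl i) = g then q⁻¹ * u g else
      u (act g (simpleRefl i)) - if Ascends g i then 0 else (q - q⁻¹) * u g := by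
  have e : ∀ f, act f (simpleRefl i) = g ↔ f = act g (simpleRefl i) := fun f => by
    constructor
    · rintro rfl; rw [act_act_simpleRefl]
    · rintro rfl; rw [act_act_simpleRefl]
  change ∑ᶠ f, u f * hBasis i f g = _
  rw [finsum_eq_sum_of_support_subset (s := {g, act g (simpleRefl i)})]
  · by_cases h : act g (simpleRefl i) = g
    · rw [if_pos h, h, Finset.pair_eq_singleton, Finset.sum_singleton, hBasis, if_pos h,
        Finsupp.single_eq_same, mul_comm]
    · rw [if_neg h, Finset.sum_pair (Ne.symm h)]
      have h' : ¬ act (act g (simpleRefl i)) (simpleRefl i) = act g (simpleRefl i) := by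
        rw [act_act_simpleRefl]; exact Ne.symm h
      have ha := ascends_act (i := i) (g := g) fun c => h (act_simpleRefl_self.2 c)
      rw [hBasis, hBasis, if_neg h, if_neg h', act_act_simpleRefl]
      simp only [ha]
      split_ifs with h1
      · rw [Finsupp.sub_apply, Finsupp.single_eq_same, Finsupp.single_apply,
          Finsupp.single_apply, if_neg h, if_neg h]
        ring
      · rw [Finsupp.sub_apply, Finsupp.single_eq_same, Finsupp.single_eq_same,
          Finsupp.single_apply, if_neg h]
        ring
  · intro f hf
    rw [Finset.coe_pair, Set.mem_insert_iff, Set.mem_singleton_iff]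
    by_contra! hc
    apply hf
    have h2 : ¬ act f (simpleRefl i) = g := fun c => hc.2 ((e f).1 c)
    change u f * hBasis i f g = 0
    unfold hBasis
    split_ifs <;> simp [hc.1, h2]

/-- The families `u` with `u H_i = -q u`. -/
def AntiSym (m n : ℕ) : Submodule Qq (Fam m n) where
  carrier := {u | ∀ g i, (g (lo i) = g (hi i) → u g = 0) ∧
    (Ascends g i → u (act g (simpleRefl i)) = -q * u g)}
  zero_mem' := fun g i => by simp
  add_mem' := fun {u v} hu hv g i => ⟨fun h => by
    rw [Pi.add_apply, (hu g i).1 h, (hv g i).1 h, add_zero], fun h => by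
    rw [Pi.add_apply, (hu g i).2 h, (hv g i).2 h, Pi.add_apply]; ring⟩
  smul_mem' := fun a u hu g i => ⟨fun h => by
    rw [Pi.smul_apply, (hu g i).1 h, smul_zero], fun h => by
    rw [Pi.smul_apply, (hu g i).2 h, Pi.smul_apply, smul_eq_mul, smul_eq_mul]; ring⟩

theorem q_add_inv_ne_zero : q + q⁻¹ ≠ 0 := by
  intro h
  have h0 := q_ne_zero
  have h1 : q ^ 2 + 1 = 0 := by
    have : q * (q + q⁻¹) = 0 := by rw [h, mul_zero]
    rw [mul_add, mul_inv_cancel₀ h0] at this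
    rw [← this]; ring
  refine transcendental_q ⟨Polynomial.X ^ 2 + 1, ?_, by simpa using h1⟩
  intro hc
  have := congrArg (Polynomial.coeff · 2) hc
  simp [Polynomial.coeff_one] at this

/-- At equal entries H_i acts by q⁻¹, so that (q + q⁻¹) u_g = 0. -/
theorem mem_antiSym_of_hOp {u : Fam m n} (h : ∀ i, hOp i u = (-q) • u) : u ∈ AntiSym m n := by
  classical
  intro g i
  have h1 := congrFun (h i) g
  rw [hOp_apply, Pi.smul_apply, smul_eq_mul] at h1
  refine ⟨fun hg => ?_, fun hg => ?_⟩
  · rw [if_pos (act_simpleRefl_self.2 hg)] at h1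
    have : (q + q⁻¹) * u g = 0 := by linear_combination h1
    exact (mul_eq_zero.1 this).resolve_left q_add_inv_ne_zero
  · have hne : ¬ act g (simpleRefl i) = g := fun c => by
      have := act_simpleRefl_self.1 c
      cases i <;> simp only [Ascends, lo, hi] at * <;> omega
    rw [if_neg hne, if_pos hg, sub_zero] at h1
    exact h1

/-- `f` is weakly decreasing on the first and weakly increasing on the second block. -/
def IsAnti (f : IntFun m n) : Prop :=
  Antitone (fun i : Fin m => f (Sum.inl i)) ∧ Monotone (fun j : Fin n => f (Sum.inr j))

theorem exists_anti (f : IntFun m n) : ∃ f₀ x, IsAnti f₀ ∧ f = act f₀ x := by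
  let σ : S m n := (Tuple.sort fun i : Fin m => -f (Sum.inl i),
    Tuple.sort fun j : Fin n => f (Sum.inr j))
  refine ⟨act f σ, σ⁻¹, ⟨?_, ?_⟩, by rw [← act_mul, mul_inv_cancel, act_one]⟩
  · intro i j h
    have := Tuple.monotone_sort (fun i : Fin m => -f (Sum.inl i)) h
    exact neg_le_neg_iff.1 this
  · exact Tuple.monotone_sort fun j : Fin n => f (Sum.inr j)

theorem IsAnti.ascends {f : IntFun m n} (hf : IsAnti f) {x : S m n}
    {i : Fin (m - 1) ⊕ Fin (n - 1)} (h : Asc x i)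
    (hne : act f x (lo i) ≠ act f x (hi i)) : Ascends (act f x) i := by
  cases i with
  | inl k => exact lt_of_le_of_ne (hf.1 h.le) hne.symm
  | inr k => exact lt_of_le_of_ne (hf.2 h.le) hne

/-- Restriction of a family to the orbit of an antidominant function. -/
def pull (f : IntFun m n) : Fam m n →ₗ[Qq] (S m n → Qq) where
  toFun u x := q⁻¹ ^ sinv f x * u (act f x)
  map_add' u v := by funext x; simp only [Pi.add_apply]; ring
  map_smul' a u := by
    funext x; simp only [Pi.smul_apply, smul_eq_mul, RingHom.id_apply]; ring

theorem pull_apply (f : IntFun m n) (u : Fam m n) (x : S m n) :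
    pull f u x = q⁻¹ ^ sinv f x * u (act f x) := rfl

/-- Passing from x to x s_i does not change the function if the two entries are equal, whereas H_i
then acts by q⁻¹. The weight q⁻¹ for every inversion between equal entries accounts for the
difference. -/
theorem pull_hOp {f : IntFun m n} (hf : IsAnti f) (i : Fin (m - 1) ⊕ Fin (n - 1))
    (u : Fam m n) : pull f (hOp i u) = regR i (pull f u) := by
  classical
  have h0 := q_ne_zero
  funext x
  rw [pull_apply, hOp_apply, regR_apply, pull_apply, pull_apply, act_mul]
  by_cases he : act f x (lo i) = act f x (hi i)
  · rw [if_pos (act_simpleRefl_self.2 he), act_simpleRefl_self.2 he]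
    by_cases ha : Asc x i
    · have := sinv_mul f ha
      rw [if_pos (by exact he)] at this
      rw [if_pos ha, this, pow_succ]; ring
    · have := sinv_mul f (asc_mul_of_not.2 ha)
      rw [mul_simpleRefl_cancel, perm_mul, perm_simpleRefl, Equiv.Perm.mul_apply,
        Equiv.Perm.mul_apply, Equiv.swap_apply_left, Equiv.swap_apply_right,
        if_pos (by exact he.symm)] at this
      rw [if_neg ha, this, pow_succ]
      field_simp
      ring
  · rw [if_neg (fun c => he (act_simpleRefl_self.1 c))]
    by_cases ha : Asc x i
    · have := sinv_mul f ha
      rw [if_neg (by exact he)] at this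
      rw [if_pos ha, if_pos (hf.ascends ha he), this, add_zero]; ring
    · have := sinv_mul f (asc_mul_of_not.2 ha)
      rw [mul_simpleRefl_cancel, perm_mul, perm_simpleRefl, Equiv.Perm.mul_apply,
        Equiv.Perm.mul_apply, Equiv.swap_apply_left, Equiv.swap_apply_right,
        if_neg (by exact Ne.symm he)] at this
      have hd : ¬ Ascends (act f x) i := by
        have h1 : act (act f x) (simpleRefl i) (lo i) ≠ act (act f x) (simpleRefl i) (hi i) := by
          rw [act_simpleRefl_eq, act_simpleRefl_eq, Equiv.swap_apply_left,
            Equiv.swap_apply_right]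
          exact Ne.symm he
        have h2 := hf.ascends (asc_mul_of_not.2 ha) (by rw [act_mul]; exact h1)
        rw [act_mul, ascends_act he] at h2
        exact h2
      rw [if_neg ha, if_neg hd, this, add_zero]; ring

theorem h0Op_mem_antiSym (u : Fam m n) : h0Op m n u ∈ AntiSym m n := by
  refine mem_antiSym_of_hOp fun i => ?_
  funext f
  obtain ⟨f₀, x, hf, rfl⟩ := exists_anti f
  have h1 : pull f₀ (hOp i (h0Op m n u)) = (-q) • pull f₀ (h0Op m n u) := by
    rw [pull_hOp hf, h0Op_eq, h0Of_intertwine (pull f₀) (fun i v => pull_hOp hf i v), regR_h0Of]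
  have h2 := congrFun h1 x
  rw [← map_smul, pull_apply, pull_apply] at h2
  exact mul_left_cancel₀ (pow_ne_zero _ (inv_ne_zero q_ne_zero)) h2

theorem antiSym_orbit {f : IntFun m n} (hf : IsAnti f) (x : S m n) :
    ∃ c : Qq, c ≠ 0 ∧ ∀ u ∈ AntiSym m n, u (act f x) = c * u f := by
  induction x using S_induction with
  | h1 => exact ⟨1, one_ne_zero, fun u _ => by rw [act_one, one_mul]⟩
  | hs x i hi ih =>
    obtain ⟨c, hc, h⟩ := ih
    rw [act_mul]
    by_cases he : act f x (lo i) = act f x (SuperKL.hi i)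
    · exact ⟨c, hc, fun u hu => by rw [act_simpleRefl_self.2 he, h u hu]⟩
    · refine ⟨-q * c, mul_ne_zero neg_q_ne_zero hc, fun u hu => ?_⟩
      rw [(hu _ i).2 (hf.ascends hi he), h u hu, mul_assoc]

theorem isDominant_of_anti {f : IntFun m n} (hf : IsAnti f) (h : ∀ i, f (lo i) ≠ f (hi i)) :
    IsDominant (act f (longest m n)) := by
  have h1 : StrictAnti fun i : Fin m => f (Sum.inl i) := by
    cases m with
    | zero => exact fun i => i.elim0
    | succ m =>
      exact Fin.strictAnti_iff_succ_lt.2 fun k =>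
        lt_of_le_of_ne (hf.1 (Fin.castSucc_lt_succ).le) (h (Sum.inl k)).symm
  have h2 : StrictMono fun i : Fin n => f (Sum.inr i) := by
    cases n with
    | zero => exact fun i => i.elim0
    | succ m =>
      exact Fin.strictMono_iff_lt_succ.2 fun k =>
        lt_of_le_of_ne (hf.2 (Fin.castSucc_lt_succ).le) (h (Sum.inr k))
  exact ⟨fun a b hab => h1 (Fin.rev_lt_rev.2 hab), fun a b hab => h2 (Fin.rev_lt_rev.2 hab)⟩

/-- Antisymmetric families are determined by their values on dominant functions. -/
theorem antiSym_cases (f : IntFun m n) :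
    (∃ (g : Dom m n) (c : Qq) (x : S m n), g.1 = act f x ∧ ∀ u ∈ AntiSym m n, u f = c * u g.1) ∨
      ∀ u ∈ AntiSym m n, u f = 0 := by
  obtain ⟨f₀, x, hf, rfl⟩ := exists_anti f
  obtain ⟨c, hc, h⟩ := antiSym_orbit hf x
  by_cases hi : ∀ i, f₀ (lo i) ≠ f₀ (hi i)
  · left
    obtain ⟨c', hc', h'⟩ := antiSym_orbit hf (longest m n)
    refine ⟨⟨_, isDominant_of_anti hf hi⟩, c * c'⁻¹, x⁻¹ * longest m n, ?_, fun u hu => ?_⟩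
    · rw [act_mul, ← act_mul f₀, mul_inv_cancel, act_one]
    · rw [h u hu, h' u hu, mul_assoc, inv_mul_cancel_left₀ hc']
  · right
    push Not at hi
    obtain ⟨i, hi⟩ := hi
    intro u hu
    rw [h u hu, (hu f₀ i).1 hi, mul_zero]

/-! ### The completed exterior space as a space of antisymmetric families -/

theorem bounded_act {d : ℤ} {g : IntFun m n} (h : Bounded d g) (x : S m n) :
    Bounded d (act g x) := fun i => h (perm x i)

theorem hOp_mem_That {u : Fam m n} (hu : u ∈ That m n) (i : Fin (m - 1) ⊕ Fin (n - 1)) :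
    hOp i u ∈ That m n := by
  classical
  intro d
  refine ((hu d).union ((hu d).image fun f => act f (simpleRefl i))).subset ?_
  rintro g ⟨hg, hne⟩
  rw [hOp_apply] at hne
  by_contra hc
  rw [Set.mem_union, not_or] at hc
  have h1 : u g = 0 := by
    by_contra h; exact hc.1 ⟨hg, h⟩
  have h2 : u (act g (simpleRefl i)) = 0 := by
    by_contra h; exact hc.2 ⟨_, ⟨bounded_act hg _, h⟩, act_act_simpleRefl _ _⟩
  rw [h1, h2] at hne
  simp at hne

theorem h0Op_mem_That {u : Fam m n} (hu : u ∈ That m n) : h0Op m n u ∈ That m n := by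
  rw [h0Op_eq, h0Of_apply]
  refine (That m n).sum_mem fun x _ => (That m n).smul_mem _ ?_
  induction reducedWord x using List.reverseRecOn with
  | nil => exact hu
  | append_singleton w i ih =>
    simp only [List.foldl_append, List.foldl_cons, List.foldl_nil, LinearMap.comp_apply]
    exact hOp_mem_That ih i

theorem longest_mul_self : longest m n * longest m n = 1 := by
  ext i <;> simp [longest]

theorem act_longest_longest (f : IntFun m n) : act (act f (longest m n)) (longest m n) = f := by
  rw [← act_mul, longest_mul_self, act_one]

theorem IsDominant.injective {g : IntFun m n} (h : IsDominant g) :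
    Function.Injective (fun i => g (Sum.inl i)) ∧ Function.Injective (fun i => g (Sum.inr i)) :=
  ⟨h.1.injective, h.2.injective⟩

theorem eq_one_of_dominant {g : IntFun m n} {y : S m n} (h : IsDominant g)
    (h' : IsDominant (act g y)) : y = 1 := by
  refine eq_one_of_asc fun i => ?_
  cases i with
  | inl k =>
    exact h.1.lt_iff_lt.1 (h'.1 (show (⟨k, by omega⟩ : Fin m) < ⟨k + 1, by omega⟩ by
      rw [Fin.lt_def]; exact Nat.lt_succ_self _))
  | inr k =>
    exact h.2.lt_iff_gt.1 (h'.2 (show (⟨k, by omega⟩ : Fin n) < ⟨k + 1, by omega⟩ by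
      rw [Fin.lt_def]; exact Nat.lt_succ_self _))

theorem isAnti_longest {g : IntFun m n} (h : IsDominant g) : IsAnti (act g (longest m n)) :=
  ⟨fun _ _ hab => h.1.monotone (Fin.rev_le_rev.2 hab),
    fun _ _ hab => h.2.antitone (Fin.rev_le_rev.2 hab)⟩

theorem sinv_eq_zero {g : IntFun m n} (h : IsDominant g) (y x : S m n) :
    sinv (act g y) x = 0 := by
  refine Nat.add_eq_zero_iff.2 ⟨Finset.sum_eq_zero fun p _ => if_neg fun hp => ?_,
    Finset.sum_eq_zero fun p _ => if_neg fun hp => ?_⟩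
  · exact hp.1.ne (x.1.injective (y.1.injective (h.injective.1 hp.2.2)))
  · exact hp.1.ne (x.2.injective (y.2.injective (h.injective.2 hp.2.2)))

/-- On the orbit, `u` is a multiple of the unit vector at 1, and the coefficient of H₀ at the
longest element is (-q)⁰ = 1. -/
theorem h0Op_dominant {u : Fam m n} {g : IntFun m n} (hg : IsDominant g)
    (hu : ∀ x, x ≠ 1 → u (act (act g (longest m n)) x) = 0) :
    h0Op m n u g = u (act g (longest m n)) := by
  classical
  have hf := isAnti_longest hg
  have h1 := h0Of_intertwine (pull (act g (longest m n))) (fun i v => pull_hOp hf i v) u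
  have h2 : pull (act g (longest m n)) u = u (act g (longest m n)) • Pi.single 1 1 := by
    funext x
    rw [pull_apply, sinv_eq_zero hg, pow_zero, one_mul, Pi.smul_apply, smul_eq_mul]
    by_cases hx : x = 1
    · rw [hx, act_one, Pi.single_eq_same, mul_one]
    · rw [hu x hx, Pi.single_eq_of_ne hx, mul_zero]
  rw [h2, map_smul, h0Of_regR_one] at h1
  have h3 := congrFun h1 (longest m n)
  rw [pull_apply, sinv_eq_zero hg, pow_zero, one_mul, act_longest_longest, Pi.smul_apply,
    sub_self, zpow_zero, smul_eq_mul, mul_one] at h3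
  exact h3

theorem eq_of_antiSym {u v : Fam m n} (hu : u ∈ AntiSym m n) (hv : v ∈ AntiSym m n)
    (h : ∀ g : Dom m n, u g.1 = v g.1) : u = v := by
  funext f
  rcases antiSym_cases f with ⟨g, c, x, -, hc⟩ | hc
  · rw [hc u hu, hc v hv, h]
  · rw [hc u hu, hc v hv]

theorem eq_one_of_longest_conj {x : S m n}
    (h : longest m n * x * longest m n = 1) : x = 1 := by
  calc x = longest m n * (longest m n * x * longest m n) * longest m n := by
        rw [mul_assoc (longest m n) x, ← mul_assoc, longest_mul_self, one_mul, mul_assoc,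
          longest_mul_self, mul_one]
    _ = 1 := by rw [h, mul_one, longest_mul_self]

-- Consequently the coefficient of K_g in an element of the exterior space is the value of the
-- element at g.
open Classical in
theorem kVec_apply (f g : Dom m n) : (kVec f).1 g.1 = if g = f then 1 else 0 := by
  have key : ∀ x, act (act g.1 (longest m n)) x = act f.1 (longest m n) → g = f ∧ x = 1 := by
    intro x hx
    have h1 : act g.1 (longest m n * x * longest m n) = f.1 := by
      rw [act_mul, act_mul, hx, act_longest_longest]
    have h2 := eq_one_of_dominant g.2 (y := longest m n * x * longest m n) (h1 ▸ f.2)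
    exact ⟨Subtype.ext (by rw [← h1, h2, act_one]), eq_one_of_longest_conj h2⟩
  change h0Op m n (monom (act f.1 (longest m n))) g.1 = _
  rw [h0Op_dominant g.2]
  · split_ifs with h
    · subst h; simp [monom]
    · refine Pi.single_eq_of_ne (fun e => h ?_) _
      exact (key 1 (by rw [act_one]; exact e)).1
  · intro x hx
    exact Pi.single_eq_of_ne (fun e => hx (key x e).2) _

/-! ### Weight diagrams as coordinates -/

/-- The values of a function on the two blocks. -/
def toWD (g : IntFun m n) : WD :=
  ⟨Finset.univ.image fun i => g (Sum.inl i), Finset.univ.image fun i => g (Sum.inr i)⟩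

theorem mem_toWD_A {g : IntFun m n} {z : ℤ} : z ∈ (toWD g).A ↔ ∃ i, g (Sum.inl i) = z := by
  simp [toWD]

theorem mem_toWD_B {g : IntFun m n} {z : ℤ} : z ∈ (toWD g).B ↔ ∃ i, g (Sum.inr i) = z := by
  simp [toWD]

theorem toWD_act (g : IntFun m n) (x : S m n) : toWD (act g x) = toWD g := by
  ext z
  · rw [mem_toWD_A, mem_toWD_A]; exact (x.1.surjective.exists (p := fun i => g (Sum.inl i) = z)).symm
  · rw [mem_toWD_B, mem_toWD_B]; exact (x.2.surjective.exists (p := fun i => g (Sum.inr i) = z)).symm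

theorem bd_toWD {d : ℤ} {g : IntFun m n} : WD.Bd d (toWD g) ↔ Bounded d g := by
  constructor
  · intro h i
    cases i with
    | inl i => exact h _ (Finset.mem_union_left _ (mem_toWD_A.2 ⟨i, rfl⟩))
    | inr i => exact h _ (Finset.mem_union_right _ (mem_toWD_B.2 ⟨i, rfl⟩))
  · intro h z hz
    rcases Finset.mem_union.1 hz with hz | hz
    · obtain ⟨i, rfl⟩ := mem_toWD_A.1 hz; exact h _
    · obtain ⟨i, rfl⟩ := mem_toWD_B.1 hz; exact h _

theorem toWD_injective {f g : IntFun m n} (hf : IsDominant f) (hg : IsDominant g)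
    (h : toWD f = toWD g) : f = g := by
  have key : ∀ {k : ℕ} (a b : Fin k → ℤ), StrictMono a → StrictMono b →
      Finset.univ.image a = Finset.univ.image b → a = b := by
    intro k a b ha hb hab
    have hc : (Finset.univ.image b).card = k := by
      rw [Finset.card_image_of_injective _ hb.injective, Finset.card_fin]
    exact (Finset.orderEmbOfFin_unique hc (f := a)
      (fun s => hab ▸ Finset.mem_image_of_mem _ (Finset.mem_univ _)) ha).trans
      (Finset.orderEmbOfFin_unique hc (f := b)
      (fun s => Finset.mem_image_of_mem _ (Finset.mem_univ _)) hb).symm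
  have h1 := key _ _ hf.1 hg.1 (congrArg WD.A h)
  have h2 := key (fun i => f (Sum.inr i.rev)) (fun i => g (Sum.inr i.rev))
    (fun a b hab => hf.2 (Fin.rev_lt_rev.2 hab)) (fun a b hab => hg.2 (Fin.rev_lt_rev.2 hab)) (by
      have := congrArg WD.B h
      ext z
      have := Finset.ext_iff.1 this z
      simp only [toWD, Finset.mem_image, Finset.mem_univ, true_and] at this ⊢
      rw [Fin.rev_surjective.exists (p := fun i => f (Sum.inr i) = z),
        Fin.rev_surjective.exists (p := fun i => g (Sum.inr i) = z)] at this
      exact this)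
  funext i
  cases i with
  | inl i => exact congrFun h1 i
  | inr i => simpa using congrFun h2 i.rev

theorem sz_toWD (g : Dom m n) : WD.Sz m n (toWD g.1) :=
  ⟨by rw [toWD, Finset.card_image_of_injective _ g.2.injective.1, Finset.card_fin],
    by rw [toWD, Finset.card_image_of_injective _ g.2.injective.2, Finset.card_fin]⟩

theorem exists_toWD {W : WD} (h : WD.Sz m n W) : ∃ g : Dom m n, toWD g.1 = W := by
  refine ⟨⟨Sum.elim (W.A.orderEmbOfFin h.1) fun i => W.B.orderEmbOfFin h.2 i.rev,
    fun a b hab => ?_, fun a b hab => ?_⟩, ?_⟩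
  · simpa using hab
  · simpa using hab
  · ext z
    · rw [mem_toWD_A]
      exact Set.ext_iff.1 (Finset.range_orderEmbOfFin W.A h.1) z
    · rw [mem_toWD_B]
      have := Set.ext_iff.1 (Finset.range_orderEmbOfFin W.B h.2) z
      rw [Set.mem_range, Fin.rev_surjective.exists] at this
      exact this

/-- The dominant coefficients of a family. -/
def coord (u : Fam m n) (W : WD) : Qq :=
  open Classical in if h : ∃ g : Dom m n, toWD g.1 = W then u h.choose.1 else 0

theorem coord_toWD (u : Fam m n) (g : Dom m n) : coord u (toWD g.1) = u g.1 := by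
  have h : ∃ g' : Dom m n, toWD g'.1 = toWD g.1 := ⟨g, rfl⟩
  rw [coord, dif_pos h, toWD_injective h.choose.2 g.2 h.choose_spec]

theorem sz_of_coord_ne {u : Fam m n} {W : WD} (h : coord u W ≠ 0) : WD.Sz m n W := by
  by_cases hc : ∃ g : Dom m n, toWD g.1 = W
  · obtain ⟨g, rfl⟩ := hc; exact sz_toWD g
  · rw [coord, dif_neg hc] at h; exact absurd rfl h

theorem coord_mem {u : Fam m n} (hu : u ∈ That m n) : coord u ∈ WD.Cf := by
  intro d
  refine ((hu d).image toWD).subset ?_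
  rintro W ⟨hW, hne⟩
  obtain ⟨g, rfl⟩ := exists_toWD (sz_of_coord_ne hne)
  rw [coord_toWD] at hne
  exact ⟨g.1, ⟨bd_toWD.1 hW, hne⟩, rfl⟩

/-- The antisymmetric family with given dominant coefficients. -/
def ofCoord (m n : ℕ) (c : WD → Qq) : Fam m n :=
  h0Op m n fun f => open Classical in if IsDominant (act f (longest m n)) then c (toWD f) else 0

theorem ofCoord_apply (c : WD → Qq) (g : Dom m n) : ofCoord m n c g.1 = c (toWD g.1) := by
  rw [ofCoord, h0Op_dominant g.2]
  · rw [if_pos (by rw [act_longest_longest]; exact g.2), toWD_act]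
  · intro x hx
    refine if_neg fun h => hx ?_
    rw [← act_mul, ← act_mul] at h
    exact eq_one_of_longest_conj (by rw [mul_assoc]; exact eq_one_of_dominant g.2 h)

theorem ofCoord_mem_Ehat {c : WD → Qq} (hc : c ∈ WD.Cf) : ofCoord m n c ∈ Ehat m n := by
  refine Submodule.mem_map_of_mem ?_
  intro d
  have hf : {g : Dom m n | Bounded d g.1 ∧ c (toWD g.1) ≠ 0}.Finite := by
    refine Set.Finite.of_finite_image (f := fun g : Dom m n => toWD g.1) ((hc d).subset ?_)
      fun f _ g _ h => Subtype.ext (toWD_injective f.2 g.2 h)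
    rintro W ⟨g, ⟨h1, h2⟩, rfl⟩
    exact ⟨bd_toWD.2 h1, h2⟩
  refine (hf.image fun g => act g.1 (longest m n)).subset ?_
  rintro f ⟨h1, h2⟩
  have hd : IsDominant (act f (longest m n)) := by
    by_contra h; exact h2 (if_neg h)
  refine ⟨⟨_, hd⟩, ⟨bounded_act h1 _, ?_⟩, act_longest_longest f⟩
  rw [toWD_act]
  exact fun h => h2 ((if_pos hd).trans h)

theorem Ehat_le : Ehat m n ≤ That m n ⊓ AntiSym m n := by
  rintro _ ⟨u, hu, rfl⟩
  exact ⟨h0Op_mem_That hu, h0Op_mem_antiSym u⟩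

theorem ofCoord_mem_antiSym (c : WD → Qq) : ofCoord m n c ∈ AntiSym m n := h0Op_mem_antiSym _

theorem ofCoord_coord {u : Fam m n} (hu : u ∈ AntiSym m n) : ofCoord m n (coord u) = u :=
  eq_of_antiSym (ofCoord_mem_antiSym _) hu fun g => by rw [ofCoord_apply, coord_toWD]

/-- An antisymmetric family is recovered by applying H₀ to its dominant values, placed at the
antidominant functions. With `Ehat_le` this identifies the exterior space with the antisymmetric
part of the completed tensor space. -/
theorem mem_Ehat {u : Fam m n} (h1 : u ∈ That m n) (h2 : u ∈ AntiSym m n) : u ∈ Ehat m n := by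
  rw [← ofCoord_coord h2]; exact ofCoord_mem_Ehat (coord_mem h1)

theorem coord_ofCoord {c : WD → Qq} (hc : ∀ W, c W ≠ 0 → WD.Sz m n W) :
    coord (ofCoord m n c) = c := by
  funext W
  by_cases h : WD.Sz m n W
  · obtain ⟨g, rfl⟩ := exists_toWD h
    rw [coord_toWD, ofCoord_apply]
  · rw [not_not.1 fun h' => h (hc W h'), not_not.1 fun h' => h (sz_of_coord_ne h')]

theorem antiSym_eq_zero {u : Fam m n} (hu : u ∈ AntiSym m n) {f : IntFun m n}
    (hf : (∃ i j, i ≠ j ∧ f (Sum.inl i) = f (Sum.inl j)) ∨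
      ∃ i j, i ≠ j ∧ f (Sum.inr i) = f (Sum.inr j)) : u f = 0 := by
  rcases antiSym_cases f with ⟨g, c, x, hg, -⟩ | hc
  · exfalso
    have hi := g.2.injective
    rw [hg] at hi
    rcases hf with ⟨i, j, hij, h⟩ | ⟨i, j, hij, h⟩
    · refine hij (x.1.symm.injective (hi.1 ?_))
      change f (Sum.inl (x.1 (x.1.symm i))) = f (Sum.inl (x.1 (x.1.symm j)))
      simpa using h
    · refine hij (x.2.symm.injective (hi.2 ?_))
      change f (Sum.inr (x.2 (x.2.symm i))) = f (Sum.inr (x.2 (x.2.symm j)))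
      simpa using h
  · exact hc u hu

/-! ### The quantum group preserves antisymmetric families -/

open Classical in
/-- An operator that replaces an entry `τ k` by `σ k`, with a power of `q` depending on the
entries at the places `l` with `rel k l`. -/
def moveOp (rel : Idx m n → Idx m n → Prop) (τ σ : Idx m n → ℤ) (u : Fam m n)
    (g : IntFun m n) : Qq :=
  ∑ k, if g k = τ k then
    q ^ (∑ l, if rel k l then (if g l = σ l then 1 else 0 : ℤ) - (if g l = τ l then 1 else 0)
      else 0) * u (Function.update g k (σ k)) else 0

theorem extendOp_move (s t : Idx m n → ℤ) (c : IntFun m n → Idx m n → Qq) (h) (u : Fam m n)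
    (g : IntFun m n) : extendOp (fun f => ∑ i, if f i = s i then
      Finsupp.single (Function.update f i (t i)) (c f i) else 0) h u g =
      ∑ i, if g i = t i then c (Function.update g i (s i)) i * u (Function.update g i (s i))
        else 0 := by
  classical
  have h1 : ∀ f i, u f * ((if f i = s i then
      Finsupp.single (Function.update f i (t i)) (c f i) else 0 : IntFun m n →₀ Qq) g) =
      if f = Function.update g i (s i) ∧ g i = t i then c f i * u f else 0 := by
    intro f i
    by_cases ha : f i = s i
    · rw [if_pos ha, Finsupp.single_apply]
      have : Function.update f i (t i) = g ↔ f = Function.update g i (s i) ∧ g i = t i := by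
        constructor
        · rintro rfl; simp [← ha]
        · rintro ⟨rfl, h2⟩; simp [← h2]
      simp only [this]
      split_ifs <;> ring
    · rw [if_neg ha, if_neg]
      · simp
      · rintro ⟨rfl, -⟩; simp at ha
  have hfin : ∀ i, (Function.support fun f => if f = Function.update g i (s i) ∧ g i = t i then
      c f i * u f else 0).Finite := fun i =>
    (Set.finite_singleton (Function.update g i (s i))).subset fun f hf => by
      by_contra hne
      exact hf (if_neg fun hc => hne hc.1)
  change ∑ᶠ f, u f * (∑ i, if f i = s i then
      Finsupp.single (Function.update f i (t i)) (c f i) else 0 : IntFun m n →₀ Qq) g = _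
  simp only [Finsupp.finsetSum_apply, Finset.mul_sum, h1]
  rw [finsum_sum_comm _ _ fun i _ => hfin i]
  refine Finset.sum_congr rfl fun i _ => ?_
  rw [finsum_eq_single _ (Function.update g i (s i))]
  · simp
  · intro f hf; exact if_neg fun hc => hf hc.1

theorem eSource_eTarget (a : ℤ) (k : Idx m n) :
    eTarget a k = eSource a k + 1 ∨ eSource a k = eTarget a k + 1 := by
  cases k <;> simp [eSource, eTarget]

theorem rootExp_eq (a : ℤ) (f : IntFun m n) (k : Idx m n) : rootExp a f k =
    (if f k = eTarget a k then 1 else 0) - (if f k = eSource a k then 1 else 0) := by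
  cases k <;> simp only [rootExp, sgn, eSource, eTarget] <;> split_ifs <;> omega

theorem before_irrefl (k : Idx m n) : ¬ before k k := by
  cases k <;> simp [before]

theorem eOp_eq (a : ℤ) (u : Fam m n) :
    eOp a u = moveOp before (eTarget a) (eSource a) u := by
  classical
  funext g
  refine (extendOp_move _ _ _ _ u g).trans (Finset.sum_congr rfl fun k _ => ?_)
  congr 2
  congr 1
  refine Finset.sum_congr rfl fun l _ => ?_
  by_cases h : before k l
  · have hne : l ≠ k := by rintro rfl; exact before_irrefl _ h
    rw [if_pos h, if_pos h, rootExp_eq, Function.update_of_ne hne, neg_sub]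
  · rw [if_neg h, if_neg h]

theorem fOp_eq (a : ℤ) (u : Fam m n) :
    fOp a u = moveOp (fun k l => before l k) (eSource a) (eTarget a) u := by
  classical
  funext g
  refine (extendOp_move _ _ _ _ u g).trans (Finset.sum_congr rfl fun k _ => ?_)
  congr 2
  congr 1
  refine Finset.sum_congr rfl fun l _ => ?_
  by_cases h : before l k
  · have hne : l ≠ k := by rintro rfl; exact before_irrefl _ h
    rw [if_pos h, if_pos h, rootExp_eq, Function.update_of_ne hne]
  · rw [if_neg h, if_neg h]

theorem moveOp_mem_That (rel : Idx m n → Idx m n → Prop) (τ σ : Idx m n → ℤ) {u : Fam m n}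
    (hu : u ∈ That m n) : moveOp rel τ σ u ∈ That m n := by
  classical
  intro d
  obtain ⟨M, hM⟩ : ∃ M, ∀ k, σ k ≤ M :=
    ⟨∑ k, |σ k|, fun k => (le_abs_self _).trans
      (Finset.single_le_sum (f := fun k => |σ k|) (fun _ _ => abs_nonneg _) (Finset.mem_univ k))⟩
  refine (Set.finite_iUnion fun k : Idx m n =>
    (hu (max d M)).image fun f => Function.update f k (τ k)).subset ?_
  rintro g ⟨hg, hne⟩
  obtain ⟨k, -, hk⟩ := Finset.exists_ne_zero_of_sum_ne_zero hne
  rw [Set.mem_iUnion]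
  by_cases h : g k = τ k
  · rw [if_pos h] at hk
    refine ⟨k, Function.update g k (σ k), ⟨fun l => ?_, right_ne_zero_of_mul hk⟩, ?_⟩
    · by_cases hl : l = k
      · subst hl; simp [hM]
      · rw [Function.update_of_ne hl]; exact (hg l).trans (le_max_left _ _)
    · simp [← h]
  · rw [if_neg h] at hk; exact absurd rfl hk

/-- The order of the entries that is increased by `s_i` in the Bruhat ordering. -/
def up : Fin (m - 1) ⊕ Fin (n - 1) → ℤ → ℤ → Prop
  | Sum.inl _, a, b => b < a
  | Sum.inr _, a, b => a < b

theorem ascends_iff {f : IntFun m n} {i : Fin (m - 1) ⊕ Fin (n - 1)} :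
    Ascends f i ↔ up i (f (lo i)) (f (hi i)) := by cases i <;> rfl

theorem up_irrefl (i : Fin (m - 1) ⊕ Fin (n - 1)) (a : ℤ) : ¬ up i a a := by
  cases i <;> simp [up]

theorem up_adj {i : Fin (m - 1) ⊕ Fin (n - 1)} {a b c : ℤ} (h : a = b + 1 ∨ b = a + 1)
    (hc : c ≠ b) : (up i a c → up i b c) ∧ (up i c a → up i c b) := by
  cases i <;> simp only [up] <;> omega

theorem lo_ne_hi (i : Fin (m - 1) ⊕ Fin (n - 1)) : (lo i : Idx m n) ≠ hi i := by
  cases i <;> simp [lo, hi]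

/-- The properties of `rel`, `τ`, `σ` for which `moveOp` preserves antisymmetric families. -/
structure Movable (rel : Idx m n → Idx m n → Prop) (τ σ : Idx m n → ℤ) : Prop where
  irrefl : ∀ k, ¬ rel k k
  const_τ : ∀ i k, τ (Equiv.swap (lo i) (hi i) k) = τ k
  const_σ : ∀ i k, σ (Equiv.swap (lo i) (hi i) k) = σ k
  swap : ∀ i k l, ¬ (k = lo i ∧ l = hi i) → ¬ (k = hi i ∧ l = lo i) →
    (rel (Equiv.swap (lo i) (hi i) k) (Equiv.swap (lo i) (hi i) l) ↔ rel k l)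
  adj : ∀ i, (rel (lo i) (hi i) ∧ ¬ rel (hi i) (lo i) ∧ up i (τ (lo i)) (σ (lo i))) ∨
    (rel (hi i) (lo i) ∧ ¬ rel (lo i) (hi i) ∧ up i (σ (lo i)) (τ (lo i)))
  nb : ∀ k, τ k = σ k + 1 ∨ σ k = τ k + 1

section Movable

variable {rel : Idx m n → Idx m n → Prop} {τ σ : Idx m n → ℤ}

/-- The terms for g · s_i and g correspond under exchanging the two places. Moving an entry to a
neighbouring value keeps the ascent or makes the two entries equal, when the term vanishes. The
exponents could differ only through the two places themselves, and there the unmoved entry is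
neither source nor target. -/
theorem Movable.asc (h : Movable rel τ σ) {u : Fam m n} (hu : u ∈ AntiSym m n)
    {g : IntFun m n} {i : Fin (m - 1) ⊕ Fin (n - 1)} (hg : Ascends g i) :
    moveOp rel τ σ u (act g (simpleRefl i)) = -q * moveOp rel τ σ u g := by
  classical
  unfold moveOp
  rw [Finset.mul_sum, ← Equiv.sum_comp (Equiv.swap (lo i) (hi i))]
  refine Finset.sum_congr rfl fun k _ => ?_
  rw [act_simpleRefl_eq, Equiv.swap_apply_self, h.const_τ, mul_ite, mul_zero]
  refine if_ctx_congr Iff.rfl (fun hk => ?_) fun _ => rfl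
  have hupd : Function.update (act g (simpleRefl i)) (Equiv.swap (lo i) (hi i) k)
      (σ (Equiv.swap (lo i) (hi i) k)) =
      act (Function.update g k (σ k)) (simpleRefl i) := by
    funext z
    rw [act_simpleRefl_eq, h.const_σ, Function.update_apply, Function.update_apply,
      act_simpleRefl_eq]
    have : z = Equiv.swap (lo i) (hi i) k ↔ Equiv.swap (lo i) (hi i) z = k := by
      constructor
      · rintro rfl; rw [Equiv.swap_apply_self]
      · rintro rfl; rw [Equiv.swap_apply_self]
    simp only [this]
  rw [hupd]
  set f := Function.update g k (σ k) with hf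
  by_cases hlh : f (lo i) = f (hi i)
  · rw [act_simpleRefl_self.2 hlh, (hu f i).1 hlh]; ring
  have hgl : g (lo i) ≠ g (hi i) := fun e => up_irrefl i _ (by rw [ascends_iff, e] at hg; exact hg)
  have hτ : τ (hi i) = τ (lo i) := by rw [← h.const_τ i (lo i), Equiv.swap_apply_left]
  have hσ : σ (hi i) = σ (lo i) := by rw [← h.const_σ i (lo i), Equiv.swap_apply_left]
  have hfa : Ascends f i := by
    rw [ascends_iff] at hg ⊢
    by_cases k1 : k = lo i
    · subst k1
      have e : f (hi i) = g (hi i) := Function.update_of_ne (lo_ne_hi i).symm _ _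
      have e' : f (lo i) = σ (lo i) := Function.update_self _ _ _
      rw [e, e'] at hlh ⊢
      rw [hk] at hg
      exact (up_adj (h.nb _) (Ne.symm hlh)).1 hg
    · by_cases k2 : k = hi i
      · subst k2
        have e : f (lo i) = g (lo i) := Function.update_of_ne (lo_ne_hi i) _ _
        have e' : f (hi i) = σ (hi i) := Function.update_self _ _ _
        rw [e, e'] at hlh ⊢
        rw [hk] at hg
        exact (up_adj (h.nb _) hlh).2 hg
      · rw [hf, Function.update_of_ne (Ne.symm k1), Function.update_of_ne (Ne.symm k2)]
        exact hg
  rw [(hu f i).2 hfa, mul_left_comm]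
  congr 2
  congr 1
  rw [← Equiv.sum_comp (Equiv.swap (lo i) (hi i))]
  refine Finset.sum_congr rfl fun l _ => ?_
  rw [act_simpleRefl_eq, Equiv.swap_apply_self, h.const_τ, h.const_σ]
  by_cases c1 : k = lo i ∧ l = hi i
  · obtain ⟨rfl, rfl⟩ := c1
    have e : f (hi i) = g (hi i) := Function.update_of_ne (lo_ne_hi i).symm _ _
    have e' : f (lo i) = σ (lo i) := Function.update_self _ _ _
    have n1 : g (hi i) ≠ σ (hi i) := by rw [hσ, ← e', ← e]; exact Ne.symm hlh
    have n2 : g (hi i) ≠ τ (hi i) := by rw [hτ, ← hk]; exact Ne.symm hgl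
    simp [n1, n2]
  by_cases c2 : k = hi i ∧ l = lo i
  · obtain ⟨rfl, rfl⟩ := c2
    have e : f (lo i) = g (lo i) := Function.update_of_ne (lo_ne_hi i) _ _
    have e' : f (hi i) = σ (hi i) := Function.update_self _ _ _
    have n1 : g (lo i) ≠ σ (lo i) := by rw [← hσ, ← e', ← e]; exact hlh
    have n2 : g (lo i) ≠ τ (lo i) := by rw [← hτ, ← hk]; exact hgl
    simp [n1, n2]
  rw [if_congr (h.swap i k l c1 c2) rfl rfl]

/-- Only the terms moving one of the two equal entries survive. Their functions differ by s_i, so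
their values differ by the factor -q or its inverse, while their exponents differ by one in the
compensating direction. -/
theorem Movable.eq (h : Movable rel τ σ) {u : Fam m n} (hu : u ∈ AntiSym m n)
    {g : IntFun m n} {i : Fin (m - 1) ⊕ Fin (n - 1)} (hg : g (lo i) = g (hi i)) :
    moveOp rel τ σ u g = 0 := by
  classical
  have hne := lo_ne_hi (m := m) (n := n) i
  have hτ : τ (hi i) = τ (lo i) := by rw [← h.const_τ i (lo i), Equiv.swap_apply_left]
  have hσ : σ (hi i) = σ (lo i) := by rw [← h.const_σ i (lo i), Equiv.swap_apply_left]
  unfold moveOp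
  rw [Finset.sum_eq_add (lo i) (hi i) hne]
  · by_cases hk : g (lo i) = τ (lo i)
    · have hk' : g (hi i) = τ (hi i) := by rw [hτ, ← hg, hk]
      have nb := h.nb (lo i)
      rw [if_pos hk, if_pos hk']
      have hupd : Function.update g (lo i) (σ (lo i)) =
          act (Function.update g (hi i) (σ (hi i))) (simpleRefl i) := by
        funext z
        rw [act_simpleRefl_eq, Function.update_apply, Function.update_apply, hσ]
        by_cases z1 : z = lo i
        · subst z1; simp
        by_cases z2 : z = hi i
        · subst z2; simp [hne, hne.symm, hg]
        rw [Equiv.swap_apply_of_ne_of_ne z1 z2, if_neg z1, if_neg z2]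
      set A : ℤ := ∑ l, if rel (lo i) l then (if g l = σ l then 1 else 0 : ℤ) -
        (if g l = τ l then 1 else 0) else 0 with hA
      set B : ℤ := ∑ l, if rel (hi i) l then (if g l = σ l then 1 else 0 : ℤ) -
        (if g l = τ l then 1 else 0) else 0 with hB
      have hAB : A - B = (if rel (hi i) (lo i) then 1 else 0) -
          (if rel (lo i) (hi i) then 1 else 0) := by
        have hB' : B = ∑ l, if rel (hi i) (Equiv.swap (lo i) (hi i) l) then
            (if g l = σ l then 1 else 0 : ℤ) - (if g l = τ l then 1 else 0) else 0 := by
          rw [hB, ← Equiv.sum_comp (Equiv.swap (lo i) (hi i))]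
          refine Finset.sum_congr rfl fun l _ => ?_
          have := congrFun (act_simpleRefl_self.2 hg) l
          rw [act_simpleRefl_eq] at this
          rw [h.const_τ, h.const_σ, this]
        rw [hA, hB', ← Finset.sum_sub_distrib, Finset.sum_eq_single (hi i)]
        · have n1 : g (hi i) ≠ σ (hi i) := by rw [hk', hσ, hτ]; omega
          rw [Equiv.swap_apply_right, if_neg n1, if_pos hk']
          split_ifs <;> simp
        · intro l _ hl
          have e : rel (hi i) (Equiv.swap (lo i) (hi i) l) ↔ rel (lo i) l := by
            by_cases hl' : l = lo i
            · subst hl'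
              rw [Equiv.swap_apply_left]
              exact iff_of_false (h.irrefl _) (h.irrefl _)
            · have := h.swap i (lo i) l (fun c => hl c.2) (fun c => hne c.1)
              rwa [Equiv.swap_apply_left] at this
          rw [if_congr e rfl rfl, sub_self]
        · simp
      set f := Function.update g (hi i) (σ (hi i))
      have f1 : f (hi i) = σ (lo i) := by rw [← hσ]; exact Function.update_self _ _ _
      have f2 : f (lo i) = τ (lo i) := by rw [← hk]; exact Function.update_of_ne hne _ _
      rw [hupd]
      rcases h.adj i with ⟨r1, r2, hup⟩ | ⟨r1, r2, hup⟩
      · rw [if_neg r2, if_pos r1] at hAB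
        rw [(hu f i).2 (by rw [ascends_iff, f1, f2]; exact hup), show B = A + 1 by omega,
          zpow_add_one₀ q_ne_zero]
        ring
      · rw [if_neg r2, if_pos r1] at hAB
        have ha : Ascends (act f (simpleRefl i)) i := by
          rw [ascends_iff, act_simpleRefl_eq, act_simpleRefl_eq, Equiv.swap_apply_left,
            Equiv.swap_apply_right, f1, f2]
          exact hup
        have := (hu _ i).2 ha
        rw [act_act_simpleRefl] at this
        rw [this, show A = B + 1 by omega, zpow_add_one₀ q_ne_zero]
        ring
    · rw [if_neg hk, if_neg (by rw [hτ, ← hg]; exact hk), add_zero]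
  · intro k _ hk
    split_ifs
    · rw [(hu _ i).1, mul_zero]
      rw [Function.update_of_ne (Ne.symm hk.1), Function.update_of_ne (Ne.symm hk.2), hg]
    · rfl
  · simp
  · simp

theorem Movable.mem (h : Movable rel τ σ) {u : Fam m n} (hu : u ∈ AntiSym m n) :
    moveOp rel τ σ u ∈ AntiSym m n := fun _ _ => ⟨h.eq hu, h.asc hu⟩

end Movable

theorem before_swap (i : Fin (m - 1) ⊕ Fin (n - 1)) (k l : Idx m n)
    (h1 : ¬ (k = lo i ∧ l = hi i)) (h2 : ¬ (k = hi i ∧ l = lo i)) :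
    before (Equiv.swap (lo i) (hi i) k) (Equiv.swap (lo i) (hi i) l) ↔ before k l := by
  rw [← perm_simpleRefl]
  have aux : ∀ {m : ℕ} (k : Fin (m - 1)) (a b : Fin m),
      ¬ (a = ⟨k, by omega⟩ ∧ b = ⟨k + 1, by omega⟩) →
      ¬ (a = ⟨k + 1, by omega⟩ ∧ b = ⟨k, by omega⟩) →
      (Equiv.swap (⟨k, by omega⟩ : Fin m) ⟨k + 1, by omega⟩ a <
        Equiv.swap (⟨k, by omega⟩ : Fin m) ⟨k + 1, by omega⟩ b ↔ a < b) := by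
    intro m k a b h1 h2
    have hs : ∀ z : Fin m, (Equiv.swap (⟨k, by omega⟩ : Fin m) ⟨k + 1, by omega⟩ z).val =
        if z.val = k then k.val + 1 else if z.val = k + 1 then k.val else z.val := fun z => by
      rw [Equiv.swap_apply_def]
      simp only [Fin.ext_iff]
      split_ifs <;> rfl
    simp only [Fin.ext_iff] at h1 h2
    rw [Fin.lt_def, Fin.lt_def, hs, hs]
    split_ifs <;> omega
  cases i with
  | inl i =>
    cases k <;> cases l
    · simp only [before, perm, simpleRefl, Equiv.sumCongr_apply, Sum.map_inl, Sum.lex_inl_inl]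
      exact aux i _ _ (by simpa [lo, hi] using h1) (by simpa [lo, hi] using h2)
    · simp [before, perm]
    · simp [before, perm]
    · exact Iff.rfl
  | inr i =>
    cases k <;> cases l
    · exact Iff.rfl
    · simp [before, perm]
    · simp [before, perm]
    · simp only [before, perm, simpleRefl, Equiv.sumCongr_apply, Sum.map_inr, Sum.lex_inr_inr]
      exact aux i _ _ (by simpa [lo, hi] using h1) (by simpa [lo, hi] using h2)

theorem before_lo_hi (i : Fin (m - 1) ⊕ Fin (n - 1)) :
    before (lo i : Idx m n) (hi i) ∧ ¬ before (hi i : Idx m n) (lo i) := by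
  cases i <;> simp [before, lo, hi]

theorem eSource_swap (a : ℤ) (i : Fin (m - 1) ⊕ Fin (n - 1)) (k : Idx m n) :
    eSource a (Equiv.swap (lo i) (hi i) k) = eSource a k := by
  rw [← perm_simpleRefl]; cases k <;> rfl

theorem eTarget_swap (a : ℤ) (i : Fin (m - 1) ⊕ Fin (n - 1)) (k : Idx m n) :
    eTarget a (Equiv.swap (lo i) (hi i) k) = eTarget a k := by
  rw [← perm_simpleRefl]; cases k <;> rfl

theorem up_eTarget_eSource (a : ℤ) (i : Fin (m - 1) ⊕ Fin (n - 1)) :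
    up i (eTarget a (lo i : Idx m n)) (eSource a (lo i : Idx m n)) := by
  cases i <;> simp [up, lo, eTarget, eSource]

theorem eOp_mem {u : Fam m n} (hu : u ∈ Ehat m n) (a : ℤ) : eOp a u ∈ Ehat m n := by
  have h := Ehat_le hu
  rw [eOp_eq]
  refine mem_Ehat (moveOp_mem_That _ _ _ h.1) (Movable.mem ?_ h.2)
  exact ⟨before_irrefl, eTarget_swap a, eSource_swap a, before_swap,
    fun i => Or.inl ⟨(before_lo_hi i).1, (before_lo_hi i).2, up_eTarget_eSource a i⟩,
    eSource_eTarget a⟩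

theorem fOp_mem {u : Fam m n} (hu : u ∈ Ehat m n) (a : ℤ) : fOp a u ∈ Ehat m n := by
  have h := Ehat_le hu
  rw [fOp_eq]
  refine mem_Ehat (moveOp_mem_That _ _ _ h.1) (Movable.mem ?_ h.2)
  exact ⟨before_irrefl, eSource_swap a, eTarget_swap a,
    fun i k l h1 h2 => before_swap i l k (fun c => h2 ⟨c.2, c.1⟩) (fun c => h1 ⟨c.2, c.1⟩),
    fun i => Or.inr ⟨(before_lo_hi i).1, (before_lo_hi i).2, up_eTarget_eSource a i⟩,
    fun k => (eSource_eTarget a k).symm⟩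

theorem kOp_apply (a s : ℤ) (u : Fam m n) (g : IntFun m n) :
    kOp a s u g = q ^ (s * wt g a) * u g := by
  change ∑ᶠ f, u f * (Finsupp.single f (q ^ (s * wt f a)) : IntFun m n →₀ Qq) g = _
  rw [finsum_eq_single _ g]
  · rw [Finsupp.single_eq_same, mul_comm]
  · intro f hf
    rw [Finsupp.single_eq_of_ne (Ne.symm hf), mul_zero]

theorem wt_act (g : IntFun m n) (x : S m n) : wt (act g x) = wt g := by
  unfold wt
  rw [← Equiv.sum_comp (perm x) fun i => Finsupp.single (g i) (sgn i)]
  refine Finset.sum_congr rfl fun i _ => ?_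
  cases i <;> rfl

theorem kOp_mem {u : Fam m n} (hu : u ∈ Ehat m n) (a s : ℤ) : kOp a s u ∈ Ehat m n := by
  have h := Ehat_le hu
  refine mem_Ehat (fun d => (h.1 d).subset fun g hg => ⟨hg.1, fun hc => hg.2 ?_⟩)
    fun g i => ⟨fun hg => ?_, fun hg => ?_⟩
  · rw [kOp_apply, hc, mul_zero]
  · rw [kOp_apply, (h.2 g i).1 hg, mul_zero]
  · rw [kOp_apply, kOp_apply, (h.2 g i).2 hg, wt_act]; ring

/-! ### The action of the quantum group in coordinates -/

theorem sum_block {k : ℕ} {α : Type*} [AddCommMonoid α] {a : Fin k → ℤ}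
    (ha : Function.Injective a) {i₀ : Fin k} {z : ℤ} (h : a i₀ = z) (X : Fin k → α) :
    (∑ i, if a i = z then X i else 0) = X i₀ := by
  rw [Finset.sum_eq_single i₀]
  · rw [if_pos h]
  · intro i _ hi
    exact if_neg fun e => hi (ha (e.trans h.symm))
  · simp

theorem sum_block_zero {k : ℕ} {α : Type*} [AddCommMonoid α] {a : Fin k → ℤ} {z : ℤ}
    (h : ¬ ∃ i, a i = z) (X : Fin k → α) : (∑ i, if a i = z then X i else 0) = 0 :=
  Finset.sum_eq_zero fun i _ => if_neg fun e => h ⟨i, e⟩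

theorem sum_indicator_A {g : IntFun m n} (hg : IsDominant g) (z : ℤ) :
    (∑ i : Fin m, if g (Sum.inl i) = z then 1 else 0 : ℤ) =
      if z ∈ (toWD g).A then 1 else 0 := by
  by_cases h : ∃ i, g (Sum.inl i) = z
  · obtain ⟨i, hi⟩ := h
    rw [sum_block hg.injective.1 hi, if_pos (mem_toWD_A.2 ⟨i, hi⟩)]
  · rw [sum_block_zero h, if_neg fun c => h (mem_toWD_A.1 c)]

theorem sum_indicator_B {g : IntFun m n} (hg : IsDominant g) (z : ℤ) :
    (∑ i : Fin n, if g (Sum.inr i) = z then 1 else 0 : ℤ) =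
      if z ∈ (toWD g).B then 1 else 0 := by
  by_cases h : ∃ i, g (Sum.inr i) = z
  · obtain ⟨i, hi⟩ := h
    rw [sum_block hg.injective.2 hi, if_pos (mem_toWD_B.2 ⟨i, hi⟩)]
  · rw [sum_block_zero h, if_neg fun c => h (mem_toWD_B.1 c)]

theorem update_inl (g : IntFun m n) (i₀ : Fin m) (z : ℤ) :
    (∀ i, Function.update g (Sum.inl i₀) z (Sum.inl i) = if i = i₀ then z else g (Sum.inl i)) ∧
    ∀ j, Function.update g (Sum.inl i₀) z (Sum.inr j) = g (Sum.inr j) := by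
  simp [Function.update_apply]

theorem update_inr (g : IntFun m n) (j₀ : Fin n) (z : ℤ) :
    (∀ i, Function.update g (Sum.inr j₀) z (Sum.inl i) = g (Sum.inl i)) ∧
    ∀ j, Function.update g (Sum.inr j₀) z (Sum.inr j) =
      if j = j₀ then z else g (Sum.inr j) := by
  simp [Function.update_apply]

/-- A label moved to a neighbouring free value keeps its place in the order of the block; if the
value is occupied, two equal entries make `u` vanish. -/
theorem antiSym_update_inl {u : Fam m n} (hu : u ∈ AntiSym m n) {g : IntFun m n}
    (hg : IsDominant g) {i₀ : Fin m} {w z : ℤ} (hw : g (Sum.inl i₀) = w)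
    (hz : z = w + 1 ∨ w = z + 1) : u (Function.update g (Sum.inl i₀) z) =
      if z ∈ (toWD g).A then 0 else
        coord u ⟨insert z ((toWD g).A.erase w), (toWD g).B⟩ := by
  obtain ⟨u1, u2⟩ := update_inl g i₀ z
  split_ifs with h
  · obtain ⟨i, hi⟩ := mem_toWD_A.1 h
    have hne : i ≠ i₀ := by rintro rfl; omega
    exact antiSym_eq_zero hu (Or.inl ⟨i, i₀, hne, by rw [u1, u1, if_neg hne, if_pos rfl, hi]⟩)
  · have hz' : ∀ i, g (Sum.inl i) ≠ z := fun i hi => h (mem_toWD_A.2 ⟨i, hi⟩)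
    have hd : IsDominant (Function.update g (Sum.inl i₀) z) := by
      refine ⟨fun a b hab => ?_, fun a b hab => ?_⟩
      · have h0 := hg.1 hab
        have h1 := hz' a
        have h2 := hz' b
        simp only [u1] at h0 ⊢
        split_ifs with c1 c2 c2
        · subst c1; subst c2; exact absurd hab (lt_irrefl _)
        · subst c1; omega
        · subst c2; omega
        · exact h0
      · simp only [u2]; exact hg.2 hab
    rw [← coord_toWD u ⟨_, hd⟩]
    congr 1
    ext x
    · simp only [mem_toWD_A, u1, Finset.mem_insert, Finset.mem_erase]
      constructor
      · rintro ⟨i, hi⟩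
        split_ifs at hi with c
        · exact Or.inl hi.symm
        · exact Or.inr ⟨fun e => c (hg.injective.1 (hi.trans (e.trans hw.symm))), i, hi⟩
      · rintro (rfl | ⟨h1, i, hi⟩)
        · exact ⟨i₀, if_pos rfl⟩
        · exact ⟨i, by rw [if_neg]; exact hi; rintro rfl; exact h1 (hi.symm.trans hw)⟩
    · simp only [mem_toWD_B, u2]

theorem antiSym_update_inr {u : Fam m n} (hu : u ∈ AntiSym m n) {g : IntFun m n}
    (hg : IsDominant g) {i₀ : Fin n} {w z : ℤ} (hw : g (Sum.inr i₀) = w)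
    (hz : z = w + 1 ∨ w = z + 1) : u (Function.update g (Sum.inr i₀) z) =
      if z ∈ (toWD g).B then 0 else
        coord u ⟨(toWD g).A, insert z ((toWD g).B.erase w)⟩ := by
  obtain ⟨u2, u1⟩ := update_inr g i₀ z
  split_ifs with h
  · obtain ⟨i, hi⟩ := mem_toWD_B.1 h
    have hne : i ≠ i₀ := by rintro rfl; omega
    exact antiSym_eq_zero hu (Or.inr ⟨i, i₀, hne, by rw [u1, u1, if_neg hne, if_pos rfl, hi]⟩)
  · have hz' : ∀ i, g (Sum.inr i) ≠ z := fun i hi => h (mem_toWD_B.2 ⟨i, hi⟩)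
    have hd : IsDominant (Function.update g (Sum.inr i₀) z) := by
      refine ⟨fun a b hab => ?_, fun a b hab => ?_⟩
      · simp only [u2]; exact hg.1 hab
      · have h0 := hg.2 hab
        have h1 := hz' a
        have h2 := hz' b
        simp only [u1] at h0 ⊢
        split_ifs with c1 c2 c2
        · subst c1; subst c2; exact absurd hab (lt_irrefl _)
        · subst c1; omega
        · subst c2; omega
        · exact h0
    rw [← coord_toWD u ⟨_, hd⟩]
    congr 1
    ext x
    · simp only [mem_toWD_A, u2]
    · simp only [mem_toWD_B, u1, Finset.mem_insert, Finset.mem_erase]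
      constructor
      · rintro ⟨i, hi⟩
        split_ifs at hi with c
        · exact Or.inl hi.symm
        · exact Or.inr ⟨fun e => c (hg.injective.2 (hi.trans (e.trans hw.symm))), i, hi⟩
      · rintro (rfl | ⟨h1, i, hi⟩)
        · exact ⟨i₀, if_pos rfl⟩
        · exact ⟨i, by rw [if_neg]; exact hi; rintro rfl; exact h1 (hi.symm.trans hw)⟩

theorem eOp_dominant {u : Fam m n} (hu : u ∈ AntiSym m n) (a : ℤ) {g : IntFun m n}
    (hg : IsDominant g) : eOp a u g = WD.eop a (coord u) (toWD g) := by
  classical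
  rw [eOp_eq, moveOp, Fintype.sum_sum_type, WD.eop]
  congr 1
  · by_cases h : ∃ i, g (Sum.inl i) = a + 1
    · obtain ⟨i, hi⟩ := h
      refine (sum_block hg.injective.1 hi _).trans ?_
      -- By dominance, the later entries of the first block exceed a + 1, so only the second block
      -- contributes to the exponent.
      have e : (∑ l, if before (Sum.inl i) l then (if g l = eSource a l then 1 else 0 : ℤ) -
          (if g l = eTarget a l then 1 else 0) else 0) =
          (if a + 1 ∈ (toWD g).B then 1 else 0) - (if a ∈ (toWD g).B then 1 else 0) := by
        rw [Fintype.sum_sum_type, Finset.sum_eq_zero, zero_add, ← sum_indicator_B hg,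
          ← sum_indicator_B hg, ← Finset.sum_sub_distrib]
        · refine Finset.sum_congr rfl fun j _ => ?_
          rw [if_pos (by simp [before])]
          rfl
        · intro l _
          by_cases hl : before (Sum.inl i : Idx m n) (Sum.inl l)
          · have : g (Sum.inl i) < g (Sum.inl l) := hg.1 (by simpa [before] using hl)
            rw [if_pos hl, if_neg, if_neg, sub_zero]
            · simp only [eTarget]; omega
            · simp only [eSource]; omega
          · exact if_neg hl
      rw [e]
      refine (congrArg _ (antiSym_update_inl hu hg hi (z := a) (Or.inr rfl))).trans ?_
      by_cases ha : a ∈ (toWD g).A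
      · rw [if_pos ha, mul_zero, if_neg fun c : _ ∧ ¬ _ => c.2 ha]
      · rw [if_neg ha, if_pos (And.intro (mem_toWD_A.2 ⟨i, hi⟩) ha)]
    · rw [if_neg fun c => h (mem_toWD_A.1 c.1)]
      exact sum_block_zero h _
  · by_cases h : ∃ i, g (Sum.inr i) = a
    · obtain ⟨i, hi⟩ := h
      refine (sum_block hg.injective.2 hi _).trans ?_
      have e : (∑ l, if before (Sum.inr i) l then (if g l = eSource a l then 1 else 0 : ℤ) -
          (if g l = eTarget a l then 1 else 0) else 0) = 0 := by
        refine Finset.sum_eq_zero fun l _ => ?_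
        by_cases hl : before (Sum.inr i : Idx m n) l
        · cases l with
          | inl l => simp [before] at hl
          | inr l =>
            have : g (Sum.inr l) < g (Sum.inr i) := hg.2 (by simpa [before] using hl)
            rw [if_pos hl, if_neg, if_neg, sub_zero]
            · simp only [eTarget]; omega
            · simp only [eSource]; omega
        · exact if_neg hl
      rw [e, zpow_zero, one_mul]
      refine (antiSym_update_inr hu hg hi (z := a + 1) (Or.inl rfl)).trans ?_
      by_cases ha : a + 1 ∈ (toWD g).B
      · rw [if_pos ha, if_neg fun c : _ ∧ ¬ _ => c.2 ha]
      · rw [if_neg ha, if_pos (And.intro (mem_toWD_B.2 ⟨i, hi⟩) ha)]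
    · rw [if_neg fun c => h (mem_toWD_B.1 c.1)]
      exact sum_block_zero h _

theorem fOp_dominant {u : Fam m n} (hu : u ∈ AntiSym m n) (a : ℤ) {g : IntFun m n}
    (hg : IsDominant g) : fOp a u g = WD.fop a (coord u) (toWD g) := by
  classical
  rw [fOp_eq, moveOp, Fintype.sum_sum_type, WD.fop]
  congr 1
  · by_cases h : ∃ i, g (Sum.inl i) = a
    · obtain ⟨i, hi⟩ := h
      refine (sum_block hg.injective.1 hi _).trans ?_
      have e : (∑ l, if before l (Sum.inl i) then (if g l = eTarget a l then 1 else 0 : ℤ) -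
          (if g l = eSource a l then 1 else 0) else 0) = 0 := by
        refine Finset.sum_eq_zero fun l _ => ?_
        by_cases hl : before l (Sum.inl i : Idx m n)
        · cases l with
          | inr l => simp [before] at hl
          | inl l =>
            have : g (Sum.inl l) < g (Sum.inl i) := hg.1 (by simpa [before] using hl)
            rw [if_pos hl, if_neg, if_neg, sub_zero]
            · simp only [eSource]; omega
            · simp only [eTarget]; omega
        · exact if_neg hl
      rw [e, zpow_zero, one_mul]
      refine (antiSym_update_inl hu hg hi (z := a + 1) (Or.inl rfl)).trans ?_
      by_cases ha : a + 1 ∈ (toWD g).A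
      · rw [if_pos ha, if_neg fun c : _ ∧ ¬ _ => c.2 ha]
      · rw [if_neg ha, if_pos (And.intro (mem_toWD_A.2 ⟨i, hi⟩) ha)]
    · rw [if_neg fun c => h (mem_toWD_A.1 c.1)]
      exact sum_block_zero h _
  · by_cases h : ∃ i, g (Sum.inr i) = a + 1
    · obtain ⟨i, hi⟩ := h
      refine (sum_block hg.injective.2 hi _).trans ?_
      have e : (∑ l, if before l (Sum.inr i) then (if g l = eTarget a l then 1 else 0 : ℤ) -
          (if g l = eSource a l then 1 else 0) else 0) =
          (if a + 1 ∈ (toWD g).A then 1 else 0) - (if a ∈ (toWD g).A then 1 else 0) := by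
        rw [Fintype.sum_sum_type, Finset.sum_eq_zero (s := (Finset.univ : Finset (Fin n))),
          add_zero, ← sum_indicator_A hg, ← sum_indicator_A hg, ← Finset.sum_sub_distrib]
        · refine Finset.sum_congr rfl fun j _ => ?_
          rw [if_pos (by simp [before])]
          rfl
        · intro l _
          by_cases hl : before (Sum.inr l : Idx m n) (Sum.inr i)
          · have : g (Sum.inr i) < g (Sum.inr l) := hg.2 (by simpa [before] using hl)
            rw [if_pos hl, if_neg, if_neg, sub_zero]
            · simp only [eSource]; omega
            · simp only [eTarget]; omega
          · exact if_neg hl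
      rw [e]
      refine (congrArg _ (antiSym_update_inr hu hg hi (z := a) (Or.inr rfl))).trans ?_
      by_cases ha : a ∈ (toWD g).B
      · rw [if_pos ha, mul_zero, if_neg fun c : _ ∧ ¬ _ => c.2 ha]
      · rw [if_neg ha, if_pos (And.intro (mem_toWD_B.2 ⟨i, hi⟩) ha)]
    · rw [if_neg fun c => h (mem_toWD_B.1 c.1)]
      exact sum_block_zero h _

theorem card_insert_erase {s : Finset ℤ} {a b : ℤ} (ha : a ∉ s) (hb : b ∈ s) :
    (insert a (s.erase b)).card = s.card := by
  rw [Finset.card_insert_of_notMem (fun h => ha (Finset.mem_of_mem_erase h)),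
    Finset.card_erase_of_mem hb]
  have : 0 < s.card := Finset.card_pos.2 ⟨b, hb⟩
  omega

theorem sz_of_eop_ne {c : WD → Qq} (hc : ∀ W, c W ≠ 0 → WD.Sz m n W) {a : ℤ} {W : WD}
    (h : WD.eop a c W ≠ 0) : WD.Sz m n W := by
  by_contra hW
  apply h
  rw [WD.eop]
  have key : ∀ V : WD, V.A.card = W.A.card → V.B.card = W.B.card → c V = 0 := by
    intro V h1 h2
    by_contra hV
    have := hc V hV
    exact hW ⟨h1 ▸ this.1, h2 ▸ this.2⟩
  have h1 := fun e : a + 1 ∈ W.A ∧ a ∉ W.A =>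
    key ⟨insert a (W.A.erase (a + 1)), W.B⟩ (card_insert_erase e.2 e.1) rfl
  have h2 := fun e : a ∈ W.B ∧ a + 1 ∉ W.B =>
    key ⟨W.A, insert (a + 1) (W.B.erase a)⟩ rfl (card_insert_erase e.2 e.1)
  by_cases e1 : a + 1 ∈ W.A ∧ a ∉ W.A <;> by_cases e2 : a ∈ W.B ∧ a + 1 ∉ W.B
  · rw [if_pos e1, if_pos e2, h1 e1, h2 e2, mul_zero, add_zero]
  · rw [if_pos e1, if_neg e2, h1 e1, mul_zero, add_zero]
  · rw [if_neg e1, if_pos e2, h2 e2, add_zero]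
  · rw [if_neg e1, if_neg e2, add_zero]

theorem sz_of_fop_ne {c : WD → Qq} (hc : ∀ W, c W ≠ 0 → WD.Sz m n W) {a : ℤ} {W : WD}
    (h : WD.fop a c W ≠ 0) : WD.Sz m n W := by
  rw [WD.fop_eq] at h
  have := sz_of_eop_ne (m := n) (n := m) (c := fun V => c V.tr)
    (fun V hV => (hc _ hV).symm) h
  exact this.symm

theorem coord_eOp {u : Fam m n} (hu : u ∈ AntiSym m n) (a : ℤ) :
    coord (eOp a u) = WD.eop a (coord u) := by
  funext W
  by_cases h : WD.Sz m n W
  · obtain ⟨g, rfl⟩ := exists_toWD h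
    rw [coord_toWD, eOp_dominant hu a g.2]
  · rw [not_not.1 fun h' => h (sz_of_coord_ne h'),
      not_not.1 fun h' => h (sz_of_eop_ne (fun W => sz_of_coord_ne) h')]

theorem coord_fOp {u : Fam m n} (hu : u ∈ AntiSym m n) (a : ℤ) :
    coord (fOp a u) = WD.fop a (coord u) := by
  funext W
  by_cases h : WD.Sz m n W
  · obtain ⟨g, rfl⟩ := exists_toWD h
    rw [coord_toWD, fOp_dominant hu a g.2]
  · rw [not_not.1 fun h' => h (sz_of_coord_ne h'),
      not_not.1 fun h' => h (sz_of_fop_ne (fun W => sz_of_coord_ne) h')]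

/-! ### Weights and atypicality -/

theorem wt_apply {g : IntFun m n} (hg : IsDominant g) (a : ℤ) : wt g a =
    (if a ∈ (toWD g).B then 1 else 0) - (if a ∈ (toWD g).A then 1 else 0) := by
  have hA : ∑ i : Fin m, Finsupp.single (g (Sum.inl i)) (sgn (Sum.inl i : Idx m n)) a =
      -∑ i : Fin m, if g (Sum.inl i) = a then 1 else 0 := by
    rw [← Finset.sum_neg_distrib]
    refine Finset.sum_congr rfl fun i _ => ?_
    rw [Finsupp.single_apply]
    split_ifs <;> rfl
  have hB : ∑ i : Fin n, Finsupp.single (g (Sum.inr i)) (sgn (Sum.inr i : Idx m n)) a =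
      ∑ i : Fin n, if g (Sum.inr i) = a then 1 else 0 := by
    refine Finset.sum_congr rfl fun i _ => ?_
    rw [Finsupp.single_apply]
    rfl
  rw [wt, Finsupp.finsetSum_apply, Fintype.sum_sum_type, hA, hB, sum_indicator_A hg,
    sum_indicator_B hg]
  ring

/-- The weight has absolute value 1 exactly at the singles, and m + n counts each single once and
each pair twice. -/
theorem atyp_eq (g : Dom m n) : atyp g.1 = (toWD g.1).P.card := by
  set W := toWD g.1 with hW
  have hwt : ∀ a, wt g.1 a = (if a ∈ W.B then 1 else 0) - (if a ∈ W.A then 1 else 0) :=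
    wt_apply g.2
  have h1 : (wt g.1).sum (fun _ c => |c|) = ∑ a ∈ W.A ∪ W.B, |wt g.1 a| := by
    refine Finsupp.sum_of_support_subset _ (fun a ha => ?_) _ (by simp)
    rw [Finsupp.mem_support_iff, hwt] at ha
    rw [Finset.mem_union]
    by_contra! hc
    simp [hc.1, hc.2] at ha
  have h2 : ∑ a ∈ W.A ∪ W.B, |wt g.1 a| =
      ∑ a ∈ W.A ∪ W.B, ((if a ∈ W.A then 1 else 0 : ℤ) + (if a ∈ W.B then 1 else 0) -
        2 * if a ∈ W.P then 1 else 0) := by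
    refine Finset.sum_congr rfl fun a _ => ?_
    rw [hwt]
    simp only [WD.mem_P]
    by_cases ha : a ∈ W.A <;> by_cases hb : a ∈ W.B <;> simp [ha, hb]
  have h3 : ∀ s ⊆ W.A ∪ W.B, (∑ a ∈ W.A ∪ W.B, if a ∈ s then 1 else 0 : ℤ) = s.card := by
    intro s hs
    rw [Finset.sum_ite_mem, Finset.inter_eq_right.2 hs]
    simp
  have hsz := sz_toWD g
  rw [← hW] at hsz
  have hP : W.P ⊆ W.A ∪ W.B := fun x hx => Finset.mem_union_left _ (WD.mem_P.1 hx).1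
  rw [atyp, h1, h2, Finset.sum_sub_distrib, Finset.sum_add_distrib, ← Finset.mul_sum,
    h3 _ Finset.subset_union_left, h3 _ Finset.subset_union_right, h3 _ hP, hsz.1, hsz.2]
  omega

/-! ### Conjugacy to dominant functions -/

theorem conj_iff {f : IntFun m n} : Conj f ↔
    Function.Injective (fun i => f (Sum.inl i)) ∧ Function.Injective (fun j => f (Sum.inr j)) := by
  constructor
  · rintro ⟨x, hx⟩
    obtain ⟨h1, h2⟩ := hx.injective
    constructor
    · exact (Equiv.injective_comp x.1 _).1 h1
    · exact (Equiv.injective_comp x.2 _).1 h2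
  · rintro ⟨h1, h2⟩
    refine ⟨(Tuple.sort fun i => f (Sum.inl i), Tuple.sort fun j => -f (Sum.inr j)), ?_, ?_⟩
    · exact (Tuple.monotone_sort fun i => f (Sum.inl i)).strictMono_of_injective
        (h1.comp (Equiv.injective _))
    · refine Antitone.strictAnti_of_injective (fun i j h => ?_) (h2.comp (Equiv.injective _))
      exact neg_le_neg_iff.1 (Tuple.monotone_sort (fun j => -f (Sum.inr j)) h)

theorem dominantConj_props {f : IntFun m n} (h : Conj f) :
    IsDominant (dominantConj f) ∧ toWD (dominantConj f) = toWD f := by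
  rw [dominantConj, dif_pos h]
  exact ⟨h.choose_spec, toWD_act _ _⟩

/-- The signs in d_i - d_j make it equal to -1 at both places: the raising operators lower the
common value of a pair. -/
theorem add_smul_dDiff (f : IntFun m n) (b : ℕ) (i : Fin m) (j : Fin n) :
    (∀ k, (f + b • dDiff i j) (Sum.inl k) = if k = i then f (Sum.inl k) - b else f (Sum.inl k)) ∧
    (∀ l, (f + b • dDiff i j) (Sum.inr l) =
      if l = j then f (Sum.inr l) - b else f (Sum.inr l)) := by
  constructor
  · intro k
    simp only [dDiff, dVec, Pi.add_apply, Pi.smul_apply, Pi.sub_apply, sgn, Pi.single_apply,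
      Sum.inl.injEq, reduceCtorEq, if_false]
    split_ifs <;> simp; ring
  · intro k
    simp only [dDiff, dVec, Pi.add_apply, Pi.smul_apply, Pi.sub_apply, sgn, Pi.single_apply,
      Sum.inr.injEq, reduceCtorEq, if_false]
    split_ifs <;> simp; ring

/-! ### Functions obtained by moving pairs -/

/-- The pairs of positions with equal entries of `g` are listed by `p`. -/
structure PairsOf (g : IntFun m n) {r : ℕ} (p : Fin r → Fin m × Fin n) : Prop where
  dom : IsDominant g
  mono : StrictMono fun s => (p s).1
  anti : StrictAnti fun s => (p s).2
  iff : ∀ i j, g (Sum.inl i) = g (Sum.inr j) ↔ ∃ s, p s = (i, j)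

/-- `f` is obtained from `g` by giving the pairs in the positions `p` the values `y`. -/
structure Moved (g : IntFun m n) {r : ℕ} (p : Fin r → Fin m × Fin n) (y : Fin r → ℤ)
    (f : IntFun m n) : Prop where
  inl : ∀ s, f (Sum.inl (p s).1) = y s
  inr : ∀ s, f (Sum.inr (p s).2) = y s
  inl' : ∀ i, (∀ s, (p s).1 ≠ i) → f (Sum.inl i) = g (Sum.inl i)
  inr' : ∀ j, (∀ s, (p s).2 ≠ j) → f (Sum.inr j) = g (Sum.inr j)

variable {g f : IntFun m n} {r : ℕ} {p : Fin r → Fin m × Fin n} {y : Fin r → ℤ}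

theorem PairsOf.enum (h : PairsOf g p) : WD.Enum (toWD g) fun s => g (Sum.inl (p s).1) := by
  refine ⟨h.dom.1.comp h.mono, ?_⟩
  ext z
  simp only [Finset.mem_image, Finset.mem_univ, true_and, WD.mem_P, mem_toWD_A, mem_toWD_B]
  constructor
  · rintro ⟨s, rfl⟩
    exact ⟨⟨_, rfl⟩, _, ((h.iff _ _).2 ⟨s, rfl⟩).symm⟩
  · rintro ⟨⟨i, rfl⟩, j, hj⟩
    obtain ⟨s, hs⟩ := (h.iff i j).1 hj.symm
    exact ⟨s, by rw [hs]⟩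

theorem PairsOf.moved_self (h : PairsOf g p) : Moved g p (fun s => g (Sum.inl (p s).1)) g :=
  ⟨fun _ => rfl, fun s => ((h.iff _ _).2 ⟨s, rfl⟩).symm, fun _ _ => rfl, fun _ _ => rfl⟩

theorem PairsOf.sings_inl (h : PairsOf g p) {i : Fin m} :
    g (Sum.inl i) ∈ (toWD g).sings ↔ ∀ s, (p s).1 ≠ i := by
  rw [WD.mem_sings, mem_toWD_A, mem_toWD_B]
  constructor
  · rintro h' s rfl
    exact h' ⟨fun _ => ⟨_, ((h.iff _ _).2 ⟨s, rfl⟩).symm⟩, fun _ => ⟨_, rfl⟩⟩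
  · intro h' hc
    obtain ⟨j, hj⟩ := hc.1 ⟨i, rfl⟩
    obtain ⟨s, hs⟩ := (h.iff i j).1 hj.symm
    exact h' s (by rw [hs])

theorem PairsOf.sings_inr (h : PairsOf g p) {j : Fin n} :
    g (Sum.inr j) ∈ (toWD g).sings ↔ ∀ s, (p s).2 ≠ j := by
  rw [WD.mem_sings, mem_toWD_A, mem_toWD_B]
  constructor
  · rintro h' s rfl
    exact h' ⟨fun _ => ⟨_, rfl⟩, fun _ => ⟨_, ((h.iff _ _).2 ⟨s, rfl⟩)⟩⟩
  · intro h' hc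
    obtain ⟨i, hi⟩ := hc.2 ⟨j, rfl⟩
    obtain ⟨s, hs⟩ := (h.iff i j).1 hi
    exact h' s (by rw [hs])

/-- The unmoved entries are distinct within each block, so two entries of a block can only coincide
through a moved pair meeting another pair or a single. -/
theorem PairsOf.conj_moved (h : PairsOf g p) (hf : Moved g p y f) :
    Conj f ↔ Function.Injective y ∧ ∀ s, y s ∉ (toWD g).sings := by
  rw [conj_iff]
  constructor
  · rintro ⟨h1, h2⟩
    refine ⟨fun s t e => h.mono.injective (h1 ((hf.inl s).trans (e.trans (hf.inl t).symm))),
      fun s hs => ?_⟩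
    have hs' := WD.mem_sings.1 hs
    rw [mem_toWD_A, mem_toWD_B] at hs'
    by_cases hA : ∃ i, g (Sum.inl i) = y s
    · obtain ⟨i, hi⟩ := hA
      have h3 := h.sings_inl.1 (hi ▸ hs)
      exact h3 s (h1 ((hf.inl s).trans (hi.symm.trans (hf.inl' i h3).symm)))
    · obtain ⟨j, hj⟩ : ∃ j, g (Sum.inr j) = y s := by tauto
      have h3 := h.sings_inr.1 (hj ▸ hs)
      exact h3 s (h2 ((hf.inr s).trans (hj.symm.trans (hf.inr' j h3).symm)))
  · rintro ⟨h1, h2⟩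
    constructor
    · intro i i' e
      by_cases hi : ∀ s, (p s).1 ≠ i <;> by_cases hi' : ∀ s, (p s).1 ≠ i'
      · exact h.dom.injective.1 ((hf.inl' i hi).symm.trans (e.trans (hf.inl' i' hi')))
      · push Not at hi'
        obtain ⟨s, rfl⟩ := hi'
        have := (hf.inl' i hi).symm.trans (e.trans (hf.inl s))
        exact absurd (this ▸ h.sings_inl.2 hi) (h2 s)
      · push Not at hi
        obtain ⟨s, rfl⟩ := hi
        have := (hf.inl' i' hi').symm.trans (e.symm.trans (hf.inl s))
        exact absurd (this ▸ h.sings_inl.2 hi') (h2 s)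
      · push Not at hi hi'
        obtain ⟨s, rfl⟩ := hi
        obtain ⟨t, rfl⟩ := hi'
        rw [h1 ((hf.inl s).symm.trans (e.trans (hf.inl t)))]
    · intro i i' e
      by_cases hi : ∀ s, (p s).2 ≠ i <;> by_cases hi' : ∀ s, (p s).2 ≠ i'
      · exact h.dom.injective.2 ((hf.inr' i hi).symm.trans (e.trans (hf.inr' i' hi')))
      · push Not at hi'
        obtain ⟨s, rfl⟩ := hi'
        have := (hf.inr' i hi).symm.trans (e.trans (hf.inr s))
        exact absurd (this ▸ h.sings_inr.2 hi) (h2 s)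
      · push Not at hi
        obtain ⟨s, rfl⟩ := hi
        have := (hf.inr' i' hi').symm.trans (e.symm.trans (hf.inr s))
        exact absurd (this ▸ h.sings_inr.2 hi') (h2 s)
      · push Not at hi hi'
        obtain ⟨s, rfl⟩ := hi
        obtain ⟨t, rfl⟩ := hi'
        rw [h1 ((hf.inr s).symm.trans (e.trans (hf.inr t)))]

theorem PairsOf.toWD_moved (h : PairsOf g p) (hf : Moved g p y f) :
    toWD f = (toWD g).withP (Finset.univ.image y) := by
  have sA : ∀ z, z ∈ (toWD g).A \ (toWD g).B ↔
      ∃ i, (∀ s, (p s).1 ≠ i) ∧ g (Sum.inl i) = z := by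
    intro z
    rw [Finset.mem_sdiff, mem_toWD_A]
    constructor
    · rintro ⟨⟨i, rfl⟩, hB⟩
      refine ⟨i, h.sings_inl.1 (WD.mem_sings.2 fun hc => hB (hc.1 (mem_toWD_A.2 ⟨i, rfl⟩))), rfl⟩
    · rintro ⟨i, hi, rfl⟩
      exact ⟨⟨i, rfl⟩, fun hc => WD.mem_sings.1 (h.sings_inl.2 hi)
        ⟨fun _ => hc, fun _ => mem_toWD_A.2 ⟨i, rfl⟩⟩⟩
  have sB : ∀ z, z ∈ (toWD g).B \ (toWD g).A ↔
      ∃ i, (∀ s, (p s).2 ≠ i) ∧ g (Sum.inr i) = z := by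
    intro z
    rw [Finset.mem_sdiff, mem_toWD_B]
    constructor
    · rintro ⟨⟨i, rfl⟩, hB⟩
      refine ⟨i, h.sings_inr.1 (WD.mem_sings.2 fun hc => hB (hc.2 (mem_toWD_B.2 ⟨i, rfl⟩))), rfl⟩
    · rintro ⟨i, hi, rfl⟩
      exact ⟨⟨i, rfl⟩, fun hc => WD.mem_sings.1 (h.sings_inr.2 hi)
        ⟨fun _ => mem_toWD_B.2 ⟨i, rfl⟩, fun _ => hc⟩⟩
  ext z
  · rw [mem_toWD_A, WD.withP, Finset.mem_union, sA]
    simp only [Finset.mem_image, Finset.mem_univ, true_and]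
    constructor
    · rintro ⟨i, rfl⟩
      by_cases hi : ∀ s, (p s).1 ≠ i
      · exact Or.inl ⟨i, hi, (hf.inl' i hi).symm⟩
      · push Not at hi
        obtain ⟨s, rfl⟩ := hi
        exact Or.inr ⟨s, (hf.inl s).symm⟩
    · rintro (⟨i, hi, rfl⟩ | ⟨s, rfl⟩)
      · exact ⟨i, hf.inl' i hi⟩
      · exact ⟨_, hf.inl s⟩
  · rw [mem_toWD_B, WD.withP, Finset.mem_union, sB]
    simp only [Finset.mem_image, Finset.mem_univ, true_and]
    constructor
    · rintro ⟨i, rfl⟩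
      by_cases hi : ∀ s, (p s).2 ≠ i
      · exact Or.inl ⟨i, hi, (hf.inr' i hi).symm⟩
      · push Not at hi
        obtain ⟨s, rfl⟩ := hi
        exact Or.inr ⟨s, (hf.inr s).symm⟩
    · rintro (⟨i, hi, rfl⟩ | ⟨s, rfl⟩)
      · exact ⟨i, hf.inr' i hi⟩
      · exact ⟨_, hf.inr s⟩

theorem Moved.add (h : PairsOf g p) (hf : Moved g p y f) (s : Fin r) (b : ℕ) :
    Moved g p (Function.update y s (y s - b)) (f + b • dDiff (p s).1 (p s).2) := by
  obtain ⟨h1, h2⟩ := add_smul_dDiff f b (p s).1 (p s).2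
  refine ⟨fun t => ?_, fun t => ?_, fun i hi => ?_, fun j hj => ?_⟩
  · rw [h1, hf.inl, Function.update_apply]
    by_cases e : t = s
    · subst e; simp
    · rw [if_neg e, if_neg fun e' => e (h.mono.injective e')]
  · rw [h2, hf.inr, Function.update_apply]
    by_cases e : t = s
    · subst e; simp
    · rw [if_neg e, if_neg fun e' => e (h.anti.injective e')]
  · rw [h1, if_neg (hi s).symm, hf.inl' i hi]
  · rw [h2, if_neg (hj s).symm, hf.inr' j hj]

/-- Because of this, the recursive conditions in the definition of R_{i,j} range over the original
pairs only. -/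
theorem PairsOf.moved_eq (h : PairsOf g p) (hf : Moved g p y f)
    (hy : ∀ s, y s ∉ (toWD g).sings) (hi : Function.Injective y) {i : Fin m} {j : Fin n}
    (e : f (Sum.inl i) = f (Sum.inr j)) : ∃ s, p s = (i, j) := by
  by_cases hi' : ∀ s, (p s).1 ≠ i <;> by_cases hj' : ∀ s, (p s).2 ≠ j
  · exact (h.iff i j).1 (by rw [← hf.inl' i hi', e, hf.inr' j hj'])
  · push Not at hj'
    obtain ⟨s, rfl⟩ := hj'
    exact absurd (h.sings_inl.2 hi') (by rw [← hf.inl' i hi', e, hf.inr]; exact hy s)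
  · push Not at hi'
    obtain ⟨s, rfl⟩ := hi'
    exact absurd (h.sings_inr.2 hj') (by rw [← hf.inr' j hj', ← e, hf.inl]; exact hy s)
  · push Not at hi' hj'
    obtain ⟨s, rfl⟩ := hi'
    obtain ⟨t, rfl⟩ := hj'
    have := hi ((hf.inl s).symm.trans (e.trans (hf.inr t)))
    subst this
    exact ⟨s, rfl⟩

/-! ### The raising operators on peelable arcs -/

theorem Peelable.between {r : ℕ} {S : Finset ℤ} {a : Fin r → ℤ × ℤ}
    (h : Peelable S (List.ofFn a)) (s : Fin r) : (a s).2 < (a s).1 ∧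
      ∀ z, (a s).2 < z → z < (a s).1 → z ∈ S ∨ ∃ t < s, z = (a t).1 ∨ z = (a t).2 := by
  induction r generalizing S with
  | zero => exact s.elim0
  | succ r ih =>
    rw [List.ofFn_succ] at h
    obtain ⟨hy, ht, hlt, hbt, hP⟩ := h
    cases s using Fin.cases with
    | zero => exact ⟨hlt, fun z h1 h2 => Or.inl (hbt z h1 h2)⟩
    | succ s =>
      refine ⟨(ih hP s).1, fun z h1 h2 => ?_⟩
      rcases (ih hP s).2 z h1 h2 with h3 | ⟨t, ht, h3⟩
      · rw [Finset.mem_insert, Finset.mem_insert] at h3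
        rcases h3 with h3 | h3 | h3
        · exact Or.inr ⟨0, Fin.succ_pos s, Or.inl h3⟩
        · exact Or.inr ⟨0, Fin.succ_pos s, Or.inr h3⟩
        · exact Or.inl h3
      · exact Or.inr ⟨t.succ, Fin.succ_lt_succ_iff.2 ht, h3⟩

theorem ends_update {r : ℕ} (a : Fin r → ℤ × ℤ) (θ : Fin r → ℕ) (s : Fin r) :
    Function.update (ends a θ) s (a s).2 = ends a (Function.update θ s 1) := by
  funext t
  simp only [ends, Function.update_apply]
  split_ifs with h <;> simp_all

theorem Peelable.ends_notMem {r : ℕ} {S : Finset ℤ} {a : Fin r → ℤ × ℤ}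
    (h : Peelable S (List.ofFn a)) (θ : Fin r → ℕ) (s : Fin r) : ends a θ s ∉ S := by
  have := h.notMem (a s) (List.mem_ofFn.2 ⟨s, rfl⟩)
  unfold ends
  split_ifs
  · exact this.1
  · exact this.2

/-- The number b is the length of arc s. A smaller positive b would put the pair on a vertex under
the arc, which is a single, excluded by conjugacy, or an end of an arc t < s. A right end is
occupied by pair t in f. A left end is occupied by pair t in R_t(f), by induction, and this is what
the recursive condition in the definition of R excludes. -/
theorem PairsOf.raise (h : PairsOf g p) {a : Fin r → ℤ × ℤ}
    (ha : Peelable (toWD g).sings (List.ofFn a)) {θ : Fin r → ℕ} {s : Fin r}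
    (hθ : ∀ t ≤ s, θ t = 0) (hf : Moved g p (ends a θ) f) :
    Moved g p (ends a (Function.update θ s 1)) (raise (p s).1 (p s).2 f) := by
  have main : ∀ N : ℕ, ∀ s : Fin r, s.1 = N → (∀ t ≤ s, θ t = 0) →
      Moved g p (ends a (Function.update θ s 1)) (SuperKL.raise (p s).1 (p s).2 f) := by
    intro N
    induction N using Nat.strong_induction_on with
    | _ N ih =>
    intro s hsN hθ
    have IH : ∀ t < s, Moved g p (ends a (Function.update θ t 1))
        (SuperKL.raise (p t).1 (p t).2 f) := fun t hts =>
      ih t.1 (hsN ▸ hts) t rfl fun u hu => hθ u (hu.trans hts.le)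
    obtain ⟨hlt, hbt⟩ := ha.between s
    have hy : ∀ t ≤ s, ends a θ t = (a t).1 := fun t ht => by rw [ends, if_pos (hθ t ht)]
    set b₀ := ((a s).1 - (a s).2).toNat with hb
    have hb₀ : (a s).1 - (b₀ : ℤ) = (a s).2 := by omega
    have hadd : Moved g p (ends a (Function.update θ s 1)) (f + b₀ • dDiff (p s).1 (p s).2) := by
      have := hf.add h s b₀
      rwa [hy s le_rfl, hb₀, ends_update] at this
    rw [SuperKL.raise]
    suffices hs : sInf {b : ℕ | 0 < b ∧ Conj (f + b • dDiff (p s).1 (p s).2) ∧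
        ∀ (k : Fin m) (l : Fin n) (_ : k < (p s).1) (_ : (p s).2 < l),
          f (Sum.inl k) = f (Sum.inr l) →
          Conj (SuperKL.raise k l f + b • dDiff (p s).1 (p s).2)} = b₀ by
      rw [hs]; exact hadd
    refine IsLeast.csInf_eq ⟨⟨by omega, ?_, ?_⟩, ?_⟩
    · exact (h.conj_moved hadd).2 ⟨ends_injective ha _, ha.ends_notMem _⟩
    · intro k l hk hl e
      obtain ⟨t, ht⟩ := h.moved_eq hf (ha.ends_notMem _) (ends_injective ha _) e
      have hts : t < s := by
        have : (p t).1 < (p s).1 := by rw [ht]; exact hk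
        exact h.mono.lt_iff_lt.1 this
      have h1 := IH t hts
      rw [ht] at h1
      have h2 := h1.add h s b₀
      have : ends a (Function.update θ t 1) s = (a s).1 := by
        rw [ends, Function.update_of_ne hts.ne', if_pos (hθ s le_rfl)]
      rw [this, hb₀, ends_update] at h2
      exact (h.conj_moved h2).2 ⟨ends_injective ha _, ha.ends_notMem _⟩
    · rintro b ⟨b1, b2, b3⟩
      by_contra! hlt'
      have hc := hf.add h s b
      rw [hy s le_rfl] at hc
      obtain ⟨c1, c2⟩ := (h.conj_moved hc).1 b2
      rcases hbt ((a s).1 - b) (by omega) (by omega) with hz | ⟨t, hts, hz | hz⟩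
      · refine c2 s ?_
        rwa [Function.update_self]
      · refine hts.ne' (c1 ?_)
        rw [Function.update_self, Function.update_of_ne hts.ne, hy t hts.le, hz]
      · have h0 : f (Sum.inl (p t).1) = f (Sum.inr (p t).2) := by rw [hf.inl, hf.inr]
        have h1 := b3 (p t).1 (p t).2 (h.mono hts) (h.anti hts) h0
        have h2 := (IH t hts).add h s b
        obtain ⟨d1, -⟩ := (h.conj_moved h2).1 h1
        refine hts.ne' (d1 ?_)
        rw [Function.update_self, Function.update_of_ne hts.ne]
        rw [ends, Function.update_of_ne hts.ne', if_pos (hθ s le_rfl), hz, ends,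
          Function.update_self]
        simp
  exact main _ s rfl hθ

/-! ### Compositions of raising operators -/

/-- The arcs of `slide`, as a function. -/
def arcs : (r : ℕ) → Finset ℤ → (Fin r → ℤ) → (Fin r → ℕ) → Fin r → ℤ × ℤ
  | 0, _, _, _ => fun s => s.elim0
  | r + 1, S, x, θ => Fin.cons ((step S)^[θ 0] (x 0), step S ((step S)^[θ 0] (x 0)))
      (arcs r (insert ((step S)^[θ 0] (x 0)) (insert (step S ((step S)^[θ 0] (x 0))) S))
        (fun s => x s.succ) fun s => θ s.succ)

theorem ofFn_arcs {r : ℕ} (S : Finset ℤ) (x : Fin r → ℤ) (θ : Fin r → ℕ) :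
    List.ofFn (arcs r S x θ) = slide S (WD.steps x θ) := by
  induction r generalizing S with
  | zero => rfl
  | succ r ih =>
    rw [List.ofFn_succ, WD.steps, List.ofFn_succ]
    simp only [arcs, Fin.cons_zero, Fin.cons_succ, ih, slide]
    rfl

theorem arcs_fst_of_eq_zero {r : ℕ} (S : Finset ℤ) {x : Fin r → ℤ} {θ : Fin r → ℕ} {s : Fin r}
    (h : θ s = 0) : (arcs r S x θ s).1 = x s := by
  induction r generalizing S with
  | zero => exact s.elim0
  | succ r ih =>
    cases s using Fin.cases with
    | zero => simp [arcs, h]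
    | succ s =>
      simp only [arcs, Fin.cons_succ]
      exact ih _ h

/-- The arcs before s do not see the change, and the later pairs still stand at their starting
points. So the additional step takes pair s from the right end of its arc to the left end. -/
theorem arcs_update {r : ℕ} (S : Finset ℤ) (x : Fin r → ℤ) {θ : Fin r → ℕ} {s : Fin r}
    (h : ∀ t, s < t → θ t = 0) (t : Fin r) :
    (arcs r S x (Function.update θ s (θ s + 1)) t).1 =
      if t = s then (arcs r S x θ s).2 else (arcs r S x θ t).1 := by
  induction r generalizing S with
  | zero => exact s.elim0
  | succ r ih =>
    cases s using Fin.cases with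
    | zero =>
      cases t using Fin.cases with
      | zero => simp only [arcs, Fin.cons_zero, Function.update_self, if_true,
          Function.iterate_succ_apply']
      | succ t =>
        have h0 := h t.succ (Fin.succ_pos t)
        rw [if_neg (Fin.succ_ne_zero t), arcs_fst_of_eq_zero _ h0, arcs_fst_of_eq_zero]
        rw [Function.update_of_ne (Fin.succ_ne_zero t), h0]
    | succ s =>
      cases t using Fin.cases with
      | zero =>
        rw [if_neg (Fin.succ_ne_zero s).symm]
        simp only [arcs, Fin.cons_zero]
        rw [Function.update_of_ne (Fin.succ_ne_zero s).symm]
      | succ t =>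
        have e : (fun u : Fin r => Function.update θ s.succ (θ s.succ + 1) u.succ) =
            Function.update (fun u : Fin r => θ u.succ) s (θ s.succ + 1) := by
          funext u
          simp [Function.update_apply]
        simp only [arcs, Fin.cons_succ]
        rw [e, Function.update_of_ne (Fin.succ_ne_zero s).symm]
        have := ih (insert ((step S)^[θ 0] (x 0))
          (insert (step S ((step S)^[θ 0] (x 0))) S)) (fun s => x s.succ)
          (θ := fun u => θ u.succ) (s := s) (fun t ht => h _ (Fin.succ_lt_succ_iff.2 ht)) t
        rw [this]
        simp only [Fin.succ_inj]

theorem WD.Enum.peelable_arcs {g : WD} {r : ℕ} {x : Fin r → ℤ} (h : WD.Enum g x)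
    (θ : Fin r → ℕ) : Peelable g.sings (List.ofFn (arcs r g.sings x θ)) := by
  rw [ofFn_arcs]; exact h.peelable θ

section

variable {g f : IntFun m n} {r : ℕ} {p : Fin r → Fin m × Fin n}

/-- The values of the pairs. -/
def vals (g : IntFun m n) {r : ℕ} (p : Fin r → Fin m × Fin n) : Fin r → ℤ :=
  fun s => g (Sum.inl (p s).1)

/-- After every application the pair again stands at the right end of an arc, in the arc system for
the increased θ, so `PairsOf.raise` applies anew. -/
theorem PairsOf.raise_iterate (h : PairsOf g p) {θ : Fin r → ℕ} {s : Fin r}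
    (hθ : ∀ t, s < t → θ t = 0) (k : ℕ)
    (hf : Moved g p (fun t => (arcs r (toWD g).sings (vals g p) θ t).1) f) :
    Moved g p (fun t => (arcs r (toWD g).sings (vals g p)
      (Function.update θ s (θ s + k)) t).1) ((SuperKL.raise (p s).1 (p s).2)^[k] f) := by
  induction k with
  | zero => simpa using hf
  | succ k ih =>
    rw [Function.iterate_succ_apply']
    set η := Function.update θ s (θ s + k) with hη
    set a := arcs r (toWD g).sings (vals g p) η with ha
    have e0 : (fun t => (a t).1) = ends a 0 := by funext t; simp [ends]
    rw [e0] at ih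
    have hp : Peelable (toWD g).sings (List.ofFn a) := h.enum.peelable_arcs η
    have := h.raise hp (s := s) (θ := 0) (fun _ _ => rfl) ih
    have e1 : Function.update θ s (θ s + (k + 1)) = Function.update η s (η s + 1) := by
      simp [hη, add_assoc]
    rw [e1]
    convert this using 1
    funext t
    rw [arcs_update _ _ fun t ht => by rw [hη, Function.update_of_ne ht.ne', hθ t ht]]
    rw [← ends_update, Function.update_apply, ← e0]

theorem PairsOf.fold_raise (h : PairsOf g p) (θ : Fin r → ℕ) (w : List (Fin r))
    (hw : w.Pairwise (· < ·)) {η : Fin r → ℕ} (hη : ∀ s ∈ w, ∀ t, s ≤ t → η t = 0)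
    (hf : Moved g p (fun t => (arcs r (toWD g).sings (vals g p) η t).1) f) :
    Moved g p (fun t => (arcs r (toWD g).sings (vals g p)
      (fun t => if t ∈ w then θ t else η t) t).1)
      (w.foldl (fun g s => (SuperKL.raise (p s).1 (p s).2)^[θ s] g) f) := by
  induction w generalizing f η with
  | nil => simpa using hf
  | cons s w ih =>
    rw [List.pairwise_cons] at hw
    have hs := hη s (by simp)
    have h1 := h.raise_iterate (s := s) (fun t ht => hs t ht.le) (θ s) hf
    rw [hs s le_rfl, zero_add] at h1
    have h2 := ih hw.2 (fun s' hs' t ht => by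
      have := hw.1 s' hs'
      rw [Function.update_of_ne (this.trans_le ht).ne']
      exact hs t (this.le.trans ht)) h1
    rw [List.foldl_cons]
    have e : (fun t => if t ∈ s :: w then θ t else η t) =
        fun t => if t ∈ w then θ t else Function.update η s (θ s) t := by
      funext t
      simp only [List.mem_cons, Function.update_apply]
      by_cases e : t = s
      · subst e; simp
      · simp [e]
    rw [e]
    exact h2

/-- When pair s moves, the pairs before it are still at their right ends. Thus the arcs stay fixed
throughout, and each pair moves along its own arc at most once. -/
theorem PairsOf.fold_raise_reverse (h : PairsOf g p) {a : Fin r → ℤ × ℤ}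
    (ha : Peelable (toWD g).sings (List.ofFn a)) {θ : Fin r → ℕ} (hθ : ∀ s, θ s ≤ 1)
    (w : List (Fin r)) (hw : w.Pairwise (· > ·)) {η : Fin r → ℕ}
    (hη : ∀ s ∈ w, ∀ t, t ≤ s → η t = 0) (hf : Moved g p (ends a η) f) :
    Moved g p (ends a (fun t => if t ∈ w then θ t else η t))
      (w.foldl (fun g s => (SuperKL.raise (p s).1 (p s).2)^[θ s] g) f) := by
  induction w generalizing f η with
  | nil => simpa using hf
  | cons s w ih =>
    rw [List.pairwise_cons] at hw
    have hs := hη s (by simp)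
    have h1 : Moved g p (ends a (Function.update η s (θ s)))
        ((SuperKL.raise (p s).1 (p s).2)^[θ s] f) := by
      have := hθ s
      obtain h0 | h0 : θ s = 0 ∨ θ s = 1 := by omega
      · rw [h0, ← hs s le_rfl, Function.update_eq_self, hs s le_rfl]
        exact hf
      · rw [h0]
        exact h.raise ha hs hf
    have h2 := ih hw.2 (fun s' hs' t ht => by
      have := hw.1 s' hs'
      rw [Function.update_of_ne (ht.trans_lt this).ne]
      exact hs t (ht.trans this.le)) h1
    rw [List.foldl_cons]
    have e : (fun t => if t ∈ s :: w then θ t else η t) =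
        fun t => if t ∈ w then θ t else Function.update η s (θ s) t := by
      funext t
      simp only [List.mem_cons, Function.update_apply]
      by_cases e : t = s
      · subst e; simp
      · simp [e]
    rw [e]
    exact h2

theorem PairsOf.moved_arcs_zero (h : PairsOf g p) :
    Moved g p (fun t => (arcs r (toWD g).sings (vals g p) 0 t).1) g := by
  convert h.moved_self using 1
  funext t
  rw [arcs_fst_of_eq_zero _ rfl]
  rfl

theorem PairsOf.dominantConj_moved (h : PairsOf g p) {y : Fin r → ℤ}
    (hf : Moved g p y f) (h1 : Function.Injective y) (h2 : ∀ s, y s ∉ (toWD g).sings) :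
    IsDominant (dominantConj f) ∧
      toWD (dominantConj f) = (toWD g).withP (Finset.univ.image y) := by
  have hc := (h.conj_moved hf).2 ⟨h1, h2⟩
  refine ⟨(dominantConj_props hc).1, ?_⟩
  rw [(dominantConj_props hc).2, h.toWD_moved hf]

theorem PairsOf.fold_props (h : PairsOf g p) (θ : Fin r → ℕ) :
    let f := dominantConj ((List.finRange r).foldl
      (fun g s => (SuperKL.raise (p s).1 (p s).2)^[θ s] g) g)
    IsDominant f ∧ toWD f = (toWD g).slideWD (WD.steps (vals g p) θ) := by
  have h1 := h.fold_raise θ (List.finRange r) (List.pairwise_lt_finRange r) (η := 0)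
    (fun _ _ _ _ => rfl) h.moved_arcs_zero
  simp only [List.mem_finRange, if_true] at h1
  have ha := h.enum.peelable_arcs θ
  change Peelable _ (List.ofFn (arcs r (toWD g).sings (vals g p) θ)) at ha
  set a := arcs r (toWD g).sings (vals g p) θ with hadef
  have e0 : (fun t => (a t).1) = ends a 0 := by funext t; simp [ends]
  have e1 : heads (slide (toWD g).sings (WD.steps (vals g p) θ)) =
      Finset.univ.image fun t => (a t).1 := by
    rw [← ofFn_arcs, ← hadef, heads]
    ext z
    simp [List.mem_ofFn]
  rw [WD.slideWD, e1]
  exact h.dominantConj_moved h1 (e0 ▸ ends_injective ha _) fun s => by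
    rw [congrFun e0 s]; exact ha.ends_notMem _ s

theorem PairsOf.fold_reverse_props (h : PairsOf g p) {θ : Fin r → ℕ} (hθ : ∀ s, θ s ≤ 1) :
    let f := dominantConj ((List.finRange r).reverse.foldl
      (fun g s => (SuperKL.raise (p s).1 (p s).2)^[θ s] g) g)
    IsDominant f ∧ toWD f = (toWD g).withP
      (Finset.univ.image (ends (arcs r (toWD g).sings (vals g p) 0) θ)) := by
  have ha := h.enum.peelable_arcs 0
  change Peelable _ (List.ofFn (arcs r (toWD g).sings (vals g p) 0)) at ha
  have h0 := h.moved_arcs_zero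
  set a := arcs r (toWD g).sings (vals g p) 0 with hadef
  have e0 : (fun t => (a t).1) = ends a 0 := by funext t; simp [ends]
  rw [e0] at h0
  have h1 := h.fold_raise_reverse ha hθ (List.finRange r).reverse
    (List.pairwise_reverse.2 (List.pairwise_lt_finRange r)) (η := 0) (fun _ _ _ _ => rfl) h0
  simp only [List.mem_reverse, List.mem_finRange, if_true] at h1
  exact h.dominantConj_moved h1 (ends_injective ha _) (ha.ends_notMem _)

end

/-! ### The pairs of a dominant function -/

theorem exists_pairing (g : Dom m n) : ∃ p, IsPairing g.1 p := by
  have hc : (toWD g.1).P.card = atyp g.1 := (atyp_eq g).symm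
  set x := (toWD g.1).P.orderEmbOfFin hc with hx
  have hmem : ∀ s, x s ∈ (toWD g.1).P := fun s => Finset.orderEmbOfFin_mem _ _ _
  have h1 : ∀ s, ∃ i, g.1 (Sum.inl i) = x s := fun s =>
    mem_toWD_A.1 (WD.mem_P.1 (hmem s)).1
  have h2 : ∀ s, ∃ j, g.1 (Sum.inr j) = x s := fun s =>
    mem_toWD_B.1 (WD.mem_P.1 (hmem s)).2
  choose i hi using h1
  choose j hj using h2
  refine ⟨fun s => (i s, j s), fun s t hst => ?_, fun s t hst => ?_, fun s => (hi s).trans (hj s).symm⟩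
  · rw [← g.2.1.lt_iff_lt]
    change g.1 (Sum.inl (i s)) < g.1 (Sum.inl (i t))
    rw [hi, hi]; exact x.strictMono hst
  · rw [← g.2.2.lt_iff_gt]
    change g.1 (Sum.inr (j s)) < g.1 (Sum.inr (j t))
    rw [hj, hj]; exact x.strictMono hst

theorem IsPairing.pairsOf {g : Dom m n} {p : Fin (atyp g.1) → Fin m × Fin n}
    (h : IsPairing g.1 p) : PairsOf g.1 p := by
  refine ⟨g.2, h.1, h.2.1, fun i j => ⟨fun e => ?_, ?_⟩⟩
  · have h1 : StrictMono fun s => g.1 (Sum.inl (p s).1) := g.2.1.comp h.1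
    have h2 : (Finset.univ.image fun s => g.1 (Sum.inl (p s).1)) = (toWD g.1).P := by
      refine Finset.eq_of_subset_of_card_le (fun z hz => ?_) ?_
      · obtain ⟨s, -, rfl⟩ := Finset.mem_image.1 hz
        exact WD.mem_P.2 ⟨mem_toWD_A.2 ⟨_, rfl⟩, mem_toWD_B.2 ⟨_, (h.2.2 s).symm⟩⟩
      · rw [Finset.card_image_of_injective _ h1.injective, Finset.card_fin, atyp_eq]
    have h3 : g.1 (Sum.inl i) ∈ (toWD g.1).P :=
      WD.mem_P.2 ⟨mem_toWD_A.2 ⟨_, rfl⟩, mem_toWD_B.2 ⟨_, e.symm⟩⟩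
    rw [← h2] at h3
    obtain ⟨s, -, hs⟩ := Finset.mem_image.1 h3
    refine ⟨s, Prod.ext (g.2.injective.1 hs) (g.2.injective.2 ?_)⟩
    exact (h.2.2 s).symm.trans (hs.trans e)
  · rintro ⟨s, hs⟩
    have := h.2.2 s
    rwa [hs] at this

theorem exists_composite (g : Dom m n) : ∃ p, IsPairing g.1 p ∧
    ∀ (T : Fin m → Fin n → IntFun m n → IntFun m n) θ w, composite T g.1 θ w =
      dominantConj (w.foldl (fun f s => (T (p s).1 (p s).2)^[θ s] f) g.1) := by
  have h := exists_pairing g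
  refine ⟨h.choose, h.choose_spec, fun T θ w => ?_⟩
  rw [composite, dif_pos h]

/-- The values of `g` on its pairs, in increasing order. -/
def pairVals (g : Dom m n) : Fin (atyp g.1) → ℤ := vals g.1 (exists_composite g).choose

theorem enum_pairVals (g : Dom m n) : WD.Enum (toWD g.1) (pairVals g) :=
  (exists_composite g).choose_spec.1.pairsOf.enum

theorem raisePrimeTheta_props (g : Dom m n) (θ : Fin (atyp g.1) → ℕ) :
    IsDominant (raisePrimeTheta g.1 θ) ∧ toWD (raisePrimeTheta g.1 θ) =
      (toWD g.1).slideWD (WD.steps (pairVals g) θ) := by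
  have h := (exists_composite g).choose_spec
  rw [raisePrimeTheta, h.2]
  exact h.1.pairsOf.fold_props θ

/-- The arcs of the left matching. -/
def leftArcs (g : Dom m n) : Fin (atyp g.1) → ℤ × ℤ :=
  arcs _ (toWD g.1).sings (pairVals g) 0

theorem raiseTheta_props (g : Dom m n) {θ : Fin (atyp g.1) → ℕ} (hθ : ∀ s, θ s ≤ 1) :
    IsDominant (raiseTheta g.1 θ) ∧ toWD (raiseTheta g.1 θ) =
      (toWD g.1).withP (Finset.univ.image (ends (leftArcs g) θ)) := by
  have h := (exists_composite g).choose_spec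
  rw [raiseTheta, h.2]
  exact h.1.pairsOf.fold_reverse_props hθ

/-! ### The mirror symmetry between lowering and raising operators -/

/-- The mirror image of a function. -/
def mir (f : IntFun m n) : IntFun m n
  | Sum.inl i => -f (Sum.inl i.rev)
  | Sum.inr j => -f (Sum.inr j.rev)

theorem conj_mir {f : IntFun m n} : Conj (mir f) ↔ Conj f := by
  rw [conj_iff, conj_iff]
  have key : ∀ {k : ℕ} (a : Fin k → ℤ),
      Function.Injective (fun i : Fin k => -a i.rev) ↔ Function.Injective a := by
    intro k a
    exact ⟨fun h i j e => Fin.rev_injective (h (by simpa using e)),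
      fun h i j e => Fin.rev_injective (h (neg_injective e))⟩
  exact and_congr (key fun i => f (Sum.inl i)) (key fun j => f (Sum.inr j))

theorem mir_sub (f : IntFun m n) (a : ℕ) (i : Fin m) (j : Fin n) :
    mir (f - a • dDiff i j) = mir f + a • dDiff i.rev j.rev := by
  have h1 := add_smul_dDiff (f - a • dDiff i j) a i j
  rw [sub_add_cancel] at h1
  have h2 := add_smul_dDiff (mir f) a i.rev j.rev
  funext x
  cases x with
  | inl k =>
    rw [h2.1]
    change -(f - a • dDiff i j) (Sum.inl k.rev) = if _ then -f (Sum.inl k.rev) - _ else _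
    have := h1.1 k.rev
    simp only [Fin.rev_eq_iff] at this
    split_ifs at this ⊢
    · rw [this]; ring
    · rw [← this]; rfl
  | inr k =>
    rw [h2.2]
    change -(f - a • dDiff i j) (Sum.inr k.rev) = if _ then -f (Sum.inr k.rev) - _ else _
    have := h1.2 k.rev
    simp only [Fin.rev_eq_iff] at this
    split_ifs at this ⊢
    · rw [this]; ring
    · rw [← this]; rfl

/-- Negating values and reversing places turns subtraction of d_i - d_j into addition and inner
pairs into outer ones, so the two recursions coincide. -/
theorem mir_lower (f : IntFun m n) (i : Fin m) (j : Fin n) :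
    mir (lower i j f) = raise i.rev j.rev (mir f) := by
  have main : ∀ N : ℕ, ∀ (i : Fin m) (j : Fin n), (m - i.val) + j.val = N →
      mir (lower i j f) = raise i.rev j.rev (mir f) := by
    intro N
    induction N using Nat.strong_induction_on with
    | _ N ih =>
    intro i j hN
    rw [lower, raise, mir_sub]
    congr 3
    ext a
    refine and_congr_right fun _ => and_congr (by rw [← mir_sub, conj_mir]) ?_
    constructor
    · intro h k l hk hl e
      have hk' : i < k.rev := by rw [← Fin.rev_lt_rev, Fin.rev_rev]; exact hk
      have hl' : l.rev < j := by rw [← Fin.rev_lt_rev, Fin.rev_rev]; exact hl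
      have := h k.rev l.rev hk' hl' (neg_injective e)
      rw [← conj_mir, mir_sub, ih _ _ k.rev l.rev rfl, Fin.rev_rev, Fin.rev_rev] at this
      · exact this
      · have h1 : i.val < k.rev.val := hk'
        have h2 : l.rev.val < j.val := hl'
        omega
    · intro h k l hk hl e
      have := h k.rev l.rev (Fin.rev_lt_rev.2 hk) (Fin.rev_lt_rev.2 hl) (by simp [mir, e])
      rw [← conj_mir, mir_sub, ih _ _ k l rfl]
      · exact this
      · have h1 : i.val < k.val := hk
        have h2 : l.val < j.val := hl
        omega
  exact main _ i j rfl

theorem WD.neg_neg (g : WD) : g.neg.neg = g := by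
  ext x
  · rw [mem_neg_A, mem_neg_A, _root_.neg_neg]
  · rw [mem_neg_B, mem_neg_B, _root_.neg_neg]

theorem toWD_mir (f : IntFun m n) : toWD (mir f) = (toWD f).neg := by
  ext x
  · rw [mem_toWD_A, WD.mem_neg_A, mem_toWD_A, Fin.rev_surjective.exists]
    simp [mir, neg_eq_iff_eq_neg]
  · rw [mem_toWD_B, WD.mem_neg_B, mem_toWD_B, Fin.rev_surjective.exists]
    simp [mir, neg_eq_iff_eq_neg]

theorem PairsOf.mir {g : IntFun m n} {r : ℕ} {p : Fin r → Fin m × Fin n} (h : PairsOf g p) :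
    PairsOf (mir g) fun s => ((p s.rev).1.rev, (p s.rev).2.rev) where
  dom := ⟨fun _ _ hij => neg_lt_neg (h.dom.1 (Fin.rev_lt_rev.2 hij)),
    fun _ _ hij => neg_lt_neg (h.dom.2 (Fin.rev_lt_rev.2 hij))⟩
  mono _ _ hst := Fin.rev_lt_rev.2 (h.mono (Fin.rev_lt_rev.2 hst))
  anti _ _ hst := Fin.rev_lt_rev.2 (h.anti (Fin.rev_lt_rev.2 hst))
  iff i j := by
    change -g (Sum.inl i.rev) = -g (Sum.inr j.rev) ↔ _
    rw [neg_inj, h.iff]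
    constructor
    · rintro ⟨s, hs⟩
      exact ⟨s.rev, by simp [hs]⟩
    · rintro ⟨s, hs⟩
      rw [Prod.mk.injEq, Fin.rev_eq_iff, Fin.rev_eq_iff] at hs
      exact ⟨s.rev, Prod.ext hs.1 hs.2⟩

theorem mir_foldl_lower {r : ℕ} (p : Fin r → Fin m × Fin n) (θ : Fin r → ℕ)
    (w : List (Fin r)) (f : IntFun m n) :
    mir (w.foldl (fun f s => (lower (p s).1 (p s).2)^[θ s] f) f) =
      w.foldl (fun f s => (raise (p s).1.rev (p s).2.rev)^[θ s] f) (mir f) := by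
  induction w generalizing f with
  | nil => rfl
  | cons s w ih =>
    rw [List.foldl_cons, List.foldl_cons, ih]
    congr 1
    exact (Function.Semiconj.iterate_right (fun f => mir_lower f _ _) (θ s)) f

theorem foldl_reverse_finRange {α : Type*} {r : ℕ} (F : α → Fin r → α) (a : α) :
    (List.finRange r).foldl F a = (List.finRange r).reverse.foldl (fun b s => F b s.rev) a := by
  rw [List.finRange_reverse, List.foldl_map]
  simp

/-- The mirror image turns L_θ into R_θ with the numbering of the pairs reversed, which also
reverses the order of composition as required for R_θ. The arcs `a` are the left arcs of the mirror
image. -/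
theorem exists_rightArcs (g : Dom m n) : ∃ a : Fin (atyp g.1) → ℤ × ℤ,
    Peelable (toWD g.1).neg.sings (List.ofFn a) ∧ (toWD g.1).neg.P = heads (List.ofFn a) ∧
    ∀ θ : Fin (atyp g.1) → ℕ, (∀ s, θ s ≤ 1) → IsDominant (lowerTheta g.1 θ) ∧
      (toWD (lowerTheta g.1 θ)).neg =
        (toWD g.1).neg.withP (Finset.univ.image (ends a fun s => θ s.rev)) := by
  obtain ⟨p, hp, hc⟩ := exists_composite g
  have h := hp.pairsOf.mir
  set p' : Fin (atyp g.1) → Fin m × Fin n := fun s => ((p s.rev).1.rev, (p s.rev).2.rev)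
  refine ⟨arcs _ (toWD (mir g.1)).sings (vals (mir g.1) p') 0, ?_, ?_, fun θ hθ => ?_⟩
  · rw [← toWD_mir]; exact h.enum.peelable_arcs 0
  · rw [← toWD_mir, ← h.enum.image]
    ext z
    rw [mem_heads]
    simp [List.mem_ofFn, arcs_fst_of_eq_zero, vals]
  · have h1 := h.fold_reverse_props (θ := fun s => θ s.rev) fun s => hθ _
    set F := (List.finRange (atyp g.1)).foldl (fun f s => (lower (p s).1 (p s).2)^[θ s] f) g.1
    have hF : mir F = (List.finRange (atyp g.1)).reverse.foldl
        (fun f s => (raise (p' s).1 (p' s).2)^[θ s.rev] f) (mir g.1) := by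
      rw [mir_foldl_lower, foldl_reverse_finRange]
    rw [lowerTheta, hc]
    rw [← hF] at h1
    -- `dominantConj` returns an argument that is not conjugate unchanged, so dominance of the
    -- result already implies conjugacy.
    have hcj : Conj (mir F) := by
      by_contra hn
      have h2 := h1.1
      rw [dominantConj, dif_neg hn] at h2
      exact hn ⟨1, by rw [act_one]; exact h2⟩
    have h3 := dominantConj_props (conj_mir.1 hcj)
    refine ⟨h3.1, ?_⟩
    rw [h3.2, ← toWD_mir, ← (dominantConj_props hcj).2, h1.2, ← toWD_mir]

/-! ### The coefficients in terms of the operators -/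

/-- Pairs at right ends of arcs become pairs at left ends in the mirror image. There `arcWeight`
counts q⁻¹ for each, hence the inverse. -/
theorem WD.uc_eq_arcWeight {f h : WD} {L : List (ℤ × ℤ)} (hL : Peelable f.neg.sings L)
    (hP : f.neg.P = heads L) (h1 : f.neg.A \ f.neg.B = h.neg.A \ h.neg.B)
    (h2 : f.neg.B \ f.neg.A = h.neg.B \ h.neg.A) :
    uc f h = (arcWeight L h.neg.P)⁻¹ := by
  classical
  have hl : RM f fun x => -arcInv L (-x) := by
    have := (LM_of_peelable hL hP).neg
    rwa [WD.neg_neg] at this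
  have hmP : ∀ (k : WD) (x : ℤ), -x ∈ k.neg.P ↔ x ∈ k.A ∧ x ∈ k.B := fun k x => by
    rw [mem_P, mem_neg_A, mem_neg_B, _root_.neg_neg]
  have hcard : ∀ k : WD, k.neg.P.card = k.P.card := fun k => by
    refine Finset.card_bij' (fun x _ => -x) (fun x _ => -x) ?_ ?_ (by simp) (by simp)
    · intro x hx; rw [mem_P, ← hmP, _root_.neg_neg]; exact hx
    · intro x hx; rw [hmP, ← mem_P]; exact hx
  have ho : Orient (fun x => -arcInv L (-x)) f h ↔
      ∀ x, arcInv L x ∈ h.neg.P ↔ x ∉ h.neg.P ∧ arcInv L x ≠ x := by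
    constructor
    · intro ho x
      have := ho.2.2 (-x)
      rw [← hmP, ← hmP, _root_.neg_neg, _root_.neg_neg] at this
      rw [this]
      simp
    · intro ho
      refine ⟨fun x => ?_, fun x => ?_, fun x => ?_⟩
      · have := Finset.ext_iff.1 h1 (-x)
        simpa [Finset.mem_sdiff, mem_neg_A, mem_neg_B] using this.symm
      · have := Finset.ext_iff.1 h2 (-x)
        simpa [Finset.mem_sdiff, mem_neg_A, mem_neg_B] using this.symm
      · have := ho (-x)
        rw [← hmP, ← hmP, _root_.neg_neg, this, ne_eq, ne_eq, neg_eq_iff_eq_neg]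
  rw [uc_eq hl, arcWeight_eq hL]
  by_cases hc : ∀ x, arcInv L x ∈ h.neg.P ↔ x ∉ h.neg.P ∧ arcInv L x ≠ x
  · rw [if_pos (ho.2 hc), if_pos hc]
    have hlen : L.length = h.neg.P.card := by
      rw [← hL.card_heads, ← hP, hcard, hcard]
      exact card_P_le (le_of_orient hl (ho.2 hc))
    have hcnt : cnt (fun x => -arcInv L (-x)) h =
        (h.neg.P.filter fun x => ¬ arcInv L x < x).card := by
      refine Finset.card_bij' (fun x _ => -x) (fun x _ => -x) ?_ ?_ (by simp) (by simp)
      · intro x hx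
        rw [Finset.mem_filter] at hx ⊢
        rw [hmP, ← mem_P]
        have h3 : -arcInv L (-x) < x := hx.2
        exact ⟨hx.1, by omega⟩
      · intro x hx
        rw [Finset.mem_filter] at hx ⊢
        rw [mem_P, ← hmP, _root_.neg_neg]
        refine ⟨hx.1, ?_⟩
        have : arcInv L x ≠ x := fun e => by
          have := hc x
          rw [e] at this
          exact (this.1 hx.1).2 rfl
        change -arcInv L (- -x) < -x
        rw [_root_.neg_neg]
        omega
    have hsum := Finset.card_filter_add_card_filter_not (s := h.neg.P) fun x => arcInv L x < x
    rw [← hcnt] at hsum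
    have := q_ne_zero
    rw [hlen, ← hsum, pow_add]
    simp only [inv_pow]
    field_simp
  · rw [if_neg fun h => hc (ho.1 h), if_neg hc, inv_zero]

theorem uc_toWD (f g : Dom m n) :
    (∀ θ : Fin (atyp f.1) → ℕ, (∀ s, θ s ≤ 1) → g.1 = lowerTheta f.1 θ →
      WD.uc (toWD f.1) (toWD g.1) = q ^ ∑ s, θ s) ∧
    ((∀ θ : Fin (atyp f.1) → ℕ, (∀ s, θ s ≤ 1) → g.1 ≠ lowerTheta f.1 θ) →
      WD.uc (toWD f.1) (toWD g.1) = 0) := by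
  obtain ⟨a, ha, hP, hl⟩ := exists_rightArcs f
  constructor
  · intro θ hθ e
    have h1 := (hl θ hθ).2
    rw [← e] at h1
    have hw := WD.withP_props (g := (toWD f.1).neg)
      (Y := Finset.univ.image (ends a fun s => θ s.rev)) fun z hz => by
        obtain ⟨s, -, rfl⟩ := Finset.mem_image.1 hz
        exact ha.ends_notMem _ s
    rw [← h1] at hw
    rw [WD.uc_eq_arcWeight ha hP hw.2.1.symm hw.2.2.1.symm, hw.1, arcWeight_ends ha fun s => hθ _,
      inv_pow, inv_inv]
    congr 1
    exact Equiv.sum_comp Fin.revPerm θ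
  · intro h
    by_contra hne
    have hle := WD.le_of_uc_ne hne
    have hA : ∀ k : WD, k.neg.A \ k.neg.B = (k.A \ k.B).map (Equiv.neg ℤ).toEmbedding := by
      intro k; ext z; simp [WD.mem_neg_A, WD.mem_neg_B, Finset.mem_sdiff]
    have hB : ∀ k : WD, k.neg.B \ k.neg.A = (k.B \ k.A).map (Equiv.neg ℤ).toEmbedding := by
      intro k; ext z; simp [WD.mem_neg_A, WD.mem_neg_B, Finset.mem_sdiff]
    have h1 : (toWD f.1).neg.A \ (toWD f.1).neg.B = (toWD g.1).neg.A \ (toWD g.1).neg.B := by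
      rw [hA, hA, hle.1]
    have h2 : (toWD f.1).neg.B \ (toWD f.1).neg.A = (toWD g.1).neg.B \ (toWD g.1).neg.A := by
      rw [hB, hB, hle.2.1]
    rw [WD.uc_eq_arcWeight ha hP h1 h2] at hne
    obtain ⟨θ, hθ, e⟩ := exists_ends_of_arcWeight_ne fun h0 => hne (by rw [h0, inv_zero])
    refine h (fun s => θ s.rev) (fun s => hθ _) ?_
    have h3 := hl (fun s => θ s.rev) fun s => hθ _
    simp only [Fin.rev_rev] at h3
    have hw := WD.withP_props (g := (toWD f.1).neg)
      (Y := Finset.univ.image (ends a θ)) fun z hz => by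
        obtain ⟨s, -, rfl⟩ := Finset.mem_image.1 hz
        exact ha.ends_notMem _ s
    refine toWD_injective g.2 h3.1 ?_
    have e1 : (toWD g.1).neg = (toWD f.1).neg.withP (Finset.univ.image (ends a θ)) :=
      WD.eq_of_P (h1.symm.trans hw.2.1.symm) (h2.symm.trans hw.2.2.1.symm) (e.trans hw.1.symm)
    rw [← WD.neg_neg (toWD g.1), e1, ← h3.2, WD.neg_neg]

theorem leftArcs_props (g : Dom m n) : Peelable (toWD g.1).sings (List.ofFn (leftArcs g)) ∧
    (toWD g.1).P = heads (List.ofFn (leftArcs g)) := by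
  refine ⟨(enum_pairVals g).peelable_arcs 0, ?_⟩
  rw [← (enum_pairVals g).image]
  ext z
  rw [mem_heads]
  simp [List.mem_ofFn, leftArcs, arcs_fst_of_eq_zero]

theorem withP_leftArcs (g : Dom m n) (θ : Fin (atyp g.1) → ℕ) :
    ((toWD g.1).withP (Finset.univ.image (ends (leftArcs g) θ))).P =
      Finset.univ.image (ends (leftArcs g) θ) ∧
    ((toWD g.1).withP (Finset.univ.image (ends (leftArcs g) θ))).A \
      ((toWD g.1).withP (Finset.univ.image (ends (leftArcs g) θ))).B =
        (toWD g.1).A \ (toWD g.1).B ∧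
    ((toWD g.1).withP (Finset.univ.image (ends (leftArcs g) θ))).B \
      ((toWD g.1).withP (Finset.univ.image (ends (leftArcs g) θ))).A =
        (toWD g.1).B \ (toWD g.1).A := by
  have h := WD.withP_props (g := toWD g.1)
    (Y := Finset.univ.image (ends (leftArcs g) θ)) fun z hz => by
      obtain ⟨s, -, rfl⟩ := Finset.mem_image.1 hz
      exact (leftArcs_props g).1.ends_notMem _ s
  exact ⟨h.1, h.2.1, h.2.2.1⟩

theorem raiseTheta_injective (g : Dom m n) {θ η : Fin (atyp g.1) → ℕ} (hθ : ∀ s, θ s ≤ 1)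
    (hη : ∀ s, η s ≤ 1) (e : raiseTheta g.1 θ = raiseTheta g.1 η) : θ = η := by
  have h1 := (raiseTheta_props g hθ).2
  rw [e, (raiseTheta_props g hη).2] at h1
  refine image_ends_injective (leftArcs_props g).1 hθ hη ?_
  rw [← (withP_leftArcs g θ).1, ← (withP_leftArcs g η).1, h1]

theorem wc_toWD (f g : Dom m n) : WD.wc (toWD f.1) (toWD g.1) =
    ∑ᶠ (θ : Fin (atyp g.1) → ℕ) (_ : (∀ s, θ s ≤ 1) ∧ raiseTheta g.1 θ = f.1),
      q⁻¹ ^ ∑ s, θ s := by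
  have hL := leftArcs_props g
  by_cases h : ∃ θ : Fin (atyp g.1) → ℕ, (∀ s, θ s ≤ 1) ∧ raiseTheta g.1 θ = f.1
  · obtain ⟨θ, hθ, e⟩ := h
    rw [finsum_eq_single _ θ, finsum_eq_if, if_pos ⟨hθ, e⟩]
    · have h1 := (raiseTheta_props g hθ).2
      have hw := withP_leftArcs g θ
      rw [← h1, e] at hw
      rw [WD.wc_eq_arcWeight hL.1 hL.2 hw.2.1 hw.2.2, hw.1, arcWeight_ends hL.1 hθ]
    · intro η hne
      rw [finsum_eq_if, if_neg]
      rintro ⟨h1, h2⟩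
      exact hne (raiseTheta_injective g h1 hθ (h2.trans e.symm))
  · rw [finsum_eq_zero_of_forall_eq_zero fun θ => by
      rw [finsum_eq_if, if_neg fun hc => h ⟨θ, hc⟩]]
    by_contra hne
    have hle := WD.le_of_wc_ne hne
    rw [WD.wc_eq_arcWeight hL.1 hL.2 hle.1 hle.2.1] at hne
    obtain ⟨θ, hθ, e⟩ := exists_ends_of_arcWeight_ne hne
    refine h ⟨θ, hθ, toWD_injective (raiseTheta_props g hθ).1 f.2 ?_⟩
    have hw := withP_leftArcs g θ
    rw [(raiseTheta_props g hθ).2]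
    exact WD.eq_of_P (hw.2.1.trans hle.1.symm) (hw.2.2.trans hle.2.1.symm) (hw.1.trans e.symm)

theorem raisePrimeTheta_eq_iff (f g : Dom m n) (θ : Fin (atyp g.1) → ℕ) :
    raisePrimeTheta g.1 θ = f.1 ↔
      (toWD g.1).slideWD (WD.steps (pairVals g) θ) = toWD f.1 := by
  have h := raisePrimeTheta_props g θ
  rw [← h.2]
  exact ⟨fun e => by rw [e], toWD_injective h.1 f.2⟩

theorem finite_raisePrimeTheta (f g : Dom m n) :
    {θ : Fin (atyp g.1) → ℕ | raisePrimeTheta g.1 θ = f.1}.Finite := by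
  simp only [raisePrimeTheta_eq_iff]
  exact (enum_pairVals g).finite _

theorem incL_toWD (f g : Dom m n) : WD.incL (toWD f.1) (toWD g.1) =
    ∑ᶠ (θ : Fin (atyp g.1) → ℕ) (_ : raisePrimeTheta g.1 θ = f.1), (-q)⁻¹ ^ ∑ s, θ s := by
  simp only [raisePrimeTheta_eq_iff]
  exact (enum_pairVals g).incL_eq _

/-! ### The bar involution -/

theorem coord_add (u v : Fam m n) : coord (u + v) = coord u + coord v := by
  funext W
  by_cases h : ∃ g : Dom m n, toWD g.1 = W
  · obtain ⟨g, rfl⟩ := h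
    rw [Pi.add_apply, coord_toWD, coord_toWD, coord_toWD, Pi.add_apply]
  · simp only [Pi.add_apply, coord, dif_neg h, add_zero]

theorem coord_smul (a : Qq) (u : Fam m n) : coord (a • u) = a • coord u := by
  funext W
  by_cases h : ∃ g : Dom m n, toWD g.1 = W
  · obtain ⟨g, rfl⟩ := h
    rw [Pi.smul_apply, coord_toWD, coord_toWD, Pi.smul_apply]
  · simp only [Pi.smul_apply, coord, dif_neg h, smul_zero]

theorem ext_coord {u v : Fam m n} (hu : u ∈ AntiSym m n) (hv : v ∈ AntiSym m n)
    (h : coord u = coord v) : u = v := by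
  rw [← ofCoord_coord hu, ← ofCoord_coord hv, h]

theorem Ehat_antiSym (u : Ehat m n) : u.1 ∈ AntiSym m n := (Ehat_le u.2).2

theorem coord_Ehat_mem (u : Ehat m n) : coord u.1 ∈ WD.Cf := coord_mem (Ehat_le u.2).1

/-- The bar involution. -/
def barMap (m n : ℕ) : Ehat m n →ₛₗ[barQ] Ehat m n where
  toFun u := ⟨ofCoord m n (WD.bet (coord u.1)), ofCoord_mem_Ehat (WD.bet_mem (coord_Ehat_mem u))⟩
  map_add' u v := by
    refine Subtype.ext (eq_of_antiSym (ofCoord_mem_antiSym _)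
      (add_mem (ofCoord_mem_antiSym _) (ofCoord_mem_antiSym _)) fun g => ?_)
    change ofCoord m n _ g.1 = ofCoord m n _ g.1 + ofCoord m n _ g.1
    rw [ofCoord_apply, ofCoord_apply, ofCoord_apply, Submodule.coe_add, coord_add,
      WD.bet_add (coord_Ehat_mem u) (coord_Ehat_mem v), Pi.add_apply]
  map_smul' a u := by
    refine Subtype.ext (eq_of_antiSym (ofCoord_mem_antiSym _)
      (Submodule.smul_mem _ _ (ofCoord_mem_antiSym _)) fun g => ?_)
    change ofCoord m n _ g.1 = barQ a • ofCoord m n _ g.1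
    rw [ofCoord_apply, ofCoord_apply, Submodule.coe_smul, coord_smul, WD.bet_smul, Pi.smul_apply]

theorem coord_barMap (u : Ehat m n) : coord (barMap m n u).1 = WD.bet (coord u.1) :=
  coord_ofCoord fun _ => WD.sz_of_bet_ne fun _ => sz_of_coord_ne

theorem bounded_iff_of_act {d : ℤ} {f g : IntFun m n} {x : S m n} (h : g = act f x) :
    Bounded d g ↔ Bounded d f := by
  rw [← bd_toWD, ← bd_toWD, h, toWD_act]

theorem eq_zero_iff_dominant {u : Fam m n} (hu : u ∈ AntiSym m n) (d : ℤ) :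
    (∀ h, Bounded d h → u h = 0) ↔ ∀ W, WD.Bd d W → coord u W = 0 := by
  constructor
  · intro h W hW
    by_contra hne
    obtain ⟨g, rfl⟩ := exists_toWD (sz_of_coord_ne hne)
    rw [coord_toWD] at hne
    exact hne (h _ (bd_toWD.1 hW))
  · intro h f hf
    rcases antiSym_cases f with ⟨g, c, x, hg, hc⟩ | hc
    · rw [hc u hu, ← coord_toWD u, h _ (bd_toWD.2 ((bounded_iff_of_act hg).2 hf)), mul_zero]
    · exact hc u hu

/-- The weight sees only the singles, which comparable diagrams share. So the matrix of the bar
involution preserves weights, and K_a is inverted because the powers of q are. -/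
theorem WD.weight_eq_of_le {f g : WD} (h : f ≤ g) (a : ℤ) :
    ((if a ∈ f.B then 1 else 0) - (if a ∈ f.A then 1 else 0) : ℤ) =
      (if a ∈ g.B then 1 else 0) - (if a ∈ g.A then 1 else 0) := by
  have h1 := Finset.ext_iff.1 h.1 a
  have h2 := Finset.ext_iff.1 h.2.1 a
  simp only [Finset.mem_sdiff] at h1 h2
  by_cases c1 : a ∈ f.A <;> by_cases c2 : a ∈ f.B <;> by_cases c3 : a ∈ g.A <;>
    by_cases c4 : a ∈ g.B <;> simp_all

theorem barQ_zpow (k : ℤ) : barQ (q ^ k) = q ^ (-k) := by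
  rw [map_zpow₀, barQ_q, inv_zpow']

theorem coord_kOp (a s : ℤ) (u : Fam m n) (W : WD) : coord (kOp a s u) W =
    q ^ (s * ((if a ∈ W.B then 1 else 0) - (if a ∈ W.A then 1 else 0))) * coord u W := by
  by_cases h : WD.Sz m n W
  · obtain ⟨g, rfl⟩ := exists_toWD h
    rw [coord_toWD, coord_toWD, kOp_apply, wt_apply g.2]
  · rw [not_not.1 fun h' => h (sz_of_coord_ne h'),
      not_not.1 fun h' => h (sz_of_coord_ne (u := u) h'), mul_zero]

theorem bet_coord_kOp (a s : ℤ) (u : Fam m n) (W : WD) : WD.bet (coord (kOp a s u)) W =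
    q ^ (-s * ((if a ∈ W.B then 1 else 0) - (if a ∈ W.A then 1 else 0))) *
      WD.bet (coord u) W := by
  rw [WD.bet, WD.bet, WD.vmul, WD.vmul, mul_finsum]
  refine finsum_congr fun f => ?_
  by_cases hf : WD.incR f W = 0
  · rw [hf]; simp
  · rw [coord_kOp, map_mul, barQ_zpow, WD.weight_eq_of_le (IncidenceAlgebra.le_of_ne_zero hf),
      neg_mul, mul_assoc]

theorem barMap_kOp (a s : ℤ) (u : Ehat m n) :
    ∃ v : Ehat m n, v.1 = kOp a s u.1 ∧ (barMap m n v).1 = kOp a (-s) (barMap m n u).1 := by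
  refine ⟨⟨_, kOp_mem u.2 a s⟩, rfl, ext_coord (Ehat_antiSym _)
    (Ehat_le (kOp_mem (barMap m n u).2 a (-s))).2 (funext fun W => ?_)⟩
  rw [coord_barMap, coord_kOp, coord_barMap, bet_coord_kOp]

/-! ### Existence and uniqueness of the bar involution -/

/-- The canonical basis. -/
def uVec (f : Dom m n) : Ehat m n :=
  ⟨ofCoord m n (WD.uc (toWD f.1)), ofCoord_mem_Ehat (WD.uc_mem _)⟩

theorem sz_of_le_toWD {f : Dom m n} {W : WD} (h : toWD f.1 ≤ W) : WD.Sz m n W :=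
  (WD.Sz.of_le h).1 (sz_toWD f)

theorem coord_uVec (f : Dom m n) : coord (uVec f).1 = WD.uc (toWD f.1) :=
  coord_ofCoord fun _ h => sz_of_le_toWD (WD.le_of_uc_ne h)

open Classical in
theorem coord_kVec (f : Dom m n) : coord (kVec f).1 = fun W => if W = toWD f.1 then 1 else 0 := by
  funext W
  by_cases h : WD.Sz m n W
  · obtain ⟨g, rfl⟩ := exists_toWD h
    rw [coord_toWD, kVec_apply]
    exact if_congr ⟨fun e => by rw [e], fun e => Subtype.ext (toWD_injective g.2 f.2 e)⟩ rfl rfl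
  · rw [not_not.1 fun h' => h (sz_of_coord_ne h'), if_neg]
    rintro rfl
    exact h (sz_toWD f)

theorem kVec_eq_uVec {f : Dom m n} (h : atyp f.1 = 0) : kVec f = uVec f := by
  refine Subtype.ext (ext_coord (Ehat_antiSym _) (Ehat_antiSym _) ?_)
  rw [coord_kVec, coord_uVec]
  funext W
  rw [WD.uc_of_P_eq_empty (Finset.card_eq_zero.1 ((atyp_eq f).symm.trans h))]

theorem barMap_uVec (f : Dom m n) : barMap m n (uVec f) = uVec f := by
  refine Subtype.ext (ext_coord (Ehat_antiSym _) (Ehat_antiSym _) ?_)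
  rw [coord_barMap, coord_uVec, WD.bet_uc]

theorem isBar_barMap : IsBar (barMap m n) where
  continuous d := ⟨d, fun u hu => by
    rw [eq_zero_iff_dominant (Ehat_antiSym _)] at hu ⊢
    intro W hW
    rw [coord_barMap, WD.bet_local (c' := 0) hu hW, WD.bet_zero, Pi.zero_apply]⟩
  typical f hf := by rw [kVec_eq_uVec hf, barMap_uVec]
  map_e a u := by
    refine ⟨⟨_, eOp_mem u.2 a⟩, rfl, ext_coord (Ehat_antiSym _)
      (Ehat_le (eOp_mem (barMap m n u).2 a)).2 ?_⟩
    rw [coord_barMap, coord_eOp (Ehat_antiSym _), coord_eOp (Ehat_antiSym _), coord_barMap,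
      WD.bet_eop _ (coord_Ehat_mem u)]
  map_f a u := by
    refine ⟨⟨_, fOp_mem u.2 a⟩, rfl, ext_coord (Ehat_antiSym _)
      (Ehat_le (fOp_mem (barMap m n u).2 a)).2 ?_⟩
    rw [coord_barMap, coord_fOp (Ehat_antiSym _), coord_fOp (Ehat_antiSym _), coord_barMap,
      WD.bet_fop _ (coord_Ehat_mem u)]
  map_k a u := barMap_kOp a 1 u
  map_k_inv a u := by simpa using barMap_kOp a (-1) u

/-- Typical elements are fixed by assumption, and the property passes along E_v and F_v by
`WD.uc_induction`. As these operators preserve the sizes of the blocks, the simpler diagram again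
comes from a dominant function. -/
theorem IsBar.uVec {β : Ehat m n →ₛₗ[barQ] Ehat m n} (hβ : IsBar β) (f : Dom m n) :
    β (uVec f) = uVec f := by
  suffices H : ∀ W : WD, ∀ f : Dom m n, toWD f.1 = W → β (SuperKL.uVec f) = SuperKL.uVec f from
    H _ f rfl
  intro W
  induction W using WD.uc_induction with
  | base W h =>
    rintro f rfl
    have h0 : atyp f.1 = 0 := by rw [atyp_eq, h, Finset.card_empty]
    rw [← kVec_eq_uVec h0, hβ.typical f h0]
  | step v W W' ih hEF =>
    rintro f rfl
    have key : ∀ V, WD.uc W' V ≠ 0 → WD.Sz W'.A.card W'.B.card V := fun V hV =>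
      (WD.Sz.of_le (WD.le_of_uc_ne hV)).1 ⟨rfl, rfl⟩
    have h1 : WD.Sz W'.A.card W'.B.card (toWD f.1) := by
      have h0 : WD.uc (toWD f.1) (toWD f.1) ≠ 0 := by rw [WD.uc_self]; exact one_ne_zero
      rcases hEF with h | h
      · rw [← h] at h0; exact sz_of_eop_ne key h0
      · rw [← h] at h0; exact sz_of_fop_ne key h0
    have h2 := sz_toWD f
    obtain ⟨f', rfl⟩ := exists_toWD (m := m) (n := n) (W := W')
      ⟨h1.1.symm.trans h2.1, h1.2.symm.trans h2.2⟩
    have IH := ih f' rfl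
    rcases hEF with h | h
    · obtain ⟨v', h3, h4⟩ := hβ.map_e v (SuperKL.uVec f')
      have e : v' = SuperKL.uVec f := by
        refine Subtype.ext (ext_coord (Ehat_antiSym _) (Ehat_antiSym _) ?_)
        rw [h3, coord_eOp (Ehat_antiSym _), coord_uVec, coord_uVec, h]
      rw [IH, ← h3] at h4
      rw [← e]; exact Subtype.ext h4
    · obtain ⟨v', h3, h4⟩ := hβ.map_f v (SuperKL.uVec f')
      have e : v' = SuperKL.uVec f := by
        refine Subtype.ext (ext_coord (Ehat_antiSym _) (Ehat_antiSym _) ?_)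
        rw [h3, coord_fOp (Ehat_antiSym _), coord_uVec, coord_uVec, h]
      rw [IH, ← h3] at h4
      rw [← e]; exact Subtype.ext h4

theorem exists_uVec_approx (u : Ehat m n) (d : ℤ) : ∃ (s : Finset (Dom m n)) (y : Dom m n → Qq),
    ∀ h, Bounded d h → (u - ∑ f ∈ s, y f • uVec f).1 h = 0 := by
  classical
  obtain ⟨s, y, hs, hy⟩ := WD.exists_approx (coord_Ehat_mem u) d
  have hsz : ∀ W ∈ s, ∃ f : Dom m n, toWD f.1 = W := fun W hW => by
    obtain ⟨g, h1, h2⟩ := hs W hW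
    exact exists_toWD ((WD.Sz.of_le h2).1 (sz_of_coord_ne h1))
  have hinj : Set.InjOn (fun f : Dom m n => toWD f.1)
      ((fun f : Dom m n => toWD f.1) ⁻¹' (s : Set WD)) :=
    fun f _ g _ e => Subtype.ext (toWD_injective f.2 g.2 e)
  have hlin : ∀ (t : Finset (Dom m n)) (g : Dom m n),
      (∑ f ∈ t, y (toWD f.1) • uVec f : Ehat m n).1 g.1 =
        ∑ f ∈ t, y (toWD f.1) * WD.uc (toWD f.1) (toWD g.1) := by
    intro t g
    rw [AddSubmonoidClass.coe_finsetSum, Finset.sum_apply]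
    refine Finset.sum_congr rfl fun f _ => ?_
    rw [Submodule.coe_smul, Pi.smul_apply, smul_eq_mul]
    congr 1
    exact ofCoord_apply _ _
  refine ⟨s.preimage (fun f => toWD f.1) hinj, fun f => y (toWD f.1), ?_⟩
  rw [eq_zero_iff_dominant (Ehat_antiSym _)]
  intro W hW
  by_contra hne
  obtain ⟨g, rfl⟩ := exists_toWD (sz_of_coord_ne hne)
  apply hne
  rw [coord_toWD, Submodule.coe_sub, Pi.sub_apply, hlin, ← coord_toWD u.1, hy _ hW, Finset.sum_apply]
  rw [Finset.sum_preimage _ _ hinj (fun W => y W * WD.uc W (toWD g.1))]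
  · simp
  · intro W hW hn
    obtain ⟨f, rfl⟩ := hsz W hW
    exact absurd ⟨f, rfl⟩ hn

/-- Both maps fix the canonical elements and so agree on finite combinations of them. By continuity,
a combination that agrees with u on sufficiently large bounded parts determines the values of both
images at g. -/
theorem IsBar.unique {β β' : Ehat m n →ₛₗ[barQ] Ehat m n} (h : IsBar β) (h' : IsBar β') :
    β = β' := by
  refine LinearMap.ext fun u => Subtype.ext (funext fun g => ?_)
  obtain ⟨d, hd⟩ : ∃ d, Bounded d g := by
    obtain ⟨d, hd⟩ := WD.exists_Bd (toWD g)
    exact ⟨d, bd_toWD.1 hd⟩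
  obtain ⟨e, he⟩ := h.continuous d
  obtain ⟨e', he'⟩ := h'.continuous d
  obtain ⟨s, y, hs⟩ := exists_uVec_approx u (max e e')
  have h1 := he _ (fun k hk => hs k fun i => (hk i).trans (le_max_left _ _)) g hd
  have h2 := he' _ (fun k hk => hs k fun i => (hk i).trans (le_max_right _ _)) g hd
  have h3 : β (∑ f ∈ s, y f • SuperKL.uVec f) = β' (∑ f ∈ s, y f • SuperKL.uVec f) := by
    simp only [map_sum, LinearMap.map_smulₛₗ, h.uVec, h'.uVec]
  rw [map_sub, Submodule.coe_sub, Pi.sub_apply, sub_eq_zero] at h1 h2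
  rw [h1, h2, h3]

/-! ### Expansions -/

/-- At any function, all elements of the exterior space vanish or take a fixed multiple of their
value at a dominant conjugate with the same bounds. -/
theorem hasExpansion_of_dominant {v : Ehat m n} {B : Dom m n → Ehat m n} {c : Dom m n → Qq}
    (h1 : ∀ d, {g | ∃ k : Dom m n, Bounded d k.1 ∧ c g * (B g).1 k.1 ≠ 0}.Finite)
    (h2 : ∀ k : Dom m n, v.1 k.1 = ∑ᶠ g, c g * (B g).1 k.1) : HasExpansion v B c := by
  constructor
  · refine fun d => (h1 d).subset ?_
    rintro g ⟨f, hf, hne⟩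
    rcases antiSym_cases f with ⟨k, a, x, hk, ha⟩ | ha
    · refine ⟨k, (bounded_iff_of_act hk).2 hf, fun h0 => hne ?_⟩
      rw [ha _ (Ehat_antiSym _), mul_left_comm, h0, mul_zero]
    · exact absurd (by rw [ha _ (Ehat_antiSym _), mul_zero]) hne
  · intro f
    rcases antiSym_cases f with ⟨k, a, x, -, ha⟩ | ha
    · rw [ha _ (Ehat_antiSym _), h2, mul_finsum]
      refine finsum_congr fun g => ?_
      rw [ha _ (Ehat_antiSym (B g)), mul_left_comm]
    · rw [ha _ (Ehat_antiSym _), finsum_eq_zero_of_forall_eq_zero]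
      intro g
      rw [ha _ (Ehat_antiSym _), mul_zero]

theorem finsum_kVec (c : Dom m n → Qq) (k : Dom m n) :
    ∑ᶠ g, c g * (kVec g).1 k.1 = c k := by
  rw [finsum_eq_single _ k]
  · rw [kVec_apply, if_pos rfl, mul_one]
  · intro g hg
    rw [kVec_apply, if_neg hg.symm, mul_zero]

theorem hasExpansion_kVec {v : Ehat m n} {c : Dom m n → Qq} :
    HasExpansion v kVec c ↔ ∀ g, c g = v.1 g.1 := by
  constructor
  · intro h g
    rw [h.2, finsum_kVec]
  · intro h
    refine hasExpansion_of_dominant (fun d => ?_) fun k => by rw [finsum_kVec, h]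
    refine (((Ehat_le v.2).1 d).preimage (f := Subtype.val)
      Subtype.val_injective.injOn).subset ?_
    rintro g ⟨k, hk, hne⟩
    rw [kVec_apply] at hne
    split_ifs at hne with e
    · subst e
      exact ⟨hk, by rw [← h]; exact left_ne_zero_of_mul hne⟩
    · exact absurd (mul_zero _) hne

theorem finsum_toWD {F : WD → Qq} (hF : ∀ W, F W ≠ 0 → WD.Sz m n W) :
    ∑ᶠ g : Dom m n, F (toWD g.1) = ∑ᶠ W, F W := by
  have hinj : Function.Injective fun g : Dom m n => toWD g.1 :=
    fun f g e => Subtype.ext (toWD_injective f.2 g.2 e)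
  rw [← finsum_mem_range hinj, ← finsum_mem_univ F]
  refine finsum_mem_inter_support_eq' _ _ _ fun W hW => ?_
  simpa using exists_toWD (hF W hW)

/-! ### Integrality -/

/-- An orientation without pairs at right ends is `f` itself, so for g ≠ f the exponent of q is
positive. -/
theorem exists_poly_uc {f g : WD} :
    ∃ p : ℤ[X], WD.uc f g = (if g = f then 1 else 0) + q * Polynomial.aeval q p := by
  split_ifs with h
  · exact ⟨0, by rw [h, WD.uc_self]; simp⟩
  · by_cases h0 : WD.uc f g = 0
    · exact ⟨0, by rw [h0]; simp⟩
    have ho := WD.orient_of_uc_ne h0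
    have hle := WD.le_of_uc_ne h0
    have hc : WD.cnt f.mt g ≠ 0 := by
      intro hc
      rw [WD.cnt, Finset.card_eq_zero, Finset.filter_eq_empty_iff] at hc
      refine h (WD.eq_of_P hle.1 hle.2.1 ?_).symm
      refine (Finset.eq_of_subset_of_card_le (fun x hx => ?_) (WD.card_P_le hle).le).symm
      have h1 := hc hx
      have h2 := ho.2.2 x
      have h3 : f.mt x ≠ x := fun e => by
        rw [e] at h2
        exact (h2.1 (WD.mem_P.1 hx)).1 (WD.mem_P.1 hx)
      exact WD.mem_P.2 ((f.mt_RM.pair x).2 (by omega))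
    obtain ⟨k, hk⟩ := Nat.exists_eq_succ_of_ne_zero hc
    refine ⟨Polynomial.X ^ k, ?_⟩
    rw [WD.uc, if_pos ho, hk, pow_succ']
    simp

/-- Sliding by θ = 0 does not move the pairs, so every θ contributing to f ≠ g has |θ| > 0. -/
theorem exists_poly_lcx {g f : WD} {r : ℕ} {x : Fin r → ℤ} (h : WD.Enum g x) (hne : f ≠ g) :
    ∃ p : ℤ[X], WD.lcx g x f = q⁻¹ * Polynomial.aeval q⁻¹ p := by
  rw [WD.lcx]
  refine finsum_induction (fun z => ∃ p : ℤ[X], z = q⁻¹ * Polynomial.aeval q⁻¹ p) ⟨0, by simp⟩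
    ?_ fun θ => ?_
  · rintro _ _ ⟨p, rfl⟩ ⟨p', rfl⟩
    exact ⟨p + p', by rw [map_add, mul_add]⟩
  · rw [finsum_eq_if]
    split_ifs with hθ
    · have h0 : ∑ s, θ s ≠ 0 := by
        intro h0
        have hz : θ = 0 := by
          funext s
          exact (Finset.sum_eq_zero_iff.1 h0) s (Finset.mem_univ _)
        subst hz
        refine hne (hθ.symm.trans ?_)
        obtain ⟨h1, h2, h3, -⟩ := h.slide_props 0
        refine WD.eq_of_P h2 h3 (h1.trans ?_)
        rw [← ofFn_arcs, ← h.image]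
        ext z
        rw [mem_heads]
        simp [List.mem_ofFn, arcs_fst_of_eq_zero]
      obtain ⟨k, hk⟩ := Nat.exists_eq_succ_of_ne_zero h0
      refine ⟨-(-Polynomial.X) ^ k, ?_⟩
      rw [hk, pow_succ', inv_neg]
      simp
    · exact ⟨0, by simp⟩

theorem exists_poly_incL {f g : WD} :
    ∃ p : ℤ[X], WD.incL f g = (if g = f then 1 else 0) + q⁻¹ * Polynomial.aeval q⁻¹ p := by
  split_ifs with h
  · exact ⟨0, by rw [h, WD.incL_self]; simp⟩
  · simp only [zero_add]
    rw [(WD.enum_orderEmb g).incL_eq]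
    exact exists_poly_lcx (WD.enum_orderEmb g) (Ne.symm h)

theorem barQ_aeval (p : ℤ[X]) (x : Qq) :
    barQ (Polynomial.aeval x p) = Polynomial.aeval (barQ x) p := by
  rw [Polynomial.aeval_def, Polynomial.aeval_def, Polynomial.hom_eval₂]
  congr 1
  exact RingHom.ext_int _ _

theorem aeval_q_injective : Function.Injective fun p : ℤ[X] => Polynomial.aeval q p := by
  have h : ∀ p : ℤ[X],
      Polynomial.aeval q p = Polynomial.aeval q (p.map (Int.castRingHom ℚ)) := fun p => by
    rw [Polynomial.aeval_def, Polynomial.aeval_def, Polynomial.eval₂_map]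
    congr 1
    exact RingHom.ext_int _ _
  intro p p' e
  refine Polynomial.map_injective (Int.castRingHom ℚ) Int.cast_injective
    (transcendental_iff_injective.1 transcendental_q ?_)
  rw [← h, ← h]
  exact e

/-- Clearing denominators turns the equation into X^(deg p + 2) p = p.reverse, which is impossible
by degrees unless p = 0. -/
theorem eq_zero_of_mul_aeval {p : ℤ[X]}
    (h : q * Polynomial.aeval q p = q⁻¹ * Polynomial.aeval q⁻¹ p) : p = 0 := by
  have hrev : Polynomial.aeval q⁻¹ p * q ^ p.natDegree = Polynomial.aeval q p.reverse := by
    let _ := invertibleOfNonzero (inv_ne_zero q_ne_zero)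
    have hu := Polynomial.eval₂_reverse_mul_pow (algebraMap ℤ Qq) q⁻¹ p
    rw [invOf_eq_inv, inv_inv, ← Polynomial.aeval_def, ← Polynomial.aeval_def] at hu
    rw [← hu, mul_assoc, ← mul_pow, inv_mul_cancel₀ q_ne_zero, one_pow, mul_one]
  have h1 : Polynomial.aeval q (Polynomial.X ^ (p.natDegree + 2) * p) =
      Polynomial.aeval q p.reverse := by
    rw [← hrev, map_mul, map_pow, Polynomial.aeval_X]
    calc q ^ (p.natDegree + 2) * Polynomial.aeval q p
        = q ^ (p.natDegree + 1) * (q * Polynomial.aeval q p) := by ring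
      _ = q * q⁻¹ * (Polynomial.aeval q⁻¹ p * q ^ p.natDegree) := by rw [h]; ring
      _ = _ := by rw [mul_inv_cancel₀ q_ne_zero, one_mul]
  have h2 := aeval_q_injective h1
  by_contra hp
  have h3 := congrArg Polynomial.natDegree h2
  rw [Polynomial.natDegree_mul (pow_ne_zero _ Polynomial.X_ne_zero) hp,
    Polynomial.natDegree_X_pow] at h3
  have h4 := Polynomial.reverse_natDegree_le p
  omega

theorem WD.incR_self (f : WD) : incR f f = 1 := by
  have h1 : (incU.bar * incR) f f = incU f f := by rw [bar_incU_mul_incR]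
  simpa [incU_bar_self, incU_self] using h1

/-- A bar invariant family with coefficients in `q ℤ[q]` or in `q⁻¹ ℤ[q⁻¹]` vanishes. -/
theorem eq_zero_of_bet {c : WD → Qq} (hc : c ∈ WD.Cf) (hb : WD.bet c = c)
    (hp : (∀ W, ∃ p : ℤ[X], c W = q * Polynomial.aeval q p) ∨
      ∀ W, ∃ p : ℤ[X], c W = q⁻¹ * Polynomial.aeval q⁻¹ p) : c = 0 := by
  by_contra hne
  obtain ⟨W, hW⟩ := Function.ne_iff.1 hne
  obtain ⟨d, hd⟩ := WD.exists_Bd W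
  -- At a minimal bounded diagram of the support, unitriangularity reduces the bar involution to q ↦
  -- q⁻¹ on the coefficient, which is then zero by integrality.
  obtain ⟨V, hV⟩ := (hc d).exists_minimal ⟨W, hd, hW⟩
  have h1 : WD.bet c V = barQ (c V) := by
    rw [WD.bet, WD.vmul, finsum_eq_single _ V, WD.incR_self, mul_one]
    intro f hf
    by_contra h0
    have hle := IncidenceAlgebra.le_of_ne_zero (right_ne_zero_of_mul h0)
    have hcf : c f ≠ 0 := fun e => h0 (by rw [e, map_zero, zero_mul])
    exact hf (le_antisymm hle (hV.2 ⟨fun x hx => WD.le_bound hle hV.1.1 x hx, hcf⟩ hle))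
  rw [hb] at h1
  refine hV.1.2 ?_
  rcases hp with hp | hp
  · obtain ⟨p, hp⟩ := hp V
    rw [hp, map_mul, barQ_aeval, barQ_q] at h1
    rw [hp, eq_zero_of_mul_aeval h1, map_zero, mul_zero]
  · obtain ⟨p, hp⟩ := hp V
    rw [hp, map_mul, barQ_aeval, barQ_q_inv] at h1
    rw [hp, eq_zero_of_mul_aeval h1.symm, map_zero, mul_zero]

theorem eq_of_barMap {u v : Ehat m n} (hu : barMap m n u = u) (hv : barMap m n v = v)
    (hp : (∀ g : Dom m n, ∃ p : ℤ[X], u.1 g.1 - v.1 g.1 = q * Polynomial.aeval q p) ∨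
      ∀ g : Dom m n, ∃ p : ℤ[X], u.1 g.1 - v.1 g.1 = q⁻¹ * Polynomial.aeval q⁻¹ p) :
    u = v := by
  have hsub : barMap m n (u - v) = u - v := by rw [map_sub, hu, hv]
  have h0 : ∀ W, ¬ WD.Sz m n W → coord (u - v).1 W = 0 := fun W hW => by
    by_contra h; exact hW (sz_of_coord_ne h)
  have h1 := eq_zero_of_bet (coord_Ehat_mem (u - v)) (by rw [← coord_barMap, hsub]) (by
    refine hp.imp (fun hp W => ?_) (fun hp W => ?_) <;>
    · by_cases hW : WD.Sz m n W
      · obtain ⟨g, rfl⟩ := exists_toWD hW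
        obtain ⟨p, hp⟩ := hp g
        exact ⟨p, by rw [coord_toWD, ← hp]; rfl⟩
      · exact ⟨0, by rw [h0 W hW]; simp⟩)
  refine sub_eq_zero.1 (Subtype.ext (ext_coord (Ehat_antiSym _) (zero_mem _) ?_))
  rw [h1]
  have := coord_smul (0 : Qq) (0 : Fam m n)
  rw [zero_smul, zero_smul] at this
  exact this.symm

/-! ### The canonical bases -/

/-- The dual canonical basis. -/
def lVec (f : Dom m n) : Ehat m n :=
  ⟨ofCoord m n fun W => WD.incL (toWD f.1) W, ofCoord_mem_Ehat (WD.row_mem _ _)⟩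

theorem coord_lVec (f : Dom m n) : coord (lVec f).1 = fun W => WD.incL (toWD f.1) W :=
  coord_ofCoord fun _ h => sz_of_le_toWD (IncidenceAlgebra.le_of_ne_zero h)

theorem uVec_apply (f g : Dom m n) : (uVec f).1 g.1 = WD.uc (toWD f.1) (toWD g.1) :=
  ofCoord_apply _ _

theorem lVec_apply (f g : Dom m n) : (lVec f).1 g.1 = WD.incL (toWD f.1) (toWD g.1) :=
  ofCoord_apply _ _

theorem barMap_lVec (f : Dom m n) : barMap m n (lVec f) = lVec f := by
  refine Subtype.ext (ext_coord (Ehat_antiSym _) (Ehat_antiSym _) ?_)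
  rw [coord_barMap, coord_lVec, WD.bet_incL]

theorem toWD_eq_iff {f g : Dom m n} : toWD g.1 = toWD f.1 ↔ g = f :=
  ⟨fun e => Subtype.ext (toWD_injective g.2 f.2 e), fun e => by rw [e]⟩

theorem isCanonical_uVec : IsCanonical (barMap m n) uVec := by
  classical
  refine fun f => ⟨barMap_uVec f, ?_⟩
  choose p hp using fun g : Dom m n => exists_poly_uc (f := toWD f.1) (g := toWD g.1)
  refine ⟨p, hasExpansion_kVec.2 fun g => ?_⟩
  rw [uVec_apply, hp]
  congr 1
  exact if_congr toWD_eq_iff.symm rfl rfl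

theorem isDualCanonical_lVec : IsDualCanonical (barMap m n) lVec := by
  classical
  refine fun f => ⟨barMap_lVec f, ?_⟩
  choose p hp using fun g : Dom m n => exists_poly_incL (f := toWD f.1) (g := toWD g.1)
  refine ⟨p, hasExpansion_kVec.2 fun g => ?_⟩
  rw [lVec_apply, hp]
  congr 1
  exact if_congr toWD_eq_iff.symm rfl rfl

theorem IsCanonical.unique {U U' : Dom m n → Ehat m n} (h : IsCanonical (barMap m n) U)
    (h' : IsCanonical (barMap m n) U') : U = U' := by
  funext f
  obtain ⟨h1, p, hp⟩ := h f
  obtain ⟨h1', p', hp'⟩ := h' f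
  refine eq_of_barMap h1 h1' (Or.inl fun g => ⟨p g - p' g, ?_⟩)
  rw [← hasExpansion_kVec.1 hp, ← hasExpansion_kVec.1 hp', map_sub]
  ring

theorem IsDualCanonical.unique {L L' : Dom m n → Ehat m n} (h : IsDualCanonical (barMap m n) L)
    (h' : IsDualCanonical (barMap m n) L') : L = L' := by
  funext f
  obtain ⟨h1, p, hp⟩ := h f
  obtain ⟨h1', p', hp'⟩ := h' f
  refine eq_of_barMap h1 h1' (Or.inr fun g => ⟨p g - p' g, ?_⟩)
  rw [← hasExpansion_kVec.1 hp, ← hasExpansion_kVec.1 hp', map_sub]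
  ring

/-- This is a row of `incW * incL = 1`. Its sums are locally finite because a term at k indexed by g
requires f ≤ g ≤ k. -/
theorem hasExpansion_kVec_lVec (f : Dom m n) :
    HasExpansion (kVec f) lVec fun g => WD.wc (toWD f.1) (toWD g.1) := by
  refine hasExpansion_of_dominant (fun d => ?_) fun k => ?_
  · refine Set.Finite.of_finite_image (f := fun g : Dom m n => toWD g.1)
      ((WD.finite_ge_bounded (toWD f.1) d).subset ?_)
      fun f _ g _ e => Subtype.ext (toWD_injective f.2 g.2 e)
    rintro _ ⟨g, ⟨k, hk, hne⟩, rfl⟩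
    rw [lVec_apply] at hne
    have h1 := WD.le_of_wc_ne (left_ne_zero_of_mul hne)
    have h2 := IncidenceAlgebra.le_of_ne_zero (right_ne_zero_of_mul hne)
    exact ⟨h1, fun x hx => WD.le_bound h2 (bd_toWD.2 hk) x hx⟩
  · simp only [lVec_apply]
    rw [finsum_toWD (F := fun W => WD.wc (toWD f.1) W * WD.incL W (toWD k.1))
      fun W hW => sz_of_le_toWD (WD.le_of_wc_ne (left_ne_zero_of_mul hW))]
    have h := congrFun (WD.vmul_row WD.incW WD.incL (toWD f.1)) (toWD k.1)
    rw [WD.incW_mul_incL, IncidenceAlgebra.one_apply] at h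
    refine Eq.trans ?_ h.symm
    rw [kVec_apply]
    exact if_congr (eq_comm.trans toWD_eq_iff.symm |>.trans eq_comm |>.trans eq_comm) rfl rfl

theorem atNegInv_inv_neg_q : atNegInv (-q)⁻¹ = q := by
  have h : atNegInv q = -q⁻¹ := by
    have : (q : Qq) = algebraMap ℚ[X] Qq Polynomial.X := RatFunc.algebraMap_X.symm
    conv_lhs => rw [this]
    unfold atNegInv subst
    rw [RatFunc.liftRingHom_algebraMap]
    simp
  rw [map_inv₀, map_neg, h, neg_neg, inv_inv]

theorem atNegInv_incL (f g : Dom m n) : atNegInv (WD.incL (toWD f.1) (toWD g.1)) =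
    ∑ᶠ (θ : Fin (atyp g.1) → ℕ) (_ : raisePrimeTheta g.1 θ = f.1), q ^ ∑ s, θ s := by
  rw [incL_toWD]
  refine (AddMonoidHom.map_finsum_mem (fun θ : Fin (atyp g.1) → ℕ => (-q)⁻¹ ^ ∑ s, θ s)
    atNegInv.toAddMonoidHom (finite_raisePrimeTheta f g)).trans ?_
  refine finsum_congr fun θ => finsum_congr fun _ => ?_
  change atNegInv ((-q)⁻¹ ^ ∑ s, θ s) = _
  rw [map_pow, atNegInv_inv_neg_q]

end SuperKL

end

theorem mainTheorem6 (m n : ℕ) :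
    (∃! β : Ehat m n →ₛₗ[barQ] Ehat m n, IsBar β) ∧
    ∀ β : Ehat m n →ₛₗ[barQ] Ehat m n, IsBar β →
      (∃! U : Dom m n → Ehat m n, IsCanonical β U) ∧
      (∃! L : Dom m n → Ehat m n, IsDualCanonical β L) ∧
      ∀ U L : Dom m n → Ehat m n, IsCanonical β U → IsDualCanonical β L →
        -- the coefficients of the canonical basis
        (∀ u : Dom m n → Dom m n → Qq,
          (∀ f, HasExpansion (U f) kVec (fun g => u g f)) →
          ∀ g f : Dom m n,
            (∀ θ : Fin (atyp f.1) → ℕ, (∀ s, θ s ≤ 1) → g.1 = lowerTheta f.1 θ →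
              u g f = q ^ (∑ s, θ s)) ∧
            ((∀ θ : Fin (atyp f.1) → ℕ, (∀ s, θ s ≤ 1) → g.1 ≠ lowerTheta f.1 θ) →
              u g f = 0)) ∧
        -- the coefficients of the dual canonical basis
        (∀ l : Dom m n → Dom m n → Qq,
          (∀ f, HasExpansion (L f) kVec (fun g => l g f)) →
          ∀ g f : Dom m n,
            {θ : Fin (atyp g.1) → ℕ | raisePrimeTheta g.1 θ = f.1}.Finite ∧
            atNegInv (l g f) =
              ∑ᶠ (θ : Fin (atyp g.1) → ℕ) (_ : raisePrimeTheta g.1 θ = f.1),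
                q ^ (∑ s, θ s)) ∧
        -- the monomial basis in terms of the dual canonical basis, and conversely
        (∀ (g : Dom m n) (θ η : Fin (atyp g.1) → ℕ), (∀ s, θ s ≤ 1) → (∀ s, η s ≤ 1) →
          raiseTheta g.1 θ = raiseTheta g.1 η → θ = η) ∧
        ∀ f : Dom m n,
          HasExpansion (kVec f) L (fun g =>
            ∑ᶠ (θ : Fin (atyp g.1) → ℕ) (_ : (∀ s, θ s ≤ 1) ∧ raiseTheta g.1 θ = f.1),
              q⁻¹ ^ (∑ s, θ s)) ∧
          HasExpansion (L f) kVec (fun g =>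
            ∑ᶠ (θ : Fin (atyp g.1) → ℕ) (_ : raisePrimeTheta g.1 θ = f.1),
              (-q)⁻¹ ^ (∑ s, θ s)) := by
  refine ⟨⟨barMap m n, isBar_barMap, fun β hβ => hβ.unique isBar_barMap⟩, fun β hβ => ?_⟩
  obtain rfl : β = barMap m n := hβ.unique isBar_barMap
  refine ⟨⟨uVec, isCanonical_uVec, fun U hU => hU.unique isCanonical_uVec⟩,
    ⟨lVec, isDualCanonical_lVec, fun L hL => hL.unique isDualCanonical_lVec⟩,
    fun U L hU hL => ?_⟩
  obtain rfl : U = uVec := hU.unique isCanonical_uVec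
  obtain rfl : L = lVec := hL.unique isDualCanonical_lVec
  refine ⟨fun u hu g f => ?_, fun l hl g f => ⟨finite_raisePrimeTheta f g, ?_⟩,
    fun g θ η hθ hη e => raiseTheta_injective g hθ hη e, fun f => ⟨?_, ?_⟩⟩
  · have h : u g f = WD.uc (toWD f.1) (toWD g.1) :=
      (hasExpansion_kVec.1 (hu f) g).trans (uVec_apply f g)
    rw [h]
    exact uc_toWD f g
  · have h : l g f = WD.incL (toWD f.1) (toWD g.1) :=
      (hasExpansion_kVec.1 (hl f) g).trans (lVec_apply f g)
    rw [h]
    exact atNegInv_incL f g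
  · simp only [← wc_toWD]
    exact hasExpansion_kVec_lVec f
  · exact hasExpansion_kVec.2 fun g => ((lVec_apply f g).trans (incL_toWD f g)).symm
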